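/- A positive hypergraph $S$ consists of finite sets $S_k$ ($k\ge 0$, almost all empty), functions $\gamma:S_{k+1}\to S_k$ and total relations $\delta:S_{k+1}\to S_k$ (regarded as assigning to $a$ a nonempty set $\delta(a)\subseteq S_k$), with $\delta:S_1\to S_0$ a function. A morphism is a family of maps $f_k:S_k\to T_k$ commuting with $\gamma$ and restricting to bijections $\delta(a)\to\delta(f(a))$. Put $\partial(a)=\gamma(a)\cup\delta(a)$, and $\gamma^{(j)}(p)$ for the iterated codomain of $p$ of dimension $j$. Let $<^+$ on $S_k$ be the transitive closure of: $a\in\delta(\alpha)$ and $\gamma(\alpha)=b$ for some $\alpha$; let $<^-$ be the transitive closure of: $\gamma(a)\in\delta(b)$. $S$ is a positive opetope if $S_0\ne\emptyset$; $\gamma\gamma(a)=\gamma\delta(a)-\delta\delta(a)$ and $\delta\gamma(a)=\delta\delta(a)-\gamma\delta(a)$ for faces $a$ of dimension at least $2$; $<^+$ is irreflexive on every $S_k$ and linear on $S_0$; no two faces of positive dimension are comparable for both $<^-$ and $<^+$; the sets $\{a:x=\gamma(a)\}$ and $\{a:x\in\delta(a)\}$ are linearly ordered by $<^+$ for every face $x$;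 and $|S_k-\delta(S_{k+1})|\le 1$ for all $k$. Let $P$ be a positive opetope. Flags. A flag under $x_k\in P_k$ is a sequence $\vec x=[x_k,\dots,x_0]$ with $x_i\in P_i$ and $x_i\in\partial(x_{i+1})$; it is maximal if $k=\dim P$. Its sign is $(-1)^r$, with $r$ the number of $i<k$ with $x_i\in\delta(x_{i+1})$. For $a,b\in P_{k+1}$ with $x\in\partial(a)\cap\partial(b)$ put $a\prec_x b$ iff $\gamma(b)=x\in\delta(a)$, or $x\in\delta(a)\cap\delta(b)$ and $a<^+b$, or $\gamma(a)=x=\gamma(b)$ and $b<^+a$. For distinct flags $\vec x,\vec y$ under the same face, with $k$ the least level where they differ, $\vec x\lhd\vec y$ iff $k=0$ and $y_0<^+x_0$; or $k>0$, $[x_{k-1},\dots,x_0]$ has sign $+1$ and $x_k\prec_{x_{k-1}}y_k$; or $k>0$, this sign is $-1$ and $y_k\prec_{x_{k-1}}x_k$. A p-flag under $x_k$ is a flag under $x_k$ in which one face is replaced by a dummy $0$: either $x_{k-1}$, $k\ge1$ (a high p-flag $\vec x_{high}$), or, if $\vec x$ is neither the first nor the last flag under $x_k$, the face $x_i$ with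 $i$ the largest $i<k-1$ such that $x_{i+1}\in\delta(x_{i+2})$ (a low p-flag $\vec x_{low}$). For the first and the last flag under $x_k$ put $\vec x_{low}=-x_k$ and $\vec x_{low}=+x_k$, respectively. The intersection of two flags has the dummy $0$ where they differ. The cylinder hypergraph $\mathrm{Cyl}_h(P)$. Its faces are the flat faces $-p,+p$ ($p\in P$, of the dimension of $p$) and all flags and p-flags under all faces of $P$, of dimension the number of their non-dummy faces. Operations: (1) $\gamma(\pm p)=\pm\gamma(p)$ and $\delta(\pm p)=\{\pm q:q\in\delta(p)\}$. (2) For a flag, $\gamma([x_0])=+x_0$ and $\delta([x_0])=\{-x_0\}$; for $k\ge1$, $\gamma(\vec x)=\vec x_{high}$ and $\delta(\vec x)=\{[x_{k-1},\dots,x_0],\vec x_{low}\}$. (3) For a p-flag $\vec z=[x_k,\dots,x_0]$ with the dummy at level $i$, $\gamma(\vec z)=+\gamma(x_1)$ if $k=1$; if $k\ge2$, $\gamma(\vec z)=[\gamma(x_k),0,x_{k-3},\dots,x_0]$ when $i\in\{k-1,k-2\}$, and $\gamma(\vec z)$ is $\vec z$ without $x_k$ otherwise. Further $\delta(\vec z)=\{p\star\vec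 z:p\in\delta(x_k)\}$, together with $[x_{k-2},\dots,x_0]$ if $i=k-1\ge1$. Here $p\star\vec z$ is defined as follows, where $y_j=x_j$ for $j\ne i$ and $y_i=\gamma(x_{i+1})$. If $i\neq k-1$ and $p=x_{k-1}$, it is $\vec z$ without $x_k$. Otherwise, let $j$ be the largest number with $1\le j\le\min(k-1,i+1)$ such that $y_j\le^+t$ for some $t\in\delta\gamma^{(j+1)}(p)$ (for $t=p$, if $j=k-1$); if it exists, $p\star\vec z=[p,\gamma(p),\dots,\gamma^{(j+1)}(p),t,0,x_{j-2},\dots,x_0]$ (which is $[p,0,x_{k-3},\dots,x_0]$ if $j=k-1$). Otherwise, if $i>0$, it is $-p$ when $\gamma^{(0)}(p)\le^+x_0$ and $+p$ when $x_0<^+\gamma^{(0)}(p)$; if $i=0$, it is $-p$ when $\gamma^{(0)}(p)<^+\gamma(x_1)$ and $+p$ when $\gamma(x_1)\le^+\gamma^{(0)}(p)$. For a flag or p-flag $\vec x$ let $P^{\vec x}$ be the least sub-hypergraph of $\mathrm{Cyl}_h(P)$ containing $\vec x$. Proposition. $\mathrm{Cyl}_h(P)$ is $\mathbf{pOpe}$-straight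 in the category $\mathbf{pHg}$ of positive hypergraphs; that is, there are a finite linear order $Q$ and subobjects $a_q$ ($q\in Q$) of $\mathrm{Cyl}_h(P)$ with positive opetopes as domains such that $\mathrm{Cyl}_h(P)=\bigcup_{q\in Q}a_q$ and, for every $q$ which is not least in $Q$, $(\bigcup_{q'<q}a_{q'})\cap a_q$ is isomorphic to a positive opetope. More precisely: $\lhd$ is a strict linear order on the maximal flags of $P$; $P^{\vec x}$ is a positive opetope for every maximal flag $\vec x$; $\mathrm{Cyl}_h(P)$ is the union of the $P^{\vec x}$ over all maximal flags; and for every maximal flag $\vec x'$ that is not the first one, if $\vec x$ denotes its immediate predecessor for $\lhd$, then $\vec x\cap\vec x'$ is a p-flag, $P^{\vec x\cap\vec x'}$ is a positive opetope, and $$\Big(\bigcup_{\vec y\lhd\vec x'}P^{\vec y}\Big)\cap P^{\vec x'}=P^{\vec x\cap\vec x'}.$$ -/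

import Mathlib

universe u

open CategoryTheory

/-! ## Positive hypergraphs -/

/-- A positive hypergraph: finite sets of faces `F k` (nonempty for finitely many `k` only), a
codomain function `γ` and a total domain relation `δ`; on faces of dimension one `δ` is a function.
The relation `δ` is recorded through the sets `δ a` of faces related to `a`. -/
structure PosHypergraph : Type (u + 1) where
  F : ℕ → Type u
  γ : ∀ {k : ℕ}, F (k + 1) → F k
  δ : ∀ {k : ℕ}, F (k + 1) → Set (F k)
  finite_F : ∀ k, Finite (F k)
  bounded : ∃ N, ∀ k, N < k → IsEmpty (F k)
  δ_total : ∀ {k : ℕ} (a : F (k + 1)), (δ a).Nonempty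
  δ_zero : ∀ a : F 1, ∃! b, b ∈ δ a

namespace PosHypergraph

/-- A morphism of positive hypergraphs. -/
@[ext]
structure Hom (S T : PosHypergraph.{u}) where
  map : ∀ k, S.F k → T.F k
  map_γ : ∀ {k : ℕ} (a : S.F (k + 1)), T.γ (map (k + 1) a) = map k (S.γ a)
  map_δ : ∀ {k : ℕ} (a : S.F (k + 1)), Set.BijOn (map k) (S.δ a) (T.δ (map (k + 1) a))

/-- The category of positive hypergraphs. -/
instance : Category.{u} PosHypergraph.{u} where
  Hom := Hom
  id S := ⟨fun _ a => a, fun _ => rfl, fun a => Set.bijOn_id (S.δ a)⟩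
  comp f g := ⟨fun k a => g.map k (f.map k a),
    fun a => by rw [g.map_γ, f.map_γ],
    fun a => (g.map_δ (f.map _ a)).comp (f.map_δ a)⟩
  id_comp _ := rfl
  comp_id _ := rfl
  assoc _ _ _ := rfl

variable (S : PosHypergraph.{u})

instance (k : ℕ) : Finite (S.F k) := S.finite_F k

/-- The boundary `∂ a = γ a ∪ δ a`. -/
def bd {k : ℕ} (a : S.F (k + 1)) : Set (S.F k) := insert (S.γ a) (S.δ a)

/-- The upper order `a <⁺ b`. -/
def UpLT {k : ℕ} : S.F k → S.F k → Prop :=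
  Relation.TransGen fun a b => ∃ α : S.F (k + 1), a ∈ S.δ α ∧ S.γ α = b

/-- The reflexive upper order `a ≤⁺ b`. -/
def UpLE {k : ℕ} (a b : S.F k) : Prop := a = b ∨ S.UpLT a b

/-- The lower order `a <⁻ b`. -/
def LowLT {k : ℕ} : S.F (k + 1) → S.F (k + 1) → Prop :=
  Relation.TransGen fun a b => S.γ a ∈ S.δ b

/-- Positive opetopic cardinals: non-empty positive hypergraphs satisfying globularity,
strictness, disjointness and pencil linearity. -/
structure IsOpetopicCardinal : Prop where
  nonempty : Nonempty (S.F 0)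
  glob_γ : ∀ {k : ℕ} (a : S.F (k + 2)),
    {S.γ (S.γ a)} = (S.γ '' S.δ a) \ (⋃ b ∈ S.δ a, S.δ b)
  glob_δ : ∀ {k : ℕ} (a : S.F (k + 2)),
    S.δ (S.γ a) = (⋃ b ∈ S.δ a, S.δ b) \ (S.γ '' S.δ a)
  strict : ∀ {k : ℕ} (a : S.F k), ¬ S.UpLT a a
  linear_zero : ∀ a b : S.F 0, a ≠ b → S.UpLT a b ∨ S.UpLT b a
  disjoint : ∀ {k : ℕ} (a b : S.F (k + 1)),
    ¬ ((S.LowLT a b ∨ S.LowLT b a) ∧ (S.UpLT a b ∨ S.UpLT b a))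
  pencil_γ : ∀ {k : ℕ} (x : S.F k) (a b : S.F (k + 1)),
    x = S.γ a → x = S.γ b → a ≠ b → S.UpLT a b ∨ S.UpLT b a
  pencil_δ : ∀ {k : ℕ} (x : S.F k) (a b : S.F (k + 1)),
    x ∈ S.δ a → x ∈ S.δ b → a ≠ b → S.UpLT a b ∨ S.UpLT b a

/-- The size: the number of `k`-faces outside `δ (S_{k+1})`. -/
noncomputable def size (k : ℕ) : ℕ := (Set.univ \ ⋃ α : S.F (k + 1), S.δ α).ncard

/-- Positive opetopes. -/
structure IsPositiveOpetope : Prop extends S.IsOpetopicCardinal where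
  size_le_one : ∀ k, S.size k ≤ 1

/-- The dimension: the largest `k` such that there are `k`-faces. -/
noncomputable def dim : ℕ := sSup {k | Nonempty (S.F k)}

/-! ## Sub-hypergraphs -/

/-- A sub-hypergraph: a set of faces closed under `γ` and `δ`. -/
@[ext]
structure Sub where
  carrier : ∀ k, Set (S.F k)
  γ_mem : ∀ {k : ℕ} (a : S.F (k + 1)), a ∈ carrier (k + 1) → S.γ a ∈ carrier k
  δ_mem : ∀ {k : ℕ} (a : S.F (k + 1)), a ∈ carrier (k + 1) → S.δ a ⊆ carrier k

variable {S}

/-- A sub-hypergraph as a positive hypergraph, with the restricted operations. -/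
def Sub.toPosHypergraph (A : S.Sub) : PosHypergraph.{u} where
  F k := A.carrier k
  γ a := ⟨S.γ a.1, A.γ_mem a.1 a.2⟩
  δ a := {b | b.1 ∈ S.δ a.1}
  finite_F _ := inferInstance
  bounded := by
    obtain ⟨N, hN⟩ := S.bounded
    exact ⟨N, fun k hk => ⟨fun a => (hN k hk).false a.1⟩⟩
  δ_total a := by
    obtain ⟨b, hb⟩ := S.δ_total a.1
    exact ⟨⟨b, A.δ_mem a.1 a.2 hb⟩, hb⟩
  δ_zero a := by
    obtain ⟨b, hb, hu⟩ := S.δ_zero a.1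
    exact ⟨⟨b, A.δ_mem a.1 a.2 hb⟩, hb, fun c hc => Subtype.ext (hu c.1 hc)⟩

/-- `S[x]`: the least sub-hypergraph containing the face `x`. -/
def gen {k : ℕ} (x : S.F k) : S.Sub where
  carrier j := {y | ∀ A : S.Sub, x ∈ A.carrier k → y ∈ A.carrier j}
  γ_mem a ha A hx := A.γ_mem a (ha A hx)
  δ_mem a ha _ hb A hx := A.δ_mem a (ha A hx) hb

variable (S)

/-- `γ^{(j)} p` for a `k`-face `p` and `j ≤ k`. -/
def iterγ {k : ℕ} (p : S.F k) (j : ℕ) (hj : j ≤ k) : S.F j :=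
  Nat.decreasingInduction (motive := fun m _ => S.F m) (fun _ _ q => S.γ q) p hj

/-- The set `δ γ^{(j+1)} p` for `j < k = dim p`; by convention it is `{p}` for `j = k`. -/
def lowerFaces {k : ℕ} (p : S.F k) (j : ℕ) : Set (S.F j) :=
  {t | (∃ h : j + 1 ≤ k, t ∈ S.δ (S.iterγ p (j + 1) h)) ∨ ∃ h : j = k, t = S.iterγ p j h.le}

/-! ## Flags and punctured flags

Flags and punctured flags are vectors of faces, one at most in every dimension;
`none` stands for the dummy face `0` and for the levels above the top face. -/

/-- Vectors of faces. -/
abbrev Vec : Type u := ∀ i : ℕ, Option (S.F i)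

variable {S}

/-- The part of a vector on the levels `< m`; so `below (k + 1) x` is the truncation
`[x_k, …, x_0]`. -/
def below (m : ℕ) (x : S.Vec) : S.Vec := fun i => if i < m then x i else none

/-- Replace the entry at level `i` by the dummy face. -/
def punct (x : S.Vec) (i : ℕ) : S.Vec := Function.update x i none

open Classical in
/-- The intersection of two vectors: the dummy face is put wherever they differ. -/
noncomputable def meet (x y : S.Vec) : S.Vec := fun i => if x i = y i then x i else none

/-- `x = [x_k, …, x_0]` is a flag under some `k`-face. -/
structure IsFlag (k : ℕ) (x : S.Vec) : Prop where
  isSome_iff : ∀ i, (x i).isSome ↔ i ≤ k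
  mem_bd : ∀ {i : ℕ} {a : S.F i} {b : S.F (i + 1)}, x i = some a → x (i + 1) = some b → a ∈ S.bd b

open Classical in
/-- The sign of `[x_j, …, x_0]`. -/
noncomputable def sgn (x : S.Vec) : ℕ → ℤ
  | 0 => 1
  | j + 1 => if x j = (x (j + 1)).map S.γ then sgn x j else - sgn x j

/-- The pencil order `a ≺_x b`, for faces `a`, `b` with `x` in their boundaries. -/
def PencilLT {k : ℕ} (x : S.F k) (a b : S.F (k + 1)) : Prop :=
  (S.γ b = x ∧ x ∈ S.δ a) ∨ (x ∈ S.δ a ∧ x ∈ S.δ b ∧ S.UpLT a b) ∨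
    (S.γ a = x ∧ x = S.γ b ∧ S.UpLT b a)

/-- The flag order `x ◁ y`, decided at the lowest level at which the flags differ. -/
def FlagLT (x y : S.Vec) : Prop :=
  (∃ a b : S.F 0, x 0 = some a ∧ y 0 = some b ∧ a ≠ b ∧ S.UpLT b a) ∨
  ∃ (j : ℕ) (c : S.F j) (a b : S.F (j + 1)), (∀ i ≤ j, x i = y i) ∧ x j = some c ∧
    x (j + 1) = some a ∧ y (j + 1) = some b ∧ a ≠ b ∧
    ((sgn x j = 1 ∧ PencilLT c a b) ∨ (sgn x j = -1 ∧ PencilLT c b a))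

/-- `x` is the first flag under its top face `x_k`. -/
def IsFirstFlag (k : ℕ) (x : S.Vec) : Prop :=
  IsFlag k x ∧ ∀ y, IsFlag k y → y k = x k → ¬ FlagLT y x

/-- `x` is the last flag under its top face `x_k`. -/
def IsLastFlag (k : ℕ) (x : S.Vec) : Prop :=
  IsFlag k x ∧ ∀ y, IsFlag k y → y k = x k → ¬ FlagLT x y

/-- `i` is the low level of the flag `x = [x_k, …, x_0]`, i.e. the largest `i < k - 1` with
`x_{i+1} ∈ δ x_{i+2}`. (The first and the last flag under a face have no such level.) -/
def IsLowLevel (k : ℕ) (x : S.Vec) (i : ℕ) : Prop :=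
  IsGreatest {i | i + 1 < k ∧ ∃ a b, x (i + 1) = some a ∧ x (i + 2) = some b ∧ a ∈ S.δ b} i

/-- `z` is a punctured flag under some `k`-face: a flag in which the face at level `k - 1`
(high p-flags) or at the low level (low p-flags) is replaced by the dummy face. -/
def IsPFlag (k : ℕ) (z : S.Vec) : Prop :=
  ∃ (x : S.Vec) (i : ℕ), IsFlag k x ∧ (i + 1 = k ∨ IsLowLevel k x i) ∧ z = punct x i

variable (S)

/-- Flags `[x_k, …, x_0]` of `S`. -/
def Flag (k : ℕ) : Type u := {x : S.Vec // IsFlag k x}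

/-- P-flags of `S` with top face of dimension `k`. -/
def PFlag (k : ℕ) : Type u := {z : S.Vec // IsPFlag k z}

/-- Maximal flags. -/
abbrev MaxFlag : Type u := S.Flag S.dim

variable {S}

/-- The flag order on maximal flags. -/
def MaxFlag.LT (x y : S.MaxFlag) : Prop := FlagLT x.1 y.1

lemma IsPFlag.top_isSome {k : ℕ} {z : S.Vec} (hz : IsPFlag k z) : (z k).isSome := by
  obtain ⟨x, i, hx, hi, rfl⟩ := hz
  have hik : k ≠ i := by
    rcases hi with hi | hi
    · omega
    · have := hi.1.1
      omega
  rw [punct, Function.update_of_ne hik]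
  exact (hx.isSome_iff k).2 le_rfl

/-- The top face of a flag. -/
def Flag.top {k : ℕ} (x : S.Flag k) : S.F k := (x.1 k).get ((x.2.isSome_iff k).2 le_rfl)

/-- The top face of a p-flag. -/
def PFlag.top {k : ℕ} (z : S.PFlag k) : S.F k := (z.1 k).get z.2.top_isSome

lemma IsFlag.below {k : ℕ} {x : S.Vec} (hx : IsFlag k x) {m : ℕ} (hm : m ≤ k) :
    IsFlag m (below (m + 1) x) where
  isSome_iff i := by
    unfold PosHypergraph.below
    split_ifs with h
    · rw [hx.isSome_iff]; omega
    · simp; omega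
  mem_bd {i a b} ha hb := by
    unfold PosHypergraph.below at ha hb
    split_ifs at ha hb
    exact hx.mem_bd ha hb

/-- The truncation `[x_k, …, x_0]` of `[x_{k+1}, …, x_0]`. -/
def Flag.trunc {k : ℕ} (x : S.Flag (k + 1)) : S.Flag k :=
  ⟨PosHypergraph.below (k + 1) x.1, x.2.below (Nat.le_succ k)⟩

/-- The high p-flag `[x_{k+1}, 0, x_{k-1}, …, x_0]` of `[x_{k+1}, …, x_0]`. -/
def Flag.high {k : ℕ} (x : S.Flag (k + 1)) : S.PFlag (k + 1) :=
  ⟨punct x.1 k, x.1, k, x.2, Or.inl rfl, rfl⟩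

/-! ## The cylinder over a positive opetope -/

variable (S)

/-- The faces of the cylinder: flat faces `-p`, `+p`, flags and p-flags; the
dimension of a flag or p-flag is the number of its faces. -/
inductive CylFace : ℕ → Type u
  | neg {k : ℕ} (p : S.F k) : CylFace k
  | pos {k : ℕ} (p : S.F k) : CylFace k
  | flag {k : ℕ} (x : S.Flag k) : CylFace (k + 1)
  | pflag {k : ℕ} (z : S.PFlag k) : CylFace k

variable {S}

/-- The face `x_{low}` of a flag `x = [x_k, …, x_0]`, `k ≥ 1`: `-x_k` for the first flag,
`+x_k` for the last flag, and the low p-flag of `x` otherwise. -/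
def IsLow {k : ℕ} (x : S.Flag k) (w : S.CylFace k) : Prop :=
  (IsFirstFlag k x.1 ∧ w = .neg x.top) ∨ (IsLastFlag k x.1 ∧ w = .pos x.top) ∨
    (¬ IsFirstFlag k x.1 ∧ ¬ IsLastFlag k x.1 ∧
      ∃ (i : ℕ) (z : S.PFlag k), IsLowLevel k x.1 i ∧ z.1 = punct x.1 i ∧ w = .pflag z)

/-- The p-flag `z` is punctured at level `l`. -/
def PFlag.PuAt {k : ℕ} (z : S.PFlag k) (l : ℕ) : Prop := l < k ∧ z.1 l = none

/-- The entry of a p-flag at level `j`, where the dummy face at level `l` is replaced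
by `γ x_{l+1}`. -/
def PFlag.entry {k : ℕ} (z : S.PFlag k) (j : ℕ) : Option (S.F j) :=
  (z.1 j).or ((z.1 (j + 1)).map S.γ)

/-- For a p-flag `z` with puncture at level `l` and a `k`-face `p`, the face
`p ⋆ z` may be the p-flag `[p, γ p, …, γ^{(m+2)} p, t, 0, z_{m-1}, …, z_0]`, with `t` at level
`m + 1 ≤ k`: here `m ≤ l`, `t ∈ δ γ^{(m+2)} p` (or `t = p` if `m + 1 = k`),
and the entry of `z` at level `m + 1` is `≤⁺ t`. -/
def StarAt {n k : ℕ} (p : S.F k) (z : S.PFlag n) (m : ℕ) (t : S.F (m + 1)) : Prop :=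
  m + 1 ≤ k ∧ (∃ l, z.PuAt l ∧ m ≤ l) ∧ t ∈ S.lowerFaces p (m + 1) ∧
    ∃ y, z.entry (m + 1) = some y ∧ S.UpLE y t

/-- The vector `[p, γ p, …, γ^{(m+2)} p, t, 0, z_{m-1}, …, z_0]`. -/
def starVec {k : ℕ} (p : S.F k) (z : S.Vec) (m : ℕ) (t : S.F (m + 1)) : S.Vec :=
  Function.update
    (fun i => if i < m then z i else if i = m then none
      else if h : i ≤ k then some (S.iterγ p i h) else none)
    (m + 1) (some t)

/-- `w = p ⋆ z`, for a p-flag `z = [x_{k+1}, …, x_0]` punctured at some level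
and a `k`-face `p`. If `p = x_k` it is the truncation of `z`; otherwise it is
the p-flag described in `StarAt` with the largest possible `m`; otherwise it is `-p` or `+p`,
according to the position of `γ^{(0)} p` relative to `x_0` (or to `γ x_1`, if
the puncture is at level `0`). -/
def IsStar {k : ℕ} (p : S.F k) (z : S.PFlag (k + 1)) (w : S.CylFace k) : Prop :=
  (z.1 k = some p ∧ ∃ z₁ : S.PFlag k, z₁.1 = below (k + 1) z.1 ∧ w = .pflag z₁) ∨
  (z.1 k ≠ some p ∧ ∃ (m : ℕ) (t : S.F (m + 1)), IsGreatest {m | ∃ t, StarAt p z m t} m ∧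
    StarAt p z m t ∧ ∃ z₁ : S.PFlag k, z₁.1 = starVec p z.1 m t ∧ w = .pflag z₁) ∨
  (z.1 k ≠ some p ∧ (∀ m t, ¬ StarAt p z m t) ∧
    ((∃ x₀, z.1 0 = some x₀ ∧
        ((S.UpLE (S.iterγ p 0 k.zero_le) x₀ ∧ w = .neg p) ∨
          (S.UpLT x₀ (S.iterγ p 0 k.zero_le) ∧ w = .pos p))) ∨
      (z.1 0 = none ∧ ∃ x₁, z.1 1 = some x₁ ∧
        ((S.UpLT (S.iterγ p 0 k.zero_le) (S.γ x₁) ∧ w = .neg p) ∨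
          (S.UpLE (S.γ x₁) (S.iterγ p 0 k.zero_le) ∧ w = .pos p)))))

/-- The domains of the faces of the cylinder. -/
def cylδ : ∀ {k : ℕ}, S.CylFace (k + 1) → Set (S.CylFace k)
  | _, .neg p => CylFace.neg '' S.δ p
  | _, .pos p => CylFace.pos '' S.δ p
  | 0, .flag x => {.neg x.top}
  | _ + 1, .flag x => {w | w = .flag x.trunc ∨ IsLow x w}
  | 0, .pflag z => {w | ∃ p ∈ S.δ z.top, IsStar p z w}
  | k + 1, .pflag z => {w | (∃ p ∈ S.δ z.top, IsStar p z w) ∨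
      (z.PuAt (k + 1) ∧ ∃ y : S.Flag k, y.1 = below (k + 1) z.1 ∧ w = .flag y)}

open Classical in
/-- The vector of `γ z`, for a p-flag `z = [x_{k+2}, …, x_0]`: it is
`[γ x_{k+2}, 0, x_{k-1}, …, x_0]` if the puncture is at level `k + 1` or `k`, and the
truncation of `z` otherwise. -/
noncomputable def pflagγVec (k : ℕ) (z : S.Vec) : S.Vec :=
  if z (k + 1) = none ∨ z k = none then
    Function.update (below k z) (k + 1) ((z (k + 2)).map S.γ)
  else below (k + 2) z

lemma ne_none_of_some {α : Type*} {o : Option α} {a : α} (h : o = some a) : o ≠ none := by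
  simp [h]

lemma IsFlag.some_of_le {k : ℕ} {x : S.Vec} (hx : IsFlag k x) {i : ℕ} (hi : i ≤ k) :
    ∃ a, x i = some a := Option.isSome_iff_exists.1 ((hx.isSome_iff i).2 hi)

lemma IsFlag.none_of_lt {k : ℕ} {x : S.Vec} (hx : IsFlag k x) {i : ℕ} (hi : k < i) :
    x i = none := by
  have := (hx.isSome_iff i).not.2 (by omega)
  simpa using this

lemma IsFlag.extend {k : ℕ} {x : S.Vec} (hx : IsFlag k x) {a : S.F k} {b : S.F (k + 1)}
    (ha : x k = some a) (hab : a ∈ S.bd b) :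
    IsFlag (k + 1) (Function.update x (k + 1) (some b)) where
  isSome_iff i := by
    by_cases h : i = k + 1
    · subst h; simp
    · rw [Function.update_of_ne h, hx.isSome_iff]; omega
  mem_bd {i c d} hc hd := by
    by_cases h : i = k
    · subst h
      rw [Function.update_of_ne (by omega), ha] at hc
      rw [Function.update_self] at hd
      cases hc; cases hd; exact hab
    · rw [Function.update_of_ne (by omega)] at hd
      by_cases h₁ : i = k + 1
      · subst h₁
        rw [hx.none_of_lt (by omega)] at hd
        cases hd
      · rw [Function.update_of_ne h₁] at hc
        exact hx.mem_bd hc hd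

lemma isFlag_zero (a : S.F 0) : IsFlag 0 (Function.update (fun _ => none : S.Vec) 0 (some a)) where
  isSome_iff i := by
    by_cases h : i = 0
    · subst h; simp
    · rw [Function.update_of_ne h]; simpa using h
  mem_bd {i c d} _ hd := by
    rw [Function.update_of_ne (by omega)] at hd
    cases hd

/-- Faces occurring in `∂∂∂ a` occur in `∂∂γ a`. -/
lemma IsOpetopicCardinal.bd_bd_bd (hS : S.IsOpetopicCardinal) {k : ℕ} (a : S.F (k + 3))
    {b : S.F (k + 2)} (hb : b ∈ S.bd a) {y : S.F (k + 1)} (hy : y ∈ S.bd b) {w : S.F k}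
    (hw : w ∈ S.bd y) : ∃ y' ∈ S.bd (S.γ a), w ∈ S.bd y' := by
  have wf : WellFounded (S.UpLT (k := k + 1)) := by
    have : Std.Irrefl (S.UpLT (k := k + 1)) := ⟨fun a => hS.strict a⟩
    have : IsTrans _ (S.UpLT (k := k + 1)) := ⟨fun _ _ _ h₁ h₂ => h₁.trans h₂⟩
    exact Finite.wellFounded_of_trans_of_irrefl _
  have key : ∀ y b, b ∈ S.δ a → S.γ b = y → ∀ v ∈ S.δ b, w ∈ S.bd v →
      ∃ y' ∈ S.bd (S.γ a), w ∈ S.bd y' := by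
    intro y
    induction y using wf.induction with
    | _ y ih =>
      rintro b hb rfl v hv hwv
      by_cases hvg : v ∈ S.γ '' S.δ a
      · obtain ⟨c, hc, rfl⟩ := hvg
        have hlt : S.UpLT (S.γ c) (S.γ b) := Relation.TransGen.single ⟨b, hv, rfl⟩
        rcases hwv with rfl | hwv
        · have h := hS.glob_γ c
          have h' : S.γ (S.γ c) ∈ S.γ '' S.δ c := (h ▸ Set.mem_singleton _ :
            S.γ (S.γ c) ∈ (S.γ '' S.δ c) \ _).1
          obtain ⟨v', hv', he⟩ := h'
          exact ih _ hlt c hc rfl v' hv' (Or.inl he.symm)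
        · rw [hS.glob_δ c] at hwv
          have h' := hwv.1
          simp only [Set.mem_iUnion] at h'
          obtain ⟨v', hv', he⟩ := h'
          exact ih _ hlt c hc rfl v' hv' (Or.inr he)
      · refine ⟨v, Or.inr ?_, hwv⟩
        rw [hS.glob_δ a]
        exact ⟨by simp only [Set.mem_iUnion]; exact ⟨b, hb, hv⟩, hvg⟩
  rcases hb with rfl | hb
  · exact ⟨y, hy, hw⟩
  rcases hy with rfl | hy
  · rcases hw with rfl | hw
    · have h' : S.γ (S.γ b) ∈ S.γ '' S.δ b := (hS.glob_γ b ▸ Set.mem_singleton _ :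
        S.γ (S.γ b) ∈ (S.γ '' S.δ b) \ _).1
      obtain ⟨v', hv', he⟩ := h'
      exact key _ b hb rfl v' hv' (Or.inl he.symm)
    · rw [hS.glob_δ b] at hw
      have h' := hw.1
      simp only [Set.mem_iUnion] at h'
      obtain ⟨v', hv', he⟩ := h'
      exact key _ b hb rfl v' hv' (Or.inr he)
  · exact key _ b hb rfl y hy hw

lemma IsOpetopicCardinal.γ_notMem_δ (hS : S.IsOpetopicCardinal) {k : ℕ} (a : S.F (k + 1)) :
    S.γ a ∉ S.δ a := fun h => hS.strict _ (Relation.TransGen.single ⟨a, h, rfl⟩)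

lemma IsPFlag.pflagγVec (hS : S.IsOpetopicCardinal) {k : ℕ} {z : S.Vec}
    (hz : IsPFlag (k + 2) z) : IsPFlag (k + 1) (pflagγVec k z) := by
  obtain ⟨x, i, hx, hi, rfl⟩ := hz
  obtain ⟨a, ha⟩ := hx.some_of_le (i := k + 2) le_rfl
  have hik : i < k + 2 := by
    rcases hi with hi | hi
    · omega
    · have := hi.1.1; omega
  by_cases hki : k ≤ i
  · have hcond : punct x i (k + 1) = none ∨ punct x i k = none := by
      rcases (by omega : i = k + 1 ∨ i = k) with rfl | rfl <;> simp [punct]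
    have htop : punct x i (k + 2) = some a := by
      rw [punct, Function.update_of_ne (by omega), ha]
    rw [PosHypergraph.pflagγVec, if_pos hcond, htop]
    obtain ⟨y, hy, x', hx', hx'y, hx'b⟩ : ∃ y ∈ S.bd (S.γ a), ∃ x' : S.Vec, IsFlag k x' ∧
        x' k = some y ∧ ∀ j < k, x' j = x j := by
      rcases k with _ | k
      · exact ⟨S.γ (S.γ a), Or.inl rfl, _, isFlag_zero (S.γ (S.γ a)), by simp, by simp⟩
      · obtain ⟨b, hb⟩ := hx.some_of_le (i := k + 2) (by omega)
        obtain ⟨v, hv⟩ := hx.some_of_le (i := k + 1) (by omega)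
        obtain ⟨w, hw⟩ := hx.some_of_le (i := k) (by omega)
        obtain ⟨y, hy, hwy⟩ := hS.bd_bd_bd a (hx.mem_bd hb ha) (hx.mem_bd hv hb)
          (hx.mem_bd hw hv)
        refine ⟨y, hy, _, (hx.below (m := k) (by omega)).extend (a := w) (by simp [PosHypergraph.below, hw])
          hwy, by simp, fun j hj => ?_⟩
        rw [Function.update_of_ne (by omega)]
        simp [PosHypergraph.below, hj]
    refine ⟨_, k, hx'.extend hx'y hy, Or.inl rfl, ?_⟩
    funext j
    by_cases hj : j = k + 1
    · subst hj; simp [punct]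
    · by_cases hjk : j = k
      · subst hjk; simp [PosHypergraph.below, punct]
      · by_cases hlt : j < k
        · have hji : j ≠ i := by omega
          simp [PosHypergraph.below, punct, Function.update_of_ne, hj, hjk, hlt, hx'b j hlt, hji]
        · have := hx'.none_of_lt (i := j) (by omega)
          simp [PosHypergraph.below, punct, Function.update_of_ne, hj, hjk, hlt, this]
  · have hcond : ¬ (punct x i (k + 1) = none ∨ punct x i k = none) := by
      rw [punct, Function.update_of_ne (by omega), Function.update_of_ne (by omega)]
      obtain ⟨b, hb⟩ := hx.some_of_le (i := k + 1) (by omega)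
      obtain ⟨v, hv⟩ := hx.some_of_le (i := k) (by omega)
      simp [hb, hv]
    rw [PosHypergraph.pflagγVec, if_neg hcond]
    have hi' : IsLowLevel (k + 2) x i := by
      rcases hi with hi | hi
      · omega
      · exact hi
    refine ⟨_, i, hx.below (m := k + 1) (by omega), Or.inr ⟨⟨by omega, ?_⟩, ?_⟩, ?_⟩
    · obtain ⟨_, a', b', h₁, h₂, h₃⟩ := hi'.1
      refine ⟨a', b', ?_, ?_, h₃⟩
      · rw [PosHypergraph.below, if_pos (by omega), h₁]
      · rw [PosHypergraph.below, if_pos (by omega), h₂]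
    · rintro j ⟨hj, a', b', h₁, h₂, h₃⟩
      rw [PosHypergraph.below, if_pos (by omega)] at h₁ h₂
      exact hi'.2 ⟨by omega, a', b', h₁, h₂, h₃⟩
    · funext j
      by_cases hj : j = i
      · subst hj; simp [punct, PosHypergraph.below]
      · simp [punct, PosHypergraph.below, Function.update_of_ne hj, Nat.lt_succ_iff]

/-- The codomains of the faces of the cylinder. -/
noncomputable def cylγ (hS : S.IsOpetopicCardinal) : ∀ {k : ℕ}, S.CylFace (k + 1) → S.CylFace k
  | _, .neg p => .neg (S.γ p)
  | _, .pos p => .pos (S.γ p)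
  | 0, .flag x => .pos x.top
  | _ + 1, .flag x => .pflag x.high
  | 0, .pflag z => .pos (S.γ z.top)
  | k + 1, .pflag z => .pflag ⟨pflagγVec k z.1, z.2.pflagγVec hS⟩

lemma IsPFlag.none_of_lt {k : ℕ} {z : S.Vec} (hz : IsPFlag k z) {i : ℕ} (hi : k < i) :
    z i = none := by
  obtain ⟨x, j, hx, -, rfl⟩ := hz
  by_cases h : i = j
  · subst h; simp [punct]
  · rw [punct, Function.update_of_ne h, hx.none_of_lt hi]

lemma finite_vec {k : ℕ} (p : S.Vec → Prop) (hp : ∀ x, p x → ∀ i, k < i → x i = none) :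
    Finite {x : S.Vec // p x} := by
  refine Finite.of_injective
    (β := ∀ i : Fin (k + 1), Option (S.F i)) (fun x i => x.1 i) fun x y h => ?_
  refine Subtype.ext (funext fun i => ?_)
  by_cases hi : k < i
  · rw [hp _ x.2 i hi, hp _ y.2 i hi]
  · exact congrFun h ⟨i, by omega⟩

instance (k : ℕ) : Finite (S.Flag k) := finite_vec (k := k) _ fun _ hx _ hi => hx.none_of_lt hi

instance (k : ℕ) : Finite (S.PFlag k) := finite_vec (k := k) _ fun _ hx _ hi => hx.none_of_lt hi

lemma finite_cylFace (k : ℕ) : Finite (S.CylFace k) := by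
  rcases k with _ | k
  · refine Finite.of_surjective (α := S.F 0 ⊕ S.F 0 ⊕ S.PFlag 0)
      (Sum.elim .neg (Sum.elim .pos .pflag)) ?_
    rintro (p | p | x | z)
    · exact ⟨.inl p, rfl⟩
    · exact ⟨.inr (.inl p), rfl⟩
    · exact ⟨.inr (.inr z), rfl⟩
  · refine Finite.of_surjective (α := S.F (k + 1) ⊕ S.F (k + 1) ⊕ S.PFlag (k + 1) ⊕ S.Flag k)
      (Sum.elim .neg (Sum.elim .pos (Sum.elim .pflag .flag))) ?_
    rintro (p | p | x | z)
    · exact ⟨.inl p, rfl⟩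
    · exact ⟨.inr (.inl p), rfl⟩
    · exact ⟨.inr (.inr (.inr x)), rfl⟩
    · exact ⟨.inr (.inr (.inl z)), rfl⟩

lemma bounded_cylFace : ∃ N, ∀ k, N < k → IsEmpty (S.CylFace k) := by
  obtain ⟨N, hN⟩ := S.bounded
  refine ⟨N + 1, fun k hk => ⟨?_⟩⟩
  rintro (p | p | x | z)
  · exact (hN _ (by omega)).false p
  · exact (hN _ (by omega)).false p
  · exact (hN _ (by omega)).false x.top
  · exact (hN _ (by omega)).false z.top

lemma iterγ_self {k : ℕ} (p : S.F k) (h : k ≤ k) : S.iterγ p k h = p :=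
  Nat.decreasingInduction_self ..

lemma iterγ_succ {k : ℕ} (p : S.F k) (j : ℕ) (h : j + 1 ≤ k) :
    S.iterγ p j (by omega) = S.γ (S.iterγ p (j + 1) h) :=
  Nat.decreasingInduction_succ_left ..

lemma iterγ_γ {k : ℕ} (p : S.F (k + 1)) (j : ℕ) (h : j ≤ k) :
    S.iterγ p j (by omega) = S.iterγ (S.γ p) j h :=
  Nat.decreasingInduction_succ ..

lemma exists_mem_lowerFaces (hS : S.IsOpetopicCardinal) {k j : ℕ} (T : S.F (k + 1))
    (hj : j + 1 ≤ k) {t : S.F j} (ht : t ∈ S.δ (S.iterγ (S.γ T) (j + 1) hj)) :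
    ∃ p ∈ S.δ T, t ∈ S.δ (S.iterγ p (j + 1) hj) := by
  by_cases h : j + 1 = k
  · subst h
    rw [iterγ_self, hS.glob_δ] at ht
    have h' := ht.1
    simp only [Set.mem_iUnion] at h'
    obtain ⟨p, hp, h'⟩ := h'
    exact ⟨p, hp, by rwa [iterγ_self]⟩
  · obtain ⟨k, rfl⟩ : ∃ n, k = n + 1 := ⟨k - 1, by omega⟩
    have h' : S.γ (S.γ T) ∈ S.γ '' S.δ T := (hS.glob_γ T ▸ Set.mem_singleton _ :
      S.γ (S.γ T) ∈ (S.γ '' S.δ T) \ _).1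
    obtain ⟨p, hp, he⟩ := h'
    refine ⟨p, hp, ?_⟩
    rw [iterγ_γ _ _ (by omega), he, ← iterγ_γ _ _ (by omega)]
    exact ht


lemma IsFlag.iterγ_eq {k : ℕ} {x : S.Vec} (hx : IsFlag (k + 1) x) {T : S.F (k + 1)}
    (hT : x (k + 1) = some T) {i : ℕ} (hi : IsLowLevel (k + 1) x i) {j : ℕ} (hij : i + 2 ≤ j)
    (hj : j ≤ k + 1) : x j = some (S.iterγ T j hj) := by
  induction hj using Nat.decreasingInduction with
  | self => rw [hT, iterγ_self]
  | of_succ j hjk ih =>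
    specialize ih (by omega)
    rw [iterγ_succ T j hjk]
    obtain ⟨a, ha⟩ := hx.some_of_le (i := j) (by omega)
    rcases hx.mem_bd ha ih with rfl | h
    · exact ha
    · obtain ⟨j, rfl⟩ : ∃ n, j = n + 1 := ⟨j - 1, by omega⟩
      have := hi.2 ⟨by omega, a, _, ha, ih, h⟩
      omega

lemma exists_isStar (hS : S.IsOpetopicCardinal) {k : ℕ} (z : S.PFlag (k + 1)) :
    (∃ p ∈ S.δ z.top, ∃ w, IsStar p z w) ∨ z.PuAt k := by
  obtain ⟨z, hz⟩ := z
  obtain ⟨x, i, hx, hi, rfl⟩ := id hz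
  rcases hi with hi | hi
  · obtain rfl : i = k := by omega
    exact Or.inr ⟨by omega, by simp [punct]⟩
  left
  obtain ⟨hik, a, b, ha, hb, hab⟩ := hi.1
  set T := PFlag.top ⟨_, hz⟩ with hTdef
  have hT : x (k + 1) = some T := by
    have h : punct x i (k + 1) = some T := by simp [hTdef, PFlag.top]
    rwa [punct, Function.update_of_ne (by omega)] at h
  have hpu : ∀ l, PFlag.PuAt ⟨_, hz⟩ l → l = i := by
    rintro l ⟨hl, h⟩
    by_contra hne
    change punct x i l = none at h
    rw [punct, Function.update_of_ne hne] at h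
    obtain ⟨c, hc⟩ := hx.some_of_le hl.le
    rw [hc] at h
    cases h
  by_cases h1 : i + 1 = k
  · subst h1
    obtain rfl : b = T := by rw [hb] at hT; exact Option.some.inj hT
    refine ⟨a, hab, _, Or.inl ⟨?_, ⟨below (i + 2) (punct x i), ?_⟩, rfl, rfl⟩⟩
    · change punct x i (i + 1) = some a
      rw [punct, Function.update_of_ne (by omega), ha]
    · refine ⟨_, i, hx.below (m := i + 1) (by omega), Or.inl rfl, ?_⟩
      funext j
      by_cases hj : j = i
      · subst hj; simp [punct, PosHypergraph.below]
      · simp [punct, PosHypergraph.below, Function.update_of_ne hj,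
          show j < i + 2 ↔ j ≤ i + 1 by omega]
  · have hb' := hx.iterγ_eq hT hi (j := i + 2) le_rfl (by omega)
    rw [hb] at hb'
    obtain rfl := Option.some.inj hb'
    rw [iterγ_γ T (i + 2) (by omega)] at hab
    obtain ⟨p, hp, hap⟩ := exists_mem_lowerFaces hS T (by omega) hab
    have hne : punct x i k ≠ some p := by
      rw [punct, Function.update_of_ne (by omega), hx.iterγ_eq hT hi (j := k) (by omega) (by omega),
        iterγ_succ T k le_rfl, iterγ_self]
      rintro h
      rw [← Option.some.inj h] at hp
      exact hS.γ_notMem_δ T hp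
    have hst : StarAt p ⟨_, hz⟩ i a := by
      refine ⟨by omega, ⟨i, ⟨by omega, by simp [punct]⟩, le_rfl⟩, Or.inl ⟨by omega, hap⟩, a, ?_,
        Or.inl rfl⟩
      simp [PFlag.entry, punct, ha]
    refine ⟨p, hp, _, Or.inr (Or.inl ⟨hne, i, a, ⟨⟨a, hst⟩, ?_⟩, hst,
      ⟨starVec p (punct x i) i a, ?_⟩, rfl, rfl⟩)⟩
    · rintro m ⟨t, -, ⟨l, hl, hml⟩, -⟩
      rwa [hpu l hl] at hml
    · set x' : S.Vec := fun j => if j ≤ i + 1 then x j else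
        if h : j ≤ k then some (S.iterγ p j h) else none with hx'
      have hlo : ∀ j ≤ i + 1, x' j = x j := fun j hj => by simp [hx', hj]
      have hhi : ∀ j (_ : i + 1 < j) (h : j ≤ k), x' j = some (S.iterγ p j h) := fun j hj h => by
        have : ¬ j ≤ i + 1 := by omega
        simp [hx', this, h]
      have hno : ∀ j, k < j → x' j = none := fun j hj => by
        have h₁ : ¬ j ≤ i + 1 := by omega
        have h₂ : ¬ j ≤ k := by omega
        simp [hx', h₁, h₂]
      refine ⟨x', i, ⟨fun j => ?_, fun {j c d} hc hd => ?_⟩, Or.inr ⟨⟨by omega, a, _, ?_,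
        hhi (i + 2) (by omega) (by omega), hap⟩, ?_⟩, ?_⟩
      · by_cases h₁ : j ≤ i + 1
        · rw [hlo j h₁, hx.isSome_iff]; omega
        · by_cases h₂ : j ≤ k
          · simp [hhi j (by omega) h₂, h₂]
          · simp [hno j (by omega), h₂]
      · by_cases h₁ : j ≤ i
        · rw [hlo _ (by omega)] at hc hd
          exact hx.mem_bd hc hd
        · by_cases h₂ : j + 1 ≤ k
          · rw [hhi _ (by omega) h₂] at hd
            cases hd
            by_cases h₃ : j = i + 1
            · subst h₃
              rw [hlo _ le_rfl, ha] at hc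
              cases hc
              exact Or.inr hap
            · rw [hhi _ (by omega) (by omega), iterγ_succ p j h₂] at hc
              cases hc
              exact Or.inl rfl
          · rw [hno _ (by omega)] at hd
            cases hd
      · rw [hlo _ le_rfl, ha]
      · rintro j ⟨hj, c, d, hc, hd, hcd⟩
        by_contra hlt
        rw [hhi _ (by omega) (by omega)] at hd
        rw [hhi _ (by omega) (by omega), iterγ_succ p (j + 1) (by omega)] at hc
        cases hc; cases hd
        exact hS.γ_notMem_δ _ hcd
      · funext j
        by_cases h₁ : j = i + 1
        · subst h₁; simp [starVec, punct, hlo, ha]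
        · rw [starVec, Function.update_of_ne h₁]
          by_cases h₂ : j = i
          · subst h₂; simp [punct]
          · simp only [punct, Function.update_of_ne h₂]
            by_cases h₃ : j < i
            · rw [if_pos h₃, hlo j (by omega)]
            · rw [if_neg h₃, if_neg h₂]
              have : ¬ j ≤ i + 1 := by omega
              simp [hx', this]

lemma cylδ_zero (hS : S.IsOpetopicCardinal) (a : S.CylFace 1) : ∃! b, b ∈ cylδ a := by
  match a with
  | .neg p =>
    obtain ⟨b, hb, hu⟩ := S.δ_zero p
    refine ⟨.neg b, ⟨b, hb, rfl⟩, ?_⟩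
    rintro _ ⟨c, hc, rfl⟩
    rw [hu c hc]
  | .pos p =>
    obtain ⟨b, hb, hu⟩ := S.δ_zero p
    refine ⟨.pos b, ⟨b, hb, rfl⟩, ?_⟩
    rintro _ ⟨c, hc, rfl⟩
    rw [hu c hc]
  | .flag x => exact ⟨.neg x.top, rfl, fun _ h => h⟩
  | .pflag z =>
    obtain ⟨b, hb, hu⟩ := S.δ_zero z.top
    have hlt : S.UpLT b (S.γ z.top) := Relation.TransGen.single ⟨z.top, hb, rfl⟩
    have h0 : z.1 0 = none := by
      obtain ⟨_, x, i, hx, hi, rfl⟩ := z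
      obtain rfl : i = 0 := by
        rcases hi with hi | hi
        · omega
        · have := hi.1.1; omega
      simp [punct]
    have h1 : z.1 1 = some z.top := by simp [PFlag.top]
    have hst : ∀ p w, IsStar p z w ↔
        (S.UpLT p (S.γ z.top) ∧ w = .neg p) ∨ (S.UpLE (S.γ z.top) p ∧ w = .pos p) := by
      intro p w
      have hno : ∀ m t, ¬ StarAt p z m t := fun m t h => absurd h.1 (by omega)
      constructor
      · rintro (h | ⟨-, m, t, -, h, -⟩ | ⟨-, -, ⟨x₀, h, -⟩ | ⟨-, x₁, h, h'⟩⟩)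
        · rw [h0] at h; cases h.1
        · exact absurd h (hno m t)
        · rw [h0] at h; cases h
        · rw [h1] at h
          cases h
          rwa [iterγ_self] at h'
      · intro h
        refine Or.inr (Or.inr ⟨by simp [h0], hno, Or.inr ⟨h0, _, h1, ?_⟩⟩)
        rwa [iterγ_self]
    refine ⟨.neg b, ⟨b, hb, (hst _ _).2 (Or.inl ⟨hlt, rfl⟩)⟩, ?_⟩
    rintro w ⟨c, hc, hw⟩
    rw [hu c hc] at hw
    rcases (hst _ _).1 hw with ⟨-, h⟩ | ⟨h, -⟩
    · exact h
    · rcases h with h | h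
      · rw [h] at hlt; exact absurd hlt (hS.strict _)
      · exact absurd (hlt.trans h) (hS.strict _)

lemma cylδ_nonempty (hS : S.IsOpetopicCardinal) {k : ℕ} (a : S.CylFace (k + 1)) :
    (cylδ a).Nonempty := by
  match k, a with
  | _, .neg p => exact (S.δ_total p).image _
  | _, .pos p => exact (S.δ_total p).image _
  | 0, .flag x => exact ⟨_, rfl⟩
  | _ + 1, .flag x => exact ⟨_, Or.inl rfl⟩
  | 0, .pflag z =>
    exact (cylδ_zero hS (.pflag z)).exists
  | k + 1, .pflag z =>
    rcases exists_isStar hS z with ⟨p, hp, w, hw⟩ | h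
    · exact ⟨w, Or.inl ⟨p, hp, hw⟩⟩
    · obtain ⟨z, x, i, hx, hi, rfl⟩ := z
      refine ⟨_, Or.inr ⟨h, ⟨below (k + 1) (punct x i), ?_⟩, rfl, rfl⟩⟩
      have h2 : i = k + 1 := by
        by_contra hne
        have h2 : punct x i (k + 1) = none := h.2
        rw [punct, Function.update_of_ne (by omega)] at h2
        obtain ⟨c, hc⟩ := hx.some_of_le (i := k + 1) (by omega)
        rw [hc] at h2
        cases h2
      subst h2
      have he : below (k + 1) (punct x (k + 1)) = below (k + 1) x := by
        funext j
        by_cases hj : j < k + 1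
        · simp [PosHypergraph.below, punct, hj, Function.update_of_ne hj.ne]
        · simp [PosHypergraph.below, hj]
      rw [he]
      exact hx.below (by omega)

/-- The cylinder over a positive opetope, as a positive hypergraph. -/
noncomputable def cylinder (S : PosHypergraph.{u}) (hS : S.IsPositiveOpetope) :
    PosHypergraph.{u} where
  F := S.CylFace
  γ := cylγ hS.toIsOpetopicCardinal
  δ := cylδ
  finite_F := finite_cylFace
  bounded := bounded_cylFace
  δ_total := cylδ_nonempty hS.toIsOpetopicCardinal
  δ_zero := cylδ_zero hS.toIsOpetopicCardinal

/-- `S^x`, for a flag `x`: the least sub-hypergraph of the cylinder containing `x`. -/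
noncomputable def flagSub (hS : S.IsPositiveOpetope) {k : ℕ} (x : S.Flag k) :
    (S.cylinder hS).Sub :=
  gen (S := S.cylinder hS) (k := k + 1) (CylFace.flag x)

/-- `S^z`, for a p-flag `z`: the least sub-hypergraph of the cylinder containing `z`. -/
noncomputable def pflagSub (hS : S.IsPositiveOpetope) {k : ℕ} (z : S.PFlag k) :
    (S.cylinder hS).Sub :=
  gen (S := S.cylinder hS) (k := k) (CylFace.pflag z)

end PosHypergraph

/-! ## Straight objects -/

/-- An object `A` of a category is `X`-straight if there are a finite linear order `Q` and
subobjects `a q` of `A`, `q ∈ Q`, with domains in `X`, whose union is `A`, and such that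
for every `q` which is not the least element of `Q` the intersection of `a q` with the union
of the `a q'`, `q' < q`, is isomorphic to an object in `X`. Unions and intersections are
suprema and infima in the partial order of subobjects. -/
def IsStraight {C : Type*} [Category C] (X : ObjectProperty C) (A : C) : Prop :=
  ∃ (Q : Type) (_ : LinearOrder Q) (_ : Finite Q) (a : Q → Subobject A),
    (∀ q, X.isoClosure (a q : C)) ∧
    IsLUB (Set.range a) ⊤ ∧
    ∀ q, ¬ IsBot q → ∃ U V : Subobject A,
      IsLUB (a '' Set.Iio q) U ∧ IsGLB {U, a q} V ∧ X.isoClosure (V : C)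

namespace PosHypergraph

variable {S : PosHypergraph.{u}}

/-! ## Orders on the faces of an opetopic cardinal -/

/-! Fix a face `q` of the opetope. The flags under `q` form a finite linear order, and the whole
cylinder can be read off from these orders. The flat faces and p-flags with top face `q` are exactly
the cuts (initial segments) of the flags under `q`: `-q` is the empty cut, `+q` the full one, and a
p-flag is the gap between two adjacent flags. This holds because adjacent flags differ at exactly
one level, which is the high level if the earlier flag has sign `+1` and the low level if it has
sign `-1` (`high_adj`, `low_adj`, `adj_cases`). Two facts about the faces lie behind it. Around a
lower flag the boundary of a face `t` contains exactly two faces, ordered as the signs prescribe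
(`locLT_bd_iff`). A face strictly between those two lies in the boundary of faces strictly inside
`t` only (`lt_of_loc_between`, which comes from `lt_of_inside`).

In terms of cuts the operations become uniform. For `p ∈ ∂q` a cut over `q` restricts to a cut over
`p` (`rho`). The codomain of a face `(q, I)` is the restriction of `I` to `γ q`. Its domain consists
of the restrictions of `I` to the faces of `δ q`, together with one inserted flag `h` if `I`
separates the two flags under `q` which lie over `h` and differ only just below `q` (`gap_cylγ`,
`mem_cylδ_gap`). The explicit recipe for `p ⋆ z` computes such a restriction (`isStar_iff`). A flag
`h` under `q` has as codomain the cut on its high side, and as domain its truncation and the cut on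
its low side.

Thus the domain tree of `(q, I)` is the tree of `q`, with the vertex under the inserted flag `h`
split into the cuts `lo` and `hi` next to `h`, joined by `h` as a new edge. The domain of a flag
consists of two edges and is treated directly. So all domains are trees with the right root and
leaves (`cylinder_isTreelike`). This local property makes every face generate a positive opetope
(`isPositiveOpetope_gen`): faces of codimension at least three already occur in the codomain, and an
induction on the dimension leaves the codimensions up to two.

For the decomposition, every cut is next to some flag and every flag extends to a maximal one, so
the opetopes of maximal flags cover. In the opetope of `y` all flags are truncations of `y`, and all
cuts agree with the cut at `y` except perhaps at a truncation of `y` itself (`InA`). A face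
compatible with `x'` and with an earlier `y` is thereby forced into the opetope of `x ∩ x'`
(`mem_pflagSub`). Finally, unions and intersections of sub-hypergraphs are suprema and infima of
subobjects, because a morphism out of a sub-hypergraph is glued from its restrictions to the parts
generated by single faces (`Sub.mk_incl_le`). -/

lemma UpLE.refl {k : ℕ} (a : S.F k) : S.UpLE a a := Or.inl rfl

lemma UpLT.le {k : ℕ} {a b : S.F k} (h : S.UpLT a b) : S.UpLE a b := Or.inr h

lemma UpLE.trans_lt {k : ℕ} {a b c : S.F k} (h : S.UpLE a b) (h' : S.UpLT b c) : S.UpLT a c := by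
  rcases h with rfl | h
  · exact h'
  · exact h.trans h'

lemma UpLT.trans_le {k : ℕ} {a b c : S.F k} (h : S.UpLT a b) (h' : S.UpLE b c) : S.UpLT a c := by
  rcases h' with rfl | h'
  · exact h
  · exact h.trans h'

lemma UpLE.trans {k : ℕ} {a b c : S.F k} (h : S.UpLE a b) (h' : S.UpLE b c) : S.UpLE a c := by
  rcases h with rfl | h
  · exact h'
  · exact (h.trans_le h').le

lemma upLT_γ {k : ℕ} {a : S.F k} {b : S.F (k + 1)} (h : a ∈ S.δ b) : S.UpLT a (S.γ b) :=
  .single ⟨b, h, rfl⟩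

lemma γ_mem_bd {k : ℕ} (b : S.F (k + 1)) : S.γ b ∈ S.bd b := Or.inl rfl

lemma mem_bd_of_mem_δ {k : ℕ} {a : S.F k} {b : S.F (k + 1)} (h : a ∈ S.δ b) : a ∈ S.bd b :=
  Or.inr h

lemma UpLT.exists_head {k : ℕ} {a b : S.F k} (h : S.UpLT a b) :
    ∃ g, a ∈ S.δ g ∧ S.UpLE (S.γ g) b := by
  induction h using Relation.TransGen.head_induction_on with
  | single h =>
    obtain ⟨g, hg, rfl⟩ := h
    exact ⟨g, hg, .refl _⟩
  | head h h' _ =>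
    obtain ⟨g, hg, rfl⟩ := h
    exact ⟨g, hg, UpLT.le h'⟩

lemma UpLT.exists_tail {k : ℕ} {a b : S.F k} (h : S.UpLT a b) : ∃ g, S.γ g = b := by
  induction h with
  | single h => exact ⟨_, h.choose_spec.2⟩
  | tail _ h => exact ⟨_, h.choose_spec.2⟩

namespace IsOpetopicCardinal

lemma upLT_wf (hS : S.IsOpetopicCardinal) (k : ℕ) : WellFounded (S.UpLT (k := k)) := by
  have : Std.Irrefl (S.UpLT (k := k)) := ⟨fun a => hS.strict a⟩
  have : IsTrans _ (S.UpLT (k := k)) := ⟨fun _ _ _ h₁ h₂ => h₁.trans h₂⟩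
  exact Finite.wellFounded_of_trans_of_irrefl _

lemma upGT_wf (hS : S.IsOpetopicCardinal) (k : ℕ) :
    WellFounded (fun a b : S.F k => S.UpLT b a) := by
  have : Std.Irrefl (fun a b : S.F k => S.UpLT b a) := ⟨fun a => hS.strict a⟩
  have : IsTrans _ (fun a b : S.F k => S.UpLT b a) := ⟨fun _ _ _ h₁ h₂ => h₂.trans h₁⟩
  exact Finite.wellFounded_of_trans_of_irrefl _

lemma not_le_of_lt (hS : S.IsOpetopicCardinal) {k : ℕ} {a b : S.F k} (h : S.UpLT a b) :
    ¬ S.UpLE b a := fun h' => hS.strict _ (h.trans_le h')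

lemma ne_of_lt (hS : S.IsOpetopicCardinal) {k : ℕ} {a b : S.F k} (h : S.UpLT a b) : a ≠ b := by
  rintro rfl
  exact hS.strict _ h

lemma le_antisymm (hS : S.IsOpetopicCardinal) {k : ℕ} {a b : S.F k} (h : S.UpLE a b)
    (h' : S.UpLE b a) : a = b := by
  rcases h with h | h
  · exact h
  · exact absurd h' (hS.not_le_of_lt h)

/-! ### Globularity, element by element -/

lemma exists_γγ (hS : S.IsOpetopicCardinal) {k : ℕ} (v : S.F (k + 2)) :
    ∃ b ∈ S.δ v, S.γ b = S.γ (S.γ v) :=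
  (hS.glob_γ v ▸ Set.mem_singleton _ : S.γ (S.γ v) ∈ (S.γ '' S.δ v) \ _).1

lemma γγ_notMem (hS : S.IsOpetopicCardinal) {k : ℕ} {v : S.F (k + 2)} {b : S.F (k + 1)}
    (hb : b ∈ S.δ v) : S.γ (S.γ v) ∉ S.δ b := fun h => by
  have := (hS.glob_γ v ▸ Set.mem_singleton _ : S.γ (S.γ v) ∈ (S.γ '' S.δ v) \ _).2
  simp only [Set.mem_iUnion] at this
  exact this ⟨b, hb, h⟩

lemma γ_eq_γγ_or (hS : S.IsOpetopicCardinal) {k : ℕ} {v : S.F (k + 2)} {b : S.F (k + 1)}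
    (hb : b ∈ S.δ v) : S.γ b = S.γ (S.γ v) ∨ ∃ b' ∈ S.δ v, S.γ b ∈ S.δ b' := by
  by_cases h : ∃ b' ∈ S.δ v, S.γ b ∈ S.δ b'
  · exact Or.inr h
  · left
    have : S.γ b ∈ (S.γ '' S.δ v) \ (⋃ b ∈ S.δ v, S.δ b) := by
      refine ⟨⟨b, hb, rfl⟩, ?_⟩
      simpa only [Set.mem_iUnion, exists_prop] using h
    rw [← hS.glob_γ v] at this
    exact this

lemma exists_of_mem_δγ (hS : S.IsOpetopicCardinal) {k : ℕ} {v : S.F (k + 2)} {x : S.F k}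
    (hx : x ∈ S.δ (S.γ v)) : ∃ b ∈ S.δ v, x ∈ S.δ b := by
  rw [hS.glob_δ v] at hx
  simpa only [Set.mem_iUnion, exists_prop] using hx.1

lemma γ_ne_of_mem_δγ (hS : S.IsOpetopicCardinal) {k : ℕ} {v : S.F (k + 2)} {x : S.F k}
    (hx : x ∈ S.δ (S.γ v)) {b : S.F (k + 1)} (hb : b ∈ S.δ v) : S.γ b ≠ x := by
  rw [hS.glob_δ v] at hx
  exact fun h => hx.2 ⟨b, hb, h⟩

lemma mem_δγ_or (hS : S.IsOpetopicCardinal) {k : ℕ} {v : S.F (k + 2)} {x : S.F k}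
    {b : S.F (k + 1)} (hb : b ∈ S.δ v) (hx : x ∈ S.δ b) :
    x ∈ S.δ (S.γ v) ∨ ∃ b' ∈ S.δ v, S.γ b' = x := by
  by_cases h : ∃ b' ∈ S.δ v, S.γ b' = x
  · exact Or.inr h
  · left
    rw [hS.glob_δ v]
    refine ⟨?_, h⟩
    simp only [Set.mem_iUnion, exists_prop]
    exact ⟨b, hb, hx⟩

/-- The faces in `∂∂v` lie in `δγv` or in `γδv`. -/
lemma bd_bd_cases (hS : S.IsOpetopicCardinal) {k : ℕ} {v : S.F (k + 2)} {x : S.F k}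
    {b : S.F (k + 1)} (hx : x ∈ S.bd b) (hb : b ∈ S.bd v) :
    x ∈ S.δ (S.γ v) ∨ ∃ b' ∈ S.δ v, S.γ b' = x := by
  rcases hb with rfl | hb
  · rcases hx with rfl | hx
    · exact Or.inr (hS.exists_γγ v)
    · exact Or.inl hx
  · rcases hx with rfl | hx
    · exact Or.inr ⟨b, hb, rfl⟩
    · exact hS.mem_δγ_or hb hx

lemma upLT_γ_of_lowLT {k : ℕ} {a b : S.F (k + 1)} (h : S.LowLT a b) :
    S.UpLT (S.γ a) (S.γ b) := by
  induction h with
  | single h => exact upLT_γ h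
  | tail _ h ih => exact ih.trans (upLT_γ h)

/-- The faces witnessing the successive steps of an upper chain form a lower chain one dimension up.
-/
lemma exists_lowLT_of_upLT {k : ℕ} {y y' : S.F k} (h : S.UpLT y y') :
    ∃ e e', y ∈ S.δ e ∧ S.γ e' = y' ∧ (e = e' ∨ S.LowLT e e') := by
  induction h with
  | single h =>
    obtain ⟨e, he, rfl⟩ := h
    exact ⟨e, e, he, rfl, Or.inl rfl⟩
  | tail _ h ih =>
    obtain ⟨e', he', rfl⟩ := h
    obtain ⟨e, c, he, rfl, hc⟩ := ih
    refine ⟨e, e', he, rfl, Or.inr ?_⟩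
    rcases hc with rfl | hc
    · exact .single he'
    · exact hc.tail he'

/-- The faces in `δ b` are pairwise incomparable. -/
lemma δ_antichain (hS : S.IsOpetopicCardinal) {k : ℕ} {b : S.F (k + 1)} {y y' : S.F k}
    (hy : y ∈ S.δ b) (hy' : y' ∈ S.δ b) : ¬ S.UpLT y y' := by
  intro h
  obtain ⟨e, e', he, rfl, hee⟩ := exists_lowLT_of_upLT h
  have hlow : S.LowLT e b := by
    rcases hee with rfl | hee
    · exact .single hy'
    · exact hee.tail hy'
  -- Both `e` and `b` have `y` in their domains. If they differ, pencil linearity and `e <⁻ b`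
  -- contradict disjointness; if they coincide, the lower chain maps to a loop at `γ b`.
  by_cases hne : e = b
  · subst hne
    exact hS.strict _ (upLT_γ_of_lowLT hlow)
  · exact hS.disjoint e b ⟨Or.inl hlow, hS.pencil_δ y e b he hy hne⟩

lemma eq_of_le_of_mem_δ (hS : S.IsOpetopicCardinal) {k : ℕ} {b : S.F (k + 1)} {y y' : S.F k}
    (hy : y ∈ S.δ b) (hy' : y' ∈ S.δ b) (h : S.UpLE y y') : y = y' :=
  h.resolve_right (hS.δ_antichain hy hy')

/-- Two faces with a common codomain are comparable by pencil linearity, whereas the faces of `δ v`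
form an antichain. -/
lemma γ_injOn (hS : S.IsOpetopicCardinal) {k : ℕ} (v : S.F (k + 2)) : Set.InjOn S.γ (S.δ v) := by
  intro b hb b' hb' h
  by_contra hne
  rcases hS.pencil_γ _ b b' rfl h hne with h | h
  · exact hS.δ_antichain hb hb' h
  · exact hS.δ_antichain hb' hb h

lemma eq_of_mem_δ (hS : S.IsOpetopicCardinal) {k : ℕ} {v : S.F (k + 2)} {b b' : S.F (k + 1)}
    (hb : b ∈ S.δ v) (hb' : b' ∈ S.δ v) {x : S.F k} (hx : x ∈ S.δ b) (hx' : x ∈ S.δ b') :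
    b = b' := by
  by_contra hne
  rcases hS.pencil_δ _ b b' hx hx' hne with h | h
  · exact hS.δ_antichain hb hb' h
  · exact hS.δ_antichain hb' hb h

/-- Climbing from a codomain to the face of `δ v` that has it as a source can only stop at the root
`γγv`. -/
lemma γ_le_γγ (hS : S.IsOpetopicCardinal) {k : ℕ} {v : S.F (k + 2)} {b : S.F (k + 1)}
    (hb : b ∈ S.δ v) : S.UpLE (S.γ b) (S.γ (S.γ v)) := by
  suffices ∀ x b, b ∈ S.δ v → S.γ b = x → S.UpLE x (S.γ (S.γ v)) from this _ b hb rfl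
  intro x
  induction x using (hS.upGT_wf k).induction with
  | _ x ih =>
    rintro b hb rfl
    rcases hS.γ_eq_γγ_or hb with h | ⟨b', hb', h⟩
    · exact Or.inl h
    · exact ((upLT_γ h).trans_le (ih _ (upLT_γ h) b' hb' rfl)).le

lemma le_γγ (hS : S.IsOpetopicCardinal) {k : ℕ} {v : S.F (k + 2)} {b : S.F (k + 1)} {x : S.F k}
    (hx : x ∈ S.bd b) (hb : b ∈ S.bd v) : S.UpLE x (S.γ (S.γ v)) := by
  have key : S.UpLE (S.γ b) (S.γ (S.γ v)) := by
    rcases hb with rfl | hb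
    · exact .refl _
    · exact hS.γ_le_γγ hb
  rcases hx with rfl | hx
  · exact key
  · exact (upLT_γ hx).le.trans key

lemma γ_le_γ (hS : S.IsOpetopicCardinal) {k : ℕ} {a b : S.F (k + 1)} (h : S.UpLE a b) :
    S.UpLE (S.γ a) (S.γ b) := by
  rcases h with rfl | h
  · exact .refl _
  induction h with
  | single h =>
    obtain ⟨v, hv, rfl⟩ := h
    exact hS.γ_le_γγ hv
  | tail _ h ih =>
    obtain ⟨v, hv, rfl⟩ := h
    exact ih.trans (hS.γ_le_γγ hv)

/-- Below every face in `∂∂v` there is one in `δγv`. -/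
lemma exists_le_mem_δγ (hS : S.IsOpetopicCardinal) {k : ℕ} {v : S.F (k + 2)} {b : S.F (k + 1)}
    {x : S.F k} (hx : x ∈ S.bd b) (hb : b ∈ S.bd v) : ∃ y ∈ S.δ (S.γ v), S.UpLE y x := by
  induction x using (hS.upLT_wf k).induction generalizing b with
  | _ x ih =>
    rcases hS.bd_bd_cases hx hb with h | ⟨b', hb', rfl⟩
    · exact ⟨x, h, .refl _⟩
    · obtain ⟨y, hy⟩ := S.δ_total b'
      obtain ⟨w, hw, hwy⟩ := ih y (upLT_γ hy) (Or.inr hy) (Or.inr hb')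
      exact ⟨w, hw, hwy.trans (upLT_γ hy).le⟩

lemma exists_le_mem_δ (hS : S.IsOpetopicCardinal) {k : ℕ} {a b : S.F (k + 1)} (h : S.UpLE a b)
    {x : S.F k} (hx : x ∈ S.δ a) : ∃ y ∈ S.δ b, S.UpLE y x := by
  rcases h with rfl | h
  · exact ⟨x, hx, .refl _⟩
  induction h with
  | single h =>
    obtain ⟨v, hv, rfl⟩ := h
    exact hS.exists_le_mem_δγ (Or.inr hx) (Or.inr hv)
  | tail _ h ih =>
    obtain ⟨v, hv, rfl⟩ := h
    obtain ⟨y, hy, hyx⟩ := ih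
    obtain ⟨w, hw, hwy⟩ := hS.exists_le_mem_δγ (Or.inr hy) (Or.inr hv)
    exact ⟨w, hw, hwy.trans hyx⟩

/-- As long as `r` is the codomain of some `b' ∈ δ v`, globularity of `b'` gives a lower face in `δ
b'` with the same source `s`. The descent ends at a leaf of the tree of `v`. The next lemma does the
same for targets. -/
lemma exists_le_mem_δγ_of_mem_δ (hS : S.IsOpetopicCardinal) {k : ℕ} {v : S.F (k + 3)}
    {b : S.F (k + 2)} {r : S.F (k + 1)} {s : S.F k} (hb : b ∈ S.bd v) (hr : r ∈ S.bd b)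
    (hs : s ∈ S.δ r) : ∃ r₀ ∈ S.δ (S.γ v), s ∈ S.δ r₀ ∧ S.UpLE r₀ r := by
  induction r using (hS.upLT_wf _).induction generalizing b with
  | _ r ih =>
    rcases hS.bd_bd_cases hr hb with h | ⟨b', hb', rfl⟩
    · exact ⟨r, h, hs, .refl _⟩
    · obtain ⟨y, hy, hsy⟩ := hS.exists_of_mem_δγ hs
      obtain ⟨w, hw, hsw, hwy⟩ := ih y (upLT_γ hy) (Or.inr hb') (Or.inr hy) hsy
      exact ⟨w, hw, hsw, hwy.trans (upLT_γ hy).le⟩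

lemma exists_le_mem_δγ_of_γ_eq (hS : S.IsOpetopicCardinal) {k : ℕ} {v : S.F (k + 3)}
    {b : S.F (k + 2)} {r : S.F (k + 1)} {s : S.F k} (hb : b ∈ S.bd v) (hr : r ∈ S.bd b)
    (hs : S.γ r = s) : ∃ r₀ ∈ S.δ (S.γ v), S.γ r₀ = s ∧ S.UpLE r₀ r := by
  induction r using (hS.upLT_wf _).induction generalizing b with
  | _ r ih =>
    rcases hS.bd_bd_cases hr hb with h | ⟨b', hb', rfl⟩
    · exact ⟨r, h, hs, .refl _⟩
    · obtain ⟨y, hy, hsy⟩ := hS.exists_γγ b'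
      obtain ⟨w, hw, hsw, hwy⟩ := ih y (upLT_γ hy) (Or.inr hb') (Or.inr hy) (hsy.trans hs)
      exact ⟨w, hw, hsw, hwy.trans (upLT_γ hy).le⟩

/-- Two faces above a common face are comparable. -/
lemma upLE_total_of_le (hS : S.IsOpetopicCardinal) {k : ℕ} {c a b : S.F k} (ha : S.UpLE c a)
    (hb : S.UpLE c b) : S.UpLE a b ∨ S.UpLT b a := by
  induction c using (hS.upGT_wf k).induction with
  | _ c ih =>
    rcases ha with rfl | ha
    · exact Or.inl hb
    rcases hb with rfl | hb
    · exact Or.inr ha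
    -- Both chains leave `c` through faces having `c` in their domains. These are comparable, so the
    -- lower of their codomains is a common lower bound above `c`.
    obtain ⟨g, hg, hga⟩ := ha.exists_head
    obtain ⟨g', hg', hgb⟩ := hb.exists_head
    by_cases hne : g = g'
    · subst hne
      exact ih _ (upLT_γ hg) hga hgb
    · rcases hS.pencil_δ c g g' hg hg' hne with h | h
      · exact ih _ (upLT_γ hg) hga ((hS.γ_le_γ h.le).trans hgb)
      · exact ih _ (upLT_γ hg') ((hS.γ_le_γ h.le).trans hga) hgb

/-- A face `r` strictly inside `t` lies in the boundaries of faces inside `t` only. -/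
lemma lt_of_inside (hS : S.IsOpetopicCardinal) {k : ℕ} {t e : S.F (k + 1)} {c r : S.F k}
    (hc : c ∈ S.δ t) (hcr : S.UpLT c r) (hr : S.UpLT r (S.γ t)) (he : r ∈ S.bd e) :
    S.UpLT e t := by
  induction t using (hS.upLT_wf _).induction generalizing c with
  | _ t ih =>
    -- The chain from `c` to `r` starts with a face `g` which has to lie below `t`. Hence `t` is a
    -- codomain `γ v`, and the tree of `v` can be searched from the leaf `c` upwards.
    obtain ⟨g, hg, hgr⟩ := hcr.exists_head
    have hgt : S.UpLT g t := by
      by_cases hne : g = t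
      · subst hne
        exact absurd hgr (hS.not_le_of_lt hr)
      · rcases hS.pencil_δ c g t hg hc hne with h | h
        · exact h
        · exact absurd ((hS.γ_le_γ h.le).trans hgr) (hS.not_le_of_lt hr)
    obtain ⟨v, rfl⟩ := hgt.exists_tail
    obtain ⟨b, hb, hcb⟩ := hS.exists_of_mem_δγ hc
    clear hc g hg hgr hgt
    induction c using (hS.upGT_wf _).induction generalizing b with
    | _ c ih' =>
      have hbv : S.UpLT b (S.γ v) := upLT_γ hb
      -- Three positions of `r` relative to the edge `b` leaving `c`: at its end, where the pencils
      -- of `r` decide; inside `b`, where the outer induction applies; beyond it, where `γ b` takes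
      -- the place of `c`.
      rcases hS.upLE_total_of_le hcr.le (upLT_γ hcb).le with (h | h) | h
      · obtain ⟨b', hb', hrb'⟩ : ∃ b' ∈ S.δ v, S.γ b ∈ S.δ b' := by
          refine (hS.γ_eq_γγ_or hb).resolve_left fun h' => ?_
          rw [h, h'] at hr
          exact hS.strict _ hr
        rw [← h] at hrb'
        rcases he with he | he
        · by_cases hne : e = b
          · exact hne ▸ hbv
          rcases hS.pencil_γ r e b he h hne with h₁ | h₁
          · exact h₁.trans hbv
          rcases hS.upLE_total_of_le h₁.le hbv.le with (h₂ | h₂) | h₂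
          · rw [h₂] at he
            exact absurd he (hS.ne_of_lt hr)
          · exact h₂
          · exact absurd (he ▸ hS.γ_le_γ h₂.le) (hS.not_le_of_lt hr)
        · have hb'v : S.UpLT b' (S.γ v) := upLT_γ hb'
          by_cases hne : e = b'
          · exact hne ▸ hb'v
          rcases hS.pencil_δ r e b' he hrb' hne with h₁ | h₁
          · exact h₁.trans hb'v
          have hnot : r ∉ S.δ (S.γ v) := fun h' => hS.γ_ne_of_mem_δγ h' hb h.symm
          rcases hS.upLE_total_of_le h₁.le hb'v.le with (h₂ | h₂) | h₂
          · rw [h₂] at he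
            exact absurd he hnot
          · exact h₂
          · obtain ⟨r₀, hr₀, hr₀r⟩ := hS.exists_le_mem_δγ (Or.inr hrb') (Or.inr hb')
            obtain ⟨c', hc', hc'r⟩ := hS.exists_le_mem_δ h₂.le hr₀
            obtain rfl := hS.eq_of_le_of_mem_δ hc' he (hc'r.trans hr₀r)
            exact absurd (hS.le_antisymm hc'r hr₀r ▸ hr₀) hnot
      · exact (ih b hbv hcb hcr h).trans hbv
      · obtain ⟨b', hb', hrb'⟩ : ∃ b' ∈ S.δ v, S.γ b ∈ S.δ b' := by
          refine (hS.γ_eq_γγ_or hb).resolve_left fun h' => ?_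
          rw [h'] at h
          exact hS.strict _ (h.trans hr)
        exact ih' _ (upLT_γ hcb) h b' hb' hrb'

end IsOpetopicCardinal

end PosHypergraph

namespace PosHypergraph

variable {S : PosHypergraph.{u}}

/-! ## The pencil order -/

namespace IsOpetopicCardinal

lemma not_γ_eq_of_mem_δ (hS : S.IsOpetopicCardinal) {k : ℕ} {a : S.F (k + 1)} {x : S.F k}
    (hx : x ∈ S.δ a) : S.γ a ≠ x := by
  rintro rfl
  exact hS.γ_notMem_δ _ hx

lemma pencilLT_irrefl (hS : S.IsOpetopicCardinal) {k : ℕ} (x : S.F k) (a : S.F (k + 1)) :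
    ¬ PencilLT x a a := by
  rintro (⟨h, h'⟩ | ⟨-, -, h⟩ | ⟨-, -, h⟩)
  · exact hS.not_γ_eq_of_mem_δ h' h
  · exact hS.strict _ h
  · exact hS.strict _ h

lemma pencilLT_trans (hS : S.IsOpetopicCardinal) {k : ℕ} {x : S.F k} {a b c : S.F (k + 1)}
    (h : PencilLT x a b) (h' : PencilLT x b c) : PencilLT x a c := by
  rcases h with ⟨h₁, h₂⟩ | ⟨h₁, h₂, h₃⟩ | ⟨h₁, h₂, h₃⟩ <;>
    rcases h' with ⟨h₄, h₅⟩ | ⟨h₄, h₅, h₆⟩ | ⟨h₄, h₅, h₆⟩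
  · exact Or.inl ⟨h₄, h₂⟩
  · exact absurd h₁ (hS.not_γ_eq_of_mem_δ h₄)
  · exact Or.inl ⟨h₅.symm, h₂⟩
  · exact Or.inl ⟨h₄, h₁⟩
  · exact Or.inr (Or.inl ⟨h₁, h₅, h₃.trans h₆⟩)
  · exact absurd h₄ (hS.not_γ_eq_of_mem_δ h₂)
  · exact absurd h₂.symm (hS.not_γ_eq_of_mem_δ h₅)
  · exact absurd h₂.symm (hS.not_γ_eq_of_mem_δ h₄)
  · exact Or.inr (Or.inr ⟨h₁, h₅, h₆.trans h₃⟩)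

lemma pencilLT_total (hS : S.IsOpetopicCardinal) {k : ℕ} {x : S.F k} {a b : S.F (k + 1)}
    (ha : x ∈ S.bd a) (hb : x ∈ S.bd b) (hne : a ≠ b) : PencilLT x a b ∨ PencilLT x b a := by
  rcases ha with ha | ha <;> rcases hb with hb | hb
  · rcases hS.pencil_γ x a b ha hb hne with h | h
    · exact Or.inr (Or.inr (Or.inr ⟨hb.symm, ha, h⟩))
    · exact Or.inl (Or.inr (Or.inr ⟨ha.symm, hb, h⟩))
  · exact Or.inr (Or.inl ⟨ha.symm, hb⟩)
  · exact Or.inl (Or.inl ⟨hb.symm, ha⟩)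
  · rcases hS.pencil_δ x a b ha hb hne with h | h
    · exact Or.inl (Or.inr (Or.inl ⟨ha, hb, h⟩))
    · exact Or.inr (Or.inr (Or.inl ⟨hb, ha, h⟩))

/-- Every face of codimension two lies in a second face of codimension one. -/
lemma exists_other (hS : S.IsOpetopicCardinal) {k : ℕ} {t : S.F (k + 2)} {r : S.F (k + 1)}
    {c : S.F k} (hr : r ∈ S.bd t) (hc : c ∈ S.bd r) :
    ∃ r' ∈ S.bd t, r' ≠ r ∧ c ∈ S.bd r' := by
  rcases hr with rfl | hr
  · rcases hc with rfl | hc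
    · obtain ⟨b, hb, h⟩ := hS.exists_γγ t
      exact ⟨b, Or.inr hb, (hS.not_γ_eq_of_mem_δ hb).symm, Or.inl h.symm⟩
    · obtain ⟨b, hb, h⟩ := hS.exists_of_mem_δγ hc
      exact ⟨b, Or.inr hb, (hS.not_γ_eq_of_mem_δ hb).symm, Or.inr h⟩
  · rcases hc with rfl | hc
    · rcases hS.γ_eq_γγ_or hr with h | ⟨b, hb, h⟩
      · exact ⟨S.γ t, Or.inl rfl, hS.not_γ_eq_of_mem_δ hr, Or.inl h⟩
      · refine ⟨b, Or.inr hb, ?_, Or.inr h⟩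
        rintro rfl
        exact hS.γ_notMem_δ _ h
    · rcases hS.mem_δγ_or hr hc with h | ⟨b, hb, h⟩
      · exact ⟨S.γ t, Or.inl rfl, hS.not_γ_eq_of_mem_δ hr, Or.inr h⟩
      · refine ⟨b, Or.inr hb, ?_, Or.inl h.symm⟩
        rintro rfl
        exact hS.not_γ_eq_of_mem_δ hc h

/-- Around `c` the boundary of `t` has two faces. The right-hand condition says that `a` is either
the codomain of `t` ending at `c` or a domain face starting at `c`, which are the faces that come
first in the pencil. It holds for exactly one of `a`, `b`, so one implication suffices. -/
lemma pencilLT_bd_iff (hS : S.IsOpetopicCardinal) {k : ℕ} {t : S.F (k + 2)} {a b : S.F (k + 1)}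
    {c : S.F k} (ha : a ∈ S.bd t) (hb : b ∈ S.bd t) (hne : a ≠ b) (hca : c ∈ S.bd a)
    (hcb : c ∈ S.bd b) : PencilLT c a b ↔ (c = S.γ a ↔ a = S.γ t) := by
  have hasymm : PencilLT c a b → PencilLT c b a → False := fun h h' =>
    hS.pencilLT_irrefl _ _ (hS.pencilLT_trans h h')
  have key : ∀ {a b : S.F (k + 1)}, a ∈ S.bd t → b ∈ S.bd t → a ≠ b → c ∈ S.bd a → c ∈ S.bd b →
      (c = S.γ a ↔ a = S.γ t) → PencilLT c a b := by
    intro a b ha hb hne hca hcb h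
    rcases ha with rfl | ha
    · obtain rfl := h.2 rfl
      have hb := hb.resolve_left hne.symm
      rcases hcb with hcb | hcb
      · exact Or.inr (Or.inr ⟨rfl, hcb, upLT_γ hb⟩)
      · exact absurd hcb (hS.γγ_notMem hb)
    · have hca := hca.resolve_left fun h' => hS.not_γ_eq_of_mem_δ ha (h.1 h').symm
      rcases hcb with hcb | hcb
      · exact Or.inl ⟨hcb.symm, hca⟩
      · rcases hb with rfl | hb
        · exact Or.inr (Or.inl ⟨hca, hcb, upLT_γ ha⟩)
        · exact absurd (hS.eq_of_mem_δ ha hb hca hcb) hne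
  refine ⟨fun h => ?_, key ha hb hne hca hcb⟩
  by_contra h'
  refine hasymm h (key hb ha hne.symm hcb hca ?_)
  by_cases hat : a = S.γ t
  · have hbt : b ≠ S.γ t := fun h => hne (hat.trans h.symm)
    have hb := hb.resolve_left hbt
    have hca' : c ≠ S.γ a := fun h => h' (by simp [h, hat])
    have hca := hca.resolve_left hca'
    subst hat
    simp only [hbt, iff_false]
    exact fun h => hS.γ_ne_of_mem_δγ hca hb h.symm
  · have ha := ha.resolve_left hat
    have hca' : c = S.γ a := by
      by_contra hc
      exact h' (by simp [hc, hat])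
    by_cases hbt : b = S.γ t
    · subst hbt
      simp only [iff_true]
      rcases hcb with h | h
      · exact h
      · exact absurd hca'.symm (hS.γ_ne_of_mem_δγ h ha)
    · have hb := hb.resolve_left hbt
      simp only [hbt, iff_false]
      exact fun h => hne (hS.γ_injOn t ha hb (hca'.symm.trans h))

/-- A pencil lists the faces with `a` in the domain from small to large, then those with codomain
`a` from large to small. A face `u` with `a ∈ δ u` cannot lie below `t`, since `γ u ≤⁺ γ t = a`
would contradict `a <⁺ γ u`. -/
lemma pencilLT_γ_iff (hS : S.IsOpetopicCardinal) {k : ℕ} {t u : S.F (k + 1)} {a : S.F k}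
    (hat : a = S.γ t) (hau : a ∈ S.bd u) : PencilLT a t u ↔ S.UpLT u t := by
  subst hat
  constructor
  · rintro (⟨h, h'⟩ | ⟨h, -⟩ | ⟨-, -, h⟩)
    · exact absurd h' (hS.γ_notMem_δ _)
    · exact absurd h (hS.γ_notMem_δ _)
    · exact h
  · intro h
    rcases hau with hau | hau
    · exact Or.inr (Or.inr ⟨rfl, hau, h⟩)
    · exact absurd (hS.γ_le_γ h.le) (hS.not_le_of_lt (upLT_γ hau))

lemma pencilLT_δ_iff (hS : S.IsOpetopicCardinal) {k : ℕ} {t u : S.F (k + 1)} {a : S.F k}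
    (hat : a ∈ S.δ t) (hau : a ∈ S.bd u) : PencilLT a u t ↔ S.UpLT u t := by
  constructor
  · rintro (⟨h, h'⟩ | ⟨-, -, h⟩ | ⟨-, h, -⟩)
    · exact absurd h (hS.not_γ_eq_of_mem_δ hat)
    · exact h
    · exact absurd h.symm (hS.not_γ_eq_of_mem_δ hat)
  · intro h
    rcases hau with rfl | hau
    · obtain ⟨y, hy⟩ := S.δ_total u
      obtain ⟨y', hy', h'⟩ := hS.exists_le_mem_δ h.le hy
      exact absurd (h'.trans_lt (upLT_γ hy)) (hS.δ_antichain hy' hat)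
    · exact Or.inr (Or.inl ⟨hau, hat, h⟩)

/-- The faces around `c` in `∂∂v` lie between the two of them which are in `∂γv`. -/
lemma exists_pencil_between (hS : S.IsOpetopicCardinal) {k : ℕ} {v : S.F (k + 3)}
    {e : S.F (k + 2)} {r : S.F (k + 1)} {c : S.F k} (he : e ∈ S.δ v) (hr : r ∈ S.bd e)
    (hc : c ∈ S.bd r) : ∃ a ∈ S.bd (S.γ v), ∃ b ∈ S.bd (S.γ v), a ≠ b ∧ c ∈ S.bd a ∧ c ∈ S.bd b ∧
      (a = r ∨ PencilLT c a r) ∧ (r = b ∨ PencilLT c r b) := by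
  rcases id hc with hγ | hδ
  -- The face `r₀` is a leaf below `r` playing the same role at `c`; the other bound `r₁` is the
  -- second face around `c` in `∂γv`.
  · obtain ⟨r₀, h₀, hc₀, hle⟩ := hS.exists_le_mem_δγ_of_γ_eq (Or.inr he) hr hγ.symm
    obtain ⟨r₁, h₁, hne, hc₁⟩ := hS.exists_other (Or.inr h₀) (Or.inl hc₀.symm)
    refine ⟨r₁, h₁, r₀, Or.inr h₀, hne, hc₁, Or.inl hc₀.symm, ?_, ?_⟩
    · rcases hc₁ with hc₁ | hc₁
      · rcases h₁ with rfl | h₁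
        · rcases hS.le_γγ hr (Or.inr he) with h | h
          · exact Or.inl h.symm
          · exact Or.inr (Or.inr (Or.inr ⟨hc₁.symm, hγ, h⟩))
        · exact absurd (hS.γ_injOn _ h₁ h₀ (hc₁.symm.trans hc₀.symm)) hne
      · exact Or.inr (Or.inl ⟨hγ.symm, hc₁⟩)
    · rcases hle with rfl | h
      · exact Or.inl rfl
      · exact Or.inr (Or.inr (Or.inr ⟨hγ.symm, hc₀.symm, h⟩))
  · obtain ⟨r₀, h₀, hc₀, hle⟩ := hS.exists_le_mem_δγ_of_mem_δ (Or.inr he) hr hδ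
    obtain ⟨r₁, h₁, hne, hc₁⟩ := hS.exists_other (Or.inr h₀) (Or.inr hc₀)
    refine ⟨r₀, Or.inr h₀, r₁, h₁, hne.symm, Or.inr hc₀, hc₁, ?_, ?_⟩
    · rcases hle with rfl | h
      · exact Or.inl rfl
      · exact Or.inr (Or.inr (Or.inl ⟨hc₀, hδ, h⟩))
    · rcases hc₁ with hc₁ | hc₁
      · exact Or.inr (Or.inl ⟨hc₁.symm, hδ⟩)
      · rcases h₁ with rfl | h₁
        · rcases hS.le_γγ hr (Or.inr he) with h | h
          · exact Or.inl h
          · exact Or.inr (Or.inr (Or.inl ⟨hδ, hc₁, h⟩))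
        · exact absurd (hS.eq_of_mem_δ h₁ h₀ hc₁ hc₀) hne

/-- In each consistent case `r` lies strictly between a face of `δ t` and `γ t` in the upper order,
so that `lt_of_inside` applies. -/
lemma lt_of_pencil_between (hS : S.IsOpetopicCardinal) {k : ℕ} {t e : S.F (k + 2)}
    {a b r : S.F (k + 1)} {c : S.F k} (ha : a ∈ S.bd t) (hb : b ∈ S.bd t)
    (har : PencilLT c a r) (hrb : PencilLT c r b) (hr : r ∈ S.bd e) : S.UpLT e t := by
  rcases har with ⟨h₁, h₂⟩ | ⟨h₁, h₂, h₃⟩ | ⟨h₁, h₂, h₃⟩ <;>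
    rcases hrb with ⟨h₄, h₅⟩ | ⟨h₄, h₅, h₆⟩ | ⟨h₄, h₅, h₆⟩
  · exact absurd h₁ (hS.not_γ_eq_of_mem_δ h₅)
  · exact absurd h₁ (hS.not_γ_eq_of_mem_δ h₄)
  · have hb : b ∈ S.δ t := by
      refine hb.resolve_left ?_
      rintro rfl
      rcases ha with rfl | ha
      · exact hS.not_γ_eq_of_mem_δ h₂ h₅.symm
      · exact hS.γγ_notMem ha (h₅ ▸ h₂)
    refine hS.lt_of_inside hb h₆ ?_ hr
    rcases hS.upLE_total_of_le (upLT_γ hb).le h₆.le with h | h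
    · have h' := hS.γ_le_γ h
      rw [h₁] at h'
      have : S.UpLT c (S.γ (S.γ t)) := by
        rcases ha with rfl | ha
        · exact upLT_γ h₂
        · exact (upLT_γ h₂).trans_le (hS.γ_le_γγ ha)
      exact absurd h' (hS.not_le_of_lt this)
    · exact h
  · have hbt : b ∈ S.δ t := by
      refine hb.resolve_left ?_
      rintro rfl
      rcases ha with rfl | ha
      · exact hS.not_γ_eq_of_mem_δ h₁ h₄
      · exact hS.γγ_notMem ha (h₄ ▸ h₁)
    have ha : a ∈ S.δ t := by
      refine ha.resolve_left ?_
      rintro rfl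
      exact hS.γ_ne_of_mem_δγ h₁ hbt h₄
    refine hS.lt_of_inside ha h₃ ?_ hr
    rcases hS.upLE_total_of_le (upLT_γ ha).le h₃.le with h | h
    · obtain ⟨x₀, hx₀, hx₀c⟩ := hS.exists_le_mem_δγ (Or.inl h₄.symm) (Or.inr hbt)
      obtain ⟨y, hy, hyx⟩ := hS.exists_le_mem_δ h hx₀
      obtain rfl := hS.eq_of_le_of_mem_δ hy h₂ (hyx.trans hx₀c)
      obtain rfl := hS.le_antisymm hyx hx₀c
      exact absurd h₄ (hS.γ_ne_of_mem_δγ hx₀ hbt)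
    · exact h
  · have h := h₃.trans h₆
    rcases hb with rfl | hb
    · have ha := ha.resolve_left (hS.ne_of_lt h)
      exact hS.lt_of_inside ha h₃ h₆ hr
    · rcases ha with rfl | ha
      · exact absurd (upLT_γ hb).le (hS.not_le_of_lt h)
      · exact absurd h (hS.δ_antichain ha hb)
  · exact absurd h₄ (hS.not_γ_eq_of_mem_δ h₂)
  · exact absurd h₂.symm (hS.not_γ_eq_of_mem_δ h₅)
  · exact absurd h₂.symm (hS.not_γ_eq_of_mem_δ h₄)
  · have h := h₆.trans h₃
    rcases ha with rfl | ha
    · have hb := hb.resolve_left (hS.ne_of_lt h)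
      exact hS.lt_of_inside hb h₆ h₃ hr
    · rcases hb with rfl | hb
      · exact absurd (upLT_γ ha).le (hS.not_le_of_lt h)
      · exact absurd h (hS.δ_antichain hb ha)

end IsOpetopicCardinal

/-! ## The local orders of a vector of faces -/

lemma sgn_eq (x : S.Vec) (j : ℕ) : sgn x j = 1 ∨ sgn x j = -1 := by
  induction j with
  | zero => exact Or.inl rfl
  | succ j ih =>
    rw [sgn]
    split_ifs
    · exact ih
    · rcases ih with h | h <;> simp [h]

lemma sgn_congr {x y : S.Vec} {j : ℕ} (h : ∀ i ≤ j, x i = y i) : sgn x j = sgn y j := by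
  induction j with
  | zero => rfl
  | succ j ih =>
    rw [sgn, sgn, ih fun i hi => h i (by omega), h j (by omega), h (j + 1) le_rfl]

/-- The order in which the flag order compares faces `a`, `b` at level `j` above `x`. -/
def LocLT (x : S.Vec) : ∀ j : ℕ, S.F j → S.F j → Prop
  | 0, a, b => S.UpLT b a
  | j + 1, a, b => ∃ c, x j = some c ∧
      ((sgn x j = 1 ∧ PencilLT c a b) ∨ (sgn x j = -1 ∧ PencilLT c b a))

/-- The face `a` at level `j` can be put above `[x_{j-1}, …, x_0]`. -/
def Loc (x : S.Vec) : ∀ j : ℕ, S.F j → Prop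
  | 0, _ => True
  | j + 1, a => ∃ c, x j = some c ∧ c ∈ S.bd a

open Classical in
/-- The sign of `[a, x_{j-1}, …, x_0]`. -/
noncomputable def esgn (x : S.Vec) : ∀ j : ℕ, S.F j → ℤ
  | 0, _ => 1
  | j + 1, a => if x j = some (S.γ a) then sgn x j else - sgn x j

lemma sgn_eq_esgn {x : S.Vec} {j : ℕ} {a : S.F j} (h : x j = some a) : sgn x j = esgn x j a := by
  rcases j with _ | j
  · rfl
  · rw [sgn, esgn, h, Option.map_some]

lemma esgn_eq (x : S.Vec) {j : ℕ} (a : S.F j) : esgn x j a = 1 ∨ esgn x j a = -1 := by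
  rcases j with _ | j
  · exact Or.inl rfl
  · rw [esgn]
    split_ifs
    · exact sgn_eq x j
    · rcases sgn_eq x j with h | h <;> simp [h]

lemma esgn_congr {x y : S.Vec} {j : ℕ} (h : ∀ i < j, x i = y i) (a : S.F j) :
    esgn x j a = esgn y j a := by
  rcases j with _ | j
  · rfl
  · rw [esgn, esgn, h j (by omega), sgn_congr fun i hi => h i (by omega)]

lemma LocLT.congr {x y : S.Vec} {j : ℕ} (h : ∀ i < j, x i = y i) {a b : S.F j}
    (hab : LocLT x j a b) : LocLT y j a b := by
  rcases j with _ | j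
  · exact hab
  · rw [LocLT] at hab ⊢
    rwa [← h j (by omega), ← sgn_congr (x := x) (y := y) fun i hi => h i (by omega)]

lemma Loc.congr {x y : S.Vec} {j : ℕ} (h : ∀ i < j, x i = y i) {a : S.F j}
    (ha : Loc x j a) : Loc y j a := by
  rcases j with _ | j
  · trivial
  · rw [Loc] at ha ⊢
    rwa [← h j (by omega)]

namespace IsOpetopicCardinal

lemma locLT_irrefl (hS : S.IsOpetopicCardinal) (x : S.Vec) {j : ℕ} (a : S.F j) :
    ¬ LocLT x j a a := by
  rcases j with _ | j
  · exact hS.strict a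
  · rintro ⟨c, -, ⟨-, h⟩ | ⟨-, h⟩⟩ <;> exact hS.pencilLT_irrefl _ _ h

lemma locLT_trans (hS : S.IsOpetopicCardinal) {x : S.Vec} {j : ℕ} {a b c : S.F j}
    (h : LocLT x j a b) (h' : LocLT x j b c) : LocLT x j a c := by
  rcases j with _ | j
  · exact Relation.TransGen.trans h' h
  · obtain ⟨d, hd, h⟩ := h
    obtain ⟨d', hd', h'⟩ := h'
    obtain rfl : d = d' := by rw [hd] at hd'; exact Option.some.inj hd'
    refine ⟨d, hd, ?_⟩
    rcases h with ⟨hs, h⟩ | ⟨hs, h⟩ <;> rcases h' with ⟨hs', h'⟩ | ⟨hs', h'⟩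
    · exact Or.inl ⟨hs, hS.pencilLT_trans h h'⟩
    · omega
    · omega
    · exact Or.inr ⟨hs, hS.pencilLT_trans h' h⟩

lemma locLT_asymm (hS : S.IsOpetopicCardinal) {x : S.Vec} {j : ℕ} {a b : S.F j}
    (h : LocLT x j a b) (h' : LocLT x j b a) : False :=
  hS.locLT_irrefl x a (hS.locLT_trans h h')

lemma locLT_total (hS : S.IsOpetopicCardinal) {x : S.Vec} {j : ℕ} {a b : S.F j}
    (ha : Loc x j a) (hb : Loc x j b) (hne : a ≠ b) : LocLT x j a b ∨ LocLT x j b a := by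
  rcases j with _ | j
  · exact hS.linear_zero b a hne.symm
  · obtain ⟨c, hc, ha⟩ := ha
    obtain ⟨c', hc', hb⟩ := hb
    obtain rfl : c = c' := by rw [hc] at hc'; exact Option.some.inj hc'
    rcases sgn_eq x j with hs | hs <;> rcases hS.pencilLT_total ha hb hne with h | h
    · exact Or.inl ⟨c, hc, Or.inl ⟨hs, h⟩⟩
    · exact Or.inr ⟨c, hc, Or.inl ⟨hs, h⟩⟩
    · exact Or.inr ⟨c, hc, Or.inr ⟨hs, h⟩⟩
    · exact Or.inl ⟨c, hc, Or.inr ⟨hs, h⟩⟩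

lemma exists_loc_other (hS : S.IsOpetopicCardinal) {x : S.Vec} {j : ℕ} {t : S.F (j + 1)}
    {r : S.F j} (hr : r ∈ S.bd t) (hl : Loc x j r) : ∃ r' ∈ S.bd t, r' ≠ r ∧ Loc x j r' := by
  rcases j with _ | j
  · rcases hr with rfl | hr
    · obtain ⟨b, hb⟩ := S.δ_total t
      exact ⟨b, Or.inr hb, (hS.not_γ_eq_of_mem_δ hb).symm, trivial⟩
    · exact ⟨S.γ t, Or.inl rfl, hS.not_γ_eq_of_mem_δ hr, trivial⟩
  · obtain ⟨c, hc, hcr⟩ := hl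
    obtain ⟨r', h, hne, h'⟩ := hS.exists_other hr hcr
    exact ⟨r', h, hne, c, hc, h'⟩

/-- The two faces of `t` around a flag are ordered by the signs of the extended flags. -/
lemma locLT_bd_iff (hS : S.IsOpetopicCardinal) {x : S.Vec} {j : ℕ} {t : S.F (j + 1)}
    {a b : S.F j} (ha : a ∈ S.bd t) (hb : b ∈ S.bd t) (hne : a ≠ b) (hla : Loc x j a)
    (hlb : Loc x j b) : LocLT x j a b ↔ (esgn x j a = 1 ↔ a = S.γ t) := by
  rcases j with _ | j
  · change S.UpLT b a ↔ ((1 : ℤ) = 1 ↔ _)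
    simp only [true_iff]
    constructor
    · intro h
      refine ha.resolve_right fun ha => ?_
      rcases hb with rfl | hb
      · exact hS.not_le_of_lt h (upLT_γ ha).le
      · exact hS.δ_antichain hb ha h
    · rintro rfl
      exact upLT_γ (hb.resolve_left hne.symm)
  · obtain ⟨c, hc, hca⟩ := hla
    obtain ⟨c', hc', hcb⟩ := hlb
    obtain rfl : c = c' := by rw [hc] at hc'; exact Option.some.inj hc'
    have h₁ := hS.pencilLT_bd_iff ha hb hne hca hcb
    have h₂ : PencilLT c b a ↔ ¬ PencilLT c a b :=
      ⟨fun h h' => hS.pencilLT_irrefl _ _ (hS.pencilLT_trans h h'),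
        fun h => (hS.pencilLT_total hca hcb hne).resolve_left h⟩
    simp only [LocLT, esgn, hc, Option.some.injEq, exists_eq_left', h₂, h₁]
    rcases sgn_eq x j with hs | hs
    · by_cases hγ : c = S.γ a <;> by_cases hat : a = S.γ t <;> simp_all
    · by_cases hγ : c = S.γ a <;> by_cases hat : a = S.γ t <;> simp_all

/-- The sign of the flag ending in `t` tells on which side of `t` the faces inside `t` are placed:
after `t` for sign `+1`, before it for sign `-1`. This converts comparisons of flags into `<⁺` and
back. -/
lemma locLT_up_iff (hS : S.IsOpetopicCardinal) {x : S.Vec} {j : ℕ} {t u : S.F (j + 1)} {a : S.F j}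
    (hx : x j = some a) (hat : a ∈ S.bd t) (hau : a ∈ S.bd u) :
    (esgn x (j + 1) t = 1 → (LocLT x (j + 1) t u ↔ S.UpLT u t)) ∧
    (esgn x (j + 1) t = -1 → (LocLT x (j + 1) u t ↔ S.UpLT u t)) := by
  simp only [LocLT, esgn, hx, Option.some.injEq, exists_eq_left']
  by_cases hγ : a = S.γ t
  · have h := hS.pencilLT_γ_iff hγ hau
    rcases sgn_eq x j with hs | hs <;> simp [hs, ← h, ← hγ, hx]
  · have h := hS.pencilLT_δ_iff (hat.resolve_left hγ) hau
    rcases sgn_eq x j with hs | hs <;> simp [hs, ← h, hγ, hx]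

end IsOpetopicCardinal

/-- The reflexive local order. -/
def LocLE (x : S.Vec) (j : ℕ) (a b : S.F j) : Prop := a = b ∨ LocLT x j a b

namespace IsOpetopicCardinal

lemma locLT_of_le_of_lt (hS : S.IsOpetopicCardinal) {x : S.Vec} {j : ℕ} {a b c : S.F j}
    (h : LocLE x j a b) (h' : LocLT x j b c) : LocLT x j a c := by
  rcases h with rfl | h
  · exact h'
  · exact hS.locLT_trans h h'

lemma locLT_of_lt_of_le (hS : S.IsOpetopicCardinal) {x : S.Vec} {j : ℕ} {a b c : S.F j}
    (h : LocLT x j a b) (h' : LocLE x j b c) : LocLT x j a c := by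
  rcases h' with rfl | h'
  · exact h
  · exact hS.locLT_trans h h'

lemma locLE_trans (hS : S.IsOpetopicCardinal) {x : S.Vec} {j : ℕ} {a b c : S.F j}
    (h : LocLE x j a b) (h' : LocLE x j b c) : LocLE x j a c := by
  rcases h with rfl | h
  · exact h'
  · exact Or.inr (hS.locLT_of_lt_of_le h h')

/-- One step of `exists_loc_between`. At level 0 the bounds are `γγv` and a face of `δγv` below `r`;
higher up they come from `exists_pencil_between` and are exchanged when the sign is `-1`. -/
lemma exists_loc_between_of_mem_δ (hS : S.IsOpetopicCardinal) {x : S.Vec} {j : ℕ}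
    {v : S.F (j + 2)} {e : S.F (j + 1)} {r : S.F j} (he : e ∈ S.δ v) (hr : r ∈ S.bd e)
    (hl : Loc x j r) : ∃ a ∈ S.bd (S.γ v), ∃ b ∈ S.bd (S.γ v), Loc x j a ∧ Loc x j b ∧
      LocLT x j a b ∧ LocLE x j a r ∧ LocLE x j r b := by
  rcases j with _ | j
  · obtain ⟨y, hy, hyr⟩ := hS.exists_le_mem_δγ hr (Or.inr he)
    refine ⟨_, Or.inl rfl, y, Or.inr hy, trivial, trivial, upLT_γ hy, ?_, ?_⟩
    · rcases hS.le_γγ hr (Or.inr he) with h | h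
      · exact Or.inl h.symm
      · exact Or.inr h
    · rcases hyr with h | h
      · exact Or.inl h.symm
      · exact Or.inr h
  · obtain ⟨c, hc, hcr⟩ := hl
    obtain ⟨a, ha, b, hb, hne, hca, hcb, har, hrb⟩ := hS.exists_pencil_between he hr hcr
    have hab : PencilLT c a b := by
      rcases har with rfl | har
      · exact hrb.resolve_left hne
      · rcases hrb with rfl | hrb
        · exact har
        · exact hS.pencilLT_trans har hrb
    rcases sgn_eq x j with hs | hs
    · refine ⟨a, ha, b, hb, ⟨c, hc, hca⟩, ⟨c, hc, hcb⟩, ⟨c, hc, Or.inl ⟨hs, hab⟩⟩, ?_, ?_⟩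
      · exact har.imp id fun h => ⟨c, hc, Or.inl ⟨hs, h⟩⟩
      · exact hrb.imp id fun h => ⟨c, hc, Or.inl ⟨hs, h⟩⟩
    · refine ⟨b, hb, a, ha, ⟨c, hc, hcb⟩, ⟨c, hc, hca⟩, ⟨c, hc, Or.inr ⟨hs, hab⟩⟩, ?_, ?_⟩
      · exact hrb.imp Eq.symm fun h => ⟨c, hc, Or.inr ⟨hs, h⟩⟩
      · exact har.imp Eq.symm fun h => ⟨c, hc, Or.inr ⟨hs, h⟩⟩

/-- Faces in `∂e`, for `e ≤⁺ t`, lie between the two faces in `∂t` around the same flag. -/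
lemma exists_loc_between (hS : S.IsOpetopicCardinal) {x : S.Vec} {j : ℕ}
    {t e : S.F (j + 1)} {r : S.F j} (he : S.UpLE e t) (hr : r ∈ S.bd e) (hl : Loc x j r) :
    ∃ a ∈ S.bd t, ∃ b ∈ S.bd t, Loc x j a ∧ Loc x j b ∧
      LocLT x j a b ∧ LocLE x j a r ∧ LocLE x j r b := by
  have key : ∀ {r}, r ∈ S.bd t → Loc x j r → ∃ a ∈ S.bd t, ∃ b ∈ S.bd t, Loc x j a ∧ Loc x j b ∧
      LocLT x j a b ∧ LocLE x j a r ∧ LocLE x j r b := by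
    intro r hr hl
    obtain ⟨r', hr', hne, hl'⟩ := hS.exists_loc_other hr hl
    rcases hS.locLT_total hl hl' hne.symm with h | h
    · exact ⟨r, hr, r', hr', hl, hl', h, Or.inl rfl, Or.inr h⟩
    · exact ⟨r', hr', r, hr, hl', hl, h, Or.inr h, Or.inl rfl⟩
  rcases he with rfl | he
  · exact key hr hl
  have step : ∀ {e e' r}, (∃ v, e ∈ S.δ v ∧ S.γ v = e') → r ∈ S.bd e → Loc x j r →
      (∀ {r}, r ∈ S.bd e' → Loc x j r → ∃ a ∈ S.bd t, ∃ b ∈ S.bd t, Loc x j a ∧ Loc x j b ∧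
      LocLT x j a b ∧ LocLE x j a r ∧ LocLE x j r b) →
      ∃ a ∈ S.bd t, ∃ b ∈ S.bd t, Loc x j a ∧ Loc x j b ∧
      LocLT x j a b ∧ LocLE x j a r ∧ LocLE x j r b := by
    rintro e e' r ⟨v, hv, rfl⟩ hr hl ih
    obtain ⟨a, ha, b, hb, hla, hlb, hab, har, hrb⟩ := hS.exists_loc_between_of_mem_δ hv hr hl
    obtain ⟨a₁, ha₁, b₁, hb₁, hla₁, hlb₁, hab₁, har₁, hrb₁⟩ := ih ha hla
    obtain ⟨a₂, ha₂, b₂, hb₂, hla₂, hlb₂, hab₂, har₂, hrb₂⟩ := ih hb hlb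
    refine ⟨a₁, ha₁, b₂, hb₂, hla₁, hlb₂, ?_, hS.locLE_trans har₁ har, hS.locLE_trans hrb hrb₂⟩
    exact hS.locLT_of_lt_of_le (hS.locLT_of_le_of_lt har₁ hab) hrb₂
  induction he using Relation.TransGen.head_induction_on generalizing r with
  | single h => exact step h hr hl key
  | head h _ ih => exact step h hr hl fun hr hl => ih hr hl

lemma lt_of_loc_between (hS : S.IsOpetopicCardinal) {x : S.Vec} {j : ℕ} {t e : S.F (j + 1)}
    {a b r : S.F j} (ha : a ∈ S.bd t) (hb : b ∈ S.bd t) (har : LocLT x j a r)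
    (hrb : LocLT x j r b) (hr : r ∈ S.bd e) : S.UpLT e t := by
  rcases j with _ | j
  · change S.UpLT r a at har
    change S.UpLT b r at hrb
    have h := hrb.trans har
    rcases ha with rfl | ha
    · exact hS.lt_of_inside (hb.resolve_left (hS.ne_of_lt h)) hrb har hr
    · rcases hb with rfl | hb
      · exact absurd (upLT_γ ha).le (hS.not_le_of_lt h)
      · exact absurd h (hS.δ_antichain hb ha)
  · obtain ⟨c, hc, har⟩ := har
    obtain ⟨c', hc', hrb⟩ := hrb
    obtain rfl : c = c' := by rw [hc] at hc'; exact Option.some.inj hc'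
    rcases har with ⟨hs, h⟩ | ⟨hs, h⟩ <;> rcases hrb with ⟨hs', h'⟩ | ⟨hs', h'⟩
    · exact hS.lt_of_pencil_between ha hb h h' hr
    · omega
    · omega
    · exact hS.lt_of_pencil_between hb ha h' h hr

end IsOpetopicCardinal

end PosHypergraph

namespace PosHypergraph

variable {S : PosHypergraph.{u}}

/-! ## The flag order -/

/-- The flags under a face `q`. -/
def Fl {k : ℕ} (q : S.F k) : Set S.Vec := {x | IsFlag k x ∧ x k = some q}

lemma IsFlag.loc {k : ℕ} {x : S.Vec} (hx : IsFlag k x) {j : ℕ} {a : S.F j} (ha : x j = some a) :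
    Loc x j a := by
  rcases j with _ | j
  · trivial
  · have hj : j + 1 ≤ k := (hx.isSome_iff _).1 (by simp [ha])
    obtain ⟨c, hc⟩ := hx.some_of_le (i := j) (by omega)
    exact ⟨c, hc, hx.mem_bd hc ha⟩

lemma IsFlag.le_of_some {k : ℕ} {x : S.Vec} (hx : IsFlag k x) {j : ℕ} {a : S.F j}
    (ha : x j = some a) : j ≤ k := (hx.isSome_iff _).1 (by simp [ha])

lemma IsFlag.ext {k : ℕ} {x y : S.Vec} (hx : IsFlag k x) (hy : IsFlag k y)
    (h : ∀ i ≤ k, x i = y i) : x = y := by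
  funext i
  by_cases hi : i ≤ k
  · exact h i hi
  · rw [hx.none_of_lt (by omega), hy.none_of_lt (by omega)]

namespace IsOpetopicCardinal

/-- The flag order is lexicographic, with an order at each level that depends on the levels beneath.
In this form level 0 needs no separate treatment. -/
lemma flagLT_iff (hS : S.IsOpetopicCardinal) {x y : S.Vec} : FlagLT x y ↔
    ∃ j a b, (∀ i < j, x i = y i) ∧ x j = some a ∧ y j = some b ∧ LocLT x j a b := by
  constructor
  · rintro (⟨a, b, ha, hb, -, h⟩ | ⟨j, c, a, b, hxy, hc, ha, hb, -, h⟩)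
    · exact ⟨0, a, b, by omega, ha, hb, h⟩
    · exact ⟨j + 1, a, b, fun i hi => hxy i (by omega), ha, hb, c, hc, h⟩
  · rintro ⟨_ | j, a, b, hxy, ha, hb, h⟩
    · refine Or.inl ⟨a, b, ha, hb, ?_, h⟩
      rintro rfl
      exact hS.strict _ h
    · obtain ⟨c, hc, h'⟩ := id h
      refine Or.inr ⟨j, c, a, b, fun i hi => hxy i (by omega), hc, ha, hb, ?_, h'⟩
      rintro rfl
      exact hS.locLT_irrefl _ _ h

lemma flagLT_of_agree (hS : S.IsOpetopicCardinal) {k l : ℕ} {x y x' y' : S.Vec} (h : FlagLT x y)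
    (hx : IsFlag k x) (hy : IsFlag l y) (hxx : ∀ i ≤ k, x' i = x i) (hyy : ∀ i ≤ l, y' i = y i) :
    FlagLT x' y' := by
  rw [hS.flagLT_iff] at h ⊢
  obtain ⟨j, a, b, hxy, ha, hb, h⟩ := h
  have hj := hx.le_of_some ha
  have hj' := hy.le_of_some hb
  refine ⟨j, a, b, fun i hi => ?_, by rw [hxx _ hj, ha], by rw [hyy _ hj', hb],
    h.congr fun i hi => (hxx i (by omega)).symm⟩
  rw [hxx i (by omega), hyy i (by omega), hxy i hi]

lemma flagLT_irrefl (hS : S.IsOpetopicCardinal) (x : S.Vec) : ¬ FlagLT x x := by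
  rw [hS.flagLT_iff]
  rintro ⟨j, a, b, -, ha, hb, h⟩
  rw [ha] at hb
  cases hb
  exact hS.locLT_irrefl _ _ h

lemma flagLT_trans (hS : S.IsOpetopicCardinal) {x y z : S.Vec} (h : FlagLT x y)
    (h' : FlagLT y z) : FlagLT x z := by
  rw [hS.flagLT_iff] at h h' ⊢
  obtain ⟨j, a, b, hxy, ha, hb, h⟩ := h
  obtain ⟨l, b', c, hyz, hb', hc, h'⟩ := h'
  rcases lt_trichotomy j l with hjl | rfl | hjl
  · exact ⟨j, a, b, fun i hi => (hxy i hi).trans (hyz i (by omega)), ha, by rw [← hyz j hjl, hb], h⟩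
  · rw [hb] at hb'
    cases hb'
    exact ⟨j, a, c, fun i hi => (hxy i hi).trans (hyz i hi), ha, hc,
      hS.locLT_trans h (h'.congr fun i hi => (hxy i hi).symm)⟩
  · exact ⟨l, b', c, fun i hi => (hxy i (by omega)).trans (hyz i hi), by rw [hxy l hjl, hb'], hc,
      h'.congr fun i hi => (hxy i (by omega)).symm⟩

lemma flagLT_asymm (hS : S.IsOpetopicCardinal) {x y : S.Vec} (h : FlagLT x y)
    (h' : FlagLT y x) : False := hS.flagLT_irrefl x (hS.flagLT_trans h h')

lemma flagLT_total (hS : S.IsOpetopicCardinal) {k l i : ℕ} {x y : S.Vec} (hx : IsFlag k x)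
    (hy : IsFlag l y) (hk : i ≤ k) (hl : i ≤ l) (hne : x i ≠ y i) : FlagLT x y ∨ FlagLT y x := by
  classical
  have hex : ∃ i, x i ≠ y i := ⟨i, hne⟩
  have hmin : ∀ j < Nat.find hex, x j = y j := fun j hj => not_not.1 (Nat.find_min hex hj)
  have hle : Nat.find hex ≤ i := Nat.find_min' hex hne
  have hspec := Nat.find_spec hex
  generalize Nat.find hex = j at *
  obtain ⟨a, ha⟩ := hx.some_of_le (i := j) (by omega)
  obtain ⟨b, hb⟩ := hy.some_of_le (i := j) (by omega)
  rw [hS.flagLT_iff, hS.flagLT_iff]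
  rcases hS.locLT_total (hx.loc ha) ((hy.loc hb).congr fun i hi => (hmin i hi).symm)
    (fun h => hspec (by rw [ha, hb, h])) with h | h
  · exact Or.inl ⟨j, a, b, hmin, ha, hb, h⟩
  · exact Or.inr ⟨j, b, a, fun i hi => (hmin i hi).symm, hb, ha, h.congr hmin⟩

lemma flagLT_total' (hS : S.IsOpetopicCardinal) {k : ℕ} {x y : S.Vec} (hx : IsFlag k x)
    (hy : IsFlag k y) (hne : x ≠ y) : FlagLT x y ∨ FlagLT y x := by
  by_contra h
  refine hne (hx.ext hy fun i hi => ?_)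
  by_contra hi'
  exact h (hS.flagLT_total hx hy hi hi hi')

lemma locLE_of_flagLT (hS : S.IsOpetopicCardinal) {x y : S.Vec} {j : ℕ} {a b : S.F j}
    (h : x = y ∨ FlagLT x y) (hxy : ∀ i < j, x i = y i) (ha : x j = some a) (hb : y j = some b) :
    LocLE x j a b := by
  rcases h with rfl | h
  · rw [ha] at hb
    exact Or.inl (Option.some.inj hb)
  rw [hS.flagLT_iff] at h
  obtain ⟨l, a', b', h', ha', hb', h⟩ := h
  rcases lt_trichotomy j l with hjl | rfl | hjl
  · rw [h' j hjl, hb] at ha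
    exact Or.inl (Option.some.inj ha).symm
  · rw [ha] at ha'
    rw [hb] at hb'
    cases ha'; cases hb'
    exact Or.inr h
  · rw [hxy l hjl, hb'] at ha'
    cases ha'
    exact absurd h (hS.locLT_irrefl _ _)

/-- Flags with a prescribed lower part form an interval of the lexicographic order. -/
lemma agree_of_between (hS : S.IsOpetopicCardinal) {x y z : S.Vec} {j : ℕ}
    (hxy : ∀ i < j, x i = y i) (h : x = z ∨ FlagLT x z) (h' : z = y ∨ FlagLT z y) :
    ∀ i < j, z i = x i := by
  rcases h with rfl | h
  · exact fun _ _ => rfl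
  rcases h' with rfl | h'
  · exact fun i hi => (hxy i hi).symm
  rw [hS.flagLT_iff] at h h'
  obtain ⟨l, a, b, h₁, ha, hb, h⟩ := h
  obtain ⟨m, b', c, h₂, hb', hc, h'⟩ := h'
  intro i hi
  by_cases hil : i < l
  · exact (h₁ i hil).symm
  exfalso
  rcases lt_trichotomy l m with hlm | rfl | hlm
  · have := hxy l (by omega)
    rw [ha, ← h₂ l hlm, hb] at this
    cases this
    exact hS.locLT_irrefl _ _ h
  · have := hxy l (by omega)
    rw [ha, hc] at this
    cases this
    rw [hb] at hb'
    cases hb'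
    exact hS.locLT_asymm h (h'.congr fun i hi => (h₁ i hi).symm)
  · have := hxy m (by omega)
    rw [h₁ m hlm, hb', hc] at this
    cases this
    exact hS.locLT_irrefl _ _ h'

end IsOpetopicCardinal

/-! ## Flips -/

/-- The flags `x` and `y` differ at level `i` exactly. -/
def Flip (k i : ℕ) (x y : S.Vec) : Prop :=
  IsFlag k x ∧ IsFlag k y ∧ (∀ j, j ≠ i → y j = x j) ∧ y i ≠ x i

lemma Flip.symm {k i : ℕ} {x y : S.Vec} (h : Flip k i x y) : Flip k i y x :=
  ⟨h.2.1, h.1, fun j hj => (h.2.2.1 j hj).symm, h.2.2.2.symm⟩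

lemma IsFlag.update {k i : ℕ} {x : S.Vec} (hx : IsFlag k x) {t : S.F (i + 1)} {a : S.F i}
    (ht : x (i + 1) = some t) (ha : a ∈ S.bd t) (hl : Loc x i a) :
    IsFlag k (Function.update x i (some a)) where
  isSome_iff j := by
    have := hx.le_of_some ht
    by_cases h : j = i
    · subst h; simp; omega
    · rw [Function.update_of_ne h, hx.isSome_iff]
  mem_bd {j c d} hc hd := by
    by_cases h : j = i
    · subst h
      rw [Function.update_self] at hc
      rw [Function.update_of_ne (by omega), ht] at hd
      cases hc; cases hd; exact ha
    · rw [Function.update_of_ne h] at hc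
      by_cases h' : j + 1 = i
      · subst h'
        rw [Function.update_self] at hd
        cases hd
        obtain ⟨c', hc', h⟩ := hl
        rw [hc] at hc'
        cases hc'
        exact h
      · rw [Function.update_of_ne h'] at hd
        exact hx.mem_bd hc hd

namespace IsOpetopicCardinal

lemma exists_flip (hS : S.IsOpetopicCardinal) {k i : ℕ} {x : S.Vec} (hx : IsFlag k x)
    (hi : i < k) : ∃ y, Flip k i x y := by
  obtain ⟨t, ht⟩ := hx.some_of_le (i := i + 1) (by omega)
  obtain ⟨a, ha⟩ := hx.some_of_le (i := i) (by omega)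
  obtain ⟨b, hb, hne, hl⟩ := hS.exists_loc_other (hx.mem_bd ha ht) (hx.loc ha)
  refine ⟨_, hx, hx.update ht hb hl, fun j hj => Function.update_of_ne hj _ _, ?_⟩
  rw [Function.update_self, ha]
  exact fun h => hne (Option.some.inj h)

/-- By `locLT_bd_iff` the order of the two faces depends on the sign up to level `i` and on whether
`x i` is the codomain of `x (i + 1)`. The recursion for `sgn` combines precisely these two data. -/
lemma flip_lt_iff (hS : S.IsOpetopicCardinal) {k i : ℕ} {x y : S.Vec} (h : Flip k i x y)
    (hi : i < k) : FlagLT x y ↔ sgn x (i + 1) = 1 := by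
  obtain ⟨hx, hy, hxy, hne⟩ := h
  obtain ⟨t, ht⟩ := hx.some_of_le (i := i + 1) (by omega)
  obtain ⟨a, ha⟩ := hx.some_of_le (i := i) (by omega)
  obtain ⟨b, hb⟩ := hy.some_of_le (i := i) (by omega)
  have ht' := hxy (i + 1) (by omega)
  rw [ht] at ht'
  have hagree : ∀ j < i, x j = y j := fun j hj => (hxy j (by omega)).symm
  have hab : a ≠ b := by
    rintro rfl
    exact hne (by rw [ha, hb])
  have key := hS.locLT_bd_iff (hx.mem_bd ha ht) (hy.mem_bd hb ht') hab (hx.loc ha)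
    ((hy.loc hb).congr fun j hj => (hagree j hj).symm)
  have hs : sgn x (i + 1) = 1 ↔ (esgn x i a = 1 ↔ a = S.γ t) := by
    rw [sgn, ← sgn_eq_esgn ha]
    rcases sgn_eq x i with hs | hs <;> by_cases h : a = S.γ t <;> simp [hs, h, ha, ht]
  rw [hs, ← key]
  constructor
  · intro h
    exact (hS.locLE_of_flagLT (Or.inr h) hagree ha hb).resolve_left hab
  · intro h
    exact hS.flagLT_iff.2 ⟨i, a, b, hagree, ha, hb, h⟩

/-- At level `i + 1` the sign says which of the two flags is earlier, so the signs are opposite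
there. Further up the recursion involves only entries common to both flags. -/
lemma flip_sgn (hS : S.IsOpetopicCardinal) {k i : ℕ} {x y : S.Vec} (h : Flip k i x y)
    (hi : i < k) {j : ℕ} (hj : i < j) : sgn y j = - sgn x j := by
  induction j, hj using Nat.le_induction with
  | base =>
    have h₁ := hS.flip_lt_iff h hi
    have h₂ := hS.flip_lt_iff h.symm hi
    have h₃ := hS.flagLT_total h.1 h.2.1 hi.le hi.le h.2.2.2.symm
    have h₄ : ¬ (FlagLT x y ∧ FlagLT y x) := fun h => hS.flagLT_asymm h.1 h.2
    rw [h₁, h₂] at h₃ h₄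
    have h₅ := sgn_eq x (i + 1)
    have h₆ := sgn_eq y (i + 1)
    change sgn y (i + 1) = - sgn x (i + 1)
    omega
  | succ j hj ih =>
    change i + 1 ≤ j at hj
    rw [sgn, sgn, ih, h.2.2.1 j (by omega), h.2.2.1 (j + 1) (by omega)]
    split_ifs <;> rfl

/-- Three flags pairwise differing at level `i` would need three pairwise opposite signs. -/
lemma flip_unique (hS : S.IsOpetopicCardinal) {k i : ℕ} {x y y' : S.Vec} (h : Flip k i x y)
    (h' : Flip k i x y') (hi : i < k) : y = y' := by
  by_contra hne
  have h₀ : Flip k i y y' := by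
    refine ⟨h.2.1, h'.2.1, fun j hj => (h'.2.2.1 j hj).trans (h.2.2.1 j hj).symm, fun h₁ => hne ?_⟩
    funext j
    by_cases hj : j = i
    · subst hj; exact h₁.symm
    · rw [h.2.2.1 j hj, h'.2.2.1 j hj]
  have h₁ := hS.flip_sgn h hi (j := i + 1) (by omega)
  have h₂ := hS.flip_sgn h' hi (j := i + 1) (by omega)
  have h₃ := hS.flip_sgn h₀ hi (j := i + 1) (by omega)
  have h₄ := sgn_eq x (i + 1)
  omega

end IsOpetopicCardinal

lemma IsFlag.eq_or_flip {k i : ℕ} {x y : S.Vec} (hx : IsFlag k x) (hy : IsFlag k y)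
    (h : ∀ j ≤ k, j ≠ i → y j = x j) : y = x ∨ Flip k i x y := by
  have h' : ∀ j, j ≠ i → y j = x j := fun j hj => by
    by_cases hjk : j ≤ k
    · exact h j hjk hj
    · rw [hx.none_of_lt (by omega), hy.none_of_lt (by omega)]
  by_cases hi : y i = x i
  · left
    funext j
    by_cases hj : j = i
    · subst hj; exact hi
    · exact h' j hj
  · exact Or.inr ⟨hx, hy, h', hi⟩

/-- There is no flag under `q` strictly between `x` and `y`. -/
def Adj {k : ℕ} (q : S.F k) (x y : S.Vec) : Prop :=
  x ∈ Fl q ∧ y ∈ Fl q ∧ FlagLT x y ∧ ∀ z ∈ Fl q, FlagLT x z → FlagLT z y → False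

/-- The flag `[q, f_k, …, f_0]`. -/
def ext {k : ℕ} (q : S.F (k + 1)) (f : S.Vec) : S.Vec := Function.update f (k + 1) (some q)

lemma ext_of_le {k : ℕ} (q : S.F (k + 1)) (f : S.Vec) {i : ℕ} (hi : i ≤ k) : ext q f i = f i :=
  Function.update_of_ne (by omega) _ _

lemma ext_top {k : ℕ} (q : S.F (k + 1)) (f : S.Vec) : ext q f (k + 1) = some q :=
  Function.update_self ..

lemma ext_mem {k : ℕ} {q : S.F (k + 1)} {p : S.F k} {f : S.Vec} (hf : f ∈ Fl p)
    (hp : p ∈ S.bd q) : ext q f ∈ Fl q :=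
  ⟨hf.1.extend hf.2 hp, ext_top q f⟩

lemma below_of_lt {m : ℕ} {x : S.Vec} {i : ℕ} (hi : i < m) : below m x i = x i := if_pos hi

lemma IsFlag.below_eq_self {k : ℕ} {x : S.Vec} (hx : IsFlag k x) {m : ℕ} (hm : k < m) :
    PosHypergraph.below m x = x := by
  funext i
  by_cases hi : i < m
  · exact below_of_lt hi
  · rw [PosHypergraph.below, if_neg hi, hx.none_of_lt (by omega)]

lemma below_mem {k m : ℕ} {x : S.Vec} (hx : IsFlag k x) (hm : m ≤ k) {p : S.F m}
    (hp : x m = some p) : below (m + 1) x ∈ Fl p :=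
  ⟨hx.below hm, by rw [below_of_lt (by omega), hp]⟩

lemma ext_below {k : ℕ} {q : S.F (k + 1)} {x : S.Vec} (hx : x ∈ Fl q) :
    ext q (below (k + 1) x) = x := by
  funext i
  by_cases hi : i = k + 1
  · subst hi
    rw [ext_top, hx.2]
  · by_cases hi' : i < k + 1
    · rw [ext_of_le _ _ (by omega), below_of_lt hi']
    · rw [ext, Function.update_of_ne hi, PosHypergraph.below, if_neg hi', hx.1.none_of_lt (by omega)]

namespace IsOpetopicCardinal

/-- A common top face never decides a comparison. Thus the flags under `p ∈ ∂q` embed as an ordered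
subset of those under `q`, and cuts over `q` restrict to cuts over `p`. -/
lemma flagLT_ext (hS : S.IsOpetopicCardinal) {k : ℕ} {q : S.F (k + 1)} {f g : S.Vec}
    (hf : IsFlag k f) (hg : IsFlag k g) : FlagLT (ext q f) (ext q g) ↔ FlagLT f g := by
  have key : ∀ {f g : S.Vec}, IsFlag k f → IsFlag k g → FlagLT f g →
      FlagLT (ext q f) (ext q g) := fun hf hg h =>
    hS.flagLT_of_agree h hf hg (fun i hi => ext_of_le q _ hi) (fun i hi => ext_of_le q _ hi)
  refine ⟨fun h => ?_, key hf hg⟩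
  by_cases hne : f = g
  · subst hne
    exact absurd h (hS.flagLT_irrefl _)
  · exact (hS.flagLT_total' hf hg hne).resolve_right fun h' => hS.flagLT_asymm h (key hg hf h')

/-- A flag in between agrees with both below level `k` and has the same top face, hence is one of
the two. -/
lemma high_adj (hS : S.IsOpetopicCardinal) {k : ℕ} {q : S.F (k + 1)} {x y : S.Vec}
    (h : Flip (k + 1) k x y) (hx : x (k + 1) = some q) (hs : sgn x (k + 1) = 1) : Adj q x y := by
  refine ⟨⟨h.1, hx⟩, ⟨h.2.1, by rw [h.2.2.1 _ (by omega), hx]⟩, (hS.flip_lt_iff h (by omega)).2 hs,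
    fun z hz h₁ h₂ => ?_⟩
  have hag := hS.agree_of_between (j := k) (fun i hi => (h.2.2.1 i (by omega)).symm)
    (Or.inr h₁) (Or.inr h₂)
  rcases h.1.eq_or_flip (i := k) hz.1 (fun j hj hjk => by
    rcases (by omega : j < k ∨ j = k + 1) with hj | rfl
    · exact hag j hj
    · rw [hz.2, hx]) with rfl | hf
  · exact hS.flagLT_irrefl _ h₁
  · obtain rfl := hS.flip_unique h hf (by omega)
    exact hS.flagLT_irrefl _ h₂

end IsOpetopicCardinal

/-! ### Building flags -/

/-- `x` has faces at the levels below `n` exactly, each in the boundary of the next one. -/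
structure IsPre (n : ℕ) (x : S.Vec) : Prop where
  isSome_iff : ∀ i, (x i).isSome ↔ i < n
  mem_bd : ∀ {i : ℕ} {a : S.F i} {b : S.F (i + 1)}, x i = some a → x (i + 1) = some b → a ∈ S.bd b

lemma IsPre.isFlag {k : ℕ} {x : S.Vec} (hx : IsPre (k + 1) x) : IsFlag k x :=
  ⟨fun i => (hx.isSome_iff i).trans Nat.lt_succ_iff, hx.mem_bd⟩

lemma IsFlag.isPre {k n : ℕ} {x : S.Vec} (hx : IsFlag k x) (hn : n ≤ k + 1) :
    IsPre n (PosHypergraph.below n x) where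
  isSome_iff i := by
    unfold PosHypergraph.below
    split_ifs with h
    · rw [hx.isSome_iff]; omega
    · simp; omega
  mem_bd {i a b} ha hb := by
    unfold PosHypergraph.below at ha hb
    split_ifs at ha hb
    exact hx.mem_bd ha hb

lemma IsPre.snoc {n : ℕ} {x : S.Vec} (hx : IsPre n x) {a : S.F n} (ha : Loc x n a) :
    IsPre (n + 1) (Function.update x n (some a)) where
  isSome_iff i := by
    by_cases h : i = n
    · subst h; simp
    · rw [Function.update_of_ne h, hx.isSome_iff]; omega
  mem_bd {i c d} hc hd := by
    by_cases h : i + 1 = n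
    · subst h
      rw [Function.update_of_ne (by omega)] at hc
      rw [Function.update_self] at hd
      cases hd
      obtain ⟨c', hc', h⟩ := ha
      rw [hc] at hc'
      cases hc'
      exact h
    · rw [Function.update_of_ne h] at hd
      by_cases h' : i = n
      · subst h'
        have := (hx.isSome_iff (i + 1)).1 (by simp [hd])
        omega
      · rw [Function.update_of_ne h'] at hc
        exact hx.mem_bd hc hd

/-- Any admissible lower part is completed to a flag under `p` by iterated codomains. In the next
lemma the completion enters the codomains through a face `t` of a domain, as in the vectors
`starVec`. -/
lemma exists_flag_iterγ {k : ℕ} (p : S.F k) {j : ℕ} {g : S.Vec} (hg : IsPre j g) (hj : j ≤ k)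
    (hl : Loc g j (S.iterγ p j hj)) : ∃ f ∈ Fl p, (∀ i < j, f i = g i) ∧
      ∀ i (hi : i ≤ k), j ≤ i → f i = some (S.iterγ p i hi) := by
  have h₁ : ∀ i < j, (fun i => if i < j then g i else if h : i ≤ k then some (S.iterγ p i h)
    else none : S.Vec) i = g i := fun i hi => by simp [hi]
  have h₂ : ∀ i (hi : i ≤ k), j ≤ i → (fun i => if i < j then g i else if h : i ≤ k then
    some (S.iterγ p i h) else none : S.Vec) i = some (S.iterγ p i hi) := fun i hi hij => by
      simp [hi, hij]
  have h₃ : ∀ i, k < i → (fun i => if i < j then g i else if h : i ≤ k then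
    some (S.iterγ p i h) else none : S.Vec) i = none := fun i hi => by
      have : ¬ i < j := by omega
      have : ¬ i ≤ k := by omega
      simp [*]
  generalize (fun i => if i < j then g i else if h : i ≤ k then some (S.iterγ p i h)
    else none : S.Vec) = f at *
  refine ⟨f, ⟨⟨fun i => ?_, fun {i a b} ha hb => ?_⟩, ?_⟩, h₁, h₂⟩
  · by_cases hi : i < j
    · rw [h₁ i hi, hg.isSome_iff]; omega
    · by_cases hik : i ≤ k
      · simp [h₂ i hik (by omega), hik]
      · simp [h₃ i (by omega), hik]
  · by_cases hi : i + 1 < j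
    · rw [h₁ _ hi] at hb
      rw [h₁ _ (by omega)] at ha
      exact hg.mem_bd ha hb
    · by_cases hik : i + 1 ≤ k
      · rw [h₂ _ hik (by omega)] at hb
        cases hb
        by_cases hij : i + 1 = j
        · subst hij
          rw [h₁ _ (by omega)] at ha
          obtain ⟨c, hc, h⟩ := hl
          rw [ha] at hc
          cases hc
          exact h
        · rw [h₂ _ (by omega) (by omega), iterγ_succ p i hik] at ha
          cases ha
          exact Or.inl rfl
      · rw [h₃ _ (by omega)] at hb
        cases hb
  · rw [h₂ k le_rfl hj, iterγ_self]

lemma exists_flag_lowerFaces {k : ℕ} (p : S.F k) {j : ℕ} {g : S.Vec} (hg : IsPre j g)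
    {t : S.F j} (ht : t ∈ S.lowerFaces p j) (hl : Loc g j t) : ∃ f ∈ Fl p, (∀ i < j, f i = g i) ∧
      f j = some t ∧ ∀ i (hi : i ≤ k), j < i → f i = some (S.iterγ p i hi) := by
  rcases ht with ⟨h, ht⟩ | ⟨rfl, rfl⟩
  · obtain ⟨f, hf, h₁, h₂⟩ := exists_flag_iterγ p (hg.snoc hl) h
      ⟨t, by simp, Or.inr ht⟩
    refine ⟨f, hf, fun i hi => ?_, ?_, fun i hi hij => h₂ i hi (by omega)⟩
    · rw [h₁ i (by omega), Function.update_of_ne (by omega)]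
    · rw [h₁ j (by omega), Function.update_self]
  · obtain ⟨f, hf, h₁, h₂⟩ := exists_flag_iterγ p hg le_rfl hl
    exact ⟨f, hf, h₁, h₂ j le_rfl le_rfl, fun i hi hij => by omega⟩

lemma Fl_nonempty {k : ℕ} (p : S.F k) : (Fl p).Nonempty := by
  obtain ⟨f, hf, -⟩ := exists_flag_iterγ p (j := 0) (g := fun _ => none)
    ⟨by simp, fun h => by simp at h⟩ k.zero_le trivial
  exact ⟨f, hf⟩

namespace IsOpetopicCardinal

/-- Every flag under `q` lies between two adjacent flags through `γ q`. -/
lemma exists_γ_between (hS : S.IsOpetopicCardinal) {k : ℕ} {q : S.F (k + 2)} {y : S.Vec}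
    (hy : y ∈ Fl q) : ∃ f₁ f₂, Flip (k + 1) k f₁ f₂ ∧ f₁ ∈ Fl (S.γ q) ∧ f₂ ∈ Fl (S.γ q) ∧
      sgn f₁ (k + 1) = 1 ∧ (∀ i < k, f₁ i = y i) ∧ (ext q f₁ = y ∨ FlagLT (ext q f₁) y) ∧
      (y = ext q f₂ ∨ FlagLT y (ext q f₂)) := by
  obtain ⟨e, he⟩ := hy.1.some_of_le (i := k + 1) (by omega)
  obtain ⟨r, hr⟩ := hy.1.some_of_le (i := k) (by omega)
  have heq := hy.1.mem_bd he hy.2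
  have hre := hy.1.mem_bd hr he
  have hle : S.UpLE e (S.γ q) := by
    rcases heq with rfl | h
    · exact .refl _
    · exact (upLT_γ h).le
  -- The bounding flags keep `y` below level `k` and pass through the two faces `a`, `b` of `∂γq` on
  -- either side of `r`.
  obtain ⟨a, ha, b, hb, hla, hlb, hab, har, hrb⟩ := hS.exists_loc_between hle hre (hy.1.loc hr)
  have hbel : ∀ i < k, y i = below k y i := fun i hi => (below_of_lt hi).symm
  have mk : ∀ c, c ∈ S.bd (S.γ q) → Loc y k c → ∃ f ∈ Fl (S.γ q), (∀ i < k, f i = y i) ∧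
      f k = some c := by
    intro c hc hlc
    refine ⟨_, ⟨(((hy.1.isPre (n := k) (by omega)).snoc (hlc.congr hbel)).snoc
      (a := S.γ q) ⟨c, by simp, hc⟩).isFlag, by simp⟩, fun i hi => ?_, ?_⟩
    · rw [Function.update_of_ne (by omega), Function.update_of_ne (by omega), below_of_lt hi]
    · rw [Function.update_of_ne (by omega), Function.update_self]
  obtain ⟨f₁, hf₁, h₁, ha₁⟩ := mk a ha hla
  obtain ⟨f₂, hf₂, h₂, hb₂⟩ := mk b hb hlb
  have hne : b ≠ a := by
    rintro rfl
    exact hS.locLT_irrefl _ _ hab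
  have hflip : Flip (k + 1) k f₁ f₂ := by
    refine (hf₁.1.eq_or_flip hf₂.1 fun j hj hjk => ?_).resolve_left ?_
    · rcases (by omega : j < k ∨ j = k + 1) with hj | rfl
      · rw [h₁ j hj, h₂ j hj]
      · rw [hf₁.2, hf₂.2]
    · rintro rfl
      rw [ha₁] at hb₂
      exact hne (Option.some.inj hb₂).symm
  have hs : sgn f₁ (k + 1) = 1 := by
    rw [← hS.flip_lt_iff hflip (by omega), hS.flagLT_iff]
    exact ⟨k, a, b, fun i hi => by rw [h₁ i hi, h₂ i hi], ha₁, hb₂,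
      hab.congr fun i hi => (h₁ i hi).symm⟩
  have hs₂ := hS.flip_sgn hflip (by omega) (j := k + 1) (by omega)
  rw [hs] at hs₂
  -- If `r` is itself one of the two bounds, level `k` does not decide. The comparison moves to
  -- level `k + 1`, where `e ≤⁺ γ q` and the sign of `f` give the answer.
  have aux : ∀ {f : S.Vec} {c}, f ∈ Fl (S.γ q) → (∀ i < k, f i = y i) → f k = some c → r = c →
      y = ext q f ∨ ((sgn f (k + 1) = 1 → FlagLT (ext q f) y) ∧
        (sgn f (k + 1) = -1 → FlagLT y (ext q f))) := by
    rintro f _ hf h hc rfl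
    have hE := ext_mem hf (γ_mem_bd q)
    have hagree : ∀ i < k + 1, ext q f i = y i := fun i hi => by
      rw [ext_of_le _ _ (by omega)]
      rcases (by omega : i < k ∨ i = k) with hi | rfl
      · exact h i hi
      · rw [hc, hr]
    have hEk : ext q f (k + 1) = some (S.γ q) := by
      rw [ext_of_le _ _ (by omega), hf.2]
    rcases hle with rfl | hlt
    · left
      refine hy.1.ext hE.1 fun i hi => ?_
      rcases (by omega : i < k + 1 ∨ i = k + 1 ∨ i = k + 2) with hi | rfl | rfl
      · exact (hagree i hi).symm
      · rw [he, hEk]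
      · rw [hy.2, hE.2]
    · right
      have hup := hS.locLT_up_iff (x := ext q f) (j := k) (t := S.γ q) (u := e) (a := r)
        (by rw [hagree k (by omega), hr]) (hf.1.mem_bd hc hf.2) hre
      rw [← sgn_eq_esgn hEk, sgn_congr (y := f) fun i hi => ext_of_le q f hi] at hup
      refine ⟨fun hs => ?_, fun hs => ?_⟩
      · exact hS.flagLT_iff.2 ⟨k + 1, _, e, hagree, hEk, he, (hup.1 hs).2 hlt⟩
      · exact hS.flagLT_iff.2 ⟨k + 1, e, _, fun i hi => (hagree i hi).symm, he, hEk,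
          ((hup.2 hs).2 hlt).congr hagree⟩
  refine ⟨f₁, f₂, hflip, hf₁, hf₂, hs, h₁, ?_, ?_⟩
  · rcases har with rfl | har
    · exact (aux hf₁ h₁ ha₁ rfl).imp Eq.symm fun h => h.1 hs
    · refine Or.inr (hS.flagLT_iff.2 ⟨k, a, r, fun i hi => ?_, ?_, hr, har.congr fun i hi => ?_⟩)
      · rw [ext_of_le _ _ (by omega), h₁ i hi]
      · rw [ext_of_le _ _ (by omega), ha₁]
      · rw [ext_of_le _ _ (by omega), h₁ i hi]
  · rcases hrb with rfl | hrb
    · exact (aux hf₂ h₂ hb₂ rfl).imp id fun h => h.2 hs₂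
    · refine Or.inr (hS.flagLT_iff.2 ⟨k, r, b, fun i hi => ?_, hr, ?_, hrb⟩)
      · rw [ext_of_le _ _ (by omega), h₂ i hi]
      · rw [ext_of_le _ _ (by omega), hb₂]

end IsOpetopicCardinal

/-! ### Low levels -/

/-- The condition on the low level involves only entries above level `i`, which the flip leaves
unchanged. -/
lemma Flip.isLowLevel {k i : ℕ} {x y : S.Vec} (h : Flip k i x y) (hi : IsLowLevel k x i) :
    IsLowLevel k y i := by
  obtain ⟨hx, hy, hxy, hne⟩ := h
  refine ⟨?_, fun j hj => ?_⟩
  · obtain ⟨h, a, b, ha, hb, hab⟩ := hi.1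
    exact ⟨h, a, b, by rw [hxy _ (by omega), ha], by rw [hxy _ (by omega), hb], hab⟩
  · by_contra hij
    obtain ⟨h, a, b, ha, hb, hab⟩ := hj
    have := hi.2 ⟨h, a, b, by rw [← hxy _ (by omega), ha], by rw [← hxy _ (by omega), hb], hab⟩
    omega

namespace IsOpetopicCardinal

/-- Above level `i + 1` the sign changes exactly once, in passing from `x (i + 1)` to `x (i + 2)`;
all later steps are codomains. -/
lemma sgn_low (hS : S.IsOpetopicCardinal) {k i : ℕ} {x : S.Vec} (hx : IsFlag k x)
    (hi : IsLowLevel k x i) : sgn x k = - sgn x (i + 1) := by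
  obtain ⟨h, a, b, ha, hb, hab⟩ := hi.1
  have key : ∀ j, i + 2 ≤ j → j ≤ k → sgn x j = - sgn x (i + 1) := by
    intro j hj
    induction j, hj using Nat.le_induction with
    | base =>
      intro _
      rw [sgn, if_neg]
      rw [ha, hb, Option.map_some]
      exact fun h => hS.not_γ_eq_of_mem_δ hab (Option.some.inj h).symm
    | succ j hj ih =>
      intro hjk
      rw [sgn, if_pos, ih (by omega)]
      obtain ⟨c, hc⟩ := hx.some_of_le (i := j) (by omega)
      obtain ⟨d, hd⟩ := hx.some_of_le (i := j + 1) (by omega)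
      rw [hc, hd, Option.map_some]
      rcases hx.mem_bd hc hd with rfl | h'
      · rfl
      · obtain ⟨j, rfl⟩ : ∃ n, j = n + 1 := ⟨j - 1, by omega⟩
        have := hi.2 ⟨by omega, c, d, hc, hd, h'⟩
        omega
  exact key k (by omega) le_rfl

end IsOpetopicCardinal

lemma IsLowLevel.below {k i : ℕ} {x : S.Vec} (hi : IsLowLevel (k + 1) x i) (h : i + 1 < k) :
    IsLowLevel k (below (k + 1) x) i := by
  obtain ⟨-, a, b, ha, hb, hab⟩ := hi.1
  refine ⟨⟨h, a, b, by rw [below_of_lt (by omega), ha], by rw [below_of_lt (by omega), hb], hab⟩,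
    fun j hj => ?_⟩
  obtain ⟨hj, a, b, ha, hb, hab⟩ := hj
  rw [below_of_lt (by omega)] at ha hb
  exact hi.2 ⟨by omega, a, b, ha, hb, hab⟩

namespace IsOpetopicCardinal

/-- Induction on the top dimension. If the low level is just two below the top, the face under `q`
is in `δ q`, and a flag in between would need a face of `∂q` strictly inside it. Otherwise that face
is `γ q`, and the configuration is transported to the flags under `γ q`. -/
lemma low_adj_aux (hS : S.IsOpetopicCardinal) {k i : ℕ} {q : S.F k} {x y z : S.Vec}
    (h : Flip k i x y) (hi : IsLowLevel k x i) (hx : x k = some q) (hs : sgn x k = -1)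
    (hz : z ∈ Fl q) (h₁ : FlagLT x z) (h₂ : FlagLT z y) : False := by
  induction k generalizing x y z with
  | zero => have := hi.1.1; omega
  | succ k ih =>
    obtain ⟨k, rfl⟩ : ∃ n, k = n + 1 := ⟨k - 1, by have := hi.1.1; omega⟩
    obtain ⟨p, hp⟩ := h.1.some_of_le (i := k + 1) (by omega)
    have hpq := h.1.mem_bd hp hx
    have hyq : y ∈ Fl q := ⟨h.2.1, by rw [h.2.2.1 _ (by have := hi.1.1; omega), hx]⟩
    have hsy := hS.flip_sgn h (by have := hi.1.1; omega) (j := k + 1 + 1)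
      (by have := hi.1.1; omega)
    rw [hs] at hsy
    have hik := hi.1.1
    rcases (by omega : i = k ∨ i < k) with rfl | hik
    · have hpδ : p ∈ S.δ q := by
        obtain ⟨-, a, b, ha, hb, hab⟩ := hi.1
        rw [hp] at ha
        rw [hx] at hb
        cases ha; cases hb
        exact hab
      have hag := hS.agree_of_between (j := i) (fun l hl => (h.2.2.1 l (by omega)).symm)
        (Or.inr h₁) (Or.inr h₂)
      obtain ⟨a, ha⟩ := h.1.some_of_le (i := i) (by omega)
      obtain ⟨b, hb⟩ := h.2.1.some_of_le (i := i) (by omega)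
      obtain ⟨r, hr⟩ := hz.1.some_of_le (i := i) (by omega)
      obtain ⟨e, he⟩ := hz.1.some_of_le (i := i + 1) (by omega)
      have hpy := h.2.2.1 (i + 1) (by omega)
      rw [hp] at hpy
      have hag' : ∀ l < i, z l = y l := fun l hl => (hag l hl).trans (h.2.2.1 l (by omega)).symm
      rcases hS.locLE_of_flagLT (Or.inr h₁) (fun l hl => (hag l hl).symm) ha hr with rfl | har
      -- If `z` shares level `i` with `x`, it can differ from `x` at level `i + 1` only, and the
      -- sign `-1` would then put it before `x`.
      · rcases h.1.eq_or_flip (i := i + 1) hz.1 (fun j hj hj' => by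
          rcases (by omega : j < i ∨ j = i ∨ j = i + 2) with hj | rfl | rfl
          · exact hag j hj
          · rw [ha, hr]
          · rw [hz.2, hx]) with rfl | hf
        · exact hS.flagLT_irrefl _ h₁
        · have := (hS.flip_lt_iff hf (by omega)).1 h₁
          rw [hs] at this
          omega
      rcases hS.locLE_of_flagLT (Or.inr h₂) hag' hr hb with rfl | hrb
      · rcases h.2.1.eq_or_flip (i := i + 1) hz.1 (fun j hj hj' => by
          rcases (by omega : j < i ∨ j = i ∨ j = i + 2) with hj | rfl | rfl
          · exact hag' j hj
          · rw [hb, hr]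
          · rw [hz.2, hyq.2]) with rfl | hf
        · exact hS.flagLT_irrefl _ h₂
        · have := (hS.flip_lt_iff hf.symm (by omega)).1 h₂
          have h' := hS.flip_sgn hf (by omega) (j := i + 1 + 1) (by omega)
          rw [hsy] at h'
          omega
      -- Now `r` is strictly between `a` and `b`, so `e` lies strictly inside `p`. This is
      -- impossible for `e ∈ ∂q` and `p ∈ δ q`.
      have hlt := hS.lt_of_loc_between (h.1.mem_bd ha hp) (h.2.1.mem_bd hb hpy) har
        (hrb.congr hag) (hz.1.mem_bd hr he)
      rcases hz.1.mem_bd he hz.2 with rfl | heq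
      · exact hS.not_le_of_lt hlt (upLT_γ hpδ).le
      · exact hS.δ_antichain heq hpδ hlt
    · obtain rfl : p = S.γ q := by
        refine hpq.resolve_right fun h' => ?_
        have := hi.2 ⟨by omega, p, q, hp, hx, h'⟩
        omega
      have hxq : x ∈ Fl q := ⟨h.1, hx⟩
      have hyp : y (k + 1) = some (S.γ q) := by rw [h.2.2.1 _ (by omega), hp]
      have hf := below_mem h.1 (by omega) hp
      have hf' := below_mem h.2.1 (by omega) hyp
      -- Enclose `z` between adjacent flags through `γ q`. Under `γ q` the signs exclude `f₂ = y`;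
      -- if `f₂` precedes `y`, it lies between `x` and `y`, against the induction; if it follows
      -- `y`, then `y` lies between `f₁` and `f₂`.
      obtain ⟨f₁, f₂, hflip, hf₁, hf₂, hs₁, -, hle₁, hle₂⟩ := hS.exists_γ_between hz
      have hs₂ := hS.flip_sgn hflip (by omega) (j := k + 1) (by omega)
      rw [hs₁] at hs₂
      have hfx : FlagLT (below (k + 2) x) f₂ := by
        rw [← hS.flagLT_ext (q := q) hf.1 hf₂.1, ext_below hxq]
        rcases hle₂ with rfl | hle₂
        · exact h₁
        · exact hS.flagLT_trans h₁ hle₂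
      have hfy : FlagLT f₁ (below (k + 2) y) := by
        rw [← hS.flagLT_ext (q := q) hf₁.1 hf'.1, ext_below hyq]
        rcases hle₁ with rfl | hle₁
        · exact h₂
        · exact hS.flagLT_trans hle₁ h₂
      have hbflip : Flip (k + 1) i (below (k + 2) x) (below (k + 2) y) := by
        refine (hf.1.eq_or_flip hf'.1 fun j hj hji => ?_).resolve_left fun heq => h.2.2.2 ?_
        · rw [below_of_lt (by omega), below_of_lt (by omega), h.2.2.1 j hji]
        · have := congrFun heq i
          rwa [below_of_lt (by omega), below_of_lt (by omega)] at this
      have hsb : sgn (below (k + 2) x) (k + 1) = -1 := by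
        rw [sgn_congr (y := x) fun j hj => below_of_lt (by omega), ← hs]
        conv_rhs => rw [sgn]
        rw [if_pos]
        rw [hp, hx, Option.map_some]
      have hsb' : sgn (below (k + 2) y) (k + 1) = 1 := by
        rw [hS.flip_sgn hbflip (by omega) (j := k + 1) (by omega), hsb]
        rfl
      have hadj := hS.high_adj hflip hf₁.2 hs₁
      by_cases heq : f₂ = below (k + 2) y
      · rw [heq] at hs₂
        omega
      · rcases hS.flagLT_total' hf₂.1 hf'.1 heq with h | h
        · exact ih hbflip (hi.below (by omega)) hf.2 hsb hf₂ hfx h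
        · exact hadj.2.2.2 _ hf' hfy h

lemma low_adj (hS : S.IsOpetopicCardinal) {k i : ℕ} {q : S.F k} {x y : S.Vec}
    (h : Flip k i x y) (hi : IsLowLevel k x i) (hx : x k = some q) (hs : sgn x k = -1) :
    Adj q x y := by
  have hik := hi.1.1
  refine ⟨⟨h.1, hx⟩, ⟨h.2.1, by rw [h.2.2.1 _ (by omega), hx]⟩, ?_,
    fun z hz h₁ h₂ => hS.low_adj_aux h hi hx hs hz h₁ h₂⟩
  rw [hS.flip_lt_iff h (by omega)]
  have := hS.sgn_low h.1 hi
  omega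

lemma exists_isLowLevel {k : ℕ} {x : S.Vec} (h : ∃ i, i + 1 < k ∧
    ∃ a b, x (i + 1) = some a ∧ x (i + 2) = some b ∧ a ∈ S.δ b) : ∃ i, IsLowLevel k x i := by
  classical
  have hb : ∀ i, (i + 1 < k ∧ ∃ a b, x (i + 1) = some a ∧ x (i + 2) = some b ∧ a ∈ S.δ b) →
    i ≤ k := fun i hi => by have := hi.1; omega
  obtain ⟨i, hi⟩ := h
  exact ⟨_, Nat.findGreatest_spec (P := fun i => i + 1 < k ∧
    ∃ a b, x (i + 1) = some a ∧ x (i + 2) = some b ∧ a ∈ S.δ b) (hb i hi) hi,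
    fun j hj => Nat.le_findGreatest (hb j hj) hj⟩

/-- Such a flag consists of iterated codomains from level 1 on. At dimension one there are just the
two flags exchanged by a flip, and `exists_γ_between` carries extremality from `γ q` to `q`. The
sign tells the first flag from the last. -/
lemma extremal_of_no_low (hS : S.IsOpetopicCardinal) {k : ℕ} {q : S.F k} {x : S.Vec}
    (hx : x ∈ Fl q) (h : ∀ i, i + 1 < k → ∀ a b, x (i + 1) = some a → x (i + 2) = some b →
      a ∉ S.δ b) {z : S.Vec} (hz : z ∈ Fl q) :
    (sgn x k = 1 → ¬ FlagLT z x) ∧ (sgn x k = -1 → ¬ FlagLT x z) := by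
  induction k generalizing x z with
  | zero =>
    obtain rfl : x = z := hx.1.ext hz.1 fun i hi => by
      obtain rfl : i = 0 := by omega
      rw [hx.2, hz.2]
    exact ⟨fun _ => hS.flagLT_irrefl _, fun _ => hS.flagLT_irrefl _⟩
  | succ k ih =>
    rcases k with _ | k
    · rcases hx.1.eq_or_flip (i := 0) hz.1 (fun j hj hj' => by
        obtain rfl : j = 1 := by omega
        rw [hx.2, hz.2]) with rfl | hf
      · exact ⟨fun _ => hS.flagLT_irrefl _, fun _ => hS.flagLT_irrefl _⟩
      · have h₁ := hS.flip_lt_iff hf (by omega)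
        have h₂ := hS.flip_lt_iff hf.symm (by omega)
        have h₃ := hS.flip_sgn hf (by omega) (j := 1) (by omega)
        simp only [zero_add] at *
        rw [h₁, h₂]
        omega
    · obtain ⟨p, hp⟩ := hx.1.some_of_le (i := k + 1) (by omega)
      obtain rfl : p = S.γ q := (hx.1.mem_bd hp hx.2).resolve_right (h k (by omega) p q hp hx.2)
      have hf := below_mem hx.1 (by omega) hp
      have hsb : sgn (below (k + 2) x) (k + 1) = sgn x (k + 2) := by
        rw [sgn_congr (y := x) fun j hj => below_of_lt (by omega)]
        conv_rhs => rw [sgn]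
        rw [if_pos]
        rw [hp, hx.2, Option.map_some]
      obtain ⟨f₁, f₂, hflip, hf₁, hf₂, hs₁, -, hle₁, hle₂⟩ := hS.exists_γ_between hz
      have ih' := fun {z} (hz : z ∈ Fl (S.γ q)) => ih hf (fun i hi a b ha hb => by
        rw [below_of_lt (by omega)] at ha hb
        exact h i (by omega) a b ha hb) hz
      rw [hsb] at ih'
      constructor
      · intro hs hlt
        refine (ih' hf₁).1 hs ?_
        rw [← hS.flagLT_ext (q := q) hf₁.1 hf.1, ext_below hx]
        rcases hle₁ with rfl | hle₁
        · exact hlt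
        · exact hS.flagLT_trans hle₁ hlt
      · intro hs hlt
        refine (ih' hf₂).2 hs ?_
        rw [← hS.flagLT_ext (q := q) hf.1 hf₂.1, ext_below hx]
        rcases hle₂ with rfl | hle₂
        · exact hlt
        · exact hS.flagLT_trans hlt hle₂

lemma Adj.unique_right (hS : S.IsOpetopicCardinal) {k : ℕ} {q : S.F k} {x y y' : S.Vec}
    (h : Adj q x y) (h' : Adj q x y') : y = y' := by
  by_contra hne
  rcases hS.flagLT_total' h.2.1.1 h'.2.1.1 hne with h₁ | h₁
  · exact h'.2.2.2 y h.2.1 h.2.2.1 h₁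
  · exact h.2.2.2 y' h'.2.1 h'.2.2.1 h₁

/-- Adjacent flags differ at one level, which is high or low. -/
lemma adj_cases (hS : S.IsOpetopicCardinal) {k : ℕ} {q : S.F k} {x y : S.Vec} (h : Adj q x y) :
    ∃ i, i < k ∧ Flip k i x y ∧ ((i + 1 = k ∧ sgn x k = 1) ∨
      (IsLowLevel k x i ∧ sgn x k = -1)) := by
  rcases sgn_eq x k with hs | hs
  · rcases k with _ | k
    · refine absurd h.2.2.1 ?_
      rw [h.1.1.ext h.2.1.1 fun i hi => ?_]
      · exact hS.flagLT_irrefl _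
      · obtain rfl : i = 0 := by omega
        rw [h.1.2, h.2.1.2]
    -- The flip at the high level is an immediate successor of `x`, and immediate successors are
    -- unique.
    · obtain ⟨y', hf⟩ := hS.exists_flip h.1.1 (i := k) (by omega)
      obtain rfl := Adj.unique_right hS h (hS.high_adj hf h.1.2 hs)
      exact ⟨k, by omega, hf, Or.inl ⟨rfl, hs⟩⟩
  · by_cases hlow : ∃ i, i + 1 < k ∧ ∃ a b, x (i + 1) = some a ∧ x (i + 2) = some b ∧ a ∈ S.δ b
    · obtain ⟨i, hi⟩ := exists_isLowLevel hlow
      have hik := hi.1.1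
      obtain ⟨y', hf⟩ := hS.exists_flip h.1.1 (i := i) (by omega)
      obtain rfl := Adj.unique_right hS h (hS.low_adj hf hi h.1.2 hs)
      exact ⟨i, by omega, hf, Or.inr ⟨hi, hs⟩⟩
    -- Sign `-1` without a low level means that `x` is the last flag under `q`, so it has no
    -- successor.
    · refine absurd h.2.2.1 ((hS.extremal_of_no_low h.1 (fun i hi a b ha hb hab => ?_) h.2.1).2 hs)
      exact hlow ⟨i, hi, a, b, ha, hb, hab⟩

/-- The two flags around a p-flag. -/
lemma exists_adj_of_isPFlag (hS : S.IsOpetopicCardinal) {k : ℕ} {z : S.Vec} (hz : IsPFlag k z)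
    {q : S.F k} (hq : z k = some q) : ∃ x y i, Adj q x y ∧ i < k ∧ Flip k i x y ∧
      z = punct x i ∧ ((i + 1 = k ∧ sgn x k = 1) ∨ (IsLowLevel k x i ∧ sgn x k = -1)) := by
  obtain ⟨x, i, hx, hi, rfl⟩ := hz
  have hik : i < k := by
    rcases hi with hi | hi
    · omega
    · have := hi.1.1; omega
  rw [punct, Function.update_of_ne (by omega)] at hq
  obtain ⟨y, hf⟩ := hS.exists_flip hx hik
  have hyq : y k = some q := by rw [hf.2.2.1 k (by omega), hq]
  have hsy := hS.flip_sgn hf hik hik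
  have hpu : punct x i = punct y i := by
    funext j
    by_cases hj : j = i
    · subst hj; simp [punct]
    · rw [punct, punct, Function.update_of_ne hj, Function.update_of_ne hj, hf.2.2.1 j hj]
  rcases hi with hi | hi
  · subst hi
    rcases sgn_eq x (i + 1) with hs | hs
    · exact ⟨x, y, i, hS.high_adj hf hq hs, hik, hf, rfl, Or.inl ⟨rfl, hs⟩⟩
    · have hs' : sgn y (i + 1) = 1 := by omega
      exact ⟨y, x, i, hS.high_adj hf.symm hyq hs', hik, hf.symm, hpu, Or.inl ⟨rfl, hs'⟩⟩
  · rcases sgn_eq x k with hs | hs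
    · have hs' : sgn y k = -1 := by omega
      exact ⟨y, x, i, hS.low_adj hf.symm (hf.isLowLevel hi) hyq hs', hik, hf.symm, hpu,
        Or.inr ⟨hf.isLowLevel hi, hs'⟩⟩
    · exact ⟨x, y, i, hS.low_adj hf hi hq hs, hik, hf, rfl, Or.inr ⟨hi, hs⟩⟩

end IsOpetopicCardinal

end PosHypergraph

namespace PosHypergraph

variable {S : PosHypergraph.{u}}

/-! ## Cuts of the flag order and the faces of the cylinder -/

/-- The cut in the flags under `q` given by a p-flag `z`. -/
def cutOf {k : ℕ} (q : S.F k) (z : S.Vec) : Set S.Vec :=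
  {f | f ∈ Fl q ∧ ∃ y ∈ Fl q, (∀ i a, z i = some a → y i = some a) ∧ FlagLT f y}

/-- `w` is the flat face or p-flag over `q` which corresponds to the cut `I`. -/
def Gap : ∀ {k : ℕ}, S.CylFace k → S.F k → Set S.Vec → Prop
  | _, .neg p, q, I => p = q ∧ I = ∅
  | _, .pos p, q, I => p = q ∧ I = Fl q
  | _, .flag _, _, _ => False
  | k, .pflag z, q, I => z.1 k = some q ∧ I = cutOf q z.1

/-- `w` is the flag `h`. -/
def IsFl : ∀ {k : ℕ}, S.CylFace k → S.Vec → Prop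
  | _, .flag x, h => x.1 = h
  | _, _, _ => False

/-- Initial segments of the flags under `q`. -/
def IsLower {k : ℕ} (q : S.F k) (I : Set S.Vec) : Prop :=
  I ⊆ Fl q ∧ ∀ f ∈ I, ∀ g ∈ Fl q, FlagLT g f → g ∈ I

/-- The flags before `h`. -/
def prev {k : ℕ} (q : S.F k) (h : S.Vec) : Set S.Vec := {f | f ∈ Fl q ∧ FlagLT f h}

/-- The flags up to `h`. -/
def next {k : ℕ} (q : S.F k) (h : S.Vec) : Set S.Vec := {f | f ∈ Fl q ∧ (f = h ∨ FlagLT f h)}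

open Classical in
/-- The cut next to `h` on its low side. -/
noncomputable def lo {k : ℕ} (q : S.F k) (h : S.Vec) : Set S.Vec :=
  if sgn h k = 1 then prev q h else next q h

open Classical in
/-- The cut next to `h` on its high side. -/
noncomputable def hi {k : ℕ} (q : S.F k) (h : S.Vec) : Set S.Vec :=
  if sgn h k = 1 then next q h else prev q h

/-- The restriction of a cut to the face `p` of `q`. -/
def rho {k : ℕ} (p : S.F k) (q : S.F (k + 1)) (I : Set S.Vec) : Set S.Vec :=
  {f | f ∈ Fl p ∧ ext q f ∈ I}

/-- The two flags under `q` over `h` are separated by the cut `I`. -/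
def Ins {k : ℕ} (q : S.F (k + 1)) (I : Set S.Vec) (h : S.Vec) : Prop :=
  ∃ x y, Adj q x y ∧ Flip (k + 1) k x y ∧ x ∈ I ∧ y ∉ I ∧ h = below k x

lemma punct_self (x : S.Vec) (i : ℕ) : punct x i i = none := Function.update_self ..

lemma punct_of_ne (x : S.Vec) {i j : ℕ} (h : j ≠ i) : punct x i j = x j :=
  Function.update_of_ne h _ _

lemma Flip.punct_eq {k i : ℕ} {x y : S.Vec} (h : Flip k i x y) : punct x i = punct y i := by
  funext j
  by_cases hj : j = i
  · subst hj; simp [punct_self]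
  · rw [punct_of_ne _ hj, punct_of_ne _ hj, h.2.2.1 j hj]

namespace IsOpetopicCardinal

/-! ### Initial segments of the flags under a face -/

lemma wf_flagLT (hS : S.IsOpetopicCardinal) {k : ℕ} (q : S.F k) :
    WellFounded (fun x y : {x : S.Vec // x ∈ Fl q} => FlagLT x.1 y.1) := by
  have : Finite {x : S.Vec // x ∈ Fl q} := finite_vec (k := k) _ fun x hx i hi =>
    IsFlag.none_of_lt hx.1 hi
  have : Std.Irrefl (fun x y : {x : S.Vec // x ∈ Fl q} => FlagLT x.1 y.1) :=
    ⟨fun a => hS.flagLT_irrefl _⟩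
  have : IsTrans _ (fun x y : {x : S.Vec // x ∈ Fl q} => FlagLT x.1 y.1) :=
    ⟨fun _ _ _ h₁ h₂ => hS.flagLT_trans h₁ h₂⟩
  exact Finite.wellFounded_of_trans_of_irrefl _

lemma wf_flagGT (hS : S.IsOpetopicCardinal) {k : ℕ} (q : S.F k) :
    WellFounded (fun x y : {x : S.Vec // x ∈ Fl q} => FlagLT y.1 x.1) := by
  have : Finite {x : S.Vec // x ∈ Fl q} := finite_vec (k := k) _ fun x hx i hi =>
    IsFlag.none_of_lt hx.1 hi
  have : Std.Irrefl (fun x y : {x : S.Vec // x ∈ Fl q} => FlagLT y.1 x.1) :=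
    ⟨fun a => hS.flagLT_irrefl _⟩
  have : IsTrans _ (fun x y : {x : S.Vec // x ∈ Fl q} => FlagLT y.1 x.1) :=
    ⟨fun _ _ _ h₁ h₂ => hS.flagLT_trans h₂ h₁⟩
  exact Finite.wellFounded_of_trans_of_irrefl _

lemma exists_min (hS : S.IsOpetopicCardinal) {k : ℕ} {q : S.F k} {A : Set S.Vec} (hA : A ⊆ Fl q)
    (hne : A.Nonempty) : ∃ x ∈ A, ∀ y ∈ A, x = y ∨ FlagLT x y := by
  obtain ⟨a, ha⟩ := hne
  obtain ⟨x, hx, hmin⟩ := (hS.wf_flagLT q).has_min {x | x.1 ∈ A} ⟨⟨a, hA ha⟩, ha⟩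
  refine ⟨x.1, hx, fun y hy => ?_⟩
  by_cases h : x.1 = y
  · exact Or.inl h
  · exact Or.inr ((hS.flagLT_total' x.2.1 (hA hy).1 h).resolve_right (hmin ⟨y, hA hy⟩ hy))

lemma exists_max (hS : S.IsOpetopicCardinal) {k : ℕ} {q : S.F k} {A : Set S.Vec} (hA : A ⊆ Fl q)
    (hne : A.Nonempty) : ∃ x ∈ A, ∀ y ∈ A, y = x ∨ FlagLT y x := by
  obtain ⟨a, ha⟩ := hne
  obtain ⟨x, hx, hmin⟩ := (hS.wf_flagGT q).has_min {x | x.1 ∈ A} ⟨⟨a, hA ha⟩, ha⟩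
  refine ⟨x.1, hx, fun y hy => ?_⟩
  by_cases h : y = x.1
  · exact Or.inl h
  · exact Or.inr ((hS.flagLT_total' (hA hy).1 x.2.1 h).resolve_right (hmin ⟨y, hA hy⟩ hy))

/-- A proper nonempty initial segment ends between two adjacent flags. -/
lemma exists_straddle (hS : S.IsOpetopicCardinal) {k : ℕ} {q : S.F k} {I : Set S.Vec}
    (hI : IsLower q I) {f g : S.Vec} (hf : f ∈ I) (hg : g ∈ Fl q) (hgI : g ∉ I) :
    ∃ x y, Adj q x y ∧ x ∈ I ∧ y ∉ I ∧ (f = x ∨ FlagLT f x) ∧ (y = g ∨ FlagLT y g) := by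
  obtain ⟨x, hx, hmax⟩ := hS.exists_max hI.1 ⟨f, hf⟩
  obtain ⟨y, hy, hmin⟩ := hS.exists_min (A := Fl q \ I) Set.sdiff_subset ⟨g, hg, hgI⟩
  refine ⟨x, y, ⟨hI.1 hx, hy.1, ?_, fun z hz h₁ h₂ => ?_⟩, hx, hy.2, hmax f hf, hmin g ⟨hg, hgI⟩⟩
  · have hne : x ≠ y := by
      rintro rfl
      exact hy.2 hx
    exact (hS.flagLT_total' (hI.1 hx).1 hy.1.1 hne).resolve_right
      fun h => hy.2 (hI.2 x hx y hy.1 h)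
  · by_cases hzI : z ∈ I
    · rcases hmax z hzI with rfl | h
      · exact hS.flagLT_irrefl _ h₁
      · exact hS.flagLT_asymm h h₁
    · rcases hmin z ⟨hz, hzI⟩ with rfl | h
      · exact hS.flagLT_irrefl _ h₂
      · exact hS.flagLT_asymm h h₂

lemma eq_prev_of_straddle (hS : S.IsOpetopicCardinal) {k : ℕ} {q : S.F k} {I : Set S.Vec}
    (hI : IsLower q I) {x y : S.Vec} (h : Adj q x y) (hx : x ∈ I) (hy : y ∉ I) : I = prev q y := by
  ext f
  constructor
  · intro hf
    refine ⟨hI.1 hf, ?_⟩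
    have hne : f ≠ y := by
      rintro rfl
      exact hy hf
    exact (hS.flagLT_total' (hI.1 hf).1 h.2.1.1 hne).resolve_right
      fun h' => hy (hI.2 f hf y h.2.1 h')
  · rintro ⟨hf, hfy⟩
    by_cases hfx : f = x
    · exact hfx ▸ hx
    · rcases hS.flagLT_total' hf.1 h.1.1 hfx with h' | h'
      · exact hI.2 x hx f hf h'
      · exact (h.2.2.2 f hf h' hfy).elim

lemma prev_eq_next (hS : S.IsOpetopicCardinal) {k : ℕ} {q : S.F k} {x y : S.Vec}
    (h : Adj q x y) : prev q y = next q x := by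
  ext f
  constructor
  · rintro ⟨hf, hfy⟩
    refine ⟨hf, ?_⟩
    by_cases hfx : f = x
    · exact Or.inl hfx
    · exact Or.inr ((hS.flagLT_total' hf.1 h.1.1 hfx).resolve_right
        fun h' => h.2.2.2 f hf h' hfy)
  · rintro ⟨hf, rfl | h'⟩
    · exact ⟨hf, h.2.2.1⟩
    · exact ⟨hf, hS.flagLT_trans h' h.2.2.1⟩

/-- A cut determines the pair of flags around it. Exclusions between inserted flags rest on
comparing the levels at which such a pair differs. -/
lemma straddle_unique (hS : S.IsOpetopicCardinal) {k : ℕ} {q : S.F k} {I : Set S.Vec}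
    (hI : IsLower q I) {x y x' y' : S.Vec} (h : Adj q x y) (hx : x ∈ I) (hy : y ∉ I)
    (h' : Adj q x' y') (hx' : x' ∈ I) (hy' : y' ∉ I) : x = x' ∧ y = y' := by
  have e₁ := hS.eq_prev_of_straddle hI h hx hy
  have e₂ := hS.eq_prev_of_straddle hI h' hx' hy'
  have hyy : y = y' := by
    by_contra hne
    rcases hS.flagLT_total' h.2.1.1 h'.2.1.1 hne with h₁ | h₁
    · exact hy (e₂ ▸ ⟨h.2.1, h₁⟩)
    · exact hy' (e₁ ▸ ⟨h'.2.1, h₁⟩)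
  subst hyy
  refine ⟨?_, rfl⟩
  by_contra hne
  rcases hS.flagLT_total' h.1.1 h'.1.1 hne with h₁ | h₁
  · exact h.2.2.2 x' h'.1 h₁ h'.2.2.1
  · exact h'.2.2.2 x h.1 h₁ h.2.2.1

lemma isLower_prev (hS : S.IsOpetopicCardinal) {k : ℕ} (q : S.F k) (h : S.Vec) :
    IsLower q (prev q h) :=
  ⟨fun _ hf => hf.1, fun _ hf _ hg hgf => ⟨hg, hS.flagLT_trans hgf hf.2⟩⟩

lemma isLower_next (hS : S.IsOpetopicCardinal) {k : ℕ} (q : S.F k) (h : S.Vec) :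
    IsLower q (next q h) := by
  refine ⟨fun _ hf => hf.1, fun _ hf _ hg hgf => ⟨hg, ?_⟩⟩
  rcases hf.2 with rfl | hf
  · exact Or.inr hgf
  · exact Or.inr (hS.flagLT_trans hgf hf)

lemma isLower_lo (hS : S.IsOpetopicCardinal) {k : ℕ} (q : S.F k) (h : S.Vec) :
    IsLower q (lo q h) := by
  rw [lo]
  split_ifs
  · exact hS.isLower_prev q h
  · exact hS.isLower_next q h

lemma isLower_hi (hS : S.IsOpetopicCardinal) {k : ℕ} (q : S.F k) (h : S.Vec) :
    IsLower q (hi q h) := by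
  rw [hi]
  split_ifs
  · exact hS.isLower_next q h
  · exact hS.isLower_prev q h

lemma isLower_rho (hS : S.IsOpetopicCardinal) {k : ℕ} {p : S.F k} {q : S.F (k + 1)}
    (hp : p ∈ S.bd q) {I : Set S.Vec} (hI : IsLower q I) : IsLower p (rho p q I) :=
  ⟨fun _ hf => hf.1, fun _ hf _ hg hgf =>
    ⟨hg, hI.2 _ hf.2 _ (ext_mem hg hp) ((hS.flagLT_ext hg.1 hf.1.1).2 hgf)⟩⟩

/-- Only `x` and `y` complete the p-flag, and the later of them decides what lies before it. -/
lemma cutOf_eq (hS : S.IsOpetopicCardinal) {k i : ℕ} {q : S.F k} {x y z : S.Vec}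
    (h : Adj q x y) (hf : Flip k i x y) (hz : z = punct x i) : cutOf q z = prev q y := by
  subst hz
  ext f
  constructor
  · rintro ⟨hf', w, hw, hag, hlt⟩
    refine ⟨hf', ?_⟩
    rcases h.1.1.eq_or_flip (i := i) hw.1 (fun j hj hji => by
      obtain ⟨a, ha⟩ := h.1.1.some_of_le hj
      rw [ha]
      exact hag j a (by rw [punct_of_ne _ hji, ha])) with rfl | hfw
    · exact hS.flagLT_trans hlt h.2.2.1
    · by_cases hik : i < k
      · rwa [hS.flip_unique hf hfw hik]
      · refine absurd ?_ hf.2.2.2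
        rcases (by omega : i = k ∨ k < i) with rfl | hik
        · rw [h.1.2, h.2.1.2]
        · rw [h.1.1.none_of_lt hik, h.2.1.1.none_of_lt hik]
  · rintro ⟨hf', hlt⟩
    refine ⟨hf', y, h.2.1, fun j a hj => ?_, hlt⟩
    rw [hf.punct_eq] at hj
    by_cases hji : j = i
    · subst hji
      rw [punct_self] at hj
      cases hj
    · rwa [punct_of_ne _ hji] at hj

lemma gap_pflag (hS : S.IsOpetopicCardinal) {k i : ℕ} {q : S.F k} {x y : S.Vec}
    (h : Adj q x y) (hf : Flip k i x y) (hi : i < k) {z : S.PFlag k} (hz : z.1 = punct x i) :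
    Gap (.pflag z) q (prev q y) :=
  ⟨by rw [hz, punct_of_ne _ (by omega), h.1.2], (hS.cutOf_eq h hf hz).symm⟩

lemma exists_adj_of_gap (hS : S.IsOpetopicCardinal) {k : ℕ} {q : S.F k} {I : Set S.Vec}
    {z : S.PFlag k} (h : Gap (.pflag z) q I) : ∃ x y i, Adj q x y ∧ i < k ∧ Flip k i x y ∧
      z.1 = punct x i ∧ ((i + 1 = k ∧ sgn x k = 1) ∨ (IsLowLevel k x i ∧ sgn x k = -1)) ∧
      I = prev q y := by
  obtain ⟨x, y, i, hxy, hi, hf, hz, hc⟩ := hS.exists_adj_of_isPFlag z.2 h.1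
  exact ⟨x, y, i, hxy, hi, hf, hz, hc, h.2.trans (hS.cutOf_eq hxy hf hz)⟩

lemma exists_gap_of_adj (hS : S.IsOpetopicCardinal) {k : ℕ} {q : S.F k} {x y : S.Vec}
    (h : Adj q x y) : ∃ z : S.PFlag k, Gap (.pflag z) q (prev q y) := by
  obtain ⟨i, hik, hf, hi⟩ := hS.adj_cases h
  refine ⟨⟨punct x i, x, i, h.1.1, ?_, rfl⟩, hS.gap_pflag h hf hik rfl⟩
  rcases hi with hi | hi
  · exact Or.inl hi.1
  · exact Or.inr hi.1

end IsOpetopicCardinal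

/-! ### Cuts as flat faces and p-flags -/

lemma Gap.eq {k : ℕ} {w : S.CylFace k} {q q' : S.F k} {I I' : Set S.Vec} (h : Gap w q I)
    (h' : Gap w q' I') : q = q' ∧ I = I' := by
  cases w with
  | neg p =>
    obtain ⟨rfl, rfl⟩ := h
    exact ⟨h'.1, h'.2.symm⟩
  | pos p =>
    obtain ⟨rfl, rfl⟩ := h
    obtain ⟨rfl, rfl⟩ := h'
    exact ⟨rfl, rfl⟩
  | flag x => exact h.elim
  | pflag z =>
    obtain ⟨h, rfl⟩ := h
    obtain ⟨h', rfl⟩ := h'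
    rw [h] at h'
    cases h'
    exact ⟨rfl, rfl⟩

lemma Gap.not_isFl {k : ℕ} {w : S.CylFace k} {q : S.F k} {I : Set S.Vec} (h : Gap w q I)
    (f : S.Vec) : ¬ IsFl w f := by
  cases w <;> first | exact id | exact h.elim

lemma IsFl.eq {k : ℕ} {w : S.CylFace k} {f f' : S.Vec} (h : IsFl w f) (h' : IsFl w f') :
    f = f' := by
  cases w <;> first | exact h.symm.trans h' | exact h.elim

lemma IsFl.unique {k : ℕ} {w w' : S.CylFace k} {f : S.Vec} (h : IsFl w f) (h' : IsFl w' f) :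
    w = w' := by
  cases w with
  | flag x =>
    cases w' with
    | flag x' => rw [Subtype.ext (h.trans (Eq.symm h'))]
    | _ => exact h'.elim
  | _ => exact h.elim

lemma IsFl.isFlag {k : ℕ} {w : S.CylFace (k + 1)} {f : S.Vec} (h : IsFl w f) : IsFlag k f := by
  cases w with
  | flag x =>
    rw [← show x.1 = f from h]
    exact x.2
  | _ => exact h.elim

lemma not_isFl_zero (w : S.CylFace 0) (f : S.Vec) : ¬ IsFl w f := by
  cases w <;> exact id

lemma exists_isFl {k : ℕ} {f : S.Vec} (hf : IsFlag k f) : ∃ w : S.CylFace (k + 1), IsFl w f :=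
  ⟨.flag ⟨f, hf⟩, rfl⟩

lemma gap_or_isFl {k : ℕ} (w : S.CylFace k) : (∃ q I, Gap w q I) ∨ ∃ f, IsFl w f := by
  cases w with
  | neg p => exact Or.inl ⟨p, ∅, rfl, rfl⟩
  | pos p => exact Or.inl ⟨p, Fl p, rfl, rfl⟩
  | flag x => exact Or.inr ⟨x.1, rfl⟩
  | pflag z => exact Or.inl ⟨z.top, _, by simp [PFlag.top], rfl⟩

namespace IsOpetopicCardinal

lemma gap_isLower (hS : S.IsOpetopicCardinal) {k : ℕ} {w : S.CylFace k} {q : S.F k}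
    {I : Set S.Vec} (h : Gap w q I) : IsLower q I := by
  cases w with
  | neg p =>
    obtain ⟨-, rfl⟩ := h
    exact ⟨by simp, by simp⟩
  | pos p =>
    obtain ⟨-, rfl⟩ := h
    exact ⟨subset_rfl, fun _ _ g hg _ => hg⟩
  | flag x => exact h.elim
  | pflag z =>
    obtain ⟨x, y, i, -, -, -, -, -, rfl⟩ := hS.exists_adj_of_gap h
    exact hS.isLower_prev q y

/-- P-flags give cuts which are neither empty nor full, so they are not confused with flat faces.
For two p-flags, the cut determines the surrounding pair of flags, and the pair determines the
punctured level. -/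
lemma gap_unique (hS : S.IsOpetopicCardinal) {k : ℕ} {w w' : S.CylFace k} {q : S.F k}
    {I : Set S.Vec} (h : Gap w q I) (h' : Gap w' q I) : w = w' := by
  have hne : ∀ z : S.PFlag k, Gap (.pflag z) q I → I ≠ ∅ ∧ I ≠ Fl q := by
    intro z hz
    obtain ⟨x, y, i, hxy, -, -, -, -, rfl⟩ := hS.exists_adj_of_gap hz
    refine ⟨fun h => ?_, fun h => ?_⟩
    · exact (h ▸ ⟨hxy.1, hxy.2.2.1⟩ : x ∈ (∅ : Set S.Vec))
    · exact hS.flagLT_irrefl _ (h ▸ hxy.2.1 : y ∈ prev q y).2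
  cases w with
  | neg p =>
    cases w' with
    | neg p' => rw [h.1, h'.1]
    | pos p' => exact absurd (h'.2.symm.trans h.2) (Fl_nonempty q).ne_empty
    | flag x => exact h'.elim
    | pflag z => exact absurd h.2 (hne z h').1
  | pos p =>
    cases w' with
    | neg p' => exact absurd (h.2.symm.trans h'.2) (Fl_nonempty q).ne_empty
    | pos p' => rw [h.1, h'.1]
    | flag x => exact h'.elim
    | pflag z => exact absurd h.2 (hne z h').2
  | flag x => exact h.elim
  | pflag z =>
    cases w' with
    | neg p' => exact absurd h'.2 (hne z h).1
    | pos p' => exact absurd h'.2 (hne z h).2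
    | flag x => exact h'.elim
    | pflag z' =>
      have hI := hS.gap_isLower h
      obtain ⟨x, y, i, hxy, hi, hf, hz, -, rfl⟩ := hS.exists_adj_of_gap h
      obtain ⟨x', y', i', hxy', hi', hf', hz', -, he⟩ := hS.exists_adj_of_gap h'
      obtain ⟨rfl, rfl⟩ := hS.straddle_unique hI hxy ⟨hxy.1, hxy.2.2.1⟩
        (fun h => hS.flagLT_irrefl _ h.2) hxy' (he ▸ ⟨hxy'.1, hxy'.2.2.1⟩)
        (he ▸ fun h => hS.flagLT_irrefl _ h.2)
      obtain rfl : i = i' := by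
        by_contra hne
        exact hf.2.2.2 (hf'.2.2.1 i hne)
      rw [Subtype.ext (hz.trans hz'.symm)]

/-- A proper nonempty cut ends between two adjacent flags, and adjacent flags meet in a p-flag. -/
lemma exists_gap (hS : S.IsOpetopicCardinal) {k : ℕ} {q : S.F k} {I : Set S.Vec}
    (hI : IsLower q I) : ∃ w, Gap w q I := by
  by_cases h₁ : I = ∅
  · exact ⟨.neg q, rfl, h₁⟩
  by_cases h₂ : I = Fl q
  · exact ⟨.pos q, rfl, h₂⟩
  obtain ⟨f, hf⟩ := Set.nonempty_iff_ne_empty.2 h₁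
  obtain ⟨g, hg, hgI⟩ : ∃ g ∈ Fl q, g ∉ I := by
    by_contra h
    push Not at h
    exact h₂ (hI.1.antisymm h)
  obtain ⟨x, y, hxy, hx, hy, -⟩ := hS.exists_straddle hI hf hg hgI
  obtain ⟨z, hz⟩ := hS.exists_gap_of_adj hxy
  rw [hS.eq_prev_of_straddle hI hxy hx hy]
  exact ⟨_, hz⟩

/-! ### Codomains and domains of flags -/

lemma mem_Fl_zero (q : S.F 0) {x y : S.Vec} (hx : x ∈ Fl q) (hy : y ∈ Fl q) : x = y :=
  hx.1.ext hy.1 fun i hi => by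
    obtain rfl : i = 0 := by omega
    rw [hx.2, hy.2]

/-- The flip at the high level is the successor of `h` for sign `+1` and its predecessor for sign
`-1`; the p-flag between them is the cut on the high side. -/
lemma gap_cylγ_flag (hS : S.IsOpetopicCardinal) {k : ℕ} {q : S.F k} {w : S.CylFace (k + 1)}
    {h : S.Vec} (hw : IsFl w h) (hq : h k = some q) : Gap (cylγ hS w) q (hi q h) := by
  cases w with
  | flag x =>
    obtain rfl : x.1 = h := hw
    rcases k with _ | k
    · have : x.top = q := by simp [Flag.top, hq]
      refine ⟨this, ?_⟩
      rw [hi, if_pos (show sgn x.1 0 = 1 from rfl)]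
      exact Set.Subset.antisymm (fun f hf => hf.1)
        fun f hf => ⟨hf, Or.inl (mem_Fl_zero q hf ⟨x.2, hq⟩)⟩
    · obtain ⟨y, hf⟩ := hS.exists_flip x.2 (i := k) (by omega)
      have hyq : y (k + 1) = some q := by rw [hf.2.2.1 _ (by omega), hq]
      have hs := hS.flip_sgn hf (by omega) (j := k + 1) (by omega)
      change Gap (.pflag x.high) q _
      rw [hi]
      split_ifs with h₁
      · have hadj := hS.high_adj hf hq h₁
        rw [← hS.prev_eq_next hadj]
        exact hS.gap_pflag hadj hf (by omega) rfl
      · have hadj := hS.high_adj hf.symm hyq (by have := sgn_eq x.1 (k + 1); omega)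
        exact hS.gap_pflag hadj hf.symm (by omega) hf.punct_eq
  | _ => exact hw.elim

/-- The flip at the low level is the neighbour on the other side. A first flag must have sign `+1`
and a last one sign `-1`, as otherwise the high flip would lie beyond it; so the missing neighbour
is always on the low side. -/
lemma gap_of_isLow (hS : S.IsOpetopicCardinal) {k : ℕ} {q : S.F (k + 1)} {x : S.Flag (k + 1)}
    (hq : x.1 (k + 1) = some q) {w : S.CylFace (k + 1)} (hw : IsLow x w) :
    Gap w q (lo q x.1) := by
  have htop : x.top = q := by simp [Flag.top, hq]
  obtain ⟨y, hf⟩ := hS.exists_flip x.2 (i := k) (by omega)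
  have hyq : y (k + 1) = some q := by rw [hf.2.2.1 _ (by omega), hq]
  have hs := hS.flip_sgn hf (by omega) (j := k + 1) (by omega)
  have hse := sgn_eq x.1 (k + 1)
  rcases hw with ⟨hfirst, rfl⟩ | ⟨hlast, rfl⟩ | ⟨-, -, i, z, hi, hz, rfl⟩
  · refine ⟨htop, ?_⟩
    have h₁ : sgn x.1 (k + 1) = 1 := by
      by_contra h₁
      exact hfirst.2 y hf.2.1 (by rw [hyq, hq]) ((hS.flip_lt_iff hf.symm (by omega)).2 (by omega))
    rw [lo, if_pos h₁]
    exact Set.eq_empty_of_forall_notMem fun f hf => hfirst.2 f hf.1.1 (by rw [hf.1.2, hq]) hf.2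
  · refine ⟨htop, ?_⟩
    have h₁ : sgn x.1 (k + 1) ≠ 1 := fun h₁ =>
      hlast.2 y hf.2.1 (by rw [hyq, hq]) ((hS.flip_lt_iff hf (by omega)).2 h₁)
    rw [lo, if_neg h₁]
    refine Set.Subset.antisymm (fun f hf => hf.1) fun f hf => ⟨hf, ?_⟩
    by_cases hfx : f = x.1
    · exact Or.inl hfx
    · exact Or.inr ((hS.flagLT_total' hf.1 x.2 hfx).resolve_right
        (hlast.2 f hf.1 (by rw [hf.2, hq])))
  · have hik := hi.1.1
    obtain ⟨y, hf⟩ := hS.exists_flip x.2 (i := i) (by omega)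
    have hyq : y (k + 1) = some q := by rw [hf.2.2.1 _ (by omega), hq]
    have hs := hS.flip_sgn hf (by omega) (j := k + 1) (by omega)
    rw [lo]
    split_ifs with h₁
    · have hadj := hS.low_adj hf.symm (hf.isLowLevel hi) hyq (by omega)
      exact hS.gap_pflag hadj hf.symm (by omega) (hz.trans hf.punct_eq)
    · have hadj := hS.low_adj hf hi hq (by omega)
      rw [← hS.prev_eq_next hadj]
      exact hS.gap_pflag hadj hf (by omega) hz

lemma exists_isLow (hS : S.IsOpetopicCardinal) {k : ℕ} (x : S.Flag (k + 1)) :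
    ∃ w, IsLow x w := by
  by_cases h₁ : IsFirstFlag (k + 1) x.1
  · exact ⟨_, Or.inl ⟨h₁, rfl⟩⟩
  by_cases h₂ : IsLastFlag (k + 1) x.1
  · exact ⟨_, Or.inr (Or.inl ⟨h₂, rfl⟩)⟩
  obtain ⟨q, hq⟩ := x.2.some_of_le le_rfl
  by_cases h : ∃ i, i + 1 < k + 1 ∧ ∃ a b, x.1 (i + 1) = some a ∧ x.1 (i + 2) = some b ∧ a ∈ S.δ b
  · obtain ⟨i, hi⟩ := exists_isLowLevel h
    exact ⟨_, Or.inr (Or.inr ⟨h₁, h₂, i, ⟨punct x.1 i, x.1, i, x.2, Or.inr hi, rfl⟩, hi, rfl, rfl⟩)⟩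
  · exfalso
    have key := fun z (hz : z ∈ Fl q) => hS.extremal_of_no_low (x := x.1) ⟨x.2, hq⟩
      (fun i hi a b ha hb hab => h ⟨i, hi, a, b, ha, hb, hab⟩) hz
    rcases sgn_eq x.1 (k + 1) with hs | hs
    · exact h₁ ⟨x.2, fun y hy hyx => (key y ⟨hy, by rw [hyx, hq]⟩).1 hs⟩
    · exact h₂ ⟨x.2, fun y hy hyx => (key y ⟨hy, by rw [hyx, hq]⟩).2 hs⟩

lemma mem_cylδ_flag (hS : S.IsOpetopicCardinal) {k : ℕ} {q : S.F k} {w : S.CylFace (k + 1)}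
    {h : S.Vec} (hw : IsFl w h) (hq : h k = some q) {v : S.CylFace k} :
    v ∈ cylδ w ↔ IsFl v (below k h) ∨ Gap v q (lo q h) := by
  cases w with
  | flag x =>
    obtain rfl : x.1 = h := hw
    rcases k with _ | k
    · have htop : x.top = q := by simp [Flag.top, hq]
      have hG : Gap (.neg x.top) q (lo q x.1) := by
        refine ⟨htop, ?_⟩
        rw [lo, if_pos (show sgn x.1 0 = 1 from rfl)]
        refine Set.eq_empty_of_forall_notMem fun f hf => ?_
        obtain rfl := mem_Fl_zero q hf.1 ⟨x.2, hq⟩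
        exact hS.flagLT_irrefl _ hf.2
      constructor
      · rintro rfl
        exact Or.inr hG
      · rintro (h | h)
        · exact absurd h (not_isFl_zero _ _)
        · exact hS.gap_unique h hG
    · change v = .flag x.trunc ∨ IsLow x v ↔ _
      refine or_congr ⟨?_, fun h => IsFl.unique (w' := .flag x.trunc) h rfl⟩
        ⟨hS.gap_of_isLow hq, fun h => ?_⟩
      · rintro rfl
        rfl
      · obtain ⟨w, hw⟩ := hS.exists_isLow x
        rwa [hS.gap_unique h (hS.gap_of_isLow hq hw)]
  | _ => exact hw.elim

/-! ### Codomains of p-flags -/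

lemma below_flip {k i : ℕ} {x y : S.Vec} (h : Flip (k + 1) i x y) (hi : i < k + 1) :
    Flip k i (below (k + 1) x) (below (k + 1) y) := by
  refine ((h.1.below (m := k) (by omega)).eq_or_flip (h.2.1.below (m := k) (by omega))
    fun j hj hji => ?_).resolve_left fun heq => h.2.2.2 ?_
  · rw [below_of_lt (by omega), below_of_lt (by omega), h.2.2.1 j hji]
  · have := congrFun heq i
    rwa [below_of_lt (by omega), below_of_lt (by omega)] at this

lemma below_punct {i m : ℕ} {x : S.Vec} :
    below m (punct x i) = punct (below m x) i := by
  funext j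
  by_cases hj : j = i
  · subst hj
    rw [punct_self, below]
    split_ifs
    · exact punct_self _ _
    · rfl
  · rw [punct_of_ne _ hj, below, below, punct_of_ne _ hj]

lemma rho_prev (hS : S.IsOpetopicCardinal) {k : ℕ} {p : S.F k} {q : S.F (k + 1)}
    (hp : p ∈ S.bd q) {y f : S.Vec} (hf : f ∈ Fl p) (hy : ext q f = y) :
    rho p q (prev q y) = prev p f := by
  subst hy
  ext g
  constructor
  · rintro ⟨hg, -, h⟩
    exact ⟨hg, (hS.flagLT_ext hg.1 hf.1).1 h⟩
  · rintro ⟨hg, h⟩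
    exact ⟨hg, ext_mem hg hp, (hS.flagLT_ext hg.1 hf.1).2 h⟩

lemma sgn_below_γ {k : ℕ} {q : S.F (k + 1)} {x : S.Vec} (hx : x ∈ Fl q)
    (h : x k = some (S.γ q)) : sgn (below (k + 1) x) k = sgn x (k + 1) := by
  rw [sgn_congr (y := x) fun j hj => below_of_lt (by omega)]
  conv_rhs => rw [sgn]
  rw [if_pos]
  rw [h, hx.2, Option.map_some]

/-- If the dummy is one of the two levels under the top, the flags `x` and `y` agree below it and
are enclosed by the same adjacent flags through `γ q`, whose p-flag is the codomain. If it is lower,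
both flags pass through `γ q`, and the pair is just truncated. -/
lemma gap_cylγ_pflag (hS : S.IsOpetopicCardinal) {k : ℕ} {q : S.F (k + 1)} {I : Set S.Vec}
    {z : S.PFlag (k + 1)} (h : Gap (.pflag z) q I) :
    Gap (cylγ hS (.pflag z)) (S.γ q) (rho (S.γ q) q I) := by
  obtain ⟨x, y, i, hxy, hik, hf, hz, hc, rfl⟩ := hS.exists_adj_of_gap h
  rcases k with _ | k
  · have htop : z.top = q := by
      have := h.1
      simp [PFlag.top, this]
    obtain rfl : i = 0 := by omega
    refine ⟨by rw [htop], Set.Subset.antisymm (fun f hf => hf.1) fun f hfγ => ⟨hfγ, ?_⟩⟩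
    have hE := ext_mem hfγ (γ_mem_bd q)
    -- In dimension one the flag through `γ q` has sign `+1`, so it is the earlier flag `x`. The
    -- restricted cut is therefore full, matching the codomain `+γ q`.
    have hs : sgn (ext q f) 1 = 1 := by
      rw [sgn, if_pos]
      · rfl
      · rw [ext_top, ext_of_le _ _ le_rfl, hfγ.2, Option.map_some]
    have hsx := (hS.flip_lt_iff hf hik).1 hxy.2.2.1
    refine ⟨hE, ?_⟩
    rcases hxy.1.1.eq_or_flip (i := 0) hE.1 (fun j hj hj0 => by
      obtain rfl : j = 1 := by omega
      rw [hE.2, hxy.1.2]) with h' | h'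
    · rw [h']
      exact hxy.2.2.1
    · have := hS.flip_sgn h' hik hik
      simp only [zero_add] at *
      omega
  · change Gap (.pflag ⟨PosHypergraph.pflagγVec k z.1, _⟩) _ _
    have hzk : ∀ j, j ≠ i → z.1 j = x j := fun j hj => by rw [hz, punct_of_ne _ hj]
    by_cases hki : k ≤ i
    · have hcond : z.1 (k + 1) = none ∨ z.1 k = none := by
        rw [hz]
        rcases (by omega : i = k + 1 ∨ i = k) with rfl | rfl
        · exact Or.inl (punct_self _ _)
        · exact Or.inr (punct_self _ _)
      obtain ⟨f₁, f₂, hflip, hf₁, hf₂, hs₁, hag₁, hle₁, -⟩ := hS.exists_γ_between hxy.1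
      obtain ⟨f₁', f₂', hflip', hf₁', hf₂', hs₁', hag₁', -, hle₂⟩ := hS.exists_γ_between hxy.2.1
      -- The flags `f₁` and `f₁'` could differ at level `k` only, and both have sign `+1`.
      obtain rfl : f₁' = f₁ := by
        refine (hf₁.1.eq_or_flip (i := k) hf₁'.1 fun j hj hjk => ?_).resolve_right fun h' => ?_
        · rcases (by omega : j < k ∨ j = k + 1) with hj | rfl
          · rw [hag₁ j hj, hag₁' j hj, hf.2.2.1 j (by omega)]
          · rw [hf₁.2, hf₁'.2]
        · have := hS.flip_sgn h' (by omega) (j := k + 1) (by omega)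
          omega
      obtain rfl := hS.flip_unique hflip hflip' (by omega)
      have hadj := hS.high_adj hflip hf₁.2 hs₁
      have hv : PosHypergraph.pflagγVec k z.1 = punct f₁' k := by
        rw [PosHypergraph.pflagγVec, if_pos hcond]
        funext j
        rcases (by omega : j = k + 1 ∨ j = k ∨ j < k ∨ k + 1 < j) with rfl | rfl | hj | hj
        · rw [Function.update_self, punct_of_ne _ (by omega), hf₁.2, h.1, Option.map_some]
        · rw [Function.update_of_ne (by omega), punct_self, below, if_neg (by omega)]
        · rw [Function.update_of_ne (by omega), punct_of_ne _ (by omega), below_of_lt hj,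
            hzk j (by omega), hag₁ j hj]
        · rw [Function.update_of_ne (by omega), punct_of_ne _ (by omega), below,
            if_neg (by omega), hf₁.1.none_of_lt (by omega)]
      have hG := hS.gap_pflag hadj hflip (by omega)
        (z := ⟨PosHypergraph.pflagγVec k z.1, z.2.pflagγVec hS⟩) hv
      convert hG using 1
      rw [hS.prev_eq_next hadj]
      ext f
      constructor
      · rintro ⟨hfγ, -, hlt⟩
        refine ⟨hfγ, ?_⟩
        by_cases hne : f = f₁'
        · exact Or.inl hne
        · refine Or.inr ((hS.flagLT_total' hfγ.1 hf₁.1 hne).resolve_right fun h' => ?_)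
          refine hadj.2.2.2 f hfγ h' ((hS.flagLT_ext (q := q) hfγ.1 hf₂.1).1 ?_)
          rcases hle₂ with rfl | hle₂
          · exact hlt
          · exact hS.flagLT_trans hlt hle₂
      · rintro ⟨hfγ, hle⟩
        refine ⟨hfγ, ext_mem hfγ (γ_mem_bd q), ?_⟩
        have h₁ : FlagLT (ext q f₁') y := by
          rcases hle₁ with h | h
          · rw [h]; exact hxy.2.2.1
          · exact hS.flagLT_trans h hxy.2.2.1
        rcases hle with rfl | hle
        · exact h₁
        · exact hS.flagLT_trans ((hS.flagLT_ext (q := q) hfγ.1 hf₁.1).2 hle) h₁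
    · obtain ⟨hi, hs⟩ : IsLowLevel (k + 2) x i ∧ sgn x (k + 2) = -1 := by
        refine hc.resolve_left fun h => ?_
        have := h.1
        omega
      obtain ⟨p, hp⟩ := hxy.1.1.some_of_le (i := k + 1) (by omega)
      obtain rfl : p = S.γ q := by
        refine (hxy.1.1.mem_bd hp hxy.1.2).resolve_right fun h' => ?_
        have := hi.2 ⟨by omega, p, q, hp, hxy.1.2, h'⟩
        omega
      have hyp : y (k + 1) = some (S.γ q) := by rw [hf.2.2.1 _ (by omega), hp]
      have hf₁ := below_mem hxy.1.1 (by omega) hp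
      have hf₂ := below_mem hxy.2.1.1 (by omega) hyp
      have hbf := below_flip hf (by omega)
      have hadj := hS.low_adj hbf (hi.below (by omega)) hf₁.2
        ((sgn_below_γ hxy.1 hp).trans hs)
      have hcond : ¬ (z.1 (k + 1) = none ∨ z.1 k = none) := by
        rw [hzk _ (by omega), hzk _ (by omega)]
        obtain ⟨b, hb⟩ := hxy.1.1.some_of_le (i := k) (by omega)
        simp [hp, hb]
      have hv : PosHypergraph.pflagγVec k z.1 = punct (below (k + 2) x) i := by
        rw [PosHypergraph.pflagγVec, if_neg hcond, hz, below_punct]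
      have hG := hS.gap_pflag hadj hbf (by omega)
        (z := ⟨PosHypergraph.pflagγVec k z.1, z.2.pflagγVec hS⟩) hv
      rw [hS.rho_prev (γ_mem_bd q) hf₂ (ext_below hxy.2.1)]
      exact hG

lemma gap_cylγ (hS : S.IsOpetopicCardinal) {k : ℕ} {q : S.F (k + 1)} {I : Set S.Vec}
    {w : S.CylFace (k + 1)} (h : Gap w q I) : Gap (cylγ hS w) (S.γ q) (rho (S.γ q) q I) := by
  cases w with
  | neg p =>
    obtain ⟨rfl, rfl⟩ := h
    rw [cylγ]
    exact ⟨rfl, by simp [rho]⟩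
  | pos p =>
    obtain ⟨rfl, rfl⟩ := h
    rw [cylγ]
    exact ⟨rfl, Set.Subset.antisymm (fun f hf => hf.1)
      fun f hf => ⟨hf, ext_mem hf (γ_mem_bd p)⟩⟩
  | flag x => exact h.elim
  | pflag z => exact hS.gap_cylγ_pflag h

end IsOpetopicCardinal

end PosHypergraph

namespace PosHypergraph

variable {S : PosHypergraph.{u}}

/-! ## Domains of p-flags -/

/-- The flag order, or its opposite if `s = -1`, in the reflexive version. -/
def FlagLE (s : ℤ) (x y : S.Vec) : Prop :=
  x = y ∨ (s = 1 ∧ FlagLT x y) ∨ (s = -1 ∧ FlagLT y x)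

/-- The order of the faces at a level, or its opposite if `s = -1`, in the reflexive version. -/
def LevLE (s : ℤ) (x : S.Vec) (j : ℕ) (a b : S.F j) : Prop :=
  a = b ∨ (s = 1 ∧ LocLT x j a b) ∨ (s = -1 ∧ LocLT x j b a)

namespace IsOpetopicCardinal

lemma levLE_of_flagLE (hS : S.IsOpetopicCardinal) {s : ℤ} {x y : S.Vec} {j : ℕ} {a b : S.F j}
    (h : FlagLE s x y) (hxy : ∀ i < j, x i = y i) (ha : x j = some a) (hb : y j = some b) :
    LevLE s x j a b := by
  rcases h with rfl | ⟨rfl, h⟩ | ⟨rfl, h⟩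
  · rw [ha] at hb
    exact Or.inl (Option.some.inj hb)
  · rcases hS.locLE_of_flagLT (Or.inr h) hxy ha hb with h | h
    · exact Or.inl h
    · exact Or.inr (Or.inl ⟨rfl, h⟩)
  · rcases hS.locLE_of_flagLT (Or.inr h) (fun i hi => (hxy i hi).symm) hb ha with h | h
    · exact Or.inl h.symm
    · exact Or.inr (Or.inr ⟨rfl, h.congr fun i hi => (hxy i hi).symm⟩)

lemma levLE_antisymm (hS : S.IsOpetopicCardinal) {s : ℤ} {x : S.Vec} {j : ℕ} {a b : S.F j}
    (h : LevLE s x j a b) (h' : LevLE s x j b a) : a = b := by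
  rcases h with h | ⟨rfl, h⟩ | ⟨rfl, h⟩
  · exact h
  · rcases h' with h' | ⟨-, h'⟩ | ⟨h', -⟩
    · exact h'.symm
    · exact (hS.locLT_asymm h h').elim
    · omega
  · rcases h' with h' | ⟨h', -⟩ | ⟨-, h'⟩
    · exact h'.symm
    · omega
    · exact (hS.locLT_asymm h h').elim

/-- Two flags `g`, `h` which agree up to level `n`. -/
lemma upLE_of_flagLE (hS : S.IsOpetopicCardinal) {s : ℤ} {g h : S.Vec} {n : ℕ} {a : S.F n}
    {b t : S.F (n + 1)} (hgh : ∀ j ≤ n, g j = h j) (ha : g n = some a) (hb : g (n + 1) = some b)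
    (ht : h (n + 1) = some t) (hab : a ∈ S.bd b) (hat : a ∈ S.bd t) (hs : sgn h (n + 1) = -s)
    (hle : FlagLE s g h) : S.UpLE b t := by
  rw [sgn_eq_esgn ht] at hs
  have ha' : h n = some a := by rw [← hgh n le_rfl, ha]
  have hu := hS.locLT_up_iff ha' hat hab
  rcases hS.levLE_of_flagLE hle (fun i hi => hgh i (by omega)) hb ht with h' | ⟨rfl, h'⟩ | ⟨rfl, h'⟩
  · exact Or.inl h'
  · exact Or.inr ((hu.2 hs).1 (h'.congr fun i hi => hgh i (by omega)))
  · exact Or.inr ((hu.1 (by simpa using hs)).1 (h'.congr fun i hi => hgh i (by omega)))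

/-- Counterpart of `upLE_of_flagLE` for the other sign: a face strictly inside `t` would put `g` on
the wrong side of `h`. -/
lemma eq_of_flagLE (hS : S.IsOpetopicCardinal) {s : ℤ} {g h : S.Vec} {n : ℕ} {a : S.F n}
    {b t : S.F (n + 1)} (hgh : ∀ j ≤ n, g j = h j) (ha : g n = some a) (hb : g (n + 1) = some b)
    (ht : h (n + 1) = some t) (hab : a ∈ S.bd b) (hat : a ∈ S.bd t) (hs : sgn h (n + 1) = s)
    (hle : FlagLE s g h) (hbt : S.UpLE b t) : b = t := by
  rcases hbt with hbt | hbt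
  · exact hbt
  rw [sgn_eq_esgn ht] at hs
  have ha' : h n = some a := by rw [← hgh n le_rfl, ha]
  have hu := hS.locLT_up_iff ha' hat hab
  rcases hS.levLE_of_flagLE hle (fun i hi => hgh i (by omega)) hb ht with h' | ⟨rfl, h'⟩ | ⟨rfl, h'⟩
  · exact h'
  · exact (hS.locLT_asymm ((hu.1 hs).2 hbt) (h'.congr fun i hi => hgh i (by omega))).elim
  · exact (hS.locLT_asymm ((hu.2 hs).2 hbt) (h'.congr fun i hi => hgh i (by omega))).elim

/-- A flag between two flags which differ at level `m` only. -/
lemma upLE_of_between (hS : S.IsOpetopicCardinal) {k m : ℕ} {f f' g : S.Vec}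
    (hf : Flip k m f f') (hm : m < k) (hlt : FlagLT f f') (hg : IsFlag k g)
    (h₁ : f = g ∨ FlagLT f g) (h₂ : g = f' ∨ FlagLT g f') {t b : S.F (m + 1)}
    (ht : f (m + 1) = some t) (hb : g (m + 1) = some b) :
    (∀ j < m, g j = f j) ∧ S.UpLE b t := by
  have hag : ∀ j < m, g j = f j :=
    hS.agree_of_between (fun j hj => (hf.2.2.1 j (by omega)).symm) h₁ h₂
  refine ⟨hag, ?_⟩
  have ht' : f' (m + 1) = some t := by rw [hf.2.2.1 _ (by omega), ht]
  obtain ⟨a, ha⟩ := hf.1.some_of_le hm.le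
  obtain ⟨a', ha'⟩ := hf.2.1.some_of_le hm.le
  obtain ⟨c, hc⟩ := hg.some_of_le hm.le
  have hs := (hS.flip_lt_iff hf hm).1 hlt
  have hs' := hS.flip_sgn hf hm (j := m + 1) (by omega)
  have hcb := hg.mem_bd hc hb
  -- If `g` shares its level `m` with one of the bounds, the comparison passes to level `m + 1` and
  -- the sign turns it into `b ≤⁺ t`. Otherwise the level `m` face is strictly between, and
  -- `lt_of_loc_between` applies.
  rcases hS.locLE_of_flagLT h₁ (fun j hj => (hag j hj).symm) ha hc with rfl | hl₁
  · refine hS.upLE_of_flagLE (s := -1) (g := g) (h := f) (fun j hj => ?_) hc hb ht hcb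
      (hf.1.mem_bd ha ht) (by omega) ?_
    · rcases hj.lt_or_eq with hj | rfl
      · exact hag j hj
      · rw [ha, hc]
    · rcases h₁ with h | h
      · exact Or.inl h.symm
      · exact Or.inr (Or.inr ⟨rfl, h⟩)
  have hag' : ∀ j < m, g j = f' j := fun j hj => by rw [hag j hj, hf.2.2.1 j (by omega)]
  rcases hS.locLE_of_flagLT h₂ hag' hc ha' with rfl | hl₂
  · refine hS.upLE_of_flagLE (s := 1) (g := g) (h := f') (fun j hj => ?_) hc hb ht' hcb
      (hf.2.1.mem_bd ha' ht') (by omega) ?_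
    · rcases hj.lt_or_eq with hj | rfl
      · exact hag' j hj
      · rw [ha', hc]
    · rcases h₂ with h | h
      · exact Or.inl h
      · exact Or.inr (Or.inl ⟨rfl, h⟩)
  · exact (hS.lt_of_loc_between (hf.1.mem_bd ha ht) (hf.2.1.mem_bd ha' ht') hl₁
      (hl₂.congr hag) hcb).le

end IsOpetopicCardinal

/-- `x` and `y` are the adjacent flags under `q` around the p-flag `z` with the dummy at `i`. -/
structure Around {k : ℕ} (z : S.PFlag k) (q : S.F k) (x y : S.Vec) (i : ℕ) : Prop where
  adj : Adj q x y
  lt : i < k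
  flip : Flip k i x y
  eq : z.1 = punct x i
  level : (i + 1 = k ∧ sgn x k = 1) ∨ (IsLowLevel k x i ∧ sgn x k = -1)

namespace Around

variable {k i : ℕ} {z : S.PFlag (k + 1)} {T : S.F (k + 1)} {x y : S.Vec}

lemma puAt_iff (h : Around z T x y i) {l : ℕ} : z.PuAt l ↔ l = i := by
  constructor
  · rintro ⟨hl, hz⟩
    by_contra hne
    rw [h.eq, punct_of_ne _ hne] at hz
    obtain ⟨a, ha⟩ := h.adj.1.1.some_of_le hl.le
    rw [ha] at hz
    cases hz
  · rintro rfl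
    exact ⟨h.lt, by rw [h.eq, punct_self]⟩

lemma of_ne (h : Around z T x y i) {j : ℕ} (hj : j ≠ i) : z.1 j = x j := by
  rw [h.eq, punct_of_ne _ hj]

lemma of_ne' (h : Around z T x y i) {j : ℕ} (hj : j ≠ i) : z.1 j = y j := by
  rw [h.of_ne hj, h.flip.2.2.1 j hj]

lemma self (h : Around z T x y i) : z.1 i = none := by
  rw [h.eq, punct_self]

end Around

namespace IsOpetopicCardinal

/-- If `p` is the face of `z` at level `k`, then `p ⋆ z` is a truncation. -/
lemma gap_below (hS : S.IsOpetopicCardinal) {k i : ℕ} {z : S.PFlag (k + 1)} {T : S.F (k + 1)}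
    {x y : S.Vec} (h : Around z T x y i) {p : S.F k} (hp : p ∈ S.δ T) (hz : z.1 k = some p) :
    ∃ z₁ : S.PFlag k, z₁.1 = below (k + 1) z.1 ∧ Gap (.pflag z₁) p (rho p T (prev T y)) := by
  have hik : i ≠ k := by
    rintro rfl
    rw [h.self] at hz
    cases hz
  have hx : x k = some p := by rw [← h.of_ne hik.symm, hz]
  have hy : y k = some p := by rw [← h.of_ne' hik.symm, hz]
  have hlt := h.lt
  obtain ⟨hlow, hs⟩ := h.level.resolve_left fun h' => hik (by omega)
  obtain ⟨n, rfl⟩ : ∃ n, k = n + 1 := ⟨k - 1, by omega⟩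
  -- As `p ∈ δ T`, the low level is the greatest possible one. It becomes the high level after
  -- truncation, and the sign changes from `-1` to `+1` accordingly.
  have := hlow.2 (show n ∈ _ from ⟨by omega, p, T, hx, h.adj.1.2, hp⟩)
  have := hlow.1.1
  obtain rfl : i = n := by omega
  have hs' : sgn (below (i + 2) x) (i + 1) = 1 := by
    rw [sgn_congr (y := x) fun j hj => below_of_lt (by omega)]
    rw [sgn, if_neg] at hs
    · omega
    · rw [hx, h.adj.1.2, Option.map_some]
      intro h'
      rw [Option.some.inj h'] at hp
      exact hS.γ_notMem_δ T hp
  have hflip := below_flip h.flip (by omega)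
  have hx' := below_mem h.adj.1.1 (by omega) hx
  have hy' := below_mem h.adj.2.1.1 (by omega) hy
  have hv : below (i + 2) z.1 = punct (below (i + 2) x) i := by rw [h.eq, below_punct]
  refine ⟨⟨below (i + 2) z.1, _, i, hx'.1, Or.inl rfl, hv⟩, rfl, ?_⟩
  rw [hS.rho_prev (mem_bd_of_mem_δ hp) hy' (ext_below h.adj.2.1)]
  exact hS.gap_pflag (hS.high_adj hflip hx'.2 hs') hflip (by omega) hv

/-- Downward induction on the level: under `γ r`, for `r` in the domain one level up, there is a
face of the next iterated codomain's domain. It serves to exclude iterated codomains of `p` strictly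
inside a domain face of an iterated codomain of `T`. -/
lemma exists_le_iterγ (hS : S.IsOpetopicCardinal) {k : ℕ} {T : S.F (k + 1)} {p : S.F k}
    (hp : p ∈ S.δ T) {j : ℕ} (hj : j ≤ k) :
    ∃ r ∈ S.δ (S.iterγ T (j + 1) (by omega)), S.UpLE r (S.iterγ p j hj) := by
  induction hj using Nat.decreasingInduction with
  | self => exact ⟨p, by rwa [iterγ_self], by rw [iterγ_self]; exact UpLE.refl p⟩
  | of_succ j hjk ih =>
    obtain ⟨r, hr, hle⟩ := ih
    obtain ⟨y, hy, hyr⟩ := hS.exists_le_mem_δγ (γ_mem_bd r) (mem_bd_of_mem_δ hr)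
    rw [iterγ_succ T (j + 1) (by omega), iterγ_succ p j hjk]
    exact ⟨y, hy, hyr.trans (hS.γ_le_γ hle)⟩

lemma lowerFaces_antichain (hS : S.IsOpetopicCardinal) {k j : ℕ} {p : S.F k} {t t' : S.F j}
    (ht : t ∈ S.lowerFaces p j) (ht' : t' ∈ S.lowerFaces p j) (h : S.UpLE t t') : t = t' := by
  rcases ht with ⟨hj, ht⟩ | ⟨rfl, rfl⟩
  · rcases ht' with ⟨hj', ht'⟩ | ⟨rfl, rfl⟩
    · exact hS.eq_of_le_of_mem_δ ht ht' h
    · omega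
  · rcases ht' with ⟨hj', ht'⟩ | ⟨h', rfl⟩
    · omega
    · rfl

lemma le_γ_of_mem_bd {k : ℕ} {a : S.F k} {b : S.F (k + 1)} (h : a ∈ S.bd b) :
    S.UpLE a (S.γ b) := by
  rcases h with rfl | h
  · exact UpLE.refl _
  · exact (upLT_γ h).le

/-- The condition on the entry of `z`, which involves `γ x_{l+1}` in place of the dummy, is made
symmetric in the two flags around `z`. The substitution matters only for `m + 1 = i`. -/
lemma starAt_iff (hS : S.IsOpetopicCardinal) {k i : ℕ} {z : S.PFlag (k + 1)} {T : S.F (k + 1)}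
    {x y : S.Vec} (h : Around z T x y i) {p : S.F k} (hp : p ∈ S.δ T) {m : ℕ}
    {t : S.F (m + 1)} : StarAt p z m t ↔ m + 1 ≤ k ∧ m ≤ i ∧ t ∈ S.lowerFaces p (m + 1) ∧
      ∃ b b', x (m + 1) = some b ∧ y (m + 1) = some b' ∧ S.UpLE b t ∧ S.UpLE b' t := by
  rw [StarAt]
  refine and_congr_right fun hmk => and_congr ⟨?_, fun h' => ⟨i, h.puAt_iff.2 rfl, h'⟩⟩
    (and_congr_right fun ht => ?_)
  · rintro ⟨l, hl, hml⟩
    rwa [h.puAt_iff.1 hl] at hml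
  obtain ⟨b, hb⟩ := h.adj.1.1.some_of_le (i := m + 1) (by omega)
  obtain ⟨b', hb'⟩ := h.adj.2.1.1.some_of_le (i := m + 1) (by omega)
  by_cases hmi : m + 1 = i
  swap
  · have he : z.entry (m + 1) = some b := by
      rw [PFlag.entry, h.of_ne hmi, hb, Option.or]
    obtain rfl : b' = b := by
      rw [h.flip.2.2.1 _ hmi, hb] at hb'
      exact (Option.some.inj hb').symm
    rw [he]
    constructor
    · rintro ⟨_, ⟨⟩, hle⟩
      exact ⟨_, _, hb, hb', hle, hle⟩
    · rintro ⟨c, c', hc, -, hle, -⟩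
      rw [hb] at hc
      cases hc
      exact ⟨_, rfl, hle⟩
  · subst hmi
    obtain ⟨e, he⟩ := h.adj.1.1.some_of_le (i := m + 2) (by omega)
    have he' : y (m + 2) = some e := by rw [h.flip.2.2.1 _ (by omega), he]
    have hbe := h.adj.1.1.mem_bd hb he
    have hbe' := h.adj.2.1.1.mem_bd hb' he'
    have hne : b ≠ b' := by
      rintro rfl
      exact h.flip.2.2.2 (hb'.trans hb.symm)
    have hent : z.entry (m + 1) = some (S.γ e) := by
      rw [PFlag.entry, h.self, h.of_ne (by omega), he, Option.map_some, Option.none_or]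
    rw [hent]
    constructor
    · rintro ⟨_, ⟨⟩, hle⟩
      exact ⟨_, _, hb, hb', (le_γ_of_mem_bd hbe).trans hle, (le_γ_of_mem_bd hbe').trans hle⟩
    · rintro ⟨c, c', hc, hc', hle, hle'⟩
      rw [hb] at hc
      rw [hb'] at hc'
      cases hc
      cases hc'
      refine ⟨_, rfl, ?_⟩
      rcases hbe with rfl | hbe
      · exact hle
      rcases hbe' with rfl | hbe'
      · exact hle'
      -- If `t <⁺ γ e`, then `t` is strictly inside `e`, so the face having `t` in its domain, an
      -- iterated codomain of `p` or `T` itself, lies below `e`. For the former this violates the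
      -- antichain property in a domain of an iterated codomain of `T`; for the latter `e = T`.
      refine (hS.upLE_total_of_le (upLT_γ hbe).le hle).resolve_right fun hlt => ?_
      have hbt : S.UpLT b t := by
        rcases hle with rfl | hle
        · exact absurd (hS.eq_of_le_of_mem_δ hbe' hbe hle').symm hne
        · exact hle
      rcases ht with ⟨hj, ht⟩ | ⟨rfl, rfl⟩
      · have hin := hS.lt_of_inside hbe hbt hlt (mem_bd_of_mem_δ ht)
        obtain ⟨hlow, -⟩ := h.level.resolve_left fun h' => by omega
        have := hlow.1.1
        have hT := h.adj.1.1.iterγ_eq h.adj.1.2 hlow (j := m + 3) (by omega) (by omega)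
        obtain ⟨_, e', v, h₁, h₂, hev⟩ := hlow.1
        rw [he] at h₁
        cases h₁
        rw [hT] at h₂
        cases h₂
        obtain ⟨r, hr, hrle⟩ := hS.exists_le_iterγ hp (j := m + 2) hj
        exact hS.δ_antichain hr hev (hrle.trans_lt hin)
      · rw [h.adj.1.2] at he
        cases he
        rw [iterγ_self] at hbt hlt
        exact hS.strict _ (hS.lt_of_inside hbe hbt hlt (mem_bd_of_mem_δ hp))

lemma rho_not_mem (hS : S.IsOpetopicCardinal) {k : ℕ} {T : S.F (k + 1)} {p : S.F k} {x y f : S.Vec}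
    (hxy : Adj T x y) (hp : p ∈ S.bd T) (hf : f ∈ Fl p) (h : f ∉ rho p T (prev T y)) :
    y = ext T f ∨ FlagLT y (ext T f) := by
  by_cases he : y = ext T f
  · exact Or.inl he
  · exact Or.inr ((hS.flagLT_total' hxy.2.1.1 (ext_mem hf hp).1 he).resolve_right
      fun h' => h ⟨hf, ext_mem hf hp, h'⟩)

lemma rho_mem (hS : S.IsOpetopicCardinal) {k : ℕ} {T : S.F (k + 1)} {p : S.F k} {x y f : S.Vec}
    (hxy : Adj T x y) (h : f ∈ rho p T (prev T y)) : ext T f = x ∨ FlagLT (ext T f) x := by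
  by_cases he : ext T f = x
  · exact Or.inl he
  · exact Or.inr ((hS.flagLT_total' h.2.1.1 hxy.1.1 he).resolve_right
      fun h' => hxy.2.2.2 _ h.2.1 h' h.2.2)

lemma ext_flip {k m : ℕ} {T : S.F (k + 1)} {p : S.F k} (hp : p ∈ S.bd T) {f f' : S.Vec}
    (hf : f ∈ Fl p) (hf' : f' ∈ Fl p) (h : Flip k m f f') (hm : m < k) :
    Flip (k + 1) m (ext T f) (ext T f') := by
  refine ((ext_mem hf hp).1.eq_or_flip (ext_mem hf' hp).1 fun j hj hjm => ?_).resolve_left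
    fun he => h.2.2.2 ?_
  · rcases hj.lt_or_eq with hj | rfl
    · rw [ext_of_le _ _ (by omega), ext_of_le _ _ (by omega), h.2.2.1 j hjm]
    · rw [ext_top, ext_top]
  · have := congrFun he m
    rwa [ext_of_le _ _ (by omega), ext_of_le _ _ (by omega)] at this

/-- If the restriction of the cut to `p` ends between `f` and `f'`, differing at level
`m`, then `p ⋆ z` may be punctured at `m`. -/
lemma starAt_of_straddle (hS : S.IsOpetopicCardinal) {k i : ℕ} {z : S.PFlag (k + 1)}
    {T : S.F (k + 1)} {x y : S.Vec} (h : Around z T x y i) {p : S.F k} (hp : p ∈ S.δ T)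
    {f f' : S.Vec} (hff : Adj p f f') (hf : f ∈ rho p T (prev T y))
    (hf' : f' ∉ rho p T (prev T y)) :
    ∃ m t, m < k ∧ Flip k m f f' ∧ StarAt p z m t ∧ f (m + 1) = some t ∧
      (∀ j < m, z.1 j = f j) ∧ ∀ j (hj : j ≤ k), m + 1 < j → f j = some (S.iterγ p j hj) := by
  have hp' := mem_bd_of_mem_δ hp
  obtain ⟨m, hm, hflip, hlev⟩ := hS.adj_cases hff
  have h₁ := hS.rho_mem h.adj hf
  have h₂ := hS.rho_not_mem h.adj hp' hff.2.1 hf'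
  have hxy := h.adj.2.2.1
  have h₁' : ext T f = y ∨ FlagLT (ext T f) y := Or.inr hf.2.2
  have h₂' : x = ext T f' ∨ FlagLT x (ext T f') := by
    rcases h₂ with h₂ | h₂
    · exact Or.inr (h₂ ▸ hxy)
    · exact Or.inr (hS.flagLT_trans hxy h₂)
  have hF := ext_flip hp' hff.1 hff.2.1 hflip hm
  have hlt := (hS.flagLT_ext (q := T) hff.1.1 hff.2.1.1).2 hff.2.2.1
  obtain ⟨t, ht⟩ := hff.1.1.some_of_le (i := m + 1) (by omega)
  have ht' : ext T f (m + 1) = some t := by rw [ext_of_le _ _ (by omega), ht]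
  obtain ⟨b, hb⟩ := h.adj.1.1.some_of_le (i := m + 1) (by omega)
  obtain ⟨b', hb'⟩ := h.adj.2.1.1.some_of_le (i := m + 1) (by omega)
  -- Both flags around `z` lie between the extensions of `f` and `f'`. So they agree with these
  -- below level `m`, whence `m ≤ i`, and their faces at level `m + 1` are below `t`.
  obtain ⟨hag, hbt⟩ := hS.upLE_of_between hF (by omega) hlt h.adj.1.1 h₁ h₂' ht' hb
  obtain ⟨hag', hbt'⟩ := hS.upLE_of_between hF (by omega) hlt h.adj.2.1.1 h₁' h₂ ht' hb'
  have hmi : m ≤ i := by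
    by_contra hmi
    refine h.flip.2.2.2 ?_
    rw [hag i (by omega), hag' i (by omega)]
  have hup : ∀ j (hj : j ≤ k), m + 1 < j → f j = some (S.iterγ p j hj) := by
    intro j hj hmj
    rcases hlev with ⟨rfl, -⟩ | ⟨hlow, -⟩
    · omega
    · obtain ⟨n, rfl⟩ : ∃ n, k = n + 1 := ⟨k - 1, by omega⟩
      exact hff.1.1.iterγ_eq hff.1.2 hlow hmj hj
  refine ⟨m, t, hm, hflip, (hS.starAt_iff h hp).2 ⟨hm, hmi, ?_, b, b', hb, hb', hbt, hbt'⟩, ht,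
    fun j hj => ?_, hup⟩
  · rcases hlev with ⟨rfl, -⟩ | ⟨hlow, -⟩
    · rw [hff.1.2] at ht
      cases ht
      exact Or.inr ⟨rfl, by rw [iterγ_self]⟩
    · obtain ⟨hmk, a, b, h₁, h₂, hab⟩ := hlow.1
      rw [ht] at h₁
      rw [hup (m + 2) (by omega) (by omega)] at h₂
      cases h₁
      cases h₂
      exact Or.inl ⟨by omega, hab⟩
  · rw [h.of_ne (by omega), hag j hj, ext_of_le _ _ (by omega)]

lemma flagLE_trans (hS : S.IsOpetopicCardinal) {s : ℤ} {x y z : S.Vec} (h : FlagLE s x y)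
    (h' : FlagLE s y z) : FlagLE s x z := by
  rcases h with rfl | ⟨rfl, h⟩ | ⟨rfl, h⟩
  · exact h'
  · rcases h' with rfl | ⟨-, h'⟩ | ⟨h', -⟩
    · exact Or.inr (Or.inl ⟨rfl, h⟩)
    · exact Or.inr (Or.inl ⟨rfl, hS.flagLT_trans h h'⟩)
    · omega
  · rcases h' with rfl | ⟨h', -⟩ | ⟨-, h'⟩
    · exact Or.inr (Or.inr ⟨rfl, h⟩)
    · omega
    · exact Or.inr (Or.inr ⟨rfl, hS.flagLT_trans h' h⟩)

/-- The first (`s = 1`) or last (`s = -1`) face of `t` over the lower part of `g`. -/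
lemma exists_loc_extreme (hS : S.IsOpetopicCardinal) {s : ℤ} (hs : s = 1 ∨ s = -1) {g : S.Vec}
    {m : ℕ} {b t : S.F (m + 1)} {c : S.F m} (hbt : S.UpLE b t) (hcb : c ∈ S.bd b)
    (hc : Loc g m c) : ∃ a ∈ S.bd t, Loc g m a ∧ LevLE s g m a c ∧
      ∀ h : S.Vec, (∀ j < m, h j = g j) → h m = some a → h (m + 1) = some t →
        sgn h (m + 1) = s := by
  classical
  obtain ⟨a₁, ha₁, a₂, ha₂, hl₁, hl₂, hlt, hle₁, hle₂⟩ := hS.exists_loc_between hbt hcb hc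
  have hne : a₁ ≠ a₂ := by
    rintro rfl
    exact hS.locLT_irrefl _ _ hlt
  have key : ∀ (h : S.Vec) (a : S.F m), (∀ j < m, h j = g j) → h m = some a → h (m + 1) = some t →
      sgn h (m + 1) = if a = S.γ t then esgn g m a else - esgn g m a := by
    intro h a hj ha ht
    rw [sgn, ha, ht, Option.map_some, sgn_eq_esgn ha, esgn_congr hj]
    simp only [Option.some.injEq]
  rcases hs with rfl | rfl
  · refine ⟨a₁, ha₁, hl₁, ?_, fun h hj ha ht => ?_⟩
    · rcases hle₁ with h | h
      · exact Or.inl h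
      · exact Or.inr (Or.inl ⟨rfl, h⟩)
    · have := (hS.locLT_bd_iff ha₁ ha₂ hne hl₁ hl₂).1 hlt
      rw [key h a₁ hj ha ht]
      rcases esgn_eq g a₁ with he | he <;> split_ifs with h' <;> simp_all
  · refine ⟨a₂, ha₂, hl₂, ?_, fun h hj ha ht => ?_⟩
    · rcases hle₂ with h | h
      · exact Or.inl h.symm
      · exact Or.inr (Or.inr ⟨rfl, h⟩)
    · have := (hS.locLT_bd_iff ha₂ ha₁ hne.symm hl₂ hl₁).not.1 (hS.locLT_asymm hlt)
      rw [key h a₂ hj ha ht]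
      rcases esgn_eq g a₂ with he | he <;> split_ifs with h' <;> simp_all

/-- The flags under `p` over the lower part of `z` are not all on the same side of `g`. -/
lemma exists_not_flagLE (hS : S.IsOpetopicCardinal) {k i : ℕ} {T : S.F (k + 1)} {p : S.F k}
    (hp : p ∈ S.δ T) {s : ℤ} (hs : s = 1 ∨ s = -1) {g g' z : S.Vec} (hg : g ∈ Fl T)
    (hg' : g' ∈ Fl T) (hflip : Flip (k + 1) i g g') (hi : i < k + 1) (hle : FlagLE s g' g)
    (hz : z = punct g i) (hzk : z k ≠ some p) {m : ℕ} (hmk : m + 1 ≤ k) (hmi : m ≤ i)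
    {t : S.F (m + 1)} (htp : t ∈ S.lowerFaces p (m + 1)) {b b' : S.F (m + 1)}
    (hb : g (m + 1) = some b) (hb' : g' (m + 1) = some b') (hbt : S.UpLE b t)
    (hbt' : S.UpLE b' t)
    (hmax : ∀ r ∈ S.lowerFaces p (m + 2), ∀ c c', m + 2 ≤ k → m + 1 ≤ i → g (m + 2) = some c →
      g' (m + 2) = some c' → S.UpLE c r → S.UpLE c' r → False) :
    ∃ h ∈ Fl p, (∀ j < m, h j = g j) ∧ ¬ FlagLE s g (ext T h) := by
  -- Suppose that all flags under `p` over this lower part are on the far side of `g`. Those through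
  -- the extreme face `a` of `t` in the direction `s` then force `g` to pass through `a` and `t`.
  by_contra hcon
  push Not at hcon
  obtain ⟨c, hc⟩ := hg.1.some_of_le (i := m) (by omega)
  have hcb := hg.1.mem_bd hc hb
  obtain ⟨a, hat, hal, hle', hsgn⟩ := hS.exists_loc_extreme hs hbt hcb (hg.1.loc hc)
  have sub : ∀ h ∈ Fl p, (∀ j < m, h j = g j) → h m = some a → h (m + 1) = some t →
      c = a ∧ b = t := by
    intro h hh hj ha ht
    have hfl := hcon h hh hj
    have hj' : ∀ j < m, g j = ext T h j := fun j hjm => by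
      rw [ext_of_le _ _ (by omega), hj j hjm]
    obtain rfl := hS.levLE_antisymm (hS.levLE_of_flagLE hfl hj' hc
      (by rw [ext_of_le _ _ (by omega), ha])) hle'
    refine ⟨rfl, hS.eq_of_flagLE (n := m) (fun j hjm => ?_) hc hb
      (by rw [ext_of_le _ _ hmk, ht]) hcb hat ?_ hfl hbt⟩
    · rcases hjm.lt_or_eq with hjm | rfl
      · exact hj' j hjm
      · rw [hc, ext_of_le _ _ (by omega), ha]
    · exact hsgn _ (fun j hjm => (hj' j hjm).symm) (by rw [ext_of_le _ _ (by omega), ha])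
        (by rw [ext_of_le _ _ hmk, ht])
  have hpre := (hg.1.isPre (n := m) (by omega)).snoc (a := a)
    (hal.congr fun j hj => (below_of_lt hj).symm)
  set G : S.Vec := Function.update (below m g) m (some a) with hG
  have hGj : ∀ j < m, G j = g j := fun j hj => by
    rw [hG, Function.update_of_ne (by omega), below_of_lt hj]
  have hGm : G m = some a := Function.update_self ..
  -- For `m = i` the sign of `g` would put its flip `g'` on the other side than assumed.
  have hlt' : c = a → b = t → m < i := by
    rintro rfl rfl
    refine hmi.lt_of_ne ?_
    rintro rfl
    have hss := hsgn g (fun _ _ => rfl) hc hb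
    have hiff := hS.flip_lt_iff hflip (by omega)
    rcases hle with h | ⟨rfl, h⟩ | ⟨rfl, h⟩
    · exact hflip.2.2.2 (by rw [h])
    · exact hS.flagLT_asymm h (hiff.2 hss)
    · have := hiff.1 h
      omega
  by_cases hk : m + 1 = k
  · subst hk
    obtain ⟨h, hh, hj, ht, -⟩ := exists_flag_lowerFaces p hpre htp ⟨a, hGm, hat⟩
    obtain ⟨rfl, rfl⟩ := sub h hh (fun j hjm => by rw [hj j (by omega), hGj j hjm])
      (by rw [hj m (by omega), hGm]) ht
    have hmi' := hlt' rfl rfl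
    obtain rfl : b = p := by
      rcases htp with ⟨h', -⟩ | ⟨_, h'⟩
      · omega
      · rwa [iterγ_self] at h'
    have hik : i = m + 1 := by
      by_contra hne
      exact hzk (by rw [hz, punct_of_ne _ (by omega), hb])
    subst hik
    have hne : b' ≠ b := by
      rintro rfl
      exact hflip.2.2.2 (by rw [hb, hb'])
    rcases hg'.1.mem_bd hb' hg'.2 with rfl | hδ
    · exact hS.not_le_of_lt (upLT_γ hp) hbt'
    · exact hne (hS.eq_of_le_of_mem_δ hδ hp hbt')
  -- One level higher, `t` is in the domain of some `r`, which reverses the sign. Comparing `g` and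
  -- `g'` with a flag through `r` gives `d ≤⁺ r` and `d' ≤⁺ r`, so `m + 1` would also be admissible,
  -- against maximality.
  · obtain ⟨r, hr, htr⟩ : ∃ r ∈ S.lowerFaces p (m + 2), t ∈ S.δ r := by
      rcases htp with ⟨h', htp⟩ | ⟨h', -⟩
      · by_cases hk' : m + 2 = k
        · subst hk'
          rw [iterγ_self] at htp
          exact ⟨p, Or.inr ⟨rfl, by rw [iterγ_self]⟩, htp⟩
        · rw [iterγ_succ p (m + 1 + 1) (by omega)] at htp
          obtain ⟨r, hr, htr⟩ := hS.exists_of_mem_δγ htp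
          exact ⟨r, Or.inl ⟨by omega, hr⟩, htr⟩
      · omega
    have htG : Loc G (m + 1) t := ⟨a, hGm, hat⟩
    obtain ⟨h, hh, hj, hhr, -⟩ := exists_flag_lowerFaces p (hpre.snoc htG) hr
      ⟨t, Function.update_self .., mem_bd_of_mem_δ htr⟩
    have hjm : ∀ j < m, h j = g j := fun j hjm => by
      rw [hj j (by omega), Function.update_of_ne (by omega), hGj j hjm]
    have hha : h m = some a := by rw [hj m (by omega), Function.update_of_ne (by omega), hGm]
    have hht : h (m + 1) = some t := by rw [hj (m + 1) (by omega), Function.update_self]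
    obtain ⟨rfl, rfl⟩ := sub h hh hjm hha hht
    have hmi' := hlt' rfl rfl
    obtain ⟨d, hd⟩ := hg.1.some_of_le (i := m + 2) (by omega)
    obtain ⟨d', hd'⟩ := hg'.1.some_of_le (i := m + 2) (by omega)
    have hsr : sgn (ext T h) (m + 2) = -s := by
      rw [sgn_congr (y := h) fun j hj => ext_of_le _ _ (by omega), sgn, if_neg, hsgn h hjm hha hht]
      rw [hht, hhr, Option.map_some]
      intro h'
      rw [Option.some.inj h'] at htr
      exact hS.γ_notMem_δ r htr
    have hag : ∀ j ≤ m + 1, g j = ext T h j := by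
      intro j hjm'
      rw [ext_of_le _ _ (by omega)]
      rcases (by omega : j < m ∨ j = m ∨ j = m + 1) with hj' | rfl | rfl
      · exact (hjm j hj').symm
      · rw [hc, hha]
      · rw [hb, hht]
    have hfl := hcon h hh hjm
    have hr' : ext T h (m + 2) = some r := by rw [ext_of_le _ _ (by omega), hhr]
    have hdr : S.UpLE d r := hS.upLE_of_flagLE hag hb hd hr' (hg.1.mem_bd hb hd)
      (mem_bd_of_mem_δ htr) hsr hfl
    refine hmax r hr d d' (by omega) (by omega) hd hd' hdr ?_
    by_cases hmi1 : m + 2 = i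
    · refine hS.upLE_of_flagLE (s := s) (g := g') (h := ext T h) (n := m + 1) (a := b)
        (fun j hj => ?_) ?_ hd' hr' ?_ (mem_bd_of_mem_δ htr) hsr (hS.flagLE_trans hle hfl)
      · rw [← hag j hj, hflip.2.2.1 j (by omega)]
      · rw [hflip.2.2.1 _ (by omega), hb]
      · exact hg'.1.mem_bd (by rw [hflip.2.2.1 _ (by omega), hb]) hd'
    · rw [hflip.2.2.1 _ hmi1, hd] at hd'
      cases hd'
      exact hdr

/-- Maximality of `m` provides flags under `p`, over the lower part of `z`, on both sides of the
cut. The restricted cut therefore ends at an adjacent pair agreeing below `m`. The level where the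
pair differs is admissible, so it is `m`, and the face above it is `t` by the antichain property. -/
lemma gap_starVec (hS : S.IsOpetopicCardinal) {k i : ℕ} {z : S.PFlag (k + 1)} {T : S.F (k + 1)}
    {x y : S.Vec} (h : Around z T x y i) {p : S.F k} (hp : p ∈ S.δ T) (hz : z.1 k ≠ some p)
    {m : ℕ} {t : S.F (m + 1)} (hm : IsGreatest {m | ∃ t, StarAt p z m t} m)
    (ht : StarAt p z m t) :
    ∃ z₁ : S.PFlag k, z₁.1 = starVec p z.1 m t ∧ Gap (.pflag z₁) p (rho p T (prev T y)) := by
  have hp' := mem_bd_of_mem_δ hp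
  obtain ⟨hmk, hmi, htp, b, b', hb, hb', hbt, hbt'⟩ := (hS.starAt_iff h hp).1 ht
  obtain ⟨f, hf, hfj, hfy⟩ := hS.exists_not_flagLE hp (Or.inl rfl) h.adj.2.1 h.adj.1 h.flip.symm
    h.lt (Or.inr (Or.inl ⟨rfl, h.adj.2.2.1⟩)) (h.eq.trans h.flip.punct_eq) hz hmk hmi htp hb' hb
    hbt' hbt fun r hr c c' h₁ h₂ hc hc' hcr hcr' => by
      have := hm.2 ⟨r, (hS.starAt_iff h hp).2 ⟨h₁, h₂, hr, c', c, hc', hc, hcr', hcr⟩⟩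
      omega
  obtain ⟨f', hf', hfj', hfx'⟩ := hS.exists_not_flagLE hp (Or.inr rfl) h.adj.1 h.adj.2.1 h.flip
    h.lt (Or.inr (Or.inr ⟨rfl, h.adj.2.2.1⟩)) h.eq hz hmk hmi htp hb hb'
    hbt hbt' fun r hr c c' h₁ h₂ hc hc' hcr hcr' => by
      have := hm.2 ⟨r, (hS.starAt_iff h hp).2 ⟨h₁, h₂, hr, c, c', hc, hc', hcr, hcr'⟩⟩
      omega
  have hfI : f ∈ rho p T (prev T y) := by
    by_contra hcon
    rcases hS.rho_not_mem h.adj hp' hf hcon with h' | h'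
    · exact hfy (Or.inl h')
    · exact hfy (Or.inr (Or.inl ⟨rfl, h'⟩))
  have hfI' : f' ∉ rho p T (prev T y) := by
    intro hcon
    rcases hS.rho_mem h.adj hcon with h' | h'
    · exact hfx' (Or.inl h'.symm)
    · exact hfx' (Or.inr (Or.inr ⟨rfl, h'⟩))
  have hI := hS.isLower_rho hp' (hS.isLower_prev T y)
  obtain ⟨e, e', hee, he, he', hfe, hef'⟩ := hS.exists_straddle hI hfI hf' hfI'
  have hff : ∀ j < m, f j = f' j := fun j hj => by
    rw [hfj j hj, hfj' j hj, h.flip.2.2.1 j (by omega)]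
  have hej := hS.agree_of_between hff hfe (by
    rcases hef' with rfl | h'
    · exact Or.inr hee.2.2.1
    · exact Or.inr (hS.flagLT_trans hee.2.2.1 h'))
  have hej' := hS.agree_of_between hff (z := e') (by
    rcases hfe with rfl | h'
    · exact Or.inr hee.2.2.1
    · exact Or.inr (hS.flagLT_trans h' hee.2.2.1)) hef'
  obtain ⟨m', t', hmk', hflip, hst, het, hej'', hup⟩ := hS.starAt_of_straddle h hp hee he he'
  have h₁ := hm.2 ⟨t', hst⟩
  obtain rfl : m' = m := by
    refine Nat.le_antisymm h₁ (not_lt.1 fun h₂ => hflip.2.2.2 ?_)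
    rw [hej _ h₂, hej' _ h₂]
  obtain ⟨-, -, htp', c, c', hc, hc', hct, -⟩ := (hS.starAt_iff h hp).1 hst
  rw [hb] at hc
  cases hc
  obtain rfl : t = t' := by
    rcases hS.upLE_total_of_le hbt hct with h' | h'
    · exact hS.lowerFaces_antichain htp htp' h'
    · exact (hS.lowerFaces_antichain htp' htp h'.le).symm
  have hv : starVec p z.1 m' t = punct e m' := by
    funext j
    rw [starVec]
    rcases (by omega : j = m' + 1 ∨ j = m' ∨ j < m' ∨ m' + 1 < j) with rfl | rfl | hj | hj
    · rw [Function.update_self, punct_of_ne _ (by omega), het]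
    · rw [Function.update_of_ne (by omega), punct_self, if_neg (by omega), if_pos rfl]
    · rw [Function.update_of_ne (by omega), punct_of_ne _ (by omega), if_pos hj, hej'' j hj]
    · rw [Function.update_of_ne (by omega), punct_of_ne _ (by omega), if_neg (by omega),
        if_neg (by omega)]
      split_ifs with hjk
      · exact (hup j hjk hj).symm
      · exact (hee.1.1.none_of_lt (by omega)).symm
  have hpf : IsPFlag k (punct e m') := by
    obtain ⟨i', hik', hflip', hlev⟩ := hS.adj_cases hee
    obtain rfl : i' = m' := by
      by_contra hne
      exact hflip.2.2.2 (hflip'.2.2.1 _ (Ne.symm hne))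
    exact ⟨e, i', hee.1.1, by rcases hlev with h | h; exacts [Or.inl h.1, Or.inr h.1], rfl⟩
  refine ⟨⟨starVec p z.1 m' t, hv ▸ hpf⟩, rfl, ?_⟩
  rw [hS.eq_prev_of_straddle hI hee he he']
  exact hS.gap_pflag hee hflip hmk' hv

/-- A restricted cut that is neither empty nor full ends at an adjacent pair, which yields a
solution of `StarAt`. -/
lemma rho_trivial (hS : S.IsOpetopicCardinal) {k i : ℕ} {z : S.PFlag (k + 1)} {T : S.F (k + 1)}
    {x y : S.Vec} (h : Around z T x y i) {p : S.F k} (hp : p ∈ S.δ T)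
    (hno : ∀ m t, ¬ StarAt p z m t) :
    (∀ f ∈ Fl p, f ∈ rho p T (prev T y) → rho p T (prev T y) = Fl p) ∧
      ∀ f ∈ Fl p, f ∉ rho p T (prev T y) → rho p T (prev T y) = ∅ := by
  have hI := hS.isLower_rho (mem_bd_of_mem_δ hp) (hS.isLower_prev T y)
  have key : ∀ f ∈ rho p T (prev T y), ∀ f' ∈ Fl p, f' ∈ rho p T (prev T y) := by
    intro f hf f' hf'
    by_contra hcon
    obtain ⟨e, e', hee, he, he', -⟩ := hS.exists_straddle hI hf hf' hcon
    obtain ⟨m, t, -, -, hst, -⟩ := hS.starAt_of_straddle h hp hee he he'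
    exact hno m t hst
  refine ⟨fun f _ hfr => hI.1.antisymm fun f' hf' => key f hfr f' hf', fun f hf hfr => ?_⟩
  exact Set.eq_empty_of_forall_notMem fun f' hf' => hfr (key f' hf' f hf)

lemma flagLT_of_zero (hS : S.IsOpetopicCardinal) {x y : S.Vec} {a b : S.F 0} (ha : x 0 = some a)
    (hb : y 0 = some b) (h : S.UpLT b a) : FlagLT x y :=
  hS.flagLT_iff.2 ⟨0, a, b, fun i hi => absurd hi (by omega), ha, hb, h⟩

lemma isPre_zero : IsPre 0 (fun _ => none : S.Vec) where
  isSome_iff i := by simp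
  mem_bd h := by cases h

lemma exists_flag_γ {k : ℕ} (p : S.F k) :
    ∃ f ∈ Fl p, f 0 = some (S.iterγ p 0 k.zero_le) := by
  obtain ⟨f, hf, -, h⟩ := exists_flag_iterγ p isPre_zero k.zero_le trivial
  exact ⟨f, hf, h 0 k.zero_le le_rfl⟩

lemma exists_flag_δ {k : ℕ} (p : S.F (k + 1)) :
    ∃ f ∈ Fl p, ∃ t, f 0 = some t ∧ S.UpLT t (S.iterγ p 0 (k + 1).zero_le) := by
  obtain ⟨t, ht⟩ := S.δ_total (S.iterγ p 1 (by omega))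
  obtain ⟨f, hf, -, h, -⟩ := exists_flag_lowerFaces p isPre_zero (j := 0) (t := t)
    (Or.inl ⟨by omega, ht⟩) trivial
  exact ⟨f, hf, t, h, by rw [iterγ_succ p 0 (by omega)]; exact upLT_γ ht⟩

lemma gap_of_isStar (hS : S.IsOpetopicCardinal) {k i : ℕ} {z : S.PFlag (k + 1)} {T : S.F (k + 1)}
    {x y : S.Vec} (h : Around z T x y i) {p : S.F k} (hp : p ∈ S.δ T) {w : S.CylFace k}
    (hw : IsStar p z w) : Gap w p (rho p T (prev T y)) := by
  have hp' := mem_bd_of_mem_δ hp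
  rcases hw with ⟨hz, z₁, hz₁, rfl⟩ | ⟨hz, m, t, hm, ht, z₁, hz₁, rfl⟩ | ⟨-, hno, hw⟩
  · obtain ⟨z₂, hz₂, hG⟩ := hS.gap_below h hp hz
    rwa [Subtype.ext (hz₁.trans hz₂.symm)]
  · obtain ⟨z₂, hz₂, hG⟩ := hS.gap_starVec h hp hz hm ht
    rwa [Subtype.ext (hz₁.trans hz₂.symm)]
  · obtain ⟨hall, hnone⟩ := hS.rho_trivial h hp hno
    obtain ⟨f, hf, hf0⟩ := exists_flag_γ p
    have he : ∀ g : S.Vec, ext T g 0 = g 0 := fun g => ext_of_le _ _ k.zero_le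
    have hfx : FlagLT x (ext T f) → f ∉ rho p T (prev T y) := fun hlt hr =>
      h.adj.2.2.2 _ (ext_mem hf hp') hlt hr.2.2
    rcases hw with ⟨x₀, hx₀, hw⟩ | ⟨hz0, e, he₁, hw⟩
    · have hi0 : 0 ≠ i := by
        rintro rfl
        rw [h.self] at hx₀
        cases hx₀
      have hx : x 0 = some x₀ := by rw [← h.of_ne hi0, hx₀]
      have hy : y 0 = some x₀ := by rw [← h.of_ne' hi0, hx₀]
      rcases hw with ⟨hle, rfl⟩ | ⟨hlt, rfl⟩
      · refine ⟨rfl, ?_⟩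
        rcases hle with rfl | hle
        · have := h.lt
          obtain ⟨n, rfl⟩ : ∃ n, k = n + 1 := ⟨k - 1, by omega⟩
          -- When `γ^{(0)} p = x₀`, level 0 does not separate the flag through codomains from `x`. A
          -- flag starting in a smaller face `t` does: it comes after `x`, hence is outside the cut.
          obtain ⟨g, hg, t, hgt, hlt⟩ := exists_flag_δ p
          refine hnone g hg fun hr => h.adj.2.2.2 _ (ext_mem hg hp') ?_ hr.2.2
          exact hS.flagLT_of_zero hx ((ext_of_le _ _ (by omega)).trans hgt) hlt
        · exact hnone f hf (hfx (hS.flagLT_of_zero hx ((he f).trans hf0) hle))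
      · exact ⟨rfl, hall f hf ⟨hf, ext_mem hf hp', hS.flagLT_of_zero ((he f).trans hf0) hy hlt⟩⟩
    · obtain rfl : 0 = i := h.puAt_iff.1 ⟨by omega, hz0⟩
      have hx1 : x 1 = some e := by rw [← h.of_ne (by omega), he₁]
      have hy1 : y 1 = some e := by rw [← h.of_ne' (by omega), he₁]
      obtain ⟨a, ha⟩ := h.adj.1.1.some_of_le (i := 0) (by omega)
      obtain ⟨b, hb⟩ := h.adj.2.1.1.some_of_le (i := 0) (by omega)
      have hba : S.UpLT b a := by
        rcases hS.locLE_of_flagLT (Or.inr h.adj.2.2.1) (j := 0) (fun i hi => absurd hi (by omega))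
          ha hb with rfl | h'
        · exact absurd (hb.trans ha.symm) h.flip.2.2.2
        · exact h'
      have hbe : S.UpLT b (S.γ e) := hba.trans_le (le_γ_of_mem_bd (h.adj.1.1.mem_bd ha hx1))
      -- With the dummy at level 0, the earlier flag `x` starts in `γ e` and the later one in a
      -- smaller face; this is the source of the asymmetry between `<⁺` and `≤⁺` in the rule for
      -- `±p`.
      obtain rfl : a = S.γ e := by
        refine (h.adj.1.1.mem_bd ha hx1).resolve_right fun h₁ => ?_
        rcases h.adj.2.1.1.mem_bd hb hy1 with rfl | h₂
        · exact hS.strict _ hbe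
        · exact hS.δ_antichain h₂ h₁ hba
      rcases hw with ⟨hlt, rfl⟩ | ⟨hle, rfl⟩
      · exact ⟨rfl, hnone f hf (hfx (hS.flagLT_of_zero ha ((he f).trans hf0) hlt))⟩
      · exact ⟨rfl, hall f hf ⟨hf, ext_mem hf hp',
          hS.flagLT_of_zero ((he f).trans hf0) hb (hbe.trans_le hle)⟩⟩

lemma exists_star (hS : S.IsOpetopicCardinal) {k i : ℕ} {z : S.PFlag (k + 1)} {T : S.F (k + 1)}
    {x y : S.Vec} (h : Around z T x y i) {p : S.F k} (hp : p ∈ S.δ T) :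
    ∃ w, IsStar p z w := by
  by_cases hz : z.1 k = some p
  · obtain ⟨z₂, hz₂, -⟩ := hS.gap_below h hp hz
    exact ⟨_, Or.inl ⟨hz, z₂, hz₂, rfl⟩⟩
  by_cases hst : ∃ m t, StarAt p z m t
  · obtain ⟨m, hm, hmax⟩ := Set.Finite.exists_maximal (s := {m | ∃ t, StarAt p z m t})
      ((Set.finite_le_nat k).subset fun m ⟨t, ht⟩ => (show m ≤ k by have := ht.1; omega)) hst
    have hm' : IsGreatest {m | ∃ t, StarAt p z m t} m :=
      ⟨hm, fun n hn => by
        by_contra hlt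
        exact hlt (hmax hn (by omega))⟩
    obtain ⟨t, ht⟩ := hm
    obtain ⟨z₂, hz₂, -⟩ := hS.gap_starVec h hp hz hm' ht
    exact ⟨_, Or.inr (Or.inl ⟨hz, m, t, hm', ht, z₂, hz₂, rfl⟩)⟩
  · push Not at hst
    have tot : ∀ a b : S.F 0, S.UpLE a b ∨ S.UpLT b a := fun a b => by
      by_cases hab : a = b
      · exact Or.inl (Or.inl hab)
      · rcases hS.linear_zero a b hab with h' | h'
        · exact Or.inl (Or.inr h')
        · exact Or.inr h'
    rcases hz0 : z.1 0 with _ | x₀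
    · obtain rfl : 0 = i := h.puAt_iff.1 ⟨by omega, hz0⟩
      obtain ⟨e, he⟩ := h.adj.1.1.some_of_le (i := 1) (by omega)
      rw [← h.of_ne (by omega)] at he
      rcases tot (S.γ e) (S.iterγ p 0 k.zero_le) with h' | h'
      · exact ⟨_, Or.inr (Or.inr ⟨hz, hst, Or.inr ⟨hz0, e, he, Or.inr ⟨h', rfl⟩⟩⟩)⟩
      · exact ⟨_, Or.inr (Or.inr ⟨hz, hst, Or.inr ⟨hz0, e, he, Or.inl ⟨h', rfl⟩⟩⟩)⟩
    · rcases tot (S.iterγ p 0 k.zero_le) x₀ with h' | h'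
      · exact ⟨_, Or.inr (Or.inr ⟨hz, hst, Or.inl ⟨x₀, hz0, Or.inl ⟨h', rfl⟩⟩⟩)⟩
      · exact ⟨_, Or.inr (Or.inr ⟨hz, hst, Or.inl ⟨x₀, hz0, Or.inr ⟨h', rfl⟩⟩⟩)⟩

/-- The recipe always produces a face over the restricted cut, and such a face is unique; so the
converse needs only that the recipe has a value. -/
lemma isStar_iff (hS : S.IsOpetopicCardinal) {k i : ℕ} {z : S.PFlag (k + 1)} {T : S.F (k + 1)}
    {x y : S.Vec} (h : Around z T x y i) {p : S.F k} (hp : p ∈ S.δ T) {w : S.CylFace k} :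
    IsStar p z w ↔ Gap w p (rho p T (prev T y)) := by
  refine ⟨hS.gap_of_isStar h hp, fun hw => ?_⟩
  obtain ⟨w', hw'⟩ := hS.exists_star h hp
  rwa [hS.gap_unique hw (hS.gap_of_isStar h hp hw')]

/-- The domains of a flat face or p-flag, in terms of cuts. -/
lemma mem_cylδ_gap (hS : S.IsOpetopicCardinal) {k : ℕ} {q : S.F (k + 1)} {I : Set S.Vec}
    {w : S.CylFace (k + 1)} (hw : Gap w q I) {v : S.CylFace k} :
    v ∈ cylδ w ↔ (∃ p ∈ S.δ q, Gap v p (rho p q I)) ∨ ∃ h, Ins q I h ∧ IsFl v h := by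
  cases w with
  | neg p =>
    obtain ⟨rfl, rfl⟩ := hw
    have he : ∀ r : S.F k, rho r p ∅ = ∅ := fun r => by simp [rho]
    constructor
    · intro hv
      have hv' : v ∈ CylFace.neg '' S.δ p := by cases k <;> exact hv
      obtain ⟨r, hr, rfl⟩ := hv'
      exact Or.inl ⟨r, hr, rfl, he r⟩
    · rintro (⟨r, hr, hv⟩ | ⟨h, ⟨x, y, -, -, hx, -⟩, -⟩)
      · rw [hS.gap_unique (w' := .neg r) hv ⟨rfl, he r⟩]
        cases k <;> exact ⟨r, hr, rfl⟩
      · exact hx.elim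
  | pos p =>
    obtain ⟨rfl, rfl⟩ := hw
    have he : ∀ r ∈ S.δ p, rho r p (Fl p) = Fl r := fun r hr =>
      Set.Subset.antisymm (fun f hf => hf.1) fun f hf => ⟨hf, ext_mem hf (mem_bd_of_mem_δ hr)⟩
    constructor
    · intro hv
      have hv' : v ∈ CylFace.pos '' S.δ p := by cases k <;> exact hv
      obtain ⟨r, hr, rfl⟩ := hv'
      exact Or.inl ⟨r, hr, rfl, he r hr⟩
    · rintro (⟨r, hr, hv⟩ | ⟨h, ⟨x, y, hxy, -, -, hy, -⟩, -⟩)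
      · rw [hS.gap_unique (w' := .pos r) hv ⟨rfl, he r hr⟩]
        cases k <;> exact ⟨r, hr, rfl⟩
      · exact (hy hxy.2.1).elim
  | flag x => exact hw.elim
  | pflag z =>
    obtain ⟨x, y, i, hxy, hik, hf, hz, hc, rfl⟩ := hS.exists_adj_of_gap hw
    have hA : Around z q x y i := ⟨hxy, hik, hf, hz, hc⟩
    have htop : z.top = q := by
      have := hw.1
      simp [PFlag.top, this]
    have h₁ : (∃ p ∈ S.δ z.top, IsStar p z v) ↔ ∃ p ∈ S.δ q, Gap v p (rho p q (prev q y)) := by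
      rw [htop]
      exact exists_congr fun p => and_congr_right fun hp => hS.isStar_iff hA hp
    have hI := hS.isLower_prev q y
    have hx : x ∈ prev q y := ⟨hxy.1, hxy.2.2.1⟩
    have hy : y ∉ prev q y := fun h' => hS.flagLT_irrefl _ h'.2
    rcases k with _ | k
    · change (∃ p ∈ S.δ z.top, IsStar p z v) ↔ _
      rw [h₁]
      exact ⟨Or.inl, fun h => h.resolve_right fun ⟨f, _, hf⟩ => not_isFl_zero _ _ hf⟩
    · change ((∃ p ∈ S.δ z.top, IsStar p z v) ∨
        (z.PuAt (k + 1) ∧ ∃ y : S.Flag k, y.1 = below (k + 1) z.1 ∧ v = .flag y)) ↔ _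
      refine or_congr h₁ ⟨?_, ?_⟩
      · rintro ⟨hpu, f, hfv, rfl⟩
        obtain rfl := hA.puAt_iff.1 hpu
        refine ⟨f.1, ⟨x, y, hxy, hf, hx, hy, ?_⟩, rfl⟩
        rw [hfv]
        funext j
        unfold PosHypergraph.below
        split_ifs with hj
        · exact hA.of_ne (by omega)
        · rfl
      -- The pair around the cut is unique, so a flag is inserted precisely when the dummy is at the
      -- high level.
      · rintro ⟨h, ⟨x', y', hxy', hf', hx', hy', rfl⟩, hv⟩
        obtain ⟨rfl, rfl⟩ := hS.straddle_unique hI hxy hx hy hxy' hx' hy'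
        obtain rfl : i = k + 1 := by
          by_contra hne
          exact hf.2.2.2 (hf'.2.2.1 _ hne)
        refine ⟨hA.puAt_iff.2 rfl, ?_⟩
        cases v with
        | flag f =>
          refine ⟨f, ?_, rfl⟩
          rw [show f.1 = _ from hv]
          funext j
          unfold PosHypergraph.below
          split_ifs with hj
          · exact (hA.of_ne (by omega)).symm
          · rfl
        | _ => exact hv.elim

end IsOpetopicCardinal

end PosHypergraph

namespace PosHypergraph

variable {S : PosHypergraph.{u}}

/-! ## A local criterion for positive opetopes -/

/-- One step in the tree of the faces in the domain of `X`. -/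
def TreeStep {n : ℕ} (X : S.F (n + 2)) (a b : S.F n) : Prop := ∃ c ∈ S.δ X, a ∈ S.δ c ∧ S.γ c = b

variable (S)

/-- The domain of every face is a tree with the boundary of its codomain. -/
structure IsTreelike : Prop where
  γ_notMem : ∀ {k : ℕ} (a : S.F (k + 1)), S.γ a ∉ S.δ a
  glob_γ : ∀ {k : ℕ} (a : S.F (k + 2)),
    {S.γ (S.γ a)} = (S.γ '' S.δ a) \ (⋃ b ∈ S.δ a, S.δ b)
  glob_δ : ∀ {k : ℕ} (a : S.F (k + 2)),
    S.δ (S.γ a) = (⋃ b ∈ S.δ a, S.δ b) \ (S.γ '' S.δ a)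
  inj_γ : ∀ {k : ℕ} (a : S.F (k + 2)), Set.InjOn S.γ (S.δ a)
  disj_δ : ∀ {k : ℕ} (a : S.F (k + 2)) {b b' : S.F (k + 1)} {x : S.F k}, b ∈ S.δ a → b' ∈ S.δ a →
    x ∈ S.δ b → x ∈ S.δ b' → b = b'
  acyclic : ∀ {k : ℕ} (a : S.F (k + 2)) (x : S.F k), ¬ Relation.TransGen (TreeStep a) x x

variable {S}

/-- `y` is `x` or belongs to an iterated boundary of `x`. -/
inductive Occurs {k : ℕ} (x : S.F k) : ∀ {j : ℕ}, S.F j → Prop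
  | refl : Occurs x x
  | bd {j : ℕ} {y : S.F (j + 1)} {z : S.F j} : Occurs x y → z ∈ S.bd y → Occurs x z

lemma mem_gen_iff {k j : ℕ} {x : S.F k} {y : S.F j} : y ∈ (gen x).carrier j ↔ Occurs x y := by
  constructor
  · intro h
    exact h { carrier := fun j => {y | Occurs x y}
              γ_mem := fun a ha => Occurs.bd ha (γ_mem_bd a)
              δ_mem := fun a ha b hb => Occurs.bd ha (mem_bd_of_mem_δ hb) } Occurs.refl
  · intro h A hA
    induction h with
    | refl => exact hA
    | bd h hz ih =>
      rcases hz with rfl | hz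
      · exact A.γ_mem _ ih
      · exact A.δ_mem _ ih hz

lemma Occurs.trans {k j i : ℕ} {x : S.F k} {y : S.F j} {z : S.F i} (h : Occurs x y)
    (h' : Occurs y z) : Occurs x z := by
  induction h' with
  | refl => exact h
  | bd _ hz ih => exact ih.bd hz

lemma Occurs.le {k j : ℕ} {x : S.F k} {y : S.F j} (h : Occurs x y) : j ≤ k := by
  induction h with
  | refl => exact le_rfl
  | bd _ _ ih => omega

lemma Occurs.eq {k : ℕ} {x y : S.F k} (h : Occurs x y) : y = x := by
  have key : ∀ {j : ℕ} {y : S.F j}, Occurs x y → j = k → HEq y x := by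
    intro j y h
    induction h with
    | refl => exact fun _ => HEq.rfl
    | bd h _ _ =>
      intro hj
      have := h.le
      omega
  exact eq_of_heq (key h rfl)

lemma Occurs.head {k j : ℕ} {x : S.F (k + 1)} {y : S.F j} (h : Occurs x y) (hj : j ≤ k) :
    ∃ b ∈ S.bd x, Occurs b y := by
  induction h with
  | refl => omega
  | bd h hz ih =>
    rename_i j y z
    by_cases hjk : j + 1 ≤ k
    · obtain ⟨b, hb, hby⟩ := ih hjk
      exact ⟨b, hb, hby.bd hz⟩
    · obtain rfl : j = k := by omega
      obtain rfl := h.eq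
      exact ⟨_, hz, Occurs.refl⟩

/-- The upper order of a sub-hypergraph. -/
def RUp (A : S.Sub) {k : ℕ} : S.F k → S.F k → Prop :=
  Relation.TransGen fun a b => ∃ α ∈ A.carrier (k + 1), a ∈ S.δ α ∧ S.γ α = b

/-- The lower order of a sub-hypergraph. -/
def RLow (A : S.Sub) {k : ℕ} : S.F (k + 1) → S.F (k + 1) → Prop :=
  Relation.TransGen fun a b => b ∈ A.carrier (k + 1) ∧ S.γ a ∈ S.δ b

lemma upLT_toPosHypergraph {A : S.Sub} {k : ℕ} {a b : A.toPosHypergraph.F k} :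
    A.toPosHypergraph.UpLT a b ↔ RUp A a.1 b.1 := by
  constructor
  · intro h
    refine Relation.TransGen.lift Subtype.val ?_ _ _ h
    rintro a b ⟨α, ha, rfl⟩
    exact ⟨α.1, α.2, ha, rfl⟩
  · obtain ⟨b, hb⟩ := b
    change RUp A a.1 b → _
    intro h
    induction h with
    | single h =>
      obtain ⟨α, hα, ha, rfl⟩ := h
      exact Relation.TransGen.single ⟨⟨α, hα⟩, ha, rfl⟩
    | tail _ h ih =>
      obtain ⟨α, hα, ha, rfl⟩ := h
      exact Relation.TransGen.tail (ih (A.δ_mem α hα ha)) ⟨⟨α, hα⟩, ha, rfl⟩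

lemma lowLT_toPosHypergraph {A : S.Sub} {k : ℕ} {a b : A.toPosHypergraph.F (k + 1)}
    (h : A.toPosHypergraph.LowLT a b) : RLow A a.1 b.1 := by
  refine Relation.TransGen.lift Subtype.val ?_ _ _ h
  intro a b h
  exact ⟨b.2, h⟩

/-- The conditions on positive opetopes, other than globularity, for a sub-hypergraph. -/
structure Sub.IsOpetope (A : S.Sub) : Prop where
  nonempty : (A.carrier 0).Nonempty
  strict : ∀ {k : ℕ} (a : S.F k), ¬ RUp A a a
  linear_zero : ∀ a ∈ A.carrier 0, ∀ b ∈ A.carrier 0, a ≠ b → RUp A a b ∨ RUp A b a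
  disjoint : ∀ {k : ℕ}, ∀ a ∈ A.carrier (k + 1), ∀ b ∈ A.carrier (k + 1), RLow A a b →
    ¬ RUp A a b ∧ ¬ RUp A b a
  pencil_γ : ∀ {k : ℕ}, ∀ a ∈ A.carrier (k + 1), ∀ b ∈ A.carrier (k + 1), S.γ a = S.γ b →
    a ≠ b → RUp A a b ∨ RUp A b a
  pencil_δ : ∀ {k : ℕ} (x : S.F k), ∀ a ∈ A.carrier (k + 1), ∀ b ∈ A.carrier (k + 1), x ∈ S.δ a →
    x ∈ S.δ b → a ≠ b → RUp A a b ∨ RUp A b a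
  size : ∀ {k : ℕ}, ∀ a ∈ A.carrier k, ∀ b ∈ A.carrier k, (∀ α ∈ A.carrier (k + 1), a ∉ S.δ α) →
    (∀ α ∈ A.carrier (k + 1), b ∉ S.δ α) → a = b

lemma Sub.IsOpetope.isPositiveOpetope (hS : S.IsTreelike) {A : S.Sub} (hA : A.IsOpetope) :
    A.toPosHypergraph.IsPositiveOpetope where
  nonempty := ⟨⟨_, hA.nonempty.some_mem⟩⟩
  glob_γ a := by
    have h := hS.glob_γ a.1
    ext x
    have hx := Set.ext_iff.1 h x.1
    simp only [Set.mem_singleton_iff, Set.mem_sdiff, Set.mem_image, Set.mem_iUnion,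
      not_exists] at hx ⊢
    constructor
    · rintro rfl
      obtain ⟨⟨b, hb, he⟩, hno⟩ := hx.1 rfl
      exact ⟨⟨⟨b, A.δ_mem a.1 a.2 hb⟩, hb, Subtype.ext he⟩, fun b hb hx => hno b.1 hb hx⟩
    · rintro ⟨⟨b, hb, he⟩, hno⟩
      exact Subtype.ext (hx.2 ⟨⟨b.1, hb, congrArg Subtype.val he⟩,
        fun b hb hx => hno ⟨b, A.δ_mem a.1 a.2 hb⟩ hb hx⟩)
  glob_δ a := by
    have h := hS.glob_δ a.1
    ext x
    have hx := Set.ext_iff.1 h x.1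
    simp only [Set.mem_sdiff, Set.mem_image, Set.mem_iUnion, not_exists, not_and] at hx ⊢
    refine Iff.trans hx ⟨?_, ?_⟩
    · rintro ⟨⟨b, hb, hxb⟩, hno⟩
      exact ⟨⟨⟨b, A.δ_mem a.1 a.2 hb⟩, hb, hxb⟩, fun c hc he => hno c.1 hc (congrArg Subtype.val he)⟩
    · rintro ⟨⟨b, hb, hxb⟩, hno⟩
      exact ⟨⟨b.1, hb, hxb⟩, fun c hc he => hno ⟨c, A.δ_mem a.1 a.2 hc⟩ hc (Subtype.ext he)⟩
  strict a h := hA.strict a.1 (upLT_toPosHypergraph.1 h)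
  linear_zero a b hne := by
    rw [upLT_toPosHypergraph, upLT_toPosHypergraph]
    exact hA.linear_zero a.1 a.2 b.1 b.2 fun h => hne (Subtype.ext h)
  disjoint a b := by
    rw [upLT_toPosHypergraph, upLT_toPosHypergraph]
    rintro ⟨h | h, h'⟩
    · have := hA.disjoint a.1 a.2 b.1 b.2 (lowLT_toPosHypergraph h)
      exact h'.elim this.1 this.2
    · have := hA.disjoint b.1 b.2 a.1 a.2 (lowLT_toPosHypergraph h)
      exact h'.elim this.2 this.1
  pencil_γ x a b ha hb hne := by
    rw [upLT_toPosHypergraph, upLT_toPosHypergraph]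
    exact hA.pencil_γ a.1 a.2 b.1 b.2 (congrArg Subtype.val (ha.symm.trans hb))
      fun h => hne (Subtype.ext h)
  pencil_δ x a b ha hb hne := by
    rw [upLT_toPosHypergraph, upLT_toPosHypergraph]
    exact hA.pencil_δ x.1 a.1 a.2 b.1 b.2 ha hb fun h => hne (Subtype.ext h)
  size_le_one k := by
    rw [PosHypergraph.size, Set.ncard_le_one_iff]
    intro a b ha hb
    simp only [Set.mem_sdiff, Set.mem_univ, Set.mem_iUnion, not_exists, true_and] at ha hb
    exact Subtype.ext (hA.size a.1 a.2 b.1 b.2 (fun α hα h => ha ⟨α, hα⟩ h)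
      fun α hα h => hb ⟨α, hα⟩ h)

namespace IsTreelike

/-- The nodes of the tree of the faces in the domain of `X`. -/
lemma node_cases (hS : S.IsTreelike) {n : ℕ} {X : S.F (n + 2)} {b : S.F (n + 1)} {x : S.F n}
    (hb : b ∈ S.bd X) (hx : x ∈ S.bd b) : x ∈ S.δ (S.γ X) ∨ ∃ c ∈ S.δ X, S.γ c = x := by
  rcases hb with rfl | hb
  · rcases hx with rfl | hx
    · obtain ⟨c, hc, he⟩ := (hS.glob_γ X ▸ Set.mem_singleton _ :
        S.γ (S.γ X) ∈ (S.γ '' S.δ X) \ _).1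
      exact Or.inr ⟨c, hc, he⟩
    · exact Or.inl hx
  · rcases hx with rfl | hx
    · exact Or.inr ⟨b, hb, rfl⟩
    · by_cases h : ∃ c ∈ S.δ X, S.γ c = x
      · exact Or.inr h
      · rw [hS.glob_δ]
        refine Or.inl ⟨?_, h⟩
        simp only [Set.mem_iUnion]
        exact ⟨b, hb, hx⟩

lemma exists_of_mem_δγ (hS : S.IsTreelike) {n : ℕ} {X : S.F (n + 2)} {x : S.F n}
    (hx : x ∈ S.δ (S.γ X)) : ∃ c ∈ S.δ X, x ∈ S.δ c := by
  rw [hS.glob_δ] at hx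
  simpa only [Set.mem_iUnion, exists_prop] using hx.1

lemma γ_ne_of_mem_δγ (hS : S.IsTreelike) {n : ℕ} {X : S.F (n + 2)} {x : S.F n}
    (hx : x ∈ S.δ (S.γ X)) {c : S.F (n + 1)} (hc : c ∈ S.δ X) : S.γ c ≠ x := by
  rw [hS.glob_δ] at hx
  exact fun h => hx.2 ⟨c, hc, h⟩

lemma exists_γγ (hS : S.IsTreelike) {n : ℕ} (X : S.F (n + 2)) :
    ∃ c ∈ S.δ X, S.γ c = S.γ (S.γ X) :=
  (hS.glob_γ X ▸ Set.mem_singleton _ : S.γ (S.γ X) ∈ (S.γ '' S.δ X) \ _).1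

lemma γγ_notMem (hS : S.IsTreelike) {n : ℕ} {X : S.F (n + 2)} {c : S.F (n + 1)}
    (hc : c ∈ S.δ X) : S.γ (S.γ X) ∉ S.δ c := by
  intro h
  refine (hS.glob_γ X ▸ Set.mem_singleton _ : S.γ (S.γ X) ∈ (S.γ '' S.δ X) \ _).2 ?_
  simp only [Set.mem_iUnion]
  exact ⟨c, hc, h⟩

lemma γ_eq_γγ_or (hS : S.IsTreelike) {n : ℕ} {X : S.F (n + 2)} {c : S.F (n + 1)}
    (hc : c ∈ S.δ X) : S.γ c = S.γ (S.γ X) ∨ ∃ c' ∈ S.δ X, S.γ c ∈ S.δ c' := by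
  by_cases h : ∃ c' ∈ S.δ X, S.γ c ∈ S.δ c'
  · exact Or.inr h
  · left
    have : S.γ c ∈ ({S.γ (S.γ X)} : Set (S.F n)) := by
      rw [hS.glob_γ X]
      refine ⟨⟨c, hc, rfl⟩, ?_⟩
      simpa only [Set.mem_iUnion, exists_prop] using h
    exact this

lemma wf_step (hS : S.IsTreelike) {n : ℕ} (X : S.F (n + 2)) :
    WellFounded (Relation.TransGen (TreeStep X)) := by
  have : Std.Irrefl (Relation.TransGen (TreeStep X)) := ⟨hS.acyclic X⟩
  have : IsTrans _ (Relation.TransGen (TreeStep X)) := ⟨fun _ _ _ => Relation.TransGen.trans⟩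
  exact Finite.wellFounded_of_trans_of_irrefl _

lemma wf_step' (hS : S.IsTreelike) {n : ℕ} (X : S.F (n + 2)) :
    WellFounded (fun a b => Relation.TransGen (TreeStep X) b a) := by
  have : Std.Irrefl (fun a b => Relation.TransGen (TreeStep X) b a) := ⟨hS.acyclic X⟩
  have : IsTrans _ (fun a b => Relation.TransGen (TreeStep X) b a) :=
    ⟨fun _ _ _ h h' => Relation.TransGen.trans h' h⟩
  exact Finite.wellFounded_of_trans_of_irrefl _

/-- All nodes lie below the root. -/
lemma le_root (hS : S.IsTreelike) {n : ℕ} (X : S.F (n + 2)) {x : S.F n}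
    (hx : ∃ b ∈ S.bd X, x ∈ S.bd b) :
    Relation.ReflTransGen (TreeStep X) x (S.γ (S.γ X)) := by
  induction x using (hS.wf_step' X).induction with
  | _ x ih =>
    have key : ∀ c ∈ S.δ X, x ∈ S.δ c → Relation.ReflTransGen (TreeStep X) x (S.γ (S.γ X)) :=
      fun c hc hxc => Relation.ReflTransGen.head ⟨c, hc, hxc, rfl⟩
        (ih _ (Relation.TransGen.single ⟨c, hc, hxc, rfl⟩)
          ⟨c, mem_bd_of_mem_δ hc, γ_mem_bd c⟩)
    obtain ⟨b, hb, hxb⟩ := hx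
    rcases hS.node_cases hb hxb with h | ⟨c, hc, rfl⟩
    · obtain ⟨c, hc, hxc⟩ := hS.exists_of_mem_δγ h
      exact key c hc hxc
    · rcases hS.γ_eq_γγ_or hc with h | ⟨c', hc', h⟩
      · rw [h]
      · exact key c' hc' h

lemma lt_root (hS : S.IsTreelike) {n : ℕ} {X : S.F (n + 2)} {x : S.F n}
    (hx : x ∈ S.δ (S.γ X)) : Relation.TransGen (TreeStep X) x (S.γ (S.γ X)) := by
  refine (Relation.reflTransGen_iff_eq_or_transGen.1
    (hS.le_root X ⟨_, γ_mem_bd X, mem_bd_of_mem_δ hx⟩)).resolve_left fun h => ?_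
  obtain ⟨c, hc, hxc⟩ := hS.exists_of_mem_δγ hx
  rw [← h] at hxc
  exact hS.γγ_notMem hc hxc

lemma step_unique (hS : S.IsTreelike) {n : ℕ} {X : S.F (n + 2)} {x y z : S.F n}
    (h : TreeStep X x y) (h' : TreeStep X x z) : y = z := by
  obtain ⟨c, hc, hx, rfl⟩ := h
  obtain ⟨c', hc', hx', rfl⟩ := h'
  rw [hS.disj_δ X hc hc' hx hx']

/-- Domains of distinct faces of `δ X` are disjoint, so every node has at most one successor. -/
lemma total_of_ge (hS : S.IsTreelike) {n : ℕ} {X : S.F (n + 2)} {x y z : S.F n}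
    (h : Relation.ReflTransGen (TreeStep X) x y) (h' : Relation.ReflTransGen (TreeStep X) x z) :
    Relation.ReflTransGen (TreeStep X) y z ∨ Relation.ReflTransGen (TreeStep X) z y :=
  Relation.ReflTransGen.total_of_right_unique (fun _ _ _ => hS.step_unique) h h'

/-- Sources of a node are sources of leaves below it, and similarly for targets. -/
lemma exists_leaf_γ (hS : S.IsTreelike) {n : ℕ} {X : S.F (n + 3)} {x : S.F (n + 1)}
    (hx : ∃ b ∈ S.bd X, x ∈ S.bd b) : ∃ l ∈ S.δ (S.γ X),
      Relation.ReflTransGen (TreeStep X) l x ∧ S.γ l = S.γ x := by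
  induction x using (hS.wf_step X).induction with
  | _ x ih =>
    obtain ⟨b, hb, hxb⟩ := hx
    rcases hS.node_cases hb hxb with h | ⟨c, hc, rfl⟩
    · exact ⟨x, h, Relation.ReflTransGen.refl, rfl⟩
    · obtain ⟨d, hd, he⟩ := hS.exists_γγ c
      obtain ⟨l, hl, hle, hlγ⟩ := ih d (Relation.TransGen.single ⟨c, hc, hd, rfl⟩)
        ⟨c, mem_bd_of_mem_δ hc, mem_bd_of_mem_δ hd⟩
      exact ⟨l, hl, hle.tail ⟨c, hc, hd, rfl⟩, hlγ.trans he⟩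

lemma exists_leaf_δ (hS : S.IsTreelike) {n : ℕ} {X : S.F (n + 3)} {x : S.F (n + 1)} {z : S.F n}
    (hx : ∃ b ∈ S.bd X, x ∈ S.bd b) (hz : z ∈ S.δ x) : ∃ l ∈ S.δ (S.γ X),
      Relation.ReflTransGen (TreeStep X) l x ∧ z ∈ S.δ l := by
  induction x using (hS.wf_step X).induction with
  | _ x ih =>
    obtain ⟨b, hb, hxb⟩ := hx
    rcases hS.node_cases hb hxb with h | ⟨c, hc, rfl⟩
    · exact ⟨x, h, Relation.ReflTransGen.refl, hz⟩
    · obtain ⟨d, hd, hzd⟩ := hS.exists_of_mem_δγ hz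
      obtain ⟨l, hl, hle, hlγ⟩ := ih d (Relation.TransGen.single ⟨c, hc, hd, rfl⟩)
        ⟨c, mem_bd_of_mem_δ hc, mem_bd_of_mem_δ hd⟩ hzd
      exact ⟨l, hl, hle.tail ⟨c, hc, hd, rfl⟩, hlγ⟩

lemma node_of_lt {n : ℕ} {X : S.F (n + 2)} {x y : S.F n}
    (h : Relation.TransGen (TreeStep X) x y) :
    (∃ b ∈ S.bd X, x ∈ S.bd b) ∧ ∃ b ∈ S.bd X, y ∈ S.bd b := by
  constructor
  · obtain ⟨_, ⟨c, hc, hx, -⟩, -⟩ := Relation.TransGen.head'_iff.1 h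
    exact ⟨c, mem_bd_of_mem_δ hc, mem_bd_of_mem_δ hx⟩
  · obtain ⟨_, -, c, hc, -, rfl⟩ := Relation.TransGen.tail'_iff.1 h
    exact ⟨c, mem_bd_of_mem_δ hc, γ_mem_bd c⟩

/-- The codomain of a leaf below `b` is `γ b` or a source of another leaf below `b`. -/
lemma γ_leaf (hS : S.IsTreelike) {n : ℕ} {X : S.F (n + 3)} {l b : S.F (n + 1)}
    (hlb : Relation.ReflTransGen (TreeStep X) l b) : S.γ l = S.γ b ∨
      ∃ l' ∈ S.δ (S.γ X), Relation.ReflTransGen (TreeStep X) l' b ∧ S.γ l ∈ S.δ l' := by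
  induction hlb with
  | refl => exact Or.inl rfl
  | tail h hs ih =>
    rcases ih with ih | ⟨l', hl', hle, hm⟩
    · obtain ⟨c, hc, hbc, rfl⟩ := hs
      rcases hS.γ_eq_γγ_or hbc with he | ⟨d, hd, hm⟩
      · exact Or.inl (ih.trans he)
      · obtain ⟨l', hl', hle, hm'⟩ := hS.exists_leaf_δ
          ⟨c, mem_bd_of_mem_δ hc, mem_bd_of_mem_δ hd⟩ hm
        rw [ih]
        exact Or.inr ⟨l', hl', hle.tail ⟨c, hc, hd, rfl⟩, hm'⟩
    · exact Or.inr ⟨l', hl', hle.tail hs, hm⟩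

/-- Two children of `z` above a common leaf are comparable. If they differ, the path from one to the
other leads through `z`, which closes a cycle. -/
lemma eq_of_step_of_step (hS : S.IsTreelike) {n : ℕ} {X : S.F (n + 2)} {l x y z : S.F n}
    (hx : TreeStep X x z) (hy : TreeStep X y z) (hlx : Relation.ReflTransGen (TreeStep X) l x)
    (hly : Relation.ReflTransGen (TreeStep X) l y) : x = y := by
  have key : ∀ {x y}, TreeStep X x z → TreeStep X y z →
      Relation.ReflTransGen (TreeStep X) x y → x = y := by
    intro x y hx hy h
    rcases Relation.ReflTransGen.cases_head h with h | ⟨w, hw, h⟩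
    · exact h
    · obtain rfl := hS.step_unique hx hw
      exact (hS.acyclic X _ (Relation.TransGen.tail' h hy)).elim
  rcases hS.total_of_ge hlx hly with h | h
  · exact key hx hy h
  · exact (key hy hx h).symm

/-- Leaves have disjoint domains, so at most one leaf has `γ l` as a source. By `γ_leaf` it lies
under the child of the new node through which `l` was reached, and `γ l` would be a source of that
child already. -/
lemma γ_leaf_notMem (hS : S.IsTreelike) {n : ℕ} {X : S.F (n + 3)} {l b : S.F (n + 1)}
    (hlb : Relation.ReflTransGen (TreeStep X) l b) : S.γ l ∉ S.δ b := by
  induction hlb with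
  | refl => exact hS.γ_notMem l
  | tail h hs ih =>
    rename_i d b
    intro hz
    obtain ⟨c, hc, hdc, rfl⟩ := hs
    rcases hS.γ_leaf h with he | ⟨l', hl', hle, hm⟩
    · exact hS.γ_ne_of_mem_δγ hz hdc he.symm
    · obtain ⟨d', hd', hzd'⟩ := hS.exists_of_mem_δγ hz
      obtain ⟨l'', hl'', hle'', hm''⟩ := hS.exists_leaf_δ
        ⟨c, mem_bd_of_mem_δ hc, mem_bd_of_mem_δ hd'⟩ hzd'
      obtain rfl := hS.disj_δ _ hl' hl'' hm hm''
      obtain rfl := hS.eq_of_step_of_step ⟨c, hc, hdc, rfl⟩ ⟨c, hc, hd', rfl⟩ hle hle''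
      exact ih hzd'

/-- Convexity of the faces below `b`. -/
lemma lt_of_γ_mem_δ (hS : S.IsTreelike) {n : ℕ} {X : S.F (n + 3)} {c b d : S.F (n + 1)}
    (hcb : Relation.TransGen (TreeStep X) c b) (hd : ∃ e ∈ S.bd X, d ∈ S.bd e)
    (hcd : S.γ c ∈ S.δ d) : Relation.TransGen (TreeStep X) d b ∨ S.γ c = S.γ b := by
  obtain ⟨l, hl, hlc, hle⟩ := hS.exists_leaf_γ (node_of_lt hcb).1
  have hlb := hlc.trans hcb.to_reflTransGen
  rw [← hle] at hcd ⊢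
  rcases hS.γ_leaf hlb with h | ⟨l', hl', hl'b, hm⟩
  · exact Or.inr h
  obtain ⟨l'', hl'', hl''d, hm''⟩ := hS.exists_leaf_δ hd hcd
  obtain rfl := hS.disj_δ _ hl' hl'' hm hm''
  have hbd : ¬ Relation.ReflTransGen (TreeStep X) b d := fun h =>
    hS.γ_leaf_notMem (hlb.trans h) hcd
  -- The leaf with `γ l` as a source lies below both `b` and `d`, which makes them comparable; `b ≤
  -- d` was just excluded.
  rcases hS.total_of_ge hl'b hl''d with h | h
  · exact (hbd h).elim
  · rcases Relation.reflTransGen_iff_eq_or_transGen.1 h with rfl | h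
    · exact (hbd h).elim
    · exact Or.inl h

/-! ### The sub-hypergraph generated by a face -/

lemma bd_bd_bd (hS : S.IsTreelike) {n : ℕ} {X : S.F (n + 3)} {b : S.F (n + 2)} {c : S.F (n + 1)}
    {d : S.F n} (hb : b ∈ S.bd X) (hc : c ∈ S.bd b) (hd : d ∈ S.bd c) :
    ∃ c' ∈ S.bd (S.γ X), d ∈ S.bd c' := by
  rcases hd with rfl | hd
  · obtain ⟨l, hl, -, he⟩ := hS.exists_leaf_γ ⟨b, hb, hc⟩
    exact ⟨l, mem_bd_of_mem_δ hl, Or.inl he.symm⟩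
  · obtain ⟨l, hl, -, he⟩ := hS.exists_leaf_δ ⟨b, hb, hc⟩ hd
    exact ⟨l, mem_bd_of_mem_δ hl, Or.inr he⟩

end IsTreelike

lemma occurs_one {n : ℕ} {X : S.F (n + 1)} {y : S.F n} : Occurs X y ↔ y ∈ S.bd X := by
  constructor
  · intro h
    obtain ⟨b, hb, hy⟩ := h.head le_rfl
    rwa [hy.eq]
  · exact Occurs.refl.bd

lemma occurs_two {n : ℕ} {X : S.F (n + 2)} {y : S.F n} :
    Occurs X y ↔ ∃ b ∈ S.bd X, y ∈ S.bd b := by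
  constructor
  · intro h
    obtain ⟨b, hb, hy⟩ := h.head (by omega)
    exact ⟨b, hb, occurs_one.1 hy⟩
  · rintro ⟨b, hb, hy⟩
    exact (Occurs.refl.bd hb).bd hy

/-- Leaves of the tree of `X` carry all sources and targets of its nodes. This reduces questions
about faces of codimension at least three to `γ X`. -/
lemma IsTreelike.occurs_γ (hS : S.IsTreelike) {n j : ℕ} {X : S.F (n + 3)} {y : S.F j}
    (hj : j ≤ n) : Occurs X y ↔ Occurs (S.γ X) y := by
  constructor
  · intro h
    obtain ⟨b, hb, h⟩ := h.head (by omega)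
    obtain ⟨c, hc, h⟩ := h.head (by omega)
    obtain ⟨d, hd, h⟩ := h.head (by omega)
    obtain ⟨c', hc', hd'⟩ := hS.bd_bd_bd hb hc hd
    exact ((Occurs.refl.bd hc').bd hd').trans h
  · exact (Occurs.refl.bd (γ_mem_bd X)).trans

lemma RUp.mono {A B : S.Sub} {k : ℕ} {a b : S.F k}
    (h : ∀ α ∈ A.carrier (k + 1), α ∈ B.carrier (k + 1)) (hab : RUp A a b) : RUp B a b :=
  Relation.TransGen.mono (fun _ _ ⟨α, hα, h'⟩ => ⟨α, h α hα, h'⟩) _ _ hab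

lemma RLow.mono {A B : S.Sub} {k : ℕ} {a b : S.F (k + 1)}
    (h : ∀ α ∈ A.carrier (k + 1), α ∈ B.carrier (k + 1)) (hab : RLow A a b) : RLow B a b :=
  Relation.TransGen.mono (fun _ _ ⟨hα, h'⟩ => ⟨h _ hα, h'⟩) _ _ hab

lemma not_rUp {n k : ℕ} {X : S.F n} (hk : n ≤ k) {a b : S.F k} : ¬ RUp (gen X) a b := by
  intro h
  obtain ⟨_, -, α, hα, -⟩ := Relation.TransGen.tail'_iff.1 h
  have := (mem_gen_iff.1 hα).le
  omega

lemma RUp.of_δ {n : ℕ} {X : S.F (n + 1)} {a : S.F n} (h : a ∈ S.δ X) :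
    RUp (gen X) a (S.γ X) :=
  Relation.TransGen.single ⟨X, mem_gen_iff.2 Occurs.refl, h, rfl⟩

lemma RUp.of_step {n : ℕ} {X : S.F (n + 2)} {a b : S.F n}
    (h : Relation.TransGen (TreeStep X) a b) : RUp (gen X) a b :=
  Relation.TransGen.mono (fun _ _ ⟨c, hc, h'⟩ =>
    ⟨c, mem_gen_iff.2 (occurs_one.2 (mem_bd_of_mem_δ hc)), h'⟩) _ _ h

lemma RUp.of_reflTransGen {n : ℕ} {X : S.F (n + 2)} {a b : S.F n}
    (h : Relation.ReflTransGen (TreeStep X) a b ∨ Relation.ReflTransGen (TreeStep X) b a)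
    (hne : a ≠ b) : RUp (gen X) a b ∨ RUp (gen X) b a := by
  rcases h with h | h
  · exact Or.inl (RUp.of_step
      ((Relation.reflTransGen_iff_eq_or_transGen.1 h).resolve_left hne.symm))
  · exact Or.inr (RUp.of_step ((Relation.reflTransGen_iff_eq_or_transGen.1 h).resolve_left hne))

namespace IsTreelike

lemma rUp_one (hS : S.IsTreelike) {n : ℕ} {X : S.F (n + 1)} {a b : S.F n} (h : RUp (gen X) a b) :
    a ∈ S.δ X ∧ b = S.γ X := by
  induction h with
  | single h =>
    obtain ⟨α, hα, ha, rfl⟩ := h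
    obtain rfl := (mem_gen_iff.1 hα).eq
    exact ⟨ha, rfl⟩
  | tail _ h ih =>
    obtain ⟨α, hα, ha, rfl⟩ := h
    obtain rfl := (mem_gen_iff.1 hα).eq
    rw [ih.2] at ha
    exact (hS.γ_notMem _ ha).elim

lemma rUp_two (hS : S.IsTreelike) {n : ℕ} {X : S.F (n + 2)} {a b : S.F n} (h : RUp (gen X) a b) :
    Relation.TransGen (TreeStep X) a b := by
  have key : ∀ a b, (∃ α ∈ (gen X).carrier (n + 1), a ∈ S.δ α ∧ S.γ α = b) →
      Relation.TransGen (TreeStep X) a b := by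
    rintro a b ⟨α, hα, ha, rfl⟩
    rcases occurs_one.1 (mem_gen_iff.1 hα) with rfl | hα
    · exact hS.lt_root ha
    · exact Relation.TransGen.single ⟨α, hα, ha, rfl⟩
  induction h with
  | single h => exact key _ _ h
  | tail _ h ih => exact ih.trans (key _ _ h)

/-- Only witnesses of codimension two need care. Such a witness is a leaf, which belongs to `γ X`,
or the codomain of some `c ∈ δ X`; in that case its step is replaced by a path in the tree of `c`,
whose edges are lower nodes of the tree of `X`. -/
lemma rUp_γ (hS : S.IsTreelike) {n k : ℕ} (hk : k ≤ n) {X : S.F (n + 3)} {a b : S.F k} :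
    RUp (gen X) a b ↔ RUp (gen (S.γ X)) a b := by
  refine ⟨fun h => ?_, RUp.mono fun α hα =>
    mem_gen_iff.2 ((Occurs.refl.bd (γ_mem_bd X)).trans (mem_gen_iff.1 hα))⟩
  rcases hk.lt_or_eq with hk | rfl
  · exact h.mono fun α hα => mem_gen_iff.2 ((hS.occurs_γ hk).1 (mem_gen_iff.1 hα))
  · have key : ∀ α : S.F (k + 1), (∃ b ∈ S.bd X, α ∈ S.bd b) → ∀ a ∈ S.δ α,
        RUp (gen (S.γ X)) a (S.γ α) := by
      intro α
      induction α using (hS.wf_step X).induction with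
      | _ α ih =>
        rintro ⟨b, hb, hα⟩ a ha
        rcases hS.node_cases hb hα with h | ⟨c, hc, rfl⟩
        · exact Relation.TransGen.single
            ⟨α, mem_gen_iff.2 (occurs_one.2 (mem_bd_of_mem_δ h)), ha, rfl⟩
        · have hlt := hS.lt_root ha
          refine Relation.TransGen.trans_induction_on (motive := fun {x y} _ =>
            RUp (gen (S.γ X)) x y) hlt ?_ fun _ _ h h' => h.trans h'
          rintro x y ⟨d, hd, hx, rfl⟩
          exact ih d (Relation.TransGen.single ⟨c, hc, hd, rfl⟩)
            ⟨c, mem_bd_of_mem_δ hc, mem_bd_of_mem_δ hd⟩ x hx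
    refine Relation.TransGen.trans_induction_on (motive := fun {x y} _ =>
      RUp (gen (S.γ X)) x y) h ?_ fun _ _ h h' => h.trans h'
    rintro x y ⟨α, hα, hx, rfl⟩
    exact key α (occurs_two.1 (mem_gen_iff.1 hα)) x hx

lemma γ_le_γ (hS : S.IsTreelike) {n : ℕ} {X : S.F (n + 3)} {a b : S.F (n + 1)}
    (h : Relation.TransGen (TreeStep X) a b) :
    S.γ a = S.γ b ∨ RUp (gen X) (S.γ a) (S.γ b) := by
  refine Relation.TransGen.trans_induction_on (motive := fun {x y} _ =>
    S.γ x = S.γ y ∨ RUp (gen X) (S.γ x) (S.γ y)) h ?_ ?_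
  · rintro x y ⟨c, hc, hx, rfl⟩
    rcases Relation.reflTransGen_iff_eq_or_transGen.1
      (hS.le_root c ⟨x, mem_bd_of_mem_δ hx, γ_mem_bd x⟩) with h | h
    · exact Or.inl h.symm
    · exact Or.inr (Relation.TransGen.mono (fun _ _ ⟨d, hd, h'⟩ =>
        ⟨d, mem_gen_iff.2 (occurs_two.2 ⟨c, mem_bd_of_mem_δ hc, mem_bd_of_mem_δ hd⟩), h'⟩) _ _ h)
  · rintro x y z - - (h | h) (h' | h')
    · exact Or.inl (h.trans h')
    · rw [h]; exact Or.inr h'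
    · rw [← h']; exact Or.inr h
    · exact Or.inr (h.trans h')

lemma rUp_of_rLow {n k : ℕ} {X : S.F n} {a b : S.F (k + 1)} (h : RLow (gen X) a b) :
    RUp (gen X) (S.γ a) (S.γ b) :=
  Relation.TransGen.lift S.γ (fun _ b ⟨hb, h'⟩ => ⟨b, hb, h', rfl⟩) _ _ h

lemma strict_gen (hS : S.IsTreelike) {N : ℕ} (X : S.F N) {k : ℕ} (a : S.F k) :
    ¬ RUp (gen X) a a := by
  induction N with
  | zero => exact not_rUp (by omega)
  | succ n ih =>
    rcases (by omega : n + 1 ≤ k ∨ k = n ∨ k + 1 = n ∨ k + 2 ≤ n) with h | rfl | rfl | h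
    · exact not_rUp h
    · intro h
      obtain ⟨h₁, rfl⟩ := hS.rUp_one h
      exact hS.γ_notMem _ h₁
    · exact fun h => hS.acyclic X a (hS.rUp_two h)
    · obtain ⟨m, rfl⟩ : ∃ m, n = m + 2 := ⟨n - 2, by omega⟩
      rw [hS.rUp_γ (by omega)]
      exact ih _

/-- The essential case is codimension two. Along a lower chain ending in `b`, convexity
(`lt_of_γ_mem_δ`) keeps every face strictly below `b` in the tree, until `b` is below itself. In the
other direction `γ` is monotone for the upper order and strictly monotone for the lower one. -/
lemma disjoint_gen (hS : S.IsTreelike) {N : ℕ} (X : S.F N) {k : ℕ} (a b : S.F (k + 1))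
    (ha : Occurs X a) (hb : Occurs X b) (hab : RLow (gen X) a b) :
    ¬ RUp (gen X) a b ∧ ¬ RUp (gen X) b a := by
  induction N with
  | zero => exact ⟨not_rUp (by omega), not_rUp (by omega)⟩
  | succ n ih =>
    rcases (by omega : n + 1 ≤ k + 1 ∨ k + 1 = n ∨ k + 2 = n ∨ k + 3 ≤ n) with h | rfl | rfl | h
    · exact ⟨not_rUp h, not_rUp h⟩
    · constructor
      · intro h
        obtain ⟨h₁, rfl⟩ := hS.rUp_one h
        obtain ⟨c, hc, -, hm⟩ := Relation.TransGen.tail'_iff.1 hab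
        have hcX : Occurs X c := by
          rcases Relation.reflTransGen_iff_eq_or_transGen.1 hc with rfl | hc
          · exact ha
          · obtain ⟨_, -, h, -⟩ := Relation.TransGen.tail'_iff.1 hc
            exact mem_gen_iff.1 h
        rcases occurs_one.1 hcX with rfl | hc
        · exact hS.γ_notMem _ hm
        · exact hS.γ_ne_of_mem_δγ hm hc rfl
      · intro h
        obtain ⟨h₁, rfl⟩ := hS.rUp_one h
        obtain ⟨c, ⟨hc, hm⟩, -⟩ := Relation.TransGen.head'_iff.1 hab
        rcases occurs_one.1 (mem_gen_iff.1 hc) with rfl | hc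
        · exact hS.γ_notMem _ hm
        · exact hS.γγ_notMem hc hm
    · constructor
      · refine fun h => absurd (hS.rUp_two h) ?_
        clear h ih
        induction hab using Relation.TransGen.head_induction_on with
        | single h =>
          intro hlt
          rcases hS.lt_of_γ_mem_δ hlt (occurs_two.1 hb) h.2 with h' | h'
          · exact hS.acyclic X _ h'
          · have := h.2
            rw [h'] at this
            exact hS.γ_notMem _ this
        | head h hcb ih' =>
          intro hlt
          rcases hS.lt_of_γ_mem_δ hlt (occurs_two.1 (mem_gen_iff.1 h.1)) h.2 with h' | h'
          · exact ih' (mem_gen_iff.1 h.1) h'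
          · have := rUp_of_rLow (Relation.TransGen.head h hcb)
            rw [h'] at this
            exact hS.strict_gen X _ this
      · intro h
        have h₁ := rUp_of_rLow hab
        rcases hS.γ_le_γ (hS.rUp_two h) with h₂ | h₂
        · rw [h₂] at h₁
          exact hS.strict_gen X _ h₁
        · exact hS.strict_gen X _ (h₁.trans h₂)
    · obtain ⟨m, rfl⟩ : ∃ m, n = m + 2 := ⟨n - 2, by omega⟩
      rw [hS.rUp_γ (by omega), hS.rUp_γ (by omega)]
      exact ih _ ((hS.occurs_γ (by omega)).1 ha) ((hS.occurs_γ (by omega)).1 hb)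
        (hab.mono fun α hα => mem_gen_iff.2 ((hS.occurs_γ (by omega)).1 (mem_gen_iff.1 hα)))

/-- In codimension two, leaves with the same codomain coincide. Hence both faces lie above one leaf
and are comparable in the tree; the next lemma uses common sources in the same way. -/
lemma pencil_γ_gen (hS : S.IsTreelike) {N : ℕ} (X : S.F N) {k : ℕ} (a b : S.F (k + 1))
    (ha : Occurs X a) (hb : Occurs X b) (hab : S.γ a = S.γ b) (hne : a ≠ b) :
    RUp (gen X) a b ∨ RUp (gen X) b a := by
  induction N with
  | zero => have := ha.le; omega
  | succ n ih =>
    have := ha.le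
    rcases (by omega : k = n ∨ k + 1 = n ∨ k + 2 = n ∨ k + 3 ≤ n) with rfl | rfl | rfl | h
    · exact absurd (ha.eq.trans hb.eq.symm) hne
    · rcases occurs_one.1 ha with rfl | ha
      · rcases occurs_one.1 hb with rfl | hb
        · exact absurd rfl hne
        · exact Or.inr (RUp.of_δ hb)
      · rcases occurs_one.1 hb with rfl | hb
        · exact Or.inl (RUp.of_δ ha)
        · exact absurd (hS.inj_γ X ha hb hab) hne
    · obtain ⟨l, hl, hla, he⟩ := hS.exists_leaf_γ (occurs_two.1 ha)
      obtain ⟨l', hl', hlb, he'⟩ := hS.exists_leaf_γ (occurs_two.1 hb)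
      obtain rfl := hS.inj_γ _ hl hl' (he.trans (hab.trans he'.symm))
      exact RUp.of_reflTransGen (hS.total_of_ge hla hlb) hne
    · obtain ⟨m, rfl⟩ : ∃ m, n = m + 2 := ⟨n - 2, by omega⟩
      rw [hS.rUp_γ (by omega), hS.rUp_γ (by omega)]
      exact ih _ ((hS.occurs_γ (by omega)).1 ha) ((hS.occurs_γ (by omega)).1 hb)

lemma pencil_δ_gen (hS : S.IsTreelike) {N : ℕ} (X : S.F N) {k : ℕ} (a b : S.F (k + 1)) {x : S.F k}
    (ha : Occurs X a) (hb : Occurs X b) (hxa : x ∈ S.δ a) (hxb : x ∈ S.δ b) (hne : a ≠ b) :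
    RUp (gen X) a b ∨ RUp (gen X) b a := by
  induction N with
  | zero => have := ha.le; omega
  | succ n ih =>
    have := ha.le
    rcases (by omega : k = n ∨ k + 1 = n ∨ k + 2 = n ∨ k + 3 ≤ n) with rfl | rfl | rfl | h
    · exact absurd (ha.eq.trans hb.eq.symm) hne
    · rcases occurs_one.1 ha with rfl | ha
      · rcases occurs_one.1 hb with rfl | hb
        · exact absurd rfl hne
        · exact Or.inr (RUp.of_δ hb)
      · rcases occurs_one.1 hb with rfl | hb
        · exact Or.inl (RUp.of_δ ha)
        · exact absurd (hS.disj_δ X ha hb hxa hxb) hne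
    · obtain ⟨l, hl, hla, he⟩ := hS.exists_leaf_δ (occurs_two.1 ha) hxa
      obtain ⟨l', hl', hlb, he'⟩ := hS.exists_leaf_δ (occurs_two.1 hb) hxb
      obtain rfl := hS.disj_δ _ hl hl' he he'
      exact RUp.of_reflTransGen (hS.total_of_ge hla hlb) hne
    · obtain ⟨m, rfl⟩ : ∃ m, n = m + 2 := ⟨n - 2, by omega⟩
      rw [hS.rUp_γ (by omega), hS.rUp_γ (by omega)]
      exact ih _ ((hS.occurs_γ (by omega)).1 ha) ((hS.occurs_γ (by omega)).1 hb)

lemma linear_zero_gen (hS : S.IsTreelike) {N : ℕ} (X : S.F N) (a b : S.F 0)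
    (ha : Occurs X a) (hb : Occurs X b) (hne : a ≠ b) :
    RUp (gen X) a b ∨ RUp (gen X) b a := by
  induction N with
  | zero => exact absurd (ha.eq.trans hb.eq.symm) hne
  | succ n ih =>
    rcases (by omega : n = 0 ∨ n = 1 ∨ 2 ≤ n) with rfl | rfl | h
    · rcases occurs_one.1 ha with rfl | ha
      · rcases occurs_one.1 hb with rfl | hb
        · exact absurd rfl hne
        · exact Or.inr (RUp.of_δ hb)
      · rcases occurs_one.1 hb with rfl | hb
        · exact Or.inl (RUp.of_δ ha)
        · exact absurd ((S.δ_zero X).unique ha hb) hne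
    · refine RUp.of_reflTransGen ?_ hne
      have h₁ := hS.le_root X (occurs_two.1 ha)
      have h₂ := hS.le_root X (occurs_two.1 hb)
      rw [← Relation.reflTransGen_swap] at h₁ h₂
      -- One-dimensional faces have a single source, so the tree of a two-dimensional face does not
      -- branch downwards and is a chain ending at the root.
      have hru : Relator.RightUnique (Function.swap (TreeStep X)) := by
        rintro x y z ⟨c, hc, hy, rfl⟩ ⟨c', hc', hz, he⟩
        obtain rfl := hS.inj_γ X hc hc' he.symm
        exact (S.δ_zero c).unique hy hz
      rcases Relation.ReflTransGen.total_of_right_unique hru h₁ h₂ with h | h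
      · exact Or.inr (Relation.reflTransGen_swap.1 h)
      · exact Or.inl (Relation.reflTransGen_swap.1 h)
    · obtain ⟨m, rfl⟩ : ∃ m, n = m + 2 := ⟨n - 2, by omega⟩
      rw [hS.rUp_γ (by omega), hS.rUp_γ (by omega)]
      exact ih _ ((hS.occurs_γ (by omega)).1 ha) ((hS.occurs_γ (by omega)).1 hb)

/-- A face in no domain has to be the codomain `γ X` in codimension one and the root `γγX` in
codimension two. -/
lemma size_gen (hS : S.IsTreelike) {N : ℕ} (X : S.F N) {k : ℕ} (a b : S.F k)
    (ha : Occurs X a) (hb : Occurs X b) (ha' : ∀ α : S.F (k + 1), Occurs X α → a ∉ S.δ α)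
    (hb' : ∀ α : S.F (k + 1), Occurs X α → b ∉ S.δ α) : a = b := by
  induction N with
  | zero =>
    obtain rfl : k = 0 := by have := ha.le; omega
    exact ha.eq.trans hb.eq.symm
  | succ n ih =>
    have := ha.le
    rcases (by omega : k = n + 1 ∨ k = n ∨ k + 1 = n ∨ k + 2 ≤ n) with rfl | rfl | rfl | h
    · exact ha.eq.trans hb.eq.symm
    · have key : ∀ a, Occurs X a → (∀ α : S.F (k + 1), Occurs X α → a ∉ S.δ α) → a = S.γ X :=
        fun a ha ha' => (occurs_one.1 ha).resolve_right (ha' X Occurs.refl)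
      rw [key a ha ha', key b hb hb']
    · have key : ∀ a, Occurs X a → (∀ α : S.F (k + 1), Occurs X α → a ∉ S.δ α) →
          a = S.γ (S.γ X) := by
        intro a ha ha'
        obtain ⟨c, hc, hac⟩ := occurs_two.1 ha
        rcases hS.node_cases hc hac with h | ⟨d, hd, rfl⟩
        · exact absurd h (ha' _ (occurs_one.2 (γ_mem_bd X)))
        · refine (hS.γ_eq_γγ_or hd).resolve_right ?_
          rintro ⟨e, he, hm⟩
          exact ha' e (occurs_one.2 (mem_bd_of_mem_δ he)) hm
      rw [key a ha ha', key b hb hb']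
    · obtain ⟨m, rfl⟩ : ∃ m, n = m + 2 := ⟨n - 2, by omega⟩
      have hmono : ∀ α : S.F (k + 1), Occurs (S.γ X) α → Occurs X α :=
        fun α => (Occurs.refl.bd (γ_mem_bd X)).trans
      exact ih (S.γ X) ((hS.occurs_γ (by omega)).1 ha) ((hS.occurs_γ (by omega)).1 hb)
        (fun α hα => ha' α (hmono α hα)) (fun α hα => hb' α (hmono α hα))

lemma exists_occurs_zero {N : ℕ} (X : S.F N) : ∃ a : S.F 0, Occurs X a := by
  induction N with
  | zero => exact ⟨X, Occurs.refl⟩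
  | succ n ih =>
    obtain ⟨a, ha⟩ := ih (S.γ X)
    exact ⟨a, (Occurs.refl.bd (γ_mem_bd X)).trans ha⟩

/-- Every face of a treelike hypergraph generates a positive opetope. -/
theorem isPositiveOpetope_gen (hS : S.IsTreelike) {N : ℕ} (X : S.F N) :
    (gen X).toPosHypergraph.IsPositiveOpetope := by
  have h : (gen X).IsOpetope :=
    { nonempty := by
        obtain ⟨a, ha⟩ := exists_occurs_zero X
        exact ⟨a, mem_gen_iff.2 ha⟩
      strict := hS.strict_gen X
      linear_zero := fun a ha b hb => hS.linear_zero_gen X a b (mem_gen_iff.1 ha) (mem_gen_iff.1 hb)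
      disjoint := fun a ha b hb => hS.disjoint_gen X a b (mem_gen_iff.1 ha) (mem_gen_iff.1 hb)
      pencil_γ := fun a ha b hb => hS.pencil_γ_gen X a b (mem_gen_iff.1 ha) (mem_gen_iff.1 hb)
      pencil_δ := fun x a ha b hb => hS.pencil_δ_gen X a b (mem_gen_iff.1 ha) (mem_gen_iff.1 hb)
      size := fun a ha b hb ha' hb' => hS.size_gen X a b (mem_gen_iff.1 ha) (mem_gen_iff.1 hb)
        (fun α hα => ha' α (mem_gen_iff.2 hα)) fun α hα => hb' α (mem_gen_iff.2 hα) }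
  exact h.isPositiveOpetope hS

end IsTreelike

end PosHypergraph

namespace PosHypergraph

variable {S : PosHypergraph.{u}}

/-! ## The cylinder is treelike -/

namespace IsOpetopicCardinal

/-- Extending a flag over a codomain keeps its sign, extending it over a domain face reverses it.
All exchanges of `lo` and `hi` below come from this. -/
lemma sgn_ext_γ {k : ℕ} {q : S.F (k + 1)} {f : S.Vec} (hf : f ∈ Fl (S.γ q)) :
    sgn (ext q f) (k + 1) = sgn f k := by
  rw [sgn, if_pos]
  · exact sgn_congr fun i hi => ext_of_le _ _ hi
  · rw [ext_top, ext_of_le _ _ le_rfl, hf.2, Option.map_some]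

lemma sgn_ext_δ (hS : S.IsOpetopicCardinal) {k : ℕ} {q : S.F (k + 1)} {p : S.F k} {f : S.Vec}
    (hf : f ∈ Fl p) (hp : p ∈ S.δ q) : sgn (ext q f) (k + 1) = - sgn f k := by
  rw [sgn, if_neg, sgn_congr (y := f) fun i hi => ext_of_le _ _ hi]
  rw [ext_top, ext_of_le _ _ le_rfl, hf.2, Option.map_some]
  intro h
  rw [Option.some.inj h] at hp
  exact hS.γ_notMem_δ q hp

lemma lo_ne_hi (hS : S.IsOpetopicCardinal) {k : ℕ} {q : S.F k} {h : S.Vec} (hh : h ∈ Fl q) :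
    lo q h ≠ hi q h := by
  have h₁ : h ∈ next q h := ⟨hh, Or.inl rfl⟩
  have h₂ : h ∉ prev q h := fun h' => hS.flagLT_irrefl _ h'.2
  rw [lo, hi]
  split_ifs
  · exact fun e => h₂ (e ▸ h₁)
  · exact fun e => h₂ (e ▸ h₁)

lemma rho_next (hS : S.IsOpetopicCardinal) {k : ℕ} {p : S.F k} {q : S.F (k + 1)}
    (hp : p ∈ S.bd q) {y f : S.Vec} (hf : f ∈ Fl p) (hy : ext q f = y) :
    rho p q (next q y) = next p f := by
  subst hy
  ext g
  constructor
  · rintro ⟨hg, -, h | h⟩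
    · refine ⟨hg, Or.inl (hg.1.ext hf.1 fun i hi => ?_)⟩
      have := congrFun h i
      rwa [ext_of_le _ _ hi, ext_of_le _ _ hi] at this
    · exact ⟨hg, Or.inr ((hS.flagLT_ext hg.1 hf.1).1 h)⟩
  · rintro ⟨hg, rfl | h⟩
    · exact ⟨hg, ext_mem hg hp, Or.inl rfl⟩
    · exact ⟨hg, ext_mem hg hp, Or.inr ((hS.flagLT_ext hg.1 hf.1).2 h)⟩

/-! ### Restrictions of the two cuts next to a flag -/

section Flags

variable {k : ℕ} {q : S.F (k + 1)} {f : S.Vec}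

lemma rho_lo_γ (hS : S.IsOpetopicCardinal) (hf : f ∈ Fl q) (hp : f k = some (S.γ q)) :
    rho (S.γ q) q (lo q f) = lo (S.γ q) (below (k + 1) f) := by
  have hg := below_mem hf.1 (by omega) hp
  have hs := sgn_ext_γ hg
  rw [ext_below hf] at hs
  rw [lo, lo, hs]
  split_ifs
  · exact hS.rho_prev (γ_mem_bd q) hg (ext_below hf)
  · exact hS.rho_next (γ_mem_bd q) hg (ext_below hf)

lemma rho_hi_γ (hS : S.IsOpetopicCardinal) (hf : f ∈ Fl q) (hp : f k = some (S.γ q)) :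
    rho (S.γ q) q (hi q f) = hi (S.γ q) (below (k + 1) f) := by
  have hg := below_mem hf.1 (by omega) hp
  have hs := sgn_ext_γ hg
  rw [ext_below hf] at hs
  rw [hi, hi, hs]
  split_ifs
  · exact hS.rho_next (γ_mem_bd q) hg (ext_below hf)
  · exact hS.rho_prev (γ_mem_bd q) hg (ext_below hf)

/-- The truncation has the opposite sign, so its high side is the low side of `f`. -/
lemma rho_lo_δ (hS : S.IsOpetopicCardinal) (hf : f ∈ Fl q) {p : S.F k} (hp : f k = some p)
    (hpq : p ∈ S.δ q) : rho p q (lo q f) = hi p (below (k + 1) f) := by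
  have hg := below_mem hf.1 (by omega) hp
  have hs := hS.sgn_ext_δ hg hpq
  rw [ext_below hf] at hs
  have hse := sgn_eq (below (k + 1) f) k
  have hpq' := mem_bd_of_mem_δ hpq
  rw [lo, hi, hs]
  split_ifs with h₁ h₂
  · omega
  · exact hS.rho_prev hpq' hg (ext_below hf)
  · exact hS.rho_next hpq' hg (ext_below hf)
  · omega

lemma rho_hi_δ (hS : S.IsOpetopicCardinal) (hf : f ∈ Fl q) {p : S.F k} (hp : f k = some p)
    (hpq : p ∈ S.δ q) : rho p q (hi q f) = lo p (below (k + 1) f) := by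
  have hg := below_mem hf.1 (by omega) hp
  have hs := hS.sgn_ext_δ hg hpq
  rw [ext_below hf] at hs
  have hse := sgn_eq (below (k + 1) f) k
  have hpq' := mem_bd_of_mem_δ hpq
  rw [lo, hi, hs]
  split_ifs with h₁ h₂
  · omega
  · exact hS.rho_next hpq' hg (ext_below hf)
  · exact hS.rho_prev hpq' hg (ext_below hf)
  · omega

/-- The two cuts differ by `f` only, and `f` is not a flag through `p`. -/
lemma rho_lo_eq_hi {p : S.F k} (hp : f k ≠ some p) : rho p q (lo q f) = rho p q (hi q f) := by
  have h : rho p q (prev q f) = rho p q (next q f) := by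
    ext g
    constructor
    · rintro ⟨hg, h₁, h₂⟩
      exact ⟨hg, h₁, Or.inr h₂⟩
    · rintro ⟨hg, h₁, rfl | h₂⟩
      · rw [ext_of_le _ _ le_rfl] at hp
        exact (hp hg.2).elim
      · exact ⟨hg, h₁, h₂⟩
  rw [lo, hi]
  split_ifs
  · exact h
  · exact h.symm

/-- The cut on the high side separates `f` from its flip at the high level, so it inserts their
common lower part. -/
lemma ins_hi_iff (hS : S.IsOpetopicCardinal) (hf : f ∈ Fl q) {h : S.Vec} :
    Ins q (hi q f) h ↔ h = below k f := by
  have key : ∃ x y, Adj q x y ∧ Flip (k + 1) k x y ∧ x ∈ hi q f ∧ y ∉ hi q f ∧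
      below k x = below k f := by
    obtain ⟨y, hy⟩ := hS.exists_flip hf.1 (i := k) (by omega)
    have hyq : y (k + 1) = some q := by rw [hy.2.2.1 _ (by omega), hf.2]
    have hs := hS.flip_sgn hy (by omega) (j := k + 1) (by omega)
    have hse := sgn_eq f (k + 1)
    rw [hi]
    split_ifs with h₁
    · have hadj := hS.high_adj hy hf.2 h₁
      rw [← hS.prev_eq_next hadj]
      exact ⟨f, y, hadj, hy, ⟨hf, hadj.2.2.1⟩, fun h => hS.flagLT_irrefl _ h.2, rfl⟩
    · have hadj := hS.high_adj hy.symm hyq (by omega)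
      refine ⟨y, f, hadj, hy.symm, ⟨hadj.1, hadj.2.2.1⟩, fun h => hS.flagLT_irrefl _ h.2, ?_⟩
      funext j
      unfold PosHypergraph.below
      split_ifs with hj
      · exact hy.2.2.1 j (by omega)
      · rfl
  obtain ⟨x, y, hadj, hfl, hx, hy, he⟩ := key
  constructor
  · rintro ⟨x', y', hadj', -, hx', hy', rfl⟩
    rw [(hS.straddle_unique (hS.isLower_hi q f) hadj' hx' hy' hadj hx hy).1, he]
  · rintro rfl
    exact ⟨x, y, hadj, hfl, hx, hy, he.symm⟩

/-- If a flag were inserted, the pair around the cut would consist of a flag of sign `+1` followed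
by one of sign `-1`. The cut on the low side of `f` makes `f` the second of them with sign `+1`, or
the first with sign `-1`. -/
lemma not_ins_lo (hS : S.IsOpetopicCardinal) (hf : f ∈ Fl q) {h : S.Vec} :
    ¬ Ins q (lo q f) h := by
  rintro ⟨x, y, hadj, hfl, hx, hy, -⟩
  have hsx := (hS.flip_lt_iff hfl (by omega)).1 hadj.2.2.1
  have hsy := hS.flip_sgn hfl (by omega) (j := k + 1) (by omega)
  rw [lo] at hx hy
  split_ifs at hx hy with h₁
  · by_cases hyf : y = f
    · subst hyf
      omega
    · rcases hS.flagLT_total' hadj.2.1.1 hf.1 hyf with h' | h'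
      · exact hy ⟨hadj.2.1, h'⟩
      · exact hadj.2.2.2 f hf hx.2 h'
  · by_cases hyf : y = f
    · exact hy ⟨hadj.2.1, Or.inl hyf⟩
    · rcases hS.flagLT_total' hadj.2.1.1 hf.1 hyf with h' | h'
      · exact hy ⟨hadj.2.1, Or.inr h'⟩
      · rcases hx.2 with rfl | hx
        · exact h₁ hsx
        · exact hadj.2.2.2 f hf hx h'

end Flags

/-! ### Twofold restrictions of a cut and inserted flags -/

section Gaps

variable {k : ℕ} {q : S.F (k + 2)} {I : Set S.Vec}

lemma ins_unique (hS : S.IsOpetopicCardinal) {k : ℕ} {q : S.F (k + 1)} {I : Set S.Vec}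
    (hI : IsLower q I) {h h' : S.Vec} (hh : Ins q I h) (hh' : Ins q I h') : h = h' := by
  obtain ⟨x, y, hxy, -, hx, hy, rfl⟩ := hh
  obtain ⟨x', y', hxy', -, hx', hy', rfl⟩ := hh'
  rw [(hS.straddle_unique hI hxy hx hy hxy' hx' hy').1]

/-- Over a face with an inserted flag `h` the cut restricts to the cuts next to `h`. -/
lemma rho_rho_ins (hS : S.IsOpetopicCardinal) (hI : IsLower q I) {h : S.Vec} (hh : Ins q I h)
    {r : S.F k} (hr : h k = some r) {p : S.F (k + 1)} (hp : p ∈ S.bd q) (hrp : r ∈ S.bd p) :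
    h ∈ Fl r ∧ ((sgn (ext q (ext p h)) (k + 2) = 1 ∧ rho r p (rho p q I) = next r h) ∨
      (sgn (ext q (ext p h)) (k + 2) = -1 ∧ rho r p (rho p q I) = prev r h)) := by
  obtain ⟨x, y, hxy, hfl, hx, hy, rfl⟩ := hh
  rw [below_of_lt (by omega)] at hr
  have hh := below_mem hxy.1.1 (by omega) hr
  have he := ext_mem (ext_mem hh hrp) hp
  have hsx := (hS.flip_lt_iff hfl (by omega)).1 hxy.2.2.1
  have hsy := hS.flip_sgn hfl (by omega) (j := k + 2) (by omega)
  change sgn x (k + 2) = 1 at hsx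
  have hIe := hS.eq_prev_of_straddle hI hxy hx hy
  have hmem : ∀ g : S.Vec, g ∈ Fl r →
      (g ∈ rho r p (rho p q I) ↔ FlagLT (ext q (ext p g)) y) := by
    intro g hg
    have h₁ := ext_mem hg hrp
    have h₂ := ext_mem h₁ hp
    rw [hIe]
    exact ⟨fun h => h.2.2.2, fun h => ⟨hg, h₁, h₂, h⟩⟩
  have hmono : ∀ g ∈ Fl r, ∀ g' ∈ Fl r,
      (FlagLT (ext q (ext p g)) (ext q (ext p g')) ↔ FlagLT g g') := fun g hg g' hg' => by
    rw [hS.flagLT_ext (ext_mem hg hrp).1 (ext_mem hg' hrp).1, hS.flagLT_ext hg.1 hg'.1]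
  refine ⟨hh, ?_⟩
  -- Over `h` there are only the flags `x` and `y` under `q`. The one through `p` is `x`, which
  -- belongs to the cut, exactly if its sign is `+1`.
  rcases hxy.1.1.eq_or_flip (i := k + 1) he.1 (fun j hj hjk => by
    rcases (by omega : j ≤ k ∨ j = k + 2) with hj | rfl
    · rw [ext_of_le _ _ (by omega), ext_of_le _ _ hj, below_of_lt (by omega)]
    · rw [ext_top, hxy.1.2]) with h' | h'
  · refine Or.inl ⟨by rw [h']; exact hsx, Set.ext fun g => ⟨fun hg => ⟨hg.1, ?_⟩, ?_⟩⟩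
    · by_cases hne : g = below (k + 1) x
      · exact Or.inl hne
      · refine Or.inr ((hS.flagLT_total' hg.1.1 hh.1 hne).resolve_right fun h₁ => ?_)
        have h₂ := (hmem g hg.1).1 hg
        have h₃ := (hmono _ hh g hg.1).2 h₁
        rw [h'] at h₃
        exact hxy.2.2.2 _ (ext_mem (ext_mem hg.1 hrp) hp) h₃ h₂
    · rintro ⟨hg, rfl | hg'⟩
      · rw [hmem _ hg, h']
        exact hxy.2.2.1
      · have h₃ := (hmono g hg _ hh).2 hg'
        rw [h'] at h₃
        rw [hmem _ hg]
        exact hS.flagLT_trans h₃ hxy.2.2.1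
  · obtain rfl := hS.flip_unique hfl h' (by omega)
    refine Or.inr ⟨by omega, Set.ext fun g => ⟨fun hg => ⟨hg.1, ?_⟩, ?_⟩⟩
    · exact (hmono g hg.1 _ hh).1 ((hmem g hg.1).1 hg)
    · rintro ⟨hg, hg'⟩
      rw [hmem _ hg]
      exact (hmono g hg _ hh).2 hg'

lemma Fl_of_ins {h : S.Vec} (hh : Ins q I h) :
    ∃ r : S.F k, h ∈ Fl r ∧ ∃ p ∈ S.bd q, r ∈ S.bd p := by
  obtain ⟨x, y, hxy, -, -, -, rfl⟩ := hh
  obtain ⟨r, hr⟩ := hxy.1.1.some_of_le (i := k) (by omega)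
  obtain ⟨p, hp⟩ := hxy.1.1.some_of_le (i := k + 1) (by omega)
  exact ⟨r, below_mem hxy.1.1 (by omega) hr, p, hxy.1.1.mem_bd hp hxy.1.2, hxy.1.1.mem_bd hr hp⟩

/-- The sign over `h` changes once for each passage through a domain. Two codomains or two domains
lead to the high side of `h`, one of each to the low side; the next three lemmas are the remaining
cases. -/
lemma rho_γ_γ (hS : S.IsOpetopicCardinal) (hI : IsLower q I) {h : S.Vec} (hh : Ins q I h)
    (hr : h ∈ Fl (S.γ (S.γ q))) :
    rho (S.γ (S.γ q)) (S.γ q) (rho (S.γ q) q I) = hi (S.γ (S.γ q)) h := by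
  have hm := ext_mem hr (γ_mem_bd _)
  have := (hS.rho_rho_ins hI hh hr.2 (γ_mem_bd q) (γ_mem_bd _)).2
  rw [sgn_ext_γ hm, sgn_ext_γ hr] at this
  rw [hi]
  split_ifs with h₁
  · exact (this.resolve_right fun h' => by omega).2
  · exact (this.resolve_left fun h' => h₁ h'.1).2

lemma rho_γ_δ (hS : S.IsOpetopicCardinal) (hI : IsLower q I) {h : S.Vec} (hh : Ins q I h)
    {r : S.F k} (hr : h ∈ Fl r) (hrp : r ∈ S.δ (S.γ q)) :
    rho r (S.γ q) (rho (S.γ q) q I) = lo r h := by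
  have hm := ext_mem hr (mem_bd_of_mem_δ hrp)
  have := (hS.rho_rho_ins hI hh hr.2 (γ_mem_bd q) (mem_bd_of_mem_δ hrp)).2
  rw [sgn_ext_γ hm, hS.sgn_ext_δ hr hrp] at this
  have hs := sgn_eq h k
  rw [lo]
  split_ifs with h₁
  · exact (this.resolve_left fun h' => by omega).2
  · exact (this.resolve_right fun h' => by omega).2

lemma rho_δ_γ (hS : S.IsOpetopicCardinal) (hI : IsLower q I) {h : S.Vec} (hh : Ins q I h)
    {p : S.F (k + 1)} (hr : h ∈ Fl (S.γ p)) (hp : p ∈ S.δ q) :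
    rho (S.γ p) p (rho p q I) = lo (S.γ p) h := by
  have hm := ext_mem hr (γ_mem_bd _)
  have := (hS.rho_rho_ins hI hh hr.2 (mem_bd_of_mem_δ hp) (γ_mem_bd _)).2
  rw [hS.sgn_ext_δ hm hp, sgn_ext_γ hr] at this
  have hs := sgn_eq h k
  rw [lo]
  split_ifs with h₁
  · exact (this.resolve_left fun h' => by omega).2
  · exact (this.resolve_right fun h' => by omega).2

lemma rho_δ_δ (hS : S.IsOpetopicCardinal) (hI : IsLower q I) {h : S.Vec} (hh : Ins q I h)
    {p : S.F (k + 1)} {r : S.F k} (hr : h ∈ Fl r) (hp : p ∈ S.δ q) (hrp : r ∈ S.δ p) :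
    rho r p (rho p q I) = hi r h := by
  have hm := ext_mem hr (mem_bd_of_mem_δ hrp)
  have := (hS.rho_rho_ins hI hh hr.2 (mem_bd_of_mem_δ hp) (mem_bd_of_mem_δ hrp)).2
  rw [hS.sgn_ext_δ hm hp, hS.sgn_ext_δ hr hrp] at this
  have hs := sgn_eq h k
  rw [hi]
  split_ifs with h₁
  · exact (this.resolve_right fun h' => by omega).2
  · exact (this.resolve_left fun h' => by omega).2

/-- Over a face without an inserted flag the restrictions of the cut agree. -/
lemma rho_rho_eq (hS : S.IsOpetopicCardinal) (hI : IsLower q I) {r : S.F k}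
    (hr : ∀ h ∈ Fl r, ¬ Ins q I h) {p p' : S.F (k + 1)} (hp : p ∈ S.bd q) (hp' : p' ∈ S.bd q)
    (hrp : r ∈ S.bd p) (hrp' : r ∈ S.bd p') :
    rho r p (rho p q I) = rho r p' (rho p' q I) := by
  have key : ∀ {p p' : S.F (k + 1)}, p ∈ S.bd q → p' ∈ S.bd q → r ∈ S.bd p → r ∈ S.bd p' →
      rho r p (rho p q I) ⊆ rho r p' (rho p' q I) := by
    intro p p' hp hp' hrp hrp' f hf
    by_contra hcon
    have h₁ := ext_mem (ext_mem hf.1 hrp) hp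
    have h₂ := ext_mem (ext_mem hf.1 hrp') hp'
    have hfI : ext q (ext p f) ∈ I := hf.2.2
    have hfI' : ext q (ext p' f) ∉ I := fun h => hcon ⟨hf.1, ext_mem hf.1 hrp', h⟩
    have hfl := (h₁.1.eq_or_flip (i := k + 1) h₂.1 (fun j hj hjk => by
      rcases (by omega : j ≤ k ∨ j = k + 2) with hj | rfl
      · rw [ext_of_le _ _ (by omega), ext_of_le _ _ hj, ext_of_le _ _ (by omega), ext_of_le _ _ hj]
      · rw [ext_top, ext_top])).resolve_left fun h => hfI' (h ▸ hfI)
    have hlt : FlagLT (ext q (ext p f)) (ext q (ext p' f)) :=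
      (hS.flagLT_total (i := k + 1) h₁.1 h₂.1 (by omega) (by omega) hfl.2.2.2.symm).resolve_right
        fun h => hfI' (hI.2 _ hfI _ h₂ h)
    have hs := (hS.flip_lt_iff hfl (by omega)).1 hlt
    refine hr f hf.1 ⟨_, _, hS.high_adj hfl h₁.2 hs, hfl, hfI, hfI', ?_⟩
    funext j
    unfold PosHypergraph.below
    split_ifs with hj
    · rw [ext_of_le _ _ (by omega), ext_of_le _ _ (by omega)]
    · exact hf.1.1.none_of_lt (by omega)
  exact Set.Subset.antisymm (key hp hp' hrp hrp') (key hp' hp hrp' hrp)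

/-- A flag inserted over a face in the domain of `q` comes from a low p-flag. -/
lemma straddle_of_ins_δ (hS : S.IsOpetopicCardinal) {p : S.F (k + 1)} (hp : p ∈ S.δ q)
    {h : S.Vec} (hh : Ins p (rho p q I) h) : ∃ x y, Adj q x y ∧ Flip (k + 2) k x y ∧ x ∈ I ∧
      y ∉ I ∧ x (k + 1) = some p ∧ h = below k x := by
  obtain ⟨f, f', hff, hfl, hf, hf', rfl⟩ := hh
  have hpb := mem_bd_of_mem_δ hp
  have hF := ext_flip (T := q) hpb hff.1 hff.2.1 hfl (by omega)
  have hs := (hS.flip_lt_iff hfl (by omega)).1 hff.2.2.1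
  have he : ext q f (k + 1) = some p := by rw [ext_of_le _ _ le_rfl, hff.1.2]
  have hlow : IsLowLevel (k + 2) (ext q f) k := by
    refine ⟨⟨by omega, p, q, he, ext_top _ _, hp⟩, ?_⟩
    rintro j ⟨hj, -⟩
    omega
  refine ⟨_, _, hS.low_adj hF hlow (ext_top _ _) (by rw [hS.sgn_ext_δ hff.1 hp, hs]), hF, hf.2,
    fun h => hf' ⟨hff.2.1, h⟩, he, ?_⟩
  funext j
  unfold PosHypergraph.below
  split_ifs with hj
  · exact (ext_of_le _ _ (by omega)).symm
  · rfl

/-- Flags agreeing below level `k` are enclosed by the same adjacent flags through `γ q`, and the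
cut passes between these. -/
lemma ins_γ_of_straddle (hS : S.IsOpetopicCardinal) (hI : IsLower q I) {x y : S.Vec}
    (hxy : Adj q x y) (hx : x ∈ I) (hy : y ∉ I) (hag : ∀ j < k, y j = x j) :
    Ins (S.γ q) (rho (S.γ q) q I) (below k x) := by
  obtain ⟨f₁, f₂, hflip, hf₁, hf₂, hs₁, hag₁, hle₁, -⟩ := hS.exists_γ_between hxy.1
  obtain ⟨f₁', f₂', hflip', hf₁', hf₂', hs₁', hag₁', -, hle₂⟩ := hS.exists_γ_between hxy.2.1
  obtain rfl : f₁' = f₁ := by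
    refine (hf₁.1.eq_or_flip (i := k) hf₁'.1 fun j hj hjk => ?_).resolve_right fun h' => ?_
    · rcases (by omega : j < k ∨ j = k + 1) with hj | rfl
      · rw [hag₁ j hj, hag₁' j hj, hag j hj]
      · rw [hf₁.2, hf₁'.2]
    · have := hS.flip_sgn h' (by omega) (j := k + 1) (by omega)
      omega
  obtain rfl := hS.flip_unique hflip hflip' (by omega)
  refine ⟨f₁', f₂, hS.high_adj hflip hf₁.2 hs₁, hflip, ⟨hf₁, ?_⟩, ?_, ?_⟩
  · rcases hle₁ with h | h
    · rwa [h]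
    · exact hI.2 x hx _ (ext_mem hf₁ (γ_mem_bd q)) h
  · rintro ⟨-, h⟩
    rcases hle₂ with h' | h'
    · exact hy (h' ▸ h)
    · exact hy (hI.2 _ h y hxy.2.1 h')
  · funext j
    unfold PosHypergraph.below
    split_ifs with hj
    · exact (hag₁ j hj).symm
    · rfl

/-- The flags inserted over `γ q`. -/
lemma ins_γ_iff (hS : S.IsOpetopicCardinal) (hI : IsLower q I) {h : S.Vec} :
    Ins (S.γ q) (rho (S.γ q) q I) h ↔
      (∃ g, Ins q I g ∧ h = below k g) ∨ ∃ p ∈ S.δ q, Ins p (rho p q I) h := by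
  constructor
  · rintro ⟨f, f', hff, hfl, hf, hf', rfl⟩
    have hγ := γ_mem_bd q
    have hF := ext_flip (T := q) hγ hff.1 hff.2.1 hfl (by omega)
    obtain ⟨x, y, hxy, hx, hy, hfx, hyf⟩ := hS.exists_straddle hI hf.2 (ext_mem hff.2.1 hγ)
      fun h => hf' ⟨hff.2.1, h⟩
    have hff' : ∀ j < k, ext q f j = ext q f' j := fun j hj => (hF.2.2.1 j (by omega)).symm
    have hxj := hS.agree_of_between hff' hfx (by
      rcases hyf with rfl | h'
      · exact Or.inr hxy.2.2.1
      · exact Or.inr (hS.flagLT_trans hxy.2.2.1 h'))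
    have hyj := hS.agree_of_between hff' (z := y) (by
      rcases hfx with rfl | h'
      · exact Or.inr hxy.2.2.1
      · exact Or.inr (hS.flagLT_trans h' hxy.2.2.1)) hyf
    have hfb : below k f = below k x := by
      funext j
      unfold PosHypergraph.below
      split_ifs with hj
      · rw [hxj j hj, ext_of_le _ _ (by omega)]
      · rfl
    -- The pair around `I` agrees below level `k`, so it differs at level `k + 1`, where a flag is
    -- inserted over `q`, or at the low level `k`, where one is inserted over a face of `δ q`.
    obtain ⟨i, hik, hfl', hlev⟩ := hS.adj_cases hxy
    have hki : k ≤ i := by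
      by_contra hlt
      exact hfl'.2.2.2 (by rw [hxj i (by omega), hyj i (by omega)])
    rcases hlev with ⟨hi, -⟩ | ⟨hlow, hs⟩
    · obtain rfl : i = k + 1 := by omega
      refine Or.inl ⟨below (k + 1) x, ⟨x, y, hxy, hfl', hx, hy, rfl⟩, ?_⟩
      rw [hfb]
      funext j
      unfold PosHypergraph.below
      split_ifs with hj h' <;> first | rfl | omega
    · have := hlow.1.1
      obtain rfl : i = k := by omega
      obtain ⟨-, p, q', hp, hq', hpq⟩ := hlow.1
      rw [hxy.1.2] at hq'
      cases hq'
      have hyp : y (i + 1) = some p := by rw [hfl'.2.2.1 _ (by omega), hp]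
      have hfx' := below_mem hxy.1.1 (by omega) hp
      have hfy' := below_mem hxy.2.1.1 (by omega) hyp
      have hbf := below_flip hfl' (by omega)
      have hs' := hS.sgn_ext_δ hfx' hpq
      rw [ext_below hxy.1] at hs'
      change sgn x (i + 2) = - sgn (below (i + 2) x) (i + 1) at hs'
      have hs'' : sgn (below (i + 2) x) (i + 1) = 1 := by omega
      refine Or.inr ⟨p, hpq, _, _, hS.high_adj hbf hfx'.2 hs'', hbf, ⟨hfx', ?_⟩, ?_, ?_⟩
      · rwa [ext_below hxy.1]
      · rintro ⟨-, h'⟩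
        rw [ext_below hxy.2.1] at h'
        exact hy h'
      · rw [hfb]
        funext j
        unfold PosHypergraph.below
        split_ifs with hj h' <;> first | rfl | omega
  · rintro (⟨g, ⟨x, y, hxy, hfl, hx, hy, rfl⟩, rfl⟩ | ⟨p, hp, hh⟩)
    · convert hS.ins_γ_of_straddle hI hxy hx hy fun j hj => hfl.2.2.1 j (by omega) using 1
      funext j
      unfold PosHypergraph.below
      split_ifs with hj h' <;> first | rfl | omega
    · obtain ⟨x, y, hxy, hfl, hx, hy, -, rfl⟩ := hS.straddle_of_ins_δ hp hh
      exact hS.ins_γ_of_straddle hI hxy hx hy fun j hj => hfl.2.2.1 j (by omega)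

/-- The unique pair around `I` would have to differ at level `k + 1` only and at level `k` only. -/
lemma not_ins_of_ins_δ (hS : S.IsOpetopicCardinal) (hI : IsLower q I) {p : S.F (k + 1)}
    (hp : p ∈ S.δ q) {h g : S.Vec} (hh : Ins p (rho p q I) h) : ¬ Ins q I g := by
  rintro ⟨x, y, hxy, hfl, hx, hy, -⟩
  obtain ⟨x', y', hxy', hfl', hx', hy', -⟩ := hS.straddle_of_ins_δ hp hh
  obtain ⟨rfl, rfl⟩ := hS.straddle_unique hI hxy hx hy hxy' hx' hy'
  exact hfl.2.2.2 (hfl'.2.2.1 _ (by omega))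

lemma eq_of_ins_δ (hS : S.IsOpetopicCardinal) (hI : IsLower q I) {p p' : S.F (k + 1)}
    (hp : p ∈ S.δ q) (hp' : p' ∈ S.δ q) {h h' : S.Vec} (hh : Ins p (rho p q I) h)
    (hh' : Ins p' (rho p' q I) h') : p = p' := by
  obtain ⟨x, y, hxy, -, hx, hy, hxp, -⟩ := hS.straddle_of_ins_δ hp hh
  obtain ⟨x', y', hxy', -, hx', hy', hxp', -⟩ := hS.straddle_of_ins_δ hp' hh'
  obtain ⟨rfl, rfl⟩ := hS.straddle_unique hI hxy hx hy hxy' hx' hy'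
  rw [hxp] at hxp'
  exact Option.some.inj hxp'

end Gaps

end IsOpetopicCardinal

end PosHypergraph

namespace PosHypergraph

variable {S : PosHypergraph.{u}}

namespace IsOpetopicCardinal

lemma exists_δ_gap (hS : S.IsOpetopicCardinal) {k : ℕ} {q : S.F (k + 1)} {I : Set S.Vec}
    {w : S.CylFace (k + 1)} (hw : Gap w q I) {p : S.F k} (hp : p ∈ S.δ q) :
    ∃ v ∈ cylδ w, Gap v p (rho p q I) := by
  obtain ⟨v, hv⟩ := hS.exists_gap (hS.isLower_rho (mem_bd_of_mem_δ hp) (hS.gap_isLower hw))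
  exact ⟨v, (hS.mem_cylδ_gap hw).2 (Or.inl ⟨p, hp, hv⟩), hv⟩

lemma exists_δ_flag (hS : S.IsOpetopicCardinal) {k : ℕ} {q : S.F (k + 2)} {I : Set S.Vec}
    {w : S.CylFace (k + 2)} (hw : Gap w q I) {h : S.Vec} (hh : Ins q I h) :
    ∃ v ∈ cylδ w, IsFl v h := by
  obtain ⟨r, hr, -⟩ := Fl_of_ins hh
  obtain ⟨v, hv⟩ := exists_isFl hr.1
  exact ⟨v, (hS.mem_cylδ_gap hw).2 (Or.inr ⟨h, hh, hv⟩), hv⟩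

lemma cyl_γ_notMem (hS : S.IsOpetopicCardinal) {k : ℕ} (w : S.CylFace (k + 1)) :
    cylγ hS w ∉ cylδ w := by
  intro hm
  rcases gap_or_isFl w with ⟨q, I, hw⟩ | ⟨f, hw⟩
  · have hG := hS.gap_cylγ hw
    rcases (hS.mem_cylδ_gap hw).1 hm with ⟨p, hp, hG'⟩ | ⟨h, -, hh⟩
    · rw [← (hG.eq hG').1] at hp
      exact hS.γ_notMem_δ q hp
    · exact hG.not_isFl _ hh
  · have hf := hw.isFlag
    obtain ⟨q, hq⟩ := hf.some_of_le le_rfl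
    have hG := hS.gap_cylγ_flag hw hq
    rcases (hS.mem_cylδ_flag hw hq).1 hm with hh | hG'
    · exact hG.not_isFl _ hh
    · exact hS.lo_ne_hi ⟨hf, hq⟩ (hG'.eq hG).2

/-! ### Domain trees of the faces given by cuts -/

section Gaps

variable {k : ℕ} {q : S.F (k + 2)} {I : Set S.Vec} {w : S.CylFace (k + 2)}

/-- Over the vertex of the inserted flag `h`, an edge from `δ q` ends at `lo` and the flag ends at
`hi`. Otherwise the codomain determines the edge as in the tree of `q`. -/
lemma cyl_inj_γ_gap (hS : S.IsOpetopicCardinal) (hw : Gap w q I) :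
    Set.InjOn (cylγ hS) (cylδ w) := by
  have hI := hS.gap_isLower hw
  have key : ∀ {v v' : S.CylFace (k + 1)} {p : S.F (k + 1)} {h : S.Vec}, p ∈ S.δ q →
      Gap v p (rho p q I) → Ins q I h → IsFl v' h → cylγ hS v ≠ cylγ hS v' := by
    intro v v' p h hp hv hh hv' he
    obtain ⟨r, hr, -⟩ := Fl_of_ins hh
    have h₁ := hS.gap_cylγ hv
    have h₂ := hS.gap_cylγ_flag hv' hr.2
    rw [he] at h₁
    obtain ⟨rfl, h₃⟩ := h₁.eq h₂
    rw [hS.rho_δ_γ hI hh hr hp] at h₃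
    exact hS.lo_ne_hi hr h₃
  intro v hv v' hv' he
  rcases (hS.mem_cylδ_gap hw).1 hv with ⟨p, hp, hG⟩ | ⟨h, hh, hf⟩
  · rcases (hS.mem_cylδ_gap hw).1 hv' with ⟨p', hp', hG'⟩ | ⟨h', hh', hf'⟩
    · have h₁ := hS.gap_cylγ hG
      have h₂ := hS.gap_cylγ hG'
      rw [he] at h₁
      obtain rfl := hS.γ_injOn q hp hp' (h₁.eq h₂).1
      exact hS.gap_unique hG hG'
    · exact (key hp hG hh' hf' he).elim
  · rcases (hS.mem_cylδ_gap hw).1 hv' with ⟨p', hp', hG'⟩ | ⟨h', hh', hf'⟩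
    · exact (key hp' hG' hh hf he.symm).elim
    · obtain rfl := hS.ins_unique hI hh hh'
      exact hf.unique hf'

/-- At the split vertex the faces of `δ q` start from `hi` and the inserted flag from `lo`. A flag
inserted over a face of `δ q` determines that face and excludes an insertion over `q`. -/
lemma cyl_disj_δ_gap (hS : S.IsOpetopicCardinal) (hw : Gap w q I) {v v' : S.CylFace (k + 1)}
    {x : S.CylFace k} (hv : v ∈ cylδ w) (hv' : v' ∈ cylδ w) (hx : x ∈ cylδ v)
    (hx' : x ∈ cylδ v') : v = v' := by
  have hI := hS.gap_isLower hw
  have key : ∀ {v v' : S.CylFace (k + 1)} {p : S.F (k + 1)} {h : S.Vec}, p ∈ S.δ q →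
      Gap v p (rho p q I) → Ins q I h → IsFl v' h → x ∈ cylδ v → x ∈ cylδ v' → False := by
    intro v v' p h hp hv hh hv' hx hx'
    obtain ⟨r, hr, -⟩ := Fl_of_ins hh
    rcases (hS.mem_cylδ_gap hv).1 hx with ⟨s, hs, hG⟩ | ⟨g, hg, hf⟩
    · rcases (hS.mem_cylδ_flag hv' hr.2).1 hx' with hf' | hG'
      · exact hG.not_isFl _ hf'
      · obtain ⟨rfl, h₃⟩ := hG.eq hG'
        rw [hS.rho_δ_δ hI hh hr hp hs] at h₃
        exact hS.lo_ne_hi hr h₃.symm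
    · exact hS.not_ins_of_ins_δ hI hp hg hh
  rcases (hS.mem_cylδ_gap hw).1 hv with ⟨p, hp, hG⟩ | ⟨h, hh, hf⟩
  · rcases (hS.mem_cylδ_gap hw).1 hv' with ⟨p', hp', hG'⟩ | ⟨h', hh', hf'⟩
    · obtain rfl : p = p' := by
        rcases (hS.mem_cylδ_gap hG).1 hx with ⟨s, hs, h₁⟩ | ⟨g, hg, h₁⟩
        · rcases (hS.mem_cylδ_gap hG').1 hx' with ⟨s', hs', h₂⟩ | ⟨g', hg', h₂⟩
          · obtain ⟨rfl, -⟩ := h₁.eq h₂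
            exact hS.eq_of_mem_δ hp hp' hs hs'
          · exact (h₁.not_isFl _ h₂).elim
        · rcases (hS.mem_cylδ_gap hG').1 hx' with ⟨s', hs', h₂⟩ | ⟨g', hg', h₂⟩
          · exact (h₂.not_isFl _ h₁).elim
          · exact hS.eq_of_ins_δ hI hp hp' hg hg'
      exact hS.gap_unique hG hG'
    · exact (key hp hG hh' hf' hx hx').elim
  · rcases (hS.mem_cylδ_gap hw).1 hv' with ⟨p', hp', hG'⟩ | ⟨h', hh', hf'⟩
    · exact (key hp' hG' hh hf hx' hx).elim
    · obtain rfl := hS.ins_unique hI hh hh'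
      exact hf.unique hf'

/-- If a flag is inserted over `γγq`, it is the last edge, ending at the `hi` half of the split
root; otherwise the last edge is that of the tree of `q`. -/
lemma cyl_γγ_mem_gap (hS : S.IsOpetopicCardinal) (hw : Gap w q I) :
    ∃ v ∈ cylδ w, cylγ hS v = cylγ hS (cylγ hS w) := by
  have hI := hS.gap_isLower hw
  have hγγ := hS.gap_cylγ (hS.gap_cylγ hw)
  by_cases hins : ∃ h ∈ Fl (S.γ (S.γ q)), Ins q I h
  · obtain ⟨h, hr, hh⟩ := hins
    obtain ⟨v, hv, hvh⟩ := hS.exists_δ_flag hw hh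
    rw [hS.rho_γ_γ hI hh hr] at hγγ
    exact ⟨v, hv, hS.gap_unique (hS.gap_cylγ_flag hvh hr.2) hγγ⟩
  · push Not at hins
    obtain ⟨p, hp, he⟩ := hS.exists_γγ q
    obtain ⟨v, hv, hG⟩ := hS.exists_δ_gap hw hp
    have h₁ := hS.gap_cylγ hG
    rw [he] at h₁
    refine ⟨v, hv, hS.gap_unique h₁ ?_⟩
    rwa [hS.rho_rho_eq hI hins (mem_bd_of_mem_δ hp) (γ_mem_bd q) (he ▸ γ_mem_bd p)
      (γ_mem_bd _)]

lemma cyl_γγ_notMem_gap (hS : S.IsOpetopicCardinal) (hw : Gap w q I) {v : S.CylFace (k + 1)}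
    (hv : v ∈ cylδ w) : cylγ hS (cylγ hS w) ∉ cylδ v := by
  have hI := hS.gap_isLower hw
  have hγγ := hS.gap_cylγ (hS.gap_cylγ hw)
  intro hm
  rcases (hS.mem_cylδ_gap hw).1 hv with ⟨p, hp, hG⟩ | ⟨h, hh, hf⟩
  · rcases (hS.mem_cylδ_gap hG).1 hm with ⟨s, hs, h₁⟩ | ⟨g, hg, h₁⟩
    · rw [← (hγγ.eq h₁).1] at hs
      exact hS.γγ_notMem hp hs
    · exact hγγ.not_isFl _ h₁
  · obtain ⟨r, hr, -⟩ := Fl_of_ins hh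
    rcases (hS.mem_cylδ_flag hf hr.2).1 hm with h₁ | h₁
    · exact hγγ.not_isFl _ h₁
    · obtain ⟨rfl, h₂⟩ := h₁.eq hγγ
      rw [hS.rho_γ_γ hI hh hr] at h₂
      exact hS.lo_ne_hi hr h₂

lemma root_or_mem_δ (hS : S.IsOpetopicCardinal) {r : S.F k}
    (hr : ∃ p ∈ S.bd q, r ∈ S.bd p) : r = S.γ (S.γ q) ∨ ∃ p ∈ S.δ q, r ∈ S.δ p := by
  obtain ⟨p, hp, hrp⟩ := hr
  rcases hS.bd_bd_cases hrp hp with h | ⟨p', hp', rfl⟩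
  · exact Or.inr (hS.exists_of_mem_δγ h)
  · exact hS.γ_eq_γγ_or hp'

lemma leaf_or_eq_γ (hS : S.IsOpetopicCardinal) {r : S.F k}
    (hr : ∃ p ∈ S.bd q, r ∈ S.bd p) : r ∈ S.δ (S.γ q) ∨ ∃ p ∈ S.δ q, S.γ p = r := by
  obtain ⟨p, hp, hrp⟩ := hr
  exact hS.bd_bd_cases hrp hp

/-- An edge `p` under an inserted flag is followed by that flag; other edges are followed as in the
tree of `q`. The inserted flag itself ends at the root or at a source of the next face of `δ q`. -/
lemma cyl_γ_eq_γγ_or_gap (hS : S.IsOpetopicCardinal) (hw : Gap w q I) {v : S.CylFace (k + 1)}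
    (hv : v ∈ cylδ w) :
    cylγ hS v = cylγ hS (cylγ hS w) ∨ ∃ v' ∈ cylδ w, cylγ hS v ∈ cylδ v' := by
  have hI := hS.gap_isLower hw
  have hγγ := hS.gap_cylγ (hS.gap_cylγ hw)
  rcases (hS.mem_cylδ_gap hw).1 hv with ⟨p, hp, hG⟩ | ⟨h, hh, hf⟩
  · have h₁ := hS.gap_cylγ hG
    by_cases hins : ∃ h ∈ Fl (S.γ p), Ins q I h
    · obtain ⟨h, hr, hh⟩ := hins
      obtain ⟨v', hv', hvh⟩ := hS.exists_δ_flag hw hh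
      rw [hS.rho_δ_γ hI hh hr hp] at h₁
      exact Or.inr ⟨v', hv', (hS.mem_cylδ_flag hvh hr.2).2 (Or.inr h₁)⟩
    · push Not at hins
      have hpb := mem_bd_of_mem_δ hp
      rcases hS.γ_eq_γγ_or hp with he | ⟨p', hp', he⟩
      · left
        refine hS.gap_unique h₁ ?_
        rw [hS.rho_rho_eq hI hins hpb (γ_mem_bd q) (γ_mem_bd p) (he ▸ γ_mem_bd _), he]
        exact hγγ
      · obtain ⟨v', hv', hG'⟩ := hS.exists_δ_gap hw hp'
        refine Or.inr ⟨v', hv', (hS.mem_cylδ_gap hG').2 (Or.inl ⟨_, he, ?_⟩)⟩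
        rwa [← hS.rho_rho_eq hI hins hpb (mem_bd_of_mem_δ hp') (γ_mem_bd p) (mem_bd_of_mem_δ he)]
  · obtain ⟨r, hr, hn⟩ := Fl_of_ins hh
    have h₁ := hS.gap_cylγ_flag hf hr.2
    rcases hS.root_or_mem_δ hn with rfl | ⟨p, hp, hrp⟩
    · rw [hS.rho_γ_γ hI hh hr] at hγγ
      exact Or.inl (hS.gap_unique h₁ hγγ)
    · obtain ⟨v', hv', hG'⟩ := hS.exists_δ_gap hw hp
      refine Or.inr ⟨v', hv', (hS.mem_cylδ_gap hG').2 (Or.inl ⟨r, hrp, ?_⟩)⟩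
      rwa [hS.rho_δ_δ hI hh hr hp hrp]

/-- Leaves over faces of `δγq` correspond to those of `q`, with the `lo` half at a split vertex. A
leaf that is a flag is either the truncation of the flag inserted over `q` or is inserted over a
face of `δ q`, according to `ins_γ_iff`. -/
lemma cyl_mem_δγ_gap (hS : S.IsOpetopicCardinal) (hw : Gap w q I) {x : S.CylFace k}
    (hx : x ∈ cylδ (cylγ hS w)) :
    (∃ v ∈ cylδ w, x ∈ cylδ v) ∧ ∀ v ∈ cylδ w, cylγ hS v ≠ x := by
  have hI := hS.gap_isLower hw
  have hγ := hS.gap_cylγ hw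
  rcases (hS.mem_cylδ_gap hγ).1 hx with ⟨r, hr, hG⟩ | ⟨h, hh, hf⟩
  · have hno : ∀ v ∈ cylδ w, cylγ hS v ≠ x := by
      rintro v hv rfl
      rcases (hS.mem_cylδ_gap hw).1 hv with ⟨p, hp, hG'⟩ | ⟨h, hh, hf⟩
      · exact hS.γ_ne_of_mem_δγ hr hp ((hS.gap_cylγ hG').eq hG).1
      · obtain ⟨s, hs, -⟩ := Fl_of_ins hh
        obtain ⟨rfl, h₂⟩ := (hS.gap_cylγ_flag hf hs.2).eq hG
        rw [hS.rho_γ_δ hI hh hs hr] at h₂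
        exact hS.lo_ne_hi hs h₂.symm
    refine ⟨?_, hno⟩
    by_cases hins : ∃ h ∈ Fl r, Ins q I h
    · obtain ⟨h, hr', hh⟩ := hins
      obtain ⟨v, hv, hvh⟩ := hS.exists_δ_flag hw hh
      rw [hS.rho_γ_δ hI hh hr' hr] at hG
      exact ⟨v, hv, (hS.mem_cylδ_flag hvh hr'.2).2 (Or.inr hG)⟩
    · push Not at hins
      obtain ⟨p, hp, hrp⟩ := hS.exists_of_mem_δγ hr
      obtain ⟨v, hv, hG'⟩ := hS.exists_δ_gap hw hp
      refine ⟨v, hv, (hS.mem_cylδ_gap hG').2 (Or.inl ⟨r, hrp, ?_⟩)⟩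
      rwa [hS.rho_rho_eq hI hins (mem_bd_of_mem_δ hp) (γ_mem_bd q) (mem_bd_of_mem_δ hrp)
        (mem_bd_of_mem_δ hr)]
  · refine ⟨?_, ?_⟩
    · rcases (hS.ins_γ_iff hI).1 hh with ⟨g, hg, rfl⟩ | ⟨p, hp, hh'⟩
      · obtain ⟨v, hv, hvg⟩ := hS.exists_δ_flag hw hg
        obtain ⟨s, hs, -⟩ := Fl_of_ins hg
        exact ⟨v, hv, (hS.mem_cylδ_flag hvg hs.2).2 (Or.inl hf)⟩
      · obtain ⟨v, hv, hG'⟩ := hS.exists_δ_gap hw hp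
        exact ⟨v, hv, (hS.mem_cylδ_gap hG').2 (Or.inr ⟨h, hh', hf⟩)⟩
    · rintro v hv rfl
      rcases (hS.mem_cylδ_gap hw).1 hv with ⟨p, hp, hG'⟩ | ⟨g, hg, hf'⟩
      · exact (hS.gap_cylγ hG').not_isFl _ hf
      · obtain ⟨s, hs, -⟩ := Fl_of_ins hg
        exact (hS.gap_cylγ_flag hf' hs.2).not_isFl _ hf

lemma cyl_mem_δγ_or_gap (hS : S.IsOpetopicCardinal) (hw : Gap w q I) {v : S.CylFace (k + 1)}
    {x : S.CylFace k} (hv : v ∈ cylδ w) (hx : x ∈ cylδ v) :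
    x ∈ cylδ (cylγ hS w) ∨ ∃ v' ∈ cylδ w, cylγ hS v' = x := by
  have hI := hS.gap_isLower hw
  have hγ := hS.gap_cylγ hw
  rcases (hS.mem_cylδ_gap hw).1 hv with ⟨p, hp, hG⟩ | ⟨h, hh, hf⟩
  · have hpb := mem_bd_of_mem_δ hp
    rcases (hS.mem_cylδ_gap hG).1 hx with ⟨r, hr, hG'⟩ | ⟨g, hg, hf⟩
    · by_cases hins : ∃ h ∈ Fl r, Ins q I h
      · obtain ⟨h, hr', hh⟩ := hins
        obtain ⟨v', hv', hvh⟩ := hS.exists_δ_flag hw hh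
        rw [hS.rho_δ_δ hI hh hr' hp hr] at hG'
        exact Or.inr ⟨v', hv', hS.gap_unique (hS.gap_cylγ_flag hvh hr'.2) hG'⟩
      · push Not at hins
        rcases hS.mem_δγ_or hp hr with hrγ | ⟨p', hp', rfl⟩
        · refine Or.inl ((hS.mem_cylδ_gap hγ).2 (Or.inl ⟨r, hrγ, ?_⟩))
          rwa [← hS.rho_rho_eq hI hins hpb (γ_mem_bd q) (mem_bd_of_mem_δ hr)
            (mem_bd_of_mem_δ hrγ)]
        · obtain ⟨v', hv', hG''⟩ := hS.exists_δ_gap hw hp'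
          refine Or.inr ⟨v', hv', hS.gap_unique (hS.gap_cylγ hG'') ?_⟩
          rwa [← hS.rho_rho_eq hI hins hpb (mem_bd_of_mem_δ hp') (mem_bd_of_mem_δ hr)
            (γ_mem_bd p')]
    · exact Or.inl ((hS.mem_cylδ_gap hγ).2
        (Or.inr ⟨g, (hS.ins_γ_iff hI).2 (Or.inr ⟨p, hp, hg⟩), hf⟩))
  · obtain ⟨r, hr, hn⟩ := Fl_of_ins hh
    rcases (hS.mem_cylδ_flag hf hr.2).1 hx with hf' | hG'
    · exact Or.inl ((hS.mem_cylδ_gap hγ).2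
        (Or.inr ⟨_, (hS.ins_γ_iff hI).2 (Or.inl ⟨h, hh, rfl⟩), hf'⟩))
    · rcases hS.leaf_or_eq_γ hn with hrγ | ⟨p, hp, rfl⟩
      · refine Or.inl ((hS.mem_cylδ_gap hγ).2 (Or.inl ⟨r, hrγ, ?_⟩))
        rwa [hS.rho_γ_δ hI hh hr hrγ]
      · obtain ⟨v', hv', hG''⟩ := hS.exists_δ_gap hw hp
        refine Or.inr ⟨v', hv', hS.gap_unique (hS.gap_cylγ hG'') ?_⟩
        rwa [hS.rho_δ_γ hI hh hr hp]

end Gaps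

/-! ### Domain trees of the flags -/

section Flags

variable {k : ℕ} {q : S.F (k + 1)} {f : S.Vec} {w : S.CylFace (k + 2)}

/-- The two faces in the domain of a flag. -/
lemma exists_δ_of_flag (hS : S.IsOpetopicCardinal) (hf : f ∈ Fl q) (hw : IsFl w f) :
    ∃ v₁ v₂, IsFl v₁ (below (k + 1) f) ∧ Gap v₂ q (lo q f) ∧
      ∀ v, v ∈ cylδ w ↔ v = v₁ ∨ v = v₂ := by
  obtain ⟨v₁, hv₁⟩ := exists_isFl (hf.1.below (m := k) (by omega))
  obtain ⟨v₂, hv₂⟩ := hS.exists_gap (hS.isLower_lo q f)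
  refine ⟨v₁, v₂, hv₁, hv₂, fun v => (hS.mem_cylδ_flag hw hf.2).trans (or_congr ?_ ?_)⟩
  · exact ⟨fun h => h.unique hv₁, fun h => h ▸ hv₁⟩
  · exact ⟨fun h => hS.gap_unique h hv₂, fun h => h ▸ hv₂⟩

lemma mem_cylδ_lo (hS : S.IsOpetopicCardinal) (hf : f ∈ Fl q) {v : S.CylFace (k + 1)}
    (hv : Gap v q (lo q f)) {x : S.CylFace k} :
    x ∈ cylδ v ↔ ∃ p ∈ S.δ q, Gap x p (rho p q (lo q f)) :=
  (hS.mem_cylδ_gap hv).trans ⟨fun h => h.resolve_right fun ⟨_, h, _⟩ => hS.not_ins_lo hf h, Or.inl⟩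

lemma mem_cylδ_hi (hS : S.IsOpetopicCardinal) (hf : f ∈ Fl q) {v : S.CylFace (k + 1)}
    (hv : Gap v q (hi q f)) {x : S.CylFace k} :
    x ∈ cylδ v ↔ (∃ p ∈ S.δ q, Gap x p (rho p q (hi q f))) ∨ IsFl x (below k f) := by
  rw [hS.mem_cylδ_gap hv]
  refine or_congr_right ⟨?_, fun h => ⟨_, (hS.ins_hi_iff hf).2 rfl, h⟩⟩
  rintro ⟨h, hh, hx⟩
  rwa [← (hS.ins_hi_iff hf).1 hh]

lemma mem_cylδ_below (hS : S.IsOpetopicCardinal) (hf : f ∈ Fl q) {p : S.F k} (hp : f k = some p)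
    {v : S.CylFace (k + 1)} (hv : IsFl v (below (k + 1) f)) {x : S.CylFace k} :
    x ∈ cylδ v ↔ IsFl x (below k f) ∨ Gap x p (lo p (below (k + 1) f)) := by
  rw [hS.mem_cylδ_flag hv (below_mem hf.1 (by omega) hp).2]
  have : below k (below (k + 1) f) = below k f := by
    funext j
    unfold PosHypergraph.below
    split_ifs with hj h' <;> first | rfl | omega
  rw [this]

/-- A coincidence of codomains could occur only when `f` passes through `γ q`. Then the truncation
ends on its high side, while the other edge ends on its low side. -/
lemma cyl_inj_γ_flag (hS : S.IsOpetopicCardinal) (hf : f ∈ Fl q) (hw : IsFl w f) :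
    Set.InjOn (cylγ hS) (cylδ w) := by
  obtain ⟨v₁, v₂, h₁, h₂, hw⟩ := hS.exists_δ_of_flag hf hw
  obtain ⟨p, hp⟩ := hf.1.some_of_le (i := k) (by omega)
  have hg := below_mem hf.1 (by omega) hp
  have key : cylγ hS v₁ ≠ cylγ hS v₂ := by
    intro he
    have h₃ := hS.gap_cylγ_flag h₁ hg.2
    rw [he] at h₃
    obtain ⟨rfl, h₄⟩ := (hS.gap_cylγ h₂).eq h₃
    rw [hS.rho_lo_γ hf hp] at h₄
    exact hS.lo_ne_hi hg h₄
  intro v hv v' hv' he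
  rcases (hw v).1 hv with rfl | rfl <;> rcases (hw v').1 hv' with rfl | rfl
  · rfl
  · exact (key he).elim
  · exact (key he.symm).elim
  · rfl

lemma cyl_disj_δ_flag (hS : S.IsOpetopicCardinal) (hf : f ∈ Fl q) (hw : IsFl w f)
    {v v' : S.CylFace (k + 1)} {x : S.CylFace k} (hv : v ∈ cylδ w) (hv' : v' ∈ cylδ w)
    (hx : x ∈ cylδ v) (hx' : x ∈ cylδ v') : v = v' := by
  obtain ⟨v₁, v₂, h₁, h₂, hw⟩ := hS.exists_δ_of_flag hf hw
  obtain ⟨p, hp⟩ := hf.1.some_of_le (i := k) (by omega)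
  have hg := below_mem hf.1 (by omega) hp
  have key : ¬ (x ∈ cylδ v₁ ∧ x ∈ cylδ v₂) := by
    rw [hS.mem_cylδ_below hf hp h₁, hS.mem_cylδ_lo hf h₂]
    rintro ⟨h, p', hp', hG⟩
    rcases h with h | h
    · exact hG.not_isFl _ h
    · obtain ⟨rfl, h'⟩ := hG.eq h
      rw [hS.rho_lo_δ hf hp hp'] at h'
      exact hS.lo_ne_hi hg h'.symm
  rcases (hw v).1 hv with rfl | rfl <;> rcases (hw v').1 hv' with rfl | rfl
  · rfl
  · exact (key ⟨hx, hx'⟩).elim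
  · exact (key ⟨hx', hx⟩).elim
  · rfl

/-- If `f` passes through `γ q`, the truncation is the last edge. Otherwise the restrictions to `γ
q` do not see `f`, and the low cut over `q` is the last edge. -/
lemma cyl_γγ_mem_flag (hS : S.IsOpetopicCardinal) (hf : f ∈ Fl q) (hw : IsFl w f) :
    ∃ v ∈ cylδ w, cylγ hS v = cylγ hS (cylγ hS w) := by
  have hγγ := hS.gap_cylγ (hS.gap_cylγ_flag hw hf.2)
  obtain ⟨v₁, v₂, h₁, h₂, hw⟩ := hS.exists_δ_of_flag hf hw
  obtain ⟨p, hp⟩ := hf.1.some_of_le (i := k) (by omega)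
  have hg := below_mem hf.1 (by omega) hp
  by_cases he : p = S.γ q
  · subst he
    rw [hS.rho_hi_γ hf hp] at hγγ
    exact ⟨v₁, (hw _).2 (Or.inl rfl), hS.gap_unique (hS.gap_cylγ_flag h₁ hg.2) hγγ⟩
  · refine ⟨v₂, (hw _).2 (Or.inr rfl), hS.gap_unique (hS.gap_cylγ h₂) ?_⟩
    rwa [rho_lo_eq_hi fun h => he (Option.some.inj (hp.symm.trans h))]

lemma cyl_γγ_notMem_flag (hS : S.IsOpetopicCardinal) (hf : f ∈ Fl q) (hw : IsFl w f)
    {v : S.CylFace (k + 1)} (hv : v ∈ cylδ w) : cylγ hS (cylγ hS w) ∉ cylδ v := by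
  have hγγ := hS.gap_cylγ (hS.gap_cylγ_flag hw hf.2)
  obtain ⟨v₁, v₂, h₁, h₂, hw⟩ := hS.exists_δ_of_flag hf hw
  obtain ⟨p, hp⟩ := hf.1.some_of_le (i := k) (by omega)
  have hg := below_mem hf.1 (by omega) hp
  rcases (hw v).1 hv with rfl | rfl
  · rw [hS.mem_cylδ_below hf hp h₁]
    rintro (h | h)
    · exact hγγ.not_isFl _ h
    · obtain ⟨rfl, h'⟩ := h.eq hγγ
      rw [hS.rho_hi_γ hf hp] at h'
      exact hS.lo_ne_hi hg h'
  · rw [hS.mem_cylδ_lo hf h₂]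
    rintro ⟨p', hp', hG⟩
    rw [(hG.eq hγγ).1] at hp'
    exact hS.γ_notMem_δ q hp'

/-- If `f` passes through `p ∈ δ q`, its truncation ends at a source of the low cut over `q`. If it
passes through `γ q`, that cut ends at a source of the truncation. -/
lemma cyl_γ_eq_γγ_or_flag (hS : S.IsOpetopicCardinal) (hf : f ∈ Fl q) (hw : IsFl w f)
    {v : S.CylFace (k + 1)} (hv : v ∈ cylδ w) :
    cylγ hS v = cylγ hS (cylγ hS w) ∨ ∃ v' ∈ cylδ w, cylγ hS v ∈ cylδ v' := by
  have hγγ := hS.gap_cylγ (hS.gap_cylγ_flag hw hf.2)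
  obtain ⟨v₁, v₂, h₁, h₂, hw⟩ := hS.exists_δ_of_flag hf hw
  obtain ⟨p, hp⟩ := hf.1.some_of_le (i := k) (by omega)
  have hg := below_mem hf.1 (by omega) hp
  have h₃ := hS.gap_cylγ_flag h₁ hg.2
  have h₄ := hS.gap_cylγ h₂
  have hpq := hf.1.mem_bd hp hf.2
  rcases (hw v).1 hv with rfl | rfl
  · rcases hpq with rfl | hpq
    · rw [hS.rho_hi_γ hf hp] at hγγ
      exact Or.inl (hS.gap_unique h₃ hγγ)
    · refine Or.inr ⟨v₂, (hw _).2 (Or.inr rfl), (hS.mem_cylδ_lo hf h₂).2 ⟨p, hpq, ?_⟩⟩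
      rwa [hS.rho_lo_δ hf hp hpq]
  · by_cases he : p = S.γ q
    · subst he
      rw [hS.rho_lo_γ hf hp] at h₄
      exact Or.inr ⟨v₁, (hw _).2 (Or.inl rfl), (hS.mem_cylδ_below hf hp h₁).2 (Or.inr h₄)⟩
    · rw [rho_lo_eq_hi fun h => he (Option.some.inj (hp.symm.trans h))] at h₄
      exact Or.inl (hS.gap_unique h₄ hγγ)

lemma cyl_mem_δγ_flag (hS : S.IsOpetopicCardinal) (hf : f ∈ Fl q) (hw : IsFl w f)
    {x : S.CylFace k} (hx : x ∈ cylδ (cylγ hS w)) :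
    (∃ v ∈ cylδ w, x ∈ cylδ v) ∧ ∀ v ∈ cylδ w, cylγ hS v ≠ x := by
  have hγ := hS.gap_cylγ_flag hw hf.2
  obtain ⟨v₁, v₂, h₁, h₂, hw⟩ := hS.exists_δ_of_flag hf hw
  obtain ⟨p, hp⟩ := hf.1.some_of_le (i := k) (by omega)
  have hg := below_mem hf.1 (by omega) hp
  have h₃ := hS.gap_cylγ_flag h₁ hg.2
  have h₄ := hS.gap_cylγ h₂
  rcases (hS.mem_cylδ_hi hf hγ).1 hx with ⟨p', hp', hG⟩ | h
  · constructor
    · by_cases he : p = p'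
      · subst he
        rw [hS.rho_hi_δ hf hp hp'] at hG
        exact ⟨v₁, (hw _).2 (Or.inl rfl), (hS.mem_cylδ_below hf hp h₁).2 (Or.inr hG)⟩
      · refine ⟨v₂, (hw _).2 (Or.inr rfl), (hS.mem_cylδ_lo hf h₂).2 ⟨p', hp', ?_⟩⟩
        rwa [rho_lo_eq_hi fun h => he (Option.some.inj (hp.symm.trans h))]
    · rintro v hv rfl
      rcases (hw v).1 hv with rfl | rfl
      · obtain ⟨rfl, h'⟩ := h₃.eq hG
        rw [hS.rho_hi_δ hf hp hp'] at h'
        exact hS.lo_ne_hi hg h'.symm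
      · rw [← (h₄.eq hG).1] at hp'
        exact hS.γ_notMem_δ q hp'
  · refine ⟨⟨v₁, (hw _).2 (Or.inl rfl), (hS.mem_cylδ_below hf hp h₁).2 (Or.inl h)⟩, ?_⟩
    rintro v hv rfl
    rcases (hw v).1 hv with rfl | rfl
    · exact h₃.not_isFl _ h
    · exact h₄.not_isFl _ h

lemma cyl_mem_δγ_or_flag (hS : S.IsOpetopicCardinal) (hf : f ∈ Fl q) (hw : IsFl w f)
    {v : S.CylFace (k + 1)} {x : S.CylFace k} (hv : v ∈ cylδ w) (hx : x ∈ cylδ v) :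
    x ∈ cylδ (cylγ hS w) ∨ ∃ v' ∈ cylδ w, cylγ hS v' = x := by
  have hγ := hS.gap_cylγ_flag hw hf.2
  obtain ⟨v₁, v₂, h₁, h₂, hw⟩ := hS.exists_δ_of_flag hf hw
  obtain ⟨p, hp⟩ := hf.1.some_of_le (i := k) (by omega)
  have hg := below_mem hf.1 (by omega) hp
  have h₃ := hS.gap_cylγ_flag h₁ hg.2
  have h₄ := hS.gap_cylγ h₂
  rw [hS.mem_cylδ_hi hf hγ]
  rcases (hw v).1 hv with rfl | rfl
  · rcases (hS.mem_cylδ_below hf hp h₁).1 hx with h | h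
    · exact Or.inl (Or.inr h)
    · rcases hf.1.mem_bd hp hf.2 with rfl | hpq
      · rw [← hS.rho_lo_γ hf hp] at h
        exact Or.inr ⟨v₂, (hw _).2 (Or.inr rfl), hS.gap_unique h₄ h⟩
      · rw [← hS.rho_hi_δ hf hp hpq] at h
        exact Or.inl (Or.inl ⟨p, hpq, h⟩)
  · obtain ⟨p', hp', hG⟩ := (hS.mem_cylδ_lo hf h₂).1 hx
    by_cases he : p = p'
    · subst he
      rw [hS.rho_lo_δ hf hp hp'] at hG
      exact Or.inr ⟨v₁, (hw _).2 (Or.inl rfl), hS.gap_unique h₃ hG⟩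
    · rw [rho_lo_eq_hi fun h => he (Option.some.inj (hp.symm.trans h))] at hG
      exact Or.inl (Or.inl ⟨p', hp', hG⟩)

end Flags

/-- A step in the tree of a face of the cylinder ends at a gap, and starts at a flag, or at a gap
over a smaller face, or at the gap on the other side of a fixed flag. -/
lemma cyl_step (hS : S.IsOpetopicCardinal) {k : ℕ} (w : S.CylFace (k + 2)) :
    ∃ h : S.Vec, ∀ v ∈ cylδ w, ∀ x ∈ cylδ v, ∃ r I, Gap (cylγ hS v) r I ∧ ∀ r' I', Gap x r' I' →
      S.UpLT r' r ∨ (r' = r ∧ h ∈ Fl r ∧ I' = lo r h ∧ I = hi r h) := by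
  rcases gap_or_isFl w with ⟨q, I, hw⟩ | ⟨f, hw⟩
  · have hI := hS.gap_isLower hw
    have key : ∀ v ∈ cylδ w, ∀ p ∈ S.δ q, Gap v p (rho p q I) → ∀ x ∈ cylδ v, ∃ r I,
        Gap (cylγ hS v) r I ∧ ∀ r' I', Gap x r' I' → S.UpLT r' r := by
      intro v hv p hp hG x hx
      refine ⟨_, _, hS.gap_cylγ hG, fun r' I' hr' => ?_⟩
      rcases (hS.mem_cylδ_gap hG).1 hx with ⟨s, hs, h₁⟩ | ⟨g, -, h₁⟩
      · rw [(hr'.eq h₁).1]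
        exact upLT_γ hs
      · exact (hr'.not_isFl _ h₁).elim
    by_cases hins : ∃ h, Ins q I h
    · obtain ⟨h, hh⟩ := hins
      obtain ⟨s, hs, -⟩ := Fl_of_ins hh
      refine ⟨h, fun v hv x hx => ?_⟩
      rcases (hS.mem_cylδ_gap hw).1 hv with ⟨p, hp, hG⟩ | ⟨h', hh', hf⟩
      · obtain ⟨r, J, hJ, hlt⟩ := key v hv p hp hG x hx
        exact ⟨r, J, hJ, fun r' I' h' => Or.inl (hlt r' I' h')⟩
      · obtain rfl := hS.ins_unique hI hh hh'
        refine ⟨_, _, hS.gap_cylγ_flag hf hs.2, fun r' I' hr' => ?_⟩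
        rcases (hS.mem_cylδ_flag hf hs.2).1 hx with h₁ | h₁
        · exact (hr'.not_isFl _ h₁).elim
        · exact Or.inr ⟨(hr'.eq h₁).1, hs, (hr'.eq h₁).2, rfl⟩
    · refine ⟨fun _ => none, fun v hv x hx => ?_⟩
      rcases (hS.mem_cylδ_gap hw).1 hv with ⟨p, hp, hG⟩ | ⟨h', hh', hf⟩
      · obtain ⟨r, J, hJ, hlt⟩ := key v hv p hp hG x hx
        exact ⟨r, J, hJ, fun r' I' h' => Or.inl (hlt r' I' h')⟩
      · exact (hins ⟨h', hh'⟩).elim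
  · obtain ⟨q, hq⟩ := hw.isFlag.some_of_le le_rfl
    have hf : f ∈ Fl q := ⟨hw.isFlag, hq⟩
    obtain ⟨v₁, v₂, h₁, h₂, hw⟩ := hS.exists_δ_of_flag hf hw
    obtain ⟨p, hp⟩ := hf.1.some_of_le (i := k) (by omega)
    have hg := below_mem hf.1 (by omega) hp
    refine ⟨below (k + 1) f, fun v hv x hx => ?_⟩
    rcases (hw v).1 hv with rfl | rfl
    · refine ⟨_, _, hS.gap_cylγ_flag h₁ hg.2, fun r' I' hr' => ?_⟩
      rcases (hS.mem_cylδ_below hf hp h₁).1 hx with h | h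
      · exact (hr'.not_isFl _ h).elim
      · exact Or.inr ⟨(hr'.eq h).1, hg, (hr'.eq h).2, rfl⟩
    · refine ⟨_, _, hS.gap_cylγ h₂, fun r' I' hr' => ?_⟩
      obtain ⟨p', hp', hG⟩ := (hS.mem_cylδ_lo hf h₂).1 hx
      rw [(hr'.eq hG).1]
      exact Or.inl (upLT_γ hp')

end IsOpetopicCardinal

/-! ### Acyclicity, and the cylinder as a treelike hypergraph -/

namespace IsPositiveOpetope

/-- Along a path the underlying faces strictly increase for `<⁺`, except for the single step from
`lo r h` to `hi r h`. That step cannot be repeated, since the two cuts differ, so no path returns to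
its start. -/
lemma cylinder_acyclic (hS : S.IsPositiveOpetope) {k : ℕ} (w : S.CylFace (k + 2))
    (x : S.CylFace k) :
    ¬ Relation.TransGen (TreeStep (S := S.cylinder hS) (n := k) w) x x := by
  have hO := hS.toIsOpetopicCardinal
  obtain ⟨h, hh⟩ := hO.cyl_step w
  have key : ∀ y, Relation.TransGen (TreeStep (S := S.cylinder hS) (n := k) w) x y → ∃ r I,
      Gap y r I ∧ ∀ r' I', Gap x r' I' →
        S.UpLT r' r ∨ (r' = r ∧ h ∈ Fl r ∧ I' = lo r h ∧ I = hi r h) := by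
    intro y hy
    induction hy with
    | single hs =>
      obtain ⟨v, hv, hx, rfl⟩ := hs
      exact hh v hv _ hx
    | tail _ hs ih =>
      obtain ⟨v, hv, hx, rfl⟩ := hs
      obtain ⟨r₁, I₁, h₁, h₁'⟩ := ih
      obtain ⟨r₂, I₂, h₂, h₂'⟩ := hh v hv _ hx
      refine ⟨r₂, I₂, h₂, fun r' I' hr' => ?_⟩
      rcases h₁' r' I' hr' with h₃ | ⟨rfl, hr, rfl, rfl⟩
      · rcases h₂' r₁ I₁ h₁ with h₄ | ⟨rfl, -⟩
        · exact Or.inl (h₃.trans h₄)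
        · exact Or.inl h₃
      · rcases h₂' _ _ h₁ with h₄ | ⟨rfl, -, h₄, -⟩
        · exact Or.inl h₄
        · exact (hO.lo_ne_hi hr h₄.symm).elim
  intro hx
  obtain ⟨r, I, hG, h'⟩ := key x hx
  rcases h' r I hG with h' | ⟨-, hr, rfl, h'⟩
  · exact hO.strict _ h'
  · exact hO.lo_ne_hi hr h'

lemma mem_Fl_of_isFl {k : ℕ} {w : S.CylFace (k + 1)} {f : S.Vec} (hw : IsFl w f) :
    ∃ q : S.F k, f ∈ Fl q := by
  obtain ⟨q, hq⟩ := hw.isFlag.some_of_le le_rfl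
  exact ⟨q, hw.isFlag, hq⟩

theorem cylinder_isTreelike (hS : S.IsPositiveOpetope) : (S.cylinder hS).IsTreelike where
  γ_notMem a := hS.toIsOpetopicCardinal.cyl_γ_notMem a
  glob_γ {k} a := by
    have hO := hS.toIsOpetopicCardinal
    have h : (∃ v ∈ cylδ a, cylγ hO v = cylγ hO (cylγ hO a)) ∧
        (∀ v ∈ cylδ a, cylγ hO (cylγ hO a) ∉ cylδ v) ∧
        ∀ v ∈ cylδ a, cylγ hO v = cylγ hO (cylγ hO a) ∨ ∃ v' ∈ cylδ a, cylγ hO v ∈ cylδ v' := by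
      rcases gap_or_isFl a with ⟨q, I, hw⟩ | ⟨f, hw⟩
      · exact ⟨hO.cyl_γγ_mem_gap hw, fun v => hO.cyl_γγ_notMem_gap hw,
          fun v => hO.cyl_γ_eq_γγ_or_gap hw⟩
      · obtain ⟨q, hf⟩ := mem_Fl_of_isFl hw
        exact ⟨hO.cyl_γγ_mem_flag hf hw, fun v => hO.cyl_γγ_notMem_flag hf hw,
          fun v => hO.cyl_γ_eq_γγ_or_flag hf hw⟩
    obtain ⟨h₁, h₂, h₃⟩ := h
    refine Set.Subset.antisymm ?_ ?_
    · rintro _ rfl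
      refine ⟨h₁, fun h => ?_⟩
      simp only [Set.mem_iUnion] at h
      obtain ⟨v, hv, h⟩ := h
      exact h₂ v hv h
    · rintro _ ⟨⟨v, hv, rfl⟩, h⟩
      refine (h₃ v hv).resolve_right ?_
      rintro ⟨v', hv', h'⟩
      refine h ?_
      simp only [Set.mem_iUnion]
      exact ⟨v', hv', h'⟩
  glob_δ {k} a := by
    have hO := hS.toIsOpetopicCardinal
    have h : (∀ x ∈ cylδ (cylγ hO a), (∃ v ∈ cylδ a, x ∈ cylδ v) ∧ ∀ v ∈ cylδ a, cylγ hO v ≠ x) ∧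
        ∀ v ∈ cylδ a, ∀ x ∈ cylδ v, x ∈ cylδ (cylγ hO a) ∨ ∃ v' ∈ cylδ a, cylγ hO v' = x := by
      rcases gap_or_isFl a with ⟨q, I, hw⟩ | ⟨f, hw⟩
      · exact ⟨fun x => hO.cyl_mem_δγ_gap hw, fun v hv x => hO.cyl_mem_δγ_or_gap hw hv⟩
      · obtain ⟨q, hf⟩ := mem_Fl_of_isFl hw
        exact ⟨fun x => hO.cyl_mem_δγ_flag hf hw, fun v hv x => hO.cyl_mem_δγ_or_flag hf hw hv⟩
    obtain ⟨h₁, h₂⟩ := h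
    refine Set.Subset.antisymm ?_ ?_
    · intro x hx
      obtain ⟨⟨v, hv, hxv⟩, hno⟩ := h₁ x hx
      refine ⟨?_, ?_⟩
      · simp only [Set.mem_iUnion]
        exact ⟨v, hv, hxv⟩
      · rintro ⟨v', hv', h'⟩
        exact hno v' hv' h'
    · rintro x ⟨hx, hno⟩
      simp only [Set.mem_iUnion] at hx
      obtain ⟨v, hv, hxv⟩ := hx
      refine (h₂ v hv x hxv).resolve_right ?_
      rintro ⟨v', hv', h'⟩
      exact hno ⟨v', hv', h'⟩
  inj_γ {k} a := by
    have hO := hS.toIsOpetopicCardinal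
    rcases gap_or_isFl a with ⟨q, I, hw⟩ | ⟨f, hw⟩
    · exact hO.cyl_inj_γ_gap hw
    · obtain ⟨q, hf⟩ := mem_Fl_of_isFl hw
      exact hO.cyl_inj_γ_flag hf hw
  disj_δ {k} a b b' x hb hb' hx hx' := by
    have hO := hS.toIsOpetopicCardinal
    rcases gap_or_isFl a with ⟨q, I, hw⟩ | ⟨f, hw⟩
    · exact hO.cyl_disj_δ_gap hw hb hb' hx hx'
    · obtain ⟨q, hf⟩ := mem_Fl_of_isFl hw
      exact hO.cyl_disj_δ_flag hf hw hb hb' hx hx'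
  acyclic a x := hS.cylinder_acyclic a x

end IsPositiveOpetope

end PosHypergraph

namespace PosHypergraph

variable {S : PosHypergraph.{u}}

/-! ## Maximal flags -/

lemma bddAbove_dim : BddAbove {k | Nonempty (S.F k)} := by
  obtain ⟨N, hN⟩ := S.bounded
  refine ⟨N, fun k hk => ?_⟩
  by_contra h
  exact (hN k (by omega)).false hk.some

lemma le_dim {k : ℕ} (q : S.F k) : k ≤ S.dim := le_csSup bddAbove_dim ⟨q⟩

lemma below_congr {m : ℕ} {x y : S.Vec} (h : ∀ i < m, x i = y i) : below m x = below m y := by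
  funext i
  unfold below
  split_ifs with hi
  · exact h i hi
  · rfl

lemma below_below {m l : ℕ} (h : m ≤ l) (x : S.Vec) : below m (below l x) = below m x :=
  below_congr fun _ hi => below_of_lt (by omega)

lemma eq_of_below_eq {m : ℕ} {x y : S.Vec} (h : below m x = below m y) {i : ℕ} (hi : i < m) :
    x i = y i := by
  rw [← below_of_lt (x := x) hi, h, below_of_lt hi]

lemma Flip.below_top {k i : ℕ} {x y : S.Vec} (h : Flip k i x y) (hi : i < k) :
    Flip (i + 1) i (below (i + 2) x) (below (i + 2) y) := by
  refine ⟨h.1.below (by omega), h.2.1.below (by omega), fun j hj => ?_, ?_⟩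
  · unfold below
    split_ifs
    · exact h.2.2.1 j hj
    · rfl
  · rw [below_of_lt (by omega), below_of_lt (by omega)]
    exact h.2.2.2

namespace IsPositiveOpetope

lemma eq_of_notMem_δ (hS : S.IsPositiveOpetope) {k : ℕ} {a b : S.F k}
    (ha : ∀ α : S.F (k + 1), a ∉ S.δ α) (hb : ∀ α : S.F (k + 1), b ∉ S.δ α) : a = b := by
  refine (Set.ncard_le_one (Set.toFinite _)).1 (hS.size_le_one k) a ?_ b ?_
  · exact ⟨trivial, by simpa using ha⟩
  · exact ⟨trivial, by simpa using hb⟩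

lemma exists_top (hS : S.IsPositiveOpetope) : ∃ T : S.F S.dim, ∀ T', T' = T := by
  obtain ⟨T⟩ : Nonempty (S.F S.dim) := Nat.sSup_mem ⟨0, hS.nonempty⟩ bddAbove_dim
  have h : ∀ a : S.F S.dim, ∀ α : S.F (S.dim + 1), a ∉ S.δ α := fun a α =>
    absurd (le_dim α) (by omega)
  exact ⟨T, fun T' => hS.eq_of_notMem_δ (h T') (h T)⟩

/-- If `p` is in no domain, take a codomain `γ a` maximal for `<⁺`. It is in no domain either, so it
equals `p` because the size is at most one. -/
lemma exists_mem_bd (hS : S.IsPositiveOpetope) {k : ℕ} (hk : k < S.dim) (p : S.F k) :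
    ∃ a : S.F (k + 1), p ∈ S.bd a := by
  by_cases h : ∃ a : S.F (k + 1), p ∈ S.δ a
  · obtain ⟨a, ha⟩ := h
    exact ⟨a, Or.inr ha⟩
  · push Not at h
    obtain ⟨T, -⟩ := hS.exists_top
    obtain ⟨_, ⟨a, rfl⟩, hmax⟩ := (hS.upGT_wf k).has_min (Set.range (S.γ (k := k)))
      ⟨_, S.iterγ T (k + 1) hk, rfl⟩
    refine ⟨a, Or.inl (hS.eq_of_notMem_δ h fun α hα => ?_)⟩
    exact hmax _ ⟨α, rfl⟩ (upLT_γ hα)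

lemma exists_maximal (hS : S.IsPositiveOpetope) {k : ℕ} {f : S.Vec} (hf : IsFlag k f)
    (hk : k ≤ S.dim) : ∃ x, IsFlag S.dim x ∧ ∀ i ≤ k, x i = f i := by
  obtain ⟨d, hd⟩ := Nat.exists_eq_add_of_le hk
  induction d generalizing k f with
  | zero =>
    obtain rfl : k = S.dim := by omega
    exact ⟨f, hf, fun _ _ => rfl⟩
  | succ d ih =>
    obtain ⟨p, hp⟩ := hf.some_of_le le_rfl
    obtain ⟨a, ha⟩ := hS.exists_mem_bd (by omega) p
    obtain ⟨x, hx, h⟩ := ih (hf.extend hp ha) (by omega) (by omega)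
    refine ⟨x, hx, fun i hi => ?_⟩
    rw [h i (by omega), Function.update_of_ne (by omega)]

theorem isStrictTotalOrder (hS : S.IsPositiveOpetope) :
    IsStrictTotalOrder S.MaxFlag MaxFlag.LT where
  trichotomous a b h₁ h₂ := by
    by_contra hne
    rcases hS.flagLT_total' a.2 b.2 (fun h => hne (Subtype.ext h)) with h | h
    · exact h₁ h
    · exact h₂ h
  irrefl a := hS.flagLT_irrefl a.1
  trans _ _ _ h h' := hS.flagLT_trans h h'

/-! ## Sub-hypergraphs of the cylinder -/

lemma exists_mem_bd_gap (hS : S.IsPositiveOpetope) (A : (S.cylinder hS).Sub) {k : ℕ}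
    {w : S.CylFace (k + 1)} (hw : w ∈ A.carrier (k + 1)) {q : S.F (k + 1)} {I : Set S.Vec}
    (hq : Gap w q I) {p : S.F k} (hp : p ∈ S.bd q) :
    ∃ v : S.CylFace k, v ∈ A.carrier k ∧ Gap v p (rho p q I) := by
  rcases hp with rfl | hp
  · exact ⟨_, A.γ_mem w hw, hS.gap_cylγ hq⟩
  · obtain ⟨v, hv, h⟩ := hS.exists_δ_gap hq hp
    exact ⟨v, A.δ_mem w hw hv, h⟩

lemma exists_mem_gap (hS : S.IsPositiveOpetope) (A : (S.cylinder hS).Sub) {n : ℕ}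
    {w : S.CylFace n} (hw : w ∈ A.carrier n) {T : S.F n} {I : Set S.Vec} (hT : Gap w T I)
    {x : S.Vec} (hx : x ∈ Fl T) {j : ℕ} (hj : j ≤ n) :
    ∃ p, x j = some p ∧ ∃ v : S.CylFace j, v ∈ A.carrier j ∧ ∃ J, Gap v p J := by
  induction hj using Nat.decreasingInduction with
  | self => exact ⟨T, hx.2, w, hw, I, hT⟩
  | of_succ j hj ih =>
    obtain ⟨p, hp, v, hv, J, hJ⟩ := ih
    obtain ⟨r, hr⟩ := hx.1.some_of_le (i := j) (by omega)
    obtain ⟨v', hv', h⟩ := hS.exists_mem_bd_gap A hv hJ (hx.1.mem_bd hr hp)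
    exact ⟨r, hr, v', hv', _, h⟩

/-- The cut just before `x` restricts, along the faces of `x`, to the cut just before the
truncation. -/
lemma exists_mem_prev (hS : S.IsPositiveOpetope) (A : (S.cylinder hS).Sub) {n : ℕ}
    {w : S.CylFace n} (hw : w ∈ A.carrier n) {T : S.F n} {x : S.Vec} (hx : x ∈ Fl T)
    (hT : Gap w T (prev T x)) {j : ℕ} (hj : j ≤ n) :
    ∃ p, x j = some p ∧ ∃ v : S.CylFace j, v ∈ A.carrier j ∧ Gap v p (prev p (below (j + 1) x)) := by
  induction hj using Nat.decreasingInduction with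
  | self => exact ⟨T, hx.2, w, hw, by rwa [hx.1.below_eq_self (by omega)]⟩
  | of_succ j hj ih =>
    obtain ⟨p, hp, v, hv, hJ⟩ := ih
    obtain ⟨r, hr⟩ := hx.1.some_of_le (i := j) (by omega)
    have hrp := hx.1.mem_bd hr hp
    obtain ⟨v', hv', h⟩ := hS.exists_mem_bd_gap A hv hJ hrp
    have hb : below (j + 1) (below (j + 1 + 1) x) = below (j + 1) x := below_below (by omega) x
    rw [hS.rho_prev hrp (f := below (j + 1) x) (below_mem hx.1 (by omega) hr)
      (by rw [← hb]; exact ext_below (below_mem hx.1 (by omega) hp))] at h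
    exact ⟨r, hr, v', hv', h⟩

lemma exists_mem_below (hS : S.IsPositiveOpetope) (A : (S.cylinder hS).Sub) {k : ℕ}
    {w : S.CylFace (k + 1)} (hw : w ∈ A.carrier (k + 1)) {h : S.Vec} (hh : IsFl w h) {j : ℕ}
    (hj : j ≤ k) : ∃ v : S.CylFace (j + 1), v ∈ A.carrier (j + 1) ∧ IsFl v (below (j + 1) h) := by
  have hf := hh.isFlag
  induction hj using Nat.decreasingInduction with
  | self => exact ⟨w, hw, by rwa [hf.below_eq_self (by omega)]⟩
  | of_succ j hj ih =>
    obtain ⟨v, hv, hv'⟩ := ih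
    obtain ⟨q, hq⟩ := (hf.below (m := j + 1) hj).some_of_le le_rfl
    obtain ⟨u, hu⟩ := exists_isFl (hf.below (m := j) (by omega))
    refine ⟨u, A.δ_mem v hv ((hS.mem_cylδ_flag hv' hq).2 (Or.inl ?_)), hu⟩
    rwa [below_below (by omega)]

/-- The low domain face and the codomain of `h` are the two cuts next to it, in an order given by
the sign. -/
lemma exists_mem_prev_next (hS : S.IsPositiveOpetope) (A : (S.cylinder hS).Sub) {k : ℕ}
    {w : S.CylFace (k + 1)} (hw : w ∈ A.carrier (k + 1)) {h : S.Vec} (hh : IsFl w h) {q : S.F k}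
    (hq : h ∈ Fl q) : (∃ v : S.CylFace k, v ∈ A.carrier k ∧ Gap v q (prev q h)) ∧
      ∃ v : S.CylFace k, v ∈ A.carrier k ∧ Gap v q (next q h) := by
  have h₁ : ∃ v : S.CylFace k, v ∈ A.carrier k ∧ Gap v q (lo q h) := by
    obtain ⟨v, hv⟩ := hS.exists_gap (hS.isLower_lo q h)
    exact ⟨v, A.δ_mem w hw ((hS.mem_cylδ_flag hh hq.2).2 (Or.inr hv)), hv⟩
  have h₂ : ∃ v : S.CylFace k, v ∈ A.carrier k ∧ Gap v q (hi q h) :=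
    ⟨_, A.γ_mem w hw, hS.gap_cylγ_flag hh hq.2⟩
  unfold lo at h₁
  unfold hi at h₂
  split_ifs at h₁ h₂
  · exact ⟨h₁, h₂⟩
  · exact ⟨h₂, h₁⟩

lemma flag_mem_flagSub (hS : S.IsPositiveOpetope) {k : ℕ} (x : S.Flag k) :
    CylFace.flag x ∈ (flagSub hS x).carrier (k + 1) := fun _ h => h

/-- Every cut ends just before or just after some flag. Extending that flag to a maximal one puts
both cuts next to it in the corresponding opetope. -/
lemma exists_mem_flagSub (hS : S.IsPositiveOpetope) {d : ℕ} (w : S.CylFace d) :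
    ∃ x : S.MaxFlag, w ∈ (flagSub hS x).carrier d := by
  rcases gap_or_isFl w with ⟨q, I, hw⟩ | ⟨f, hw⟩
  · have hI := hS.gap_isLower hw
    obtain ⟨f, hf, h⟩ : ∃ f ∈ Fl q, I = prev q f ∨ I = next q f := by
      by_cases hne : I.Nonempty
      · obtain ⟨f, hf, hmax⟩ := hS.exists_max hI.1 hne
        refine ⟨f, hI.1 hf, Or.inr (Set.Subset.antisymm (fun g hg => ⟨hI.1 hg, hmax g hg⟩) ?_)⟩
        rintro g ⟨hg, rfl | h⟩
        · exact hf
        · exact hI.2 f hf g hg h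
      · obtain ⟨f, hf, hmin⟩ := hS.exists_min (subset_refl (Fl q)) (Fl_nonempty q)
        rw [Set.not_nonempty_iff_eq_empty] at hne
        refine ⟨f, hf, Or.inl ?_⟩
        rw [hne, eq_comm, Set.eq_empty_iff_forall_notMem]
        rintro g ⟨hg, h⟩
        rcases hmin g hg with rfl | h'
        · exact hS.flagLT_irrefl _ h
        · exact hS.flagLT_asymm h h'
    obtain ⟨x, hx, hxf⟩ := hS.exists_maximal hf.1 (le_dim q)
    refine ⟨⟨x, hx⟩, ?_⟩
    obtain ⟨v, hv, hvf⟩ := hS.exists_mem_below _ (hS.flag_mem_flagSub ⟨x, hx⟩) (h := x) rfl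
      (le_dim q)
    rw [(hx.below (le_dim q)).ext hf.1 fun i hi => (below_of_lt (by omega)).trans (hxf i hi)] at hvf
    obtain ⟨⟨v₁, h₁, g₁⟩, v₂, h₂, g₂⟩ := hS.exists_mem_prev_next _ hv hvf hf
    rcases h with rfl | rfl
    · rwa [hS.gap_unique hw g₁]
    · rwa [hS.gap_unique hw g₂]
  · rcases d with _ | k
    · exact absurd hw (not_isFl_zero w f)
    · have hf := hw.isFlag
      obtain ⟨p, hp⟩ := hf.some_of_le le_rfl
      obtain ⟨x, hx, hxf⟩ := hS.exists_maximal hf (le_dim p)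
      refine ⟨⟨x, hx⟩, ?_⟩
      obtain ⟨v, hv, hvf⟩ := hS.exists_mem_below _ (hS.flag_mem_flagSub ⟨x, hx⟩) (h := x) rfl
        (le_dim p)
      rw [(hx.below (le_dim p)).ext hf fun i hi => (below_of_lt (by omega)).trans (hxf i hi)] at hvf
      rwa [hw.unique hvf]

end IsPositiveOpetope

end PosHypergraph

namespace PosHypergraph

variable {S : PosHypergraph.{u}}

/-! ## Intersections of the opetopes of maximal flags -/

/-- The flags among the faces are truncations of `y`, and the cuts agree with the cut at `y`
outside the truncations of `y`. -/
def InA (y : S.Vec) {k : ℕ} (w : S.CylFace k) : Prop :=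
  (∀ h, IsFl w h → h = below k y) ∧
    ∀ q I, Gap w q I → ∀ f ∈ Fl q, f ≠ below (k + 1) y → (f ∈ I ↔ FlagLT f y)

namespace IsPositiveOpetope

lemma exists_ne_of_ne_below {k n : ℕ} {f y : S.Vec} (hf : IsFlag k f) (hy : IsFlag n y)
    (hk : k ≤ n) (hne : f ≠ below (k + 1) y) : ∃ i ≤ k, f i ≠ y i := by
  by_contra h
  push Not at h
  exact hne (hf.ext (hy.below hk) fun i hi => (h i hi).trans (below_of_lt (by omega)).symm)

/-- If `f` and `y` differ at some level up to `k`, their comparison is decided there and is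
unaffected by changes higher up. -/
lemma flagLT_iff_of_agree (hS : S.IsPositiveOpetope) {k l m n : ℕ} {f y g z : S.Vec}
    (hf : IsFlag k f) (hy : IsFlag n y) (hg : IsFlag l g) (hz : IsFlag m z)
    (hfg : ∀ i ≤ k, g i = f i) (hyz : ∀ i ≤ k, z i = y i) (hkn : k ≤ n) (hkl : k ≤ l)
    (hkm : k ≤ m) (hne : ∃ i ≤ k, f i ≠ y i) : FlagLT f y ↔ FlagLT g z := by
  have h₁ : ∀ {a b : S.Vec}, FlagLT (below (k + 1) a) (below (k + 1) b) →
      ∀ {s t : ℕ}, IsFlag s a → IsFlag t b → k ≤ s → k ≤ t → FlagLT a b := fun h _ _ ha hb hs ht =>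
    hS.flagLT_of_agree h (ha.below hs) (hb.below ht)
      (fun i hi => (below_of_lt (by omega)).symm) fun i hi => (below_of_lt (by omega)).symm
  have e₁ : below (k + 1) f = below (k + 1) g := below_congr fun i hi => (hfg i (by omega)).symm
  have e₂ : below (k + 1) y = below (k + 1) z := below_congr fun i hi => (hyz i (by omega)).symm
  obtain ⟨i, hi, hne⟩ := hne
  rcases hS.flagLT_total (hf.below le_rfl) (hy.below hkn) hi hi (by
    rwa [below_of_lt (by omega), below_of_lt (by omega)]) with h | h
  · exact ⟨fun _ => h₁ (e₁ ▸ e₂ ▸ h) hg hz hkl hkm, fun _ => h₁ h hf hy le_rfl hkn⟩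
  · have a₁ := h₁ h hy hf hkn le_rfl
    have a₂ : FlagLT z g := h₁ (e₁ ▸ e₂ ▸ h) hz hg hkm hkl
    exact ⟨fun h => (hS.flagLT_asymm h a₁).elim, fun h => (hS.flagLT_asymm h a₂).elim⟩

/-- A flag `f` under `p` that is not a truncation of `y` differs from `y` at a level of `f`, so
extending it by `q` does not alter its position relative to `y`. -/
lemma inA_rho (hS : S.IsPositiveOpetope) {n k : ℕ} {y : S.Vec} (hy : IsFlag n y) (hk : k + 1 ≤ n)
    {w : S.CylFace (k + 1)} (hw : InA y w) {q : S.F (k + 1)} {I : Set S.Vec} (hI : Gap w q I)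
    {p : S.F k} (hp : p ∈ S.bd q) {v : S.CylFace k} (hv : Gap v p (rho p q I)) : InA y v := by
  refine ⟨fun h hh => absurd hh (hv.not_isFl h), fun p' J hJ f hf hne => ?_⟩
  obtain ⟨rfl, rfl⟩ := hv.eq hJ
  have hd := exists_ne_of_ne_below hf.1 hy (by omega) hne
  have hext := ext_mem hf hp
  have h := hw.2 q I hI (ext q f) hext fun h => by
    obtain ⟨i, hi, hd⟩ := hd
    refine hd ?_
    rw [← ext_of_le q f hi, h, below_of_lt (by omega)]
  have h' := hS.flagLT_iff_of_agree hf.1 hy hext.1 hy (fun i hi => ext_of_le q f hi)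
    (fun i _ => rfl) (by omega) (by omega) (by omega) hd
  rw [h', ← h]
  exact ⟨fun h => h.2, fun h => ⟨hf, h⟩⟩

lemma inA_prev_next (hS : S.IsPositiveOpetope) {n k : ℕ} {y : S.Vec} (hy : IsFlag n y)
    (hk : k ≤ n) {q : S.F k} (hq : below (k + 1) y ∈ Fl q) {I : Set S.Vec}
    (hI : I = prev q (below (k + 1) y) ∨ I = next q (below (k + 1) y)) {v : S.CylFace k}
    (hv : Gap v q I) : InA y v := by
  refine ⟨fun h hh => absurd hh (hv.not_isFl h), fun p' J hJ f hf hne => ?_⟩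
  obtain ⟨rfl, rfl⟩ := hv.eq hJ
  have hd := exists_ne_of_ne_below hf.1 hy (by omega) hne
  rw [hS.flagLT_iff_of_agree hf.1 hy hf.1 hq.1 (fun i hi => rfl)
    (fun i hi => below_of_lt (by omega)) (by omega) (by omega) (by omega) hd]
  rcases hI with rfl | rfl
  · exact ⟨fun h => h.2, fun h => ⟨hf, h⟩⟩
  · exact ⟨fun h => h.2.resolve_left hne, fun h => ⟨hf, Or.inr h⟩⟩

lemma lo_eq {k : ℕ} (q : S.F k) (h : S.Vec) : lo q h = prev q h ∨ lo q h = next q h := by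
  unfold lo
  split_ifs <;> simp

lemma hi_eq {k : ℕ} (q : S.F k) (h : S.Vec) : hi q h = prev q h ∨ hi q h = next q h := by
  unfold hi
  split_ifs <;> simp

/-- Let the cut end between `x₁` and `y₁`. If neither is a truncation of `y`, the agreement of cuts
places `y` between them, so `y` has their common lower part. -/
lemma inA_of_ins (hS : S.IsPositiveOpetope) {n k : ℕ} {y : S.Vec} (hy : IsFlag n y)
    (hk : k + 1 ≤ n) {w : S.CylFace (k + 1)} (hw : InA y w) {q : S.F (k + 1)} {I : Set S.Vec}
    (hI : Gap w q I) {h : S.Vec} (hh : Ins q I h) {v : S.CylFace k} (hv : IsFl v h) :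
    InA y v := by
  refine ⟨fun g hg => ?_, fun p' J hJ => absurd hv (hJ.not_isFl h)⟩
  obtain rfl := hv.eq hg
  obtain ⟨x₁, y₁, ha, hf, hx, hy₁, rfl⟩ := hh
  have hag : ∀ i < k, x₁ i = y₁ i := fun i hi => (hf.2.2.1 i (by omega)).symm
  by_cases e₁ : x₁ = below (k + 2) y
  · rw [e₁, below_below (by omega)]
  by_cases e₂ : y₁ = below (k + 2) y
  · rw [below_congr hag, e₂, below_below (by omega)]
  have h₁ := (hw.2 q I hI x₁ ha.1 e₁).1 hx
  have h₂ := mt (hw.2 q I hI y₁ ha.2.1 e₂).2 hy₁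
  obtain ⟨i, hi, hne⟩ := exists_ne_of_ne_below hf.2.1 hy hk e₂
  have h₃ := (hS.flagLT_total hf.2.1 hy hi (by omega) hne).resolve_left h₂
  exact below_congr fun i hi => (hS.agree_of_between hag (Or.inr h₁) (Or.inr h₃) i hi).symm

/-- The faces of the cylinder compatible with a maximal flag. -/
noncomputable def subA (hS : S.IsPositiveOpetope) (y : S.MaxFlag) : (S.cylinder hS).Sub where
  carrier _ := {w | InA y.1 w}
  γ_mem {k} w hw := by
    have hy := y.2
    rcases gap_or_isFl w with ⟨q, I, hI⟩ | ⟨h, hh⟩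
    · exact hS.inA_rho hy (le_dim q) hw hI (γ_mem_bd q) (hS.gap_cylγ hI)
    · obtain ⟨q, hq⟩ := mem_Fl_of_isFl hh
      obtain rfl := hw.1 h hh
      exact hS.inA_prev_next hy (le_dim q) hq (hi_eq q _) (hS.gap_cylγ_flag hh hq.2)
  δ_mem {k} w hw v hv := by
    have hy := y.2
    rcases gap_or_isFl w with ⟨q, I, hI⟩ | ⟨h, hh⟩
    · rcases (hS.mem_cylδ_gap hI).1 hv with ⟨p, hp, hvp⟩ | ⟨g, hg, hvg⟩
      · exact hS.inA_rho hy (le_dim q) hw hI (mem_bd_of_mem_δ hp) hvp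
      · exact hS.inA_of_ins hy (le_dim q) hw hI hg hvg
    · obtain ⟨q, hq⟩ := mem_Fl_of_isFl hh
      obtain rfl := hw.1 h hh
      rcases (hS.mem_cylδ_flag hh hq.2).1 hv with hv | hv
      · rw [below_below (by omega)] at hv
        exact ⟨fun g hg => hg.eq hv, fun p' J hJ => absurd hv (hJ.not_isFl _)⟩
      · exact hS.inA_prev_next hy (le_dim q) hq (lo_eq q _) hv

lemma inA_of_mem_flagSub (hS : S.IsPositiveOpetope) (y : S.MaxFlag) {d : ℕ} {w : S.CylFace d}
    (hw : w ∈ (flagSub hS y).carrier d) : InA y.1 w := by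
  refine hw (hS.subA y) ⟨fun h hh => ?_, fun p' J hJ => hJ.elim⟩
  obtain rfl : y.1 = h := hh
  exact (y.2.below_eq_self (by omega)).symm

/-- Restrict the cut of `z` down to the face at level `i + 1`. There the flip of `x` and `x'` is at
the high level, so their common lower part is inserted as a flag, and its truncations follow. -/
lemma flag_mem_pflagSub (hS : S.IsPositiveOpetope) {n i : ℕ} {z : S.PFlag n} {T : S.F n}
    {x x' : S.Vec} (hxx : Adj T x x') (hflip : Flip n i x x') (hi : i < n)
    (hz : Gap (.pflag z) T (prev T x')) {k : ℕ} (hk : k < i) {w : S.CylFace (k + 1)}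
    (hw : IsFl w (below (k + 1) x')) : w ∈ (pflagSub hS z).carrier (k + 1) := by
  obtain ⟨i, rfl⟩ : ∃ j, i = j + 1 := ⟨i - 1, by omega⟩
  obtain ⟨p, hp, v, hv, hvp⟩ := hS.exists_mem_prev (pflagSub hS z) (w := .pflag z)
    (fun _ h => h) hxx.2.1 hz (j := i + 2) (by omega)
  have hfl := hflip.below_top hi
  have hp' : x (i + 2) = some p := by rw [← hflip.2.2.1 _ (by omega)]; exact hp
  have hs : sgn (below (i + 3) x) (i + 2) = 1 := by
    rw [sgn_congr (y := x) fun j hj => below_of_lt (by omega)]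
    exact (hS.flip_lt_iff hflip hi).1 hxx.2.2.1
  have hadj : Adj p (below (i + 3) x) (below (i + 3) x') :=
    hS.high_adj hfl (by rw [below_of_lt (by omega)]; exact hp') hs
  have hins : Ins p (prev p (below (i + 3) x')) (below (i + 1) (below (i + 3) x)) :=
    ⟨_, _, hadj, hfl, ⟨hadj.1, hadj.2.2.1⟩, fun h => hS.flagLT_irrefl _ h.2, rfl⟩
  obtain ⟨u, hu, huf⟩ := hS.exists_δ_flag hvp hins
  obtain ⟨u', hu', huf'⟩ := hS.exists_mem_below (pflagSub hS z)
    ((pflagSub hS z).δ_mem v hv hu) huf (j := k) (by omega)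
  rw [below_below (by omega), below_below (by omega),
    below_congr fun j hj => (hflip.2.2.1 j (by omega)).symm] at huf'
  rwa [hw.unique huf']

/-- A flag compatible with `y` and `x'` is a common truncation, and by betweenness also one of `x`.
A cut compatible with both agrees with the cut at `x'` everywhere except possibly at the truncation
of `x'`, so only that flag remains to be examined. -/
lemma mem_pflagSub (hS : S.IsPositiveOpetope) {i : ℕ} {z : S.PFlag S.dim} {T : S.F S.dim}
    {x x' y : S.MaxFlag} (hxx : Adj T x.1 x'.1) (hflip : Flip S.dim i x.1 x'.1) (hi : i < S.dim)
    (hz : Gap (.pflag z) T (prev T x'.1)) (hzx : ∀ d, (pflagSub hS z).carrier d ⊆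
      (flagSub hS x).carrier d) (hzx' : ∀ d, (pflagSub hS z).carrier d ⊆
      (flagSub hS x').carrier d) (hy : y.1 = x.1 ∨ FlagLT y.1 x.1) {d : ℕ} {w : S.CylFace d}
    (hw : InA y.1 w) (hw' : InA x'.1 w) : w ∈ (pflagSub hS z).carrier d := by
  have hlt : ∀ {k}, (∀ j < k, y.1 j = x'.1 j) → k ≤ i := fun {k} h => by
    by_contra hk
    have := hS.agree_of_between h hy (Or.inr hxx.2.2.1) i (by omega)
    exact hflip.2.2.2 ((h i (by omega)).symm.trans this.symm)
  have hyx' : FlagLT y.1 x'.1 := by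
    rcases hy with h | h
    · rw [h]; exact hxx.2.2.1
    · exact hS.flagLT_trans h hxx.2.2.1
  rcases gap_or_isFl w with ⟨q, I, hI⟩ | ⟨h, hh⟩
  · have hd := le_dim q
    have hIq := hS.gap_isLower hI
    obtain ⟨f, hf⟩ := Fl_nonempty q
    obtain ⟨x₀, hx₀, hx₀f⟩ := hS.exists_maximal hf.1 hd
    obtain ⟨T₀, hT₀⟩ := hS.exists_top
    have hx₀T : x₀ ∈ Fl T := by
      obtain ⟨T', hT'⟩ := hx₀.some_of_le le_rfl
      exact ⟨hx₀, by rw [hT', hT₀ T', hT₀ T]⟩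
    -- Restricting the cut of `z` along a maximal flag through `q` gives a face of its opetope over
    -- `q`, with cut `J`; the aim is `I = J` where possible.
    obtain ⟨q', hq', v, hv, J, hJ⟩ := hS.exists_mem_gap (pflagSub hS z) (w := .pflag z)
      (fun _ h => h) hz hx₀T hd
    rw [hx₀f d le_rfl, hf.2] at hq'
    obtain rfl := Option.some.inj hq'
    have hJq := hS.gap_isLower hJ
    have hvx := hS.inA_of_mem_flagSub x (hzx d hv)
    have hvx' := hS.inA_of_mem_flagSub x' (hzx' d hv)
    have key : (∀ f₀ ∈ Fl q, f₀ = below (d + 1) x'.1 → (f₀ ∈ I ↔ f₀ ∈ J)) →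
        w ∈ (pflagSub hS z).carrier d := fun h => by
      have : I = J := by
        ext g
        by_cases hg : g ∈ Fl q
        · by_cases he : g = below (d + 1) x'.1
          · exact h g hg he
          · rw [hw'.2 q I hI g hg he, hvx'.2 q J hJ g hg he]
        · exact ⟨fun h => absurd (hIq.1 h) hg, fun h => absurd (hJq.1 h) hg⟩
      subst this
      rwa [hS.gap_unique hI hJ]
    have notMem : ∀ {u : S.MaxFlag} {v : S.CylFace d} {K : Set S.Vec}, InA u.1 v → Gap v q K →
        FlagLT u.1 x'.1 → below (d + 1) x'.1 ∈ Fl q → below (d + 1) x'.1 ≠ below (d + 1) u.1 →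
        below (d + 1) x'.1 ∉ K := fun {u v K} hv hK hu hq hne h => by
      have h' := (hv.2 q K hK _ hq hne).1 h
      rw [hS.flagLT_iff_of_agree hq.1 u.2 x'.2 u.2 (fun i hi => (below_of_lt (by omega)).symm)
        (fun i _ => rfl) hd hd hd (exists_ne_of_ne_below hq.1 u.2 hd hne)] at h'
      exact hS.flagLT_asymm hu h'
    by_cases hag : ∀ j < d + 1, x.1 j = x'.1 j
    · have hdi : d + 1 ≤ i := by
        by_contra h
        exact hflip.2.2.2 (hag i (by omega)).symm
      by_cases hf₀ : below (d + 1) x'.1 ∈ Fl q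
      · obtain ⟨u, hu⟩ := exists_isFl hf₀.1
        obtain ⟨⟨v₁, h₁, g₁⟩, v₂, h₂, g₂⟩ := hS.exists_mem_prev_next (pflagSub hS z)
          (hS.flag_mem_pflagSub hxx hflip hi hz hdi hu) hu hf₀
        have hoff : ∀ g ∈ Fl q, g ≠ below (d + 1) x'.1 →
            (g ∈ I ↔ FlagLT g (below (d + 1) x'.1)) := fun g hg hne => by
          rw [hw'.2 q I hI g hg hne]
          exact hS.flagLT_iff_of_agree hg.1 x'.2 hg.1 hf₀.1 (fun i _ => rfl)
            (fun i hi => below_of_lt (by omega)) hd le_rfl le_rfl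
            (exists_ne_of_ne_below hg.1 x'.2 hd hne)
        by_cases hm : below (d + 1) x'.1 ∈ I
        · have : I = next q (below (d + 1) x'.1) := by
            ext g
            by_cases he : g = below (d + 1) x'.1
            · rw [he]; exact ⟨fun _ => ⟨hf₀, Or.inl rfl⟩, fun _ => hm⟩
            · exact ⟨fun h => ⟨hIq.1 h, Or.inr ((hoff g (hIq.1 h) he).1 h)⟩,
                fun h => (hoff g h.1 he).2 (h.2.resolve_left he)⟩
          rw [this] at hI
          rwa [hS.gap_unique hI g₂]
        · have : I = prev q (below (d + 1) x'.1) := by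
            ext g
            by_cases he : g = below (d + 1) x'.1
            · rw [he]; exact ⟨fun h => absurd h hm, fun h => absurd h.2 (hS.flagLT_irrefl _)⟩
            · exact ⟨fun h => ⟨hIq.1 h, (hoff g (hIq.1 h) he).1 h⟩,
                fun h => (hoff g h.1 he).2 h.2⟩
          rw [this] at hI
          rwa [hS.gap_unique hI g₁]
      · exact key fun f₀ h he => absurd (he ▸ h) hf₀
    -- Here `x` differs from `x'` at a level up to `d`, and so does `y` because `x` is between them.
    -- The truncation of `x'` then lies after `x` and `y`, hence in neither `I` nor `J`.
    · refine key fun f₀ hf₀ he => ?_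
      subst he
      refine ⟨fun h => absurd h (notMem hw hI hyx' hf₀ fun e => hag fun j hj => ?_),
        fun h => absurd h (notMem hvx hJ hxx.2.2.1 hf₀ fun e => hag fun j hj => ?_)⟩
      · have e' : ∀ j < d + 1, y.1 j = x'.1 j := fun j hj => (eq_of_below_eq e hj).symm
        exact (hS.agree_of_between e' hy (Or.inr hxx.2.2.1) j hj).trans (e' j hj)
      · exact (eq_of_below_eq e hj).symm
  · rcases d with _ | k
    · exact absurd hh (not_isFl_zero w h)
    have e := hw.1 h hh
    obtain rfl := hw'.1 h hh
    exact hS.flag_mem_pflagSub hxx hflip hi hz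
      (hlt fun j hj => (eq_of_below_eq e hj).symm) hh

/-- All maximal flags lie under the unique top face, so `x` and `x'` are adjacent there and meet in
a p-flag. Its cut is the one just after `x` and just before `x'`, so it occurs in both opetopes;
`mem_pflagSub` gives the other inclusion. -/
theorem exists_predecessor (hS : S.IsPositiveOpetope) {x' : S.MaxFlag}
    (h : ∃ y : S.MaxFlag, y.LT x') : ∃ x : S.MaxFlag, x.LT x' ∧
      (∀ y : S.MaxFlag, ¬ (x.LT y ∧ y.LT x')) ∧ ∃ z : S.PFlag S.dim, z.1 = meet x.1 x'.1 ∧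
        ∀ d, (⋃ y ∈ {y : S.MaxFlag | y.LT x'}, (flagSub hS y).carrier d) ∩
          (flagSub hS x').carrier d = (pflagSub hS z).carrier d := by
  obtain ⟨T, hT⟩ := hS.exists_top
  have hFl : ∀ x : S.MaxFlag, x.1 ∈ Fl T := fun x => by
    obtain ⟨T', hT'⟩ := x.2.some_of_le le_rfl
    exact ⟨x.2, by rw [hT', hT T']⟩
  obtain ⟨x, ⟨hxT, hxlt⟩, hmax⟩ := hS.exists_max (A := {y | y ∈ Fl T ∧ FlagLT y x'.1})
    (fun _ h => h.1) (by obtain ⟨y, hy⟩ := h; exact ⟨y.1, hFl y, hy⟩)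
  obtain ⟨x, rfl⟩ : ∃ u : S.MaxFlag, u.1 = x := ⟨⟨x, hxT.1⟩, rfl⟩
  have hle : ∀ y : S.MaxFlag, y.LT x' → y.1 = x.1 ∨ FlagLT y.1 x.1 := fun y hy =>
    hmax y.1 ⟨hFl y, hy⟩
  have hno : ∀ y : S.MaxFlag, ¬ (x.LT y ∧ y.LT x') := by
    rintro y ⟨h₁, h₂⟩
    rcases hle y h₂ with h | h
    · exact hS.flagLT_irrefl x.1 (by rw [MaxFlag.LT, h] at h₁; exact h₁)
    · exact hS.flagLT_asymm h h₁
  have hxx : Adj T x.1 x'.1 :=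
    ⟨hFl x, hFl x', hxlt, fun y hy h₁ h₂ => hno ⟨y, hy.1⟩ ⟨h₁, h₂⟩⟩
  obtain ⟨i, hi, hflip, hlev⟩ := hS.adj_cases hxx
  have hmeet : punct x.1 i = meet x.1 x'.1 := by
    funext j
    unfold meet
    by_cases hj : j = i
    · subst hj
      rw [punct_self, if_neg fun h => hflip.2.2.2 h.symm]
    · rw [punct_of_ne _ hj, if_pos (hflip.2.2.1 j hj).symm]
  have hz : IsPFlag S.dim (punct x.1 i) := ⟨x.1, i, x.2, hlev.imp And.left And.left, rfl⟩
  have hgap := hS.gap_pflag hxx hflip hi (z := ⟨_, hz⟩) rfl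
  have hzx' : CylFace.pflag ⟨_, hz⟩ ∈ (flagSub hS x').carrier S.dim := by
    obtain ⟨⟨v, hv, hvx⟩, -⟩ := hS.exists_mem_prev_next _ (hS.flag_mem_flagSub x') (h := x'.1)
      rfl (hFl x')
    rwa [hS.gap_unique hgap hvx]
  have hzx : CylFace.pflag ⟨_, hz⟩ ∈ (flagSub hS x).carrier S.dim := by
    obtain ⟨-, v, hv, hvx⟩ := hS.exists_mem_prev_next _ (hS.flag_mem_flagSub x) (h := x.1)
      rfl (hFl x)
    rw [hS.prev_eq_next hxx] at hgap
    rwa [hS.gap_unique hgap hvx]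
  have hsub : ∀ d, (pflagSub hS ⟨_, hz⟩).carrier d ⊆ (flagSub hS x).carrier d :=
    fun d w hw => hw _ hzx
  have hsub' : ∀ d, (pflagSub hS ⟨_, hz⟩).carrier d ⊆ (flagSub hS x').carrier d :=
    fun d w hw => hw _ hzx'
  refine ⟨x, hxlt, hno, ⟨_, hz⟩, hmeet, fun d => Set.Subset.antisymm ?_ fun w hw => ⟨?_, hsub' d hw⟩⟩
  · rintro w ⟨hw, hw'⟩
    obtain ⟨y, hy, hw⟩ := Set.mem_iUnion₂.1 hw
    exact hS.mem_pflagSub hxx hflip hi hgap hsub hsub' (hle y hy) (hS.inA_of_mem_flagSub y hw)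
      (hS.inA_of_mem_flagSub x' hw')
  · exact Set.mem_iUnion₂.2 ⟨x, hxlt, hsub d hw⟩

end IsPositiveOpetope

end PosHypergraph

namespace PosHypergraph

variable {S : PosHypergraph.{u}}

/-! ## Sub-hypergraphs as subobjects -/

/-- The inclusion of a sub-hypergraph. -/
def Sub.incl (A : S.Sub) : A.toPosHypergraph ⟶ S where
  map _ a := a.1
  map_γ _ := rfl
  map_δ a := ⟨fun _ hb => hb, fun _ _ _ _ h => Subtype.ext h,
    fun b hb => ⟨⟨b, A.δ_mem a.1 a.2 hb⟩, hb, rfl⟩⟩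

instance (A : S.Sub) : Mono A.incl where
  right_cancellation f g h := by
    refine Hom.ext (funext fun k => funext fun a => Subtype.ext ?_)
    exact congrFun (congrFun (congrArg Hom.map h) k) a

/-- A morphism with image in a sub-hypergraph factors through it. -/
def Sub.lift (A : S.Sub) {X : PosHypergraph.{u}} (f : X ⟶ S)
    (hf : ∀ k a, Hom.map f k a ∈ A.carrier k) : X ⟶ A.toPosHypergraph where
  map k a := ⟨Hom.map f k a, hf k a⟩
  map_γ a := Subtype.ext (Hom.map_γ f a)
  map_δ a := ⟨fun _ hb => (Hom.map_δ f a).1 hb,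
    fun _ hb _ hc h => (Hom.map_δ f a).2.1 hb hc (congrArg Subtype.val h),
    fun b hb => by
      obtain ⟨c, hc, h⟩ := (Hom.map_δ f a).2.2 hb
      exact ⟨c, hc, Subtype.ext h⟩⟩

lemma Sub.le_mk_incl (A : S.Sub) (W : Subobject S)
    (h : ∀ k a, Hom.map W.arrow k a ∈ A.carrier k) : W ≤ Subobject.mk A.incl :=
  Subobject.le_mk_of_comm (A.lift W.arrow h) rfl

lemma Sub.mk_incl_le_mk_incl {A B : S.Sub} (h : ∀ k, A.carrier k ⊆ B.carrier k) :
    Subobject.mk A.incl ≤ Subobject.mk B.incl :=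
  Subobject.mk_le_mk_of_comm (B.lift A.incl fun k a => h k a.2) rfl

lemma Sub.map_arrow_mem (A : S.Sub) {W : Subobject S} (h : W ≤ Subobject.mk A.incl) (k : ℕ)
    (a : (W : PosHypergraph.{u}).F k) : Hom.map W.arrow k a ∈ A.carrier k := by
  rw [← Subobject.ofLEMk_comp h]
  exact (Hom.map (Subobject.ofLEMk W A.incl h) k a).2

lemma mem_gen_self {k : ℕ} (w : S.F k) : w ∈ (gen w).carrier k := fun _ h => h

lemma gen_subset {A : S.Sub} {k : ℕ} {w : S.F k} (hw : w ∈ A.carrier k) (j : ℕ) :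
    (gen w).carrier j ⊆ A.carrier j := fun _ h => h A hw

/-- The inclusion of `A` factors through `U` as soon as this holds on the part generated by each
single face: each face is sent to its image under the factorization on the part it generates, and
these factorizations are compatible. -/
lemma Sub.mk_incl_le (A : S.Sub) (U : Subobject S)
    (h : ∀ k, ∀ w ∈ A.carrier k, Subobject.mk (gen w).incl ≤ U) : Subobject.mk A.incl ≤ U := by
  let φ : ∀ k (w : A.carrier k), (gen w.1).toPosHypergraph ⟶ (U : PosHypergraph.{u}) :=
    fun k w => Subobject.ofMkLE (gen w.1).incl U (h k w.1 w.2)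
  have hφ : ∀ k (w : A.carrier k), φ k w ≫ U.arrow = (gen w.1).incl := fun k w =>
    Subobject.ofMkLE_arrow _
  let s : ∀ k, A.carrier k → (U : PosHypergraph.{u}).F k := fun k w =>
    Hom.map (φ k w) k ⟨w.1, mem_gen_self w.1⟩
  have hs : ∀ k (w : A.carrier k) j (v : A.carrier j) (hv : v.1 ∈ (gen w.1).carrier j),
      Hom.map (φ k w) j ⟨v.1, hv⟩ = s j v := by
    intro k w j v hv
    -- After composition with the monomorphism `U.arrow` both sides become the same inclusion, so
    -- the factorizations agree where they overlap.
    have e : (gen w.1).lift (gen v.1).incl (fun i a => gen_subset hv i a.2) ≫ φ k w = φ j v := by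
      rw [← cancel_mono U.arrow, Category.assoc, hφ, hφ]
      rfl
    change _ = Hom.map (φ j v) j _
    rw [← e]
    rfl
  let f : A.toPosHypergraph ⟶ (U : PosHypergraph.{u}) :=
    { map := s
      map_γ := fun {k} a => by
        have h₁ := (gen a.1).γ_mem a.1 (mem_gen_self a.1)
        exact (Hom.map_γ (φ _ a) ⟨a.1, mem_gen_self a.1⟩).trans
          (hs _ a _ ⟨S.γ a.1, A.γ_mem a.1 a.2⟩ h₁)
      map_δ := fun {k} a => by
        have h₁ := (gen a.1).δ_mem a.1 (mem_gen_self a.1)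
        have hb := Hom.map_δ (φ _ a) ⟨a.1, mem_gen_self a.1⟩
        refine ⟨fun b hb' => ?_, fun b hb' c hc' he => ?_, fun c hc => ?_⟩
        · rw [← hs _ a _ b (h₁ hb')]
          exact hb.1 (x := ⟨b.1, h₁ hb'⟩) hb'
        · rw [← hs _ a _ b (h₁ hb'), ← hs _ a _ c (h₁ hc')] at he
          have h₂ := hb.2.1 (x₁ := ⟨b.1, h₁ hb'⟩) hb' (x₂ := ⟨c.1, h₁ hc'⟩) hc' he
          exact Subtype.ext (congrArg (fun x : (gen a.1).carrier k => x.1) h₂)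
        · obtain ⟨b, hb', he⟩ := hb.2.2 hc
          exact ⟨⟨b.1, A.δ_mem a.1 a.2 hb'⟩, hb',
            (hs _ a _ ⟨b.1, A.δ_mem a.1 a.2 hb'⟩ b.2).symm.trans he⟩ }
  refine Subobject.mk_le_of_comm f (Hom.ext (funext fun k => funext fun a => ?_))
  exact congrFun (congrFun (congrArg Hom.map (hφ k a)) k) ⟨a.1, mem_gen_self a.1⟩

lemma Sub.isLUB {ι : Type*} {K : Set ι} {A : ι → S.Sub} {B : S.Sub}
    (h : ∀ k, B.carrier k = ⋃ i ∈ K, (A i).carrier k) :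
    IsLUB ((fun i => Subobject.mk (A i).incl) '' K) (Subobject.mk B.incl) := by
  refine ⟨?_, fun U hU => B.mk_incl_le U fun k w hw => ?_⟩
  · rintro _ ⟨i, hi, rfl⟩
    refine Sub.mk_incl_le_mk_incl fun k w hw => ?_
    rw [h]
    exact Set.mem_iUnion₂.2 ⟨i, hi, hw⟩
  · rw [h] at hw
    obtain ⟨i, hi, hw⟩ := Set.mem_iUnion₂.1 hw
    exact (Sub.mk_incl_le_mk_incl (gen_subset hw)).trans (hU ⟨i, hi, rfl⟩)

lemma Sub.isGLB {A B C : S.Sub} (h : ∀ k, A.carrier k ∩ B.carrier k = C.carrier k) :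
    IsGLB {Subobject.mk A.incl, Subobject.mk B.incl} (Subobject.mk C.incl) := by
  refine ⟨?_, fun W hW => C.le_mk_incl W fun k a => ?_⟩
  · rintro _ (rfl | rfl)
    · exact Sub.mk_incl_le_mk_incl fun k w hw => ((h k).ge hw).1
    · exact Sub.mk_incl_le_mk_incl fun k w hw => ((h k).ge hw).2
  · rw [← h]
    exact ⟨A.map_arrow_mem (hW (Or.inl rfl)) k a, B.map_arrow_mem (hW (Or.inr rfl)) k a⟩

/-- The union of a family of sub-hypergraphs. -/
def Sub.iUnion {ι : Type*} (K : Set ι) (A : ι → S.Sub) : S.Sub where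
  carrier k := ⋃ i ∈ K, (A i).carrier k
  γ_mem _ ha := by
    obtain ⟨i, hi, h⟩ := Set.mem_iUnion₂.1 ha
    exact Set.mem_iUnion₂.2 ⟨i, hi, (A i).γ_mem _ h⟩
  δ_mem _ ha _ hb := by
    obtain ⟨i, hi, h⟩ := Set.mem_iUnion₂.1 ha
    exact Set.mem_iUnion₂.2 ⟨i, hi, (A i).δ_mem _ h hb⟩

lemma Sub.mk_incl_eq_top {A : S.Sub} (h : ∀ k, A.carrier k = Set.univ) :
    Subobject.mk A.incl = ⊤ :=
  top_le_iff.1 (A.le_mk_incl _ fun k _ => (h k).symm ▸ trivial)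

lemma Sub.isoClosure (X : ObjectProperty PosHypergraph.{u}) {A : S.Sub}
    (h : X A.toPosHypergraph) : X.isoClosure (Subobject.mk A.incl : PosHypergraph.{u}) :=
  ⟨_, h, ⟨Subobject.underlyingIso A.incl⟩⟩

/-! ### Straightness of the cylinder -/

namespace IsPositiveOpetope

lemma flagSub_isPositiveOpetope (hS : S.IsPositiveOpetope) {k : ℕ} (x : S.Flag k) :
    (flagSub hS x).toPosHypergraph.IsPositiveOpetope :=
  hS.cylinder_isTreelike.isPositiveOpetope_gen _

lemma pflagSub_isPositiveOpetope (hS : S.IsPositiveOpetope) {k : ℕ} (z : S.PFlag k) :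
    (pflagSub hS z).toPosHypergraph.IsPositiveOpetope :=
  hS.cylinder_isTreelike.isPositiveOpetope_gen _

lemma iUnion_flagSub (hS : S.IsPositiveOpetope) (d : ℕ) :
    (⋃ x : S.MaxFlag, (flagSub hS x).carrier d) = Set.univ :=
  Set.eq_univ_of_forall fun w => Set.mem_iUnion.2 (hS.exists_mem_flagSub w)

theorem isStraight_cylinder (hS : S.IsPositiveOpetope) :
    IsStraight IsPositiveOpetope (S.cylinder hS) := by
  classical
  have hsto := hS.isStrictTotalOrder
  let L : LinearOrder S.MaxFlag := linearOrderOfSTO MaxFlag.LT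
  have : Fintype S.MaxFlag := Fintype.ofFinite _
  let e : Fin (Fintype.card S.MaxFlag) ≃o S.MaxFlag := Fintype.orderIsoFinOfCardEq _ rfl
  have hlt : ∀ i j, i < j ↔ (e i).LT (e j) := fun i j => (e.lt_iff_lt (x := i) (y := j)).symm
  refine ⟨Fin (Fintype.card S.MaxFlag), inferInstance, inferInstance,
    fun q => Subobject.mk (flagSub hS (e q)).incl,
    fun q => Sub.isoClosure _ (hS.flagSub_isPositiveOpetope _), ?_, fun q hq => ?_⟩
  · have h : ∀ k, (Sub.iUnion Set.univ fun q => flagSub hS (e q)).carrier k = Set.univ :=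
      fun k => Set.eq_univ_of_forall fun w => by
        obtain ⟨x, hx⟩ := hS.exists_mem_flagSub w
        exact Set.mem_iUnion₂.2 ⟨e.symm x, trivial, by
          change w ∈ (flagSub hS (e (e.symm x))).carrier k
          rwa [e.apply_symm_apply]⟩
    rw [← Set.image_univ, ← Sub.mk_incl_eq_top h]
    exact Sub.isLUB fun k => rfl
  -- An index that is not least has a smaller one, so its maximal flag has a predecessor.
  · have hex : ∃ y : S.MaxFlag, y.LT (e q) := by
      by_contra hno
      push Not at hno
      exact hq fun j => not_lt.1 fun h => hno _ ((hlt j q).1 h)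
    obtain ⟨x, hx, -, z, -, hz⟩ := hS.exists_predecessor hex
    refine ⟨Subobject.mk (Sub.iUnion (Set.Iio q) fun q => flagSub hS (e q)).incl,
      Subobject.mk (pflagSub hS z).incl, Sub.isLUB fun k => rfl, Sub.isGLB fun k => ?_,
      Sub.isoClosure _ (hS.pflagSub_isPositiveOpetope _)⟩
    rw [← hz k]
    congr 1
    refine Set.Subset.antisymm (fun w hw => ?_) fun w hw => ?_
    · obtain ⟨j, hj, hw⟩ := Set.mem_iUnion₂.1 hw
      exact Set.mem_iUnion₂.2 ⟨e j, (hlt j q).1 hj, hw⟩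
    · obtain ⟨y, hy, hw⟩ := Set.mem_iUnion₂.1 hw
      refine Set.mem_iUnion₂.2 ⟨e.symm y, (hlt _ _).2 ?_, ?_⟩
      · rwa [e.apply_symm_apply]
      · change w ∈ (flagSub hS (e (e.symm y))).carrier k
        rwa [e.apply_symm_apply]

end IsPositiveOpetope

end PosHypergraph

theorem mainTheorem5 (P : PosHypergraph.{u}) (hP : P.IsPositiveOpetope) :
    -- the cylinder is a straight object
    IsStraight PosHypergraph.IsPositiveOpetope (P.cylinder hP) ∧
    -- the flag order is a strict linear order on the maximal flags
    IsStrictTotalOrder P.MaxFlag PosHypergraph.MaxFlag.LT ∧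
    -- the sub-hypergraph of a maximal flag is a positive opetope
    (∀ x : P.MaxFlag, (PosHypergraph.flagSub hP x).toPosHypergraph.IsPositiveOpetope) ∧
    -- the cylinder is the union of these opetopes
    (∀ d, (⋃ x : P.MaxFlag, (PosHypergraph.flagSub hP x).carrier d) = Set.univ) ∧
    -- the opetope of a non-first maximal flag `x'` meets the union of the earlier ones in the
    -- opetope of the p-flag `x ∩ x'`, where `x` is the immediate predecessor of `x'`
    (∀ x' : P.MaxFlag, (∃ y : P.MaxFlag, y.LT x') →
      ∃ x : P.MaxFlag, x.LT x' ∧ (∀ y : P.MaxFlag, ¬ (x.LT y ∧ y.LT x')) ∧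
        ∃ z : P.PFlag P.dim, z.1 = PosHypergraph.meet x.1 x'.1 ∧
          (PosHypergraph.pflagSub hP z).toPosHypergraph.IsPositiveOpetope ∧
          ∀ d, (⋃ y ∈ {y : P.MaxFlag | y.LT x'}, (PosHypergraph.flagSub hP y).carrier d) ∩
              (PosHypergraph.flagSub hP x').carrier d =
            (PosHypergraph.pflagSub hP z).carrier d) := by
  refine ⟨hP.isStraight_cylinder, hP.isStrictTotalOrder, hP.flagSub_isPositiveOpetope,
    hP.iUnion_flagSub, fun x' h => ?_⟩
  obtain ⟨x, hx, hno, z, hz, hd⟩ := hP.exists_predecessor h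
  exact ⟨x, hx, hno, z, hz, hP.pflagSub_isPositiveOpetope z, hd⟩
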